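/- **Setting.** Let $G$ be a finite bipartite graph with $2n$ vertices, $m$ edges and at least one perfect matching. The states of Broder's chain on $G$ are the perfect and the near-perfect matchings of $G$ (near-perfect: exactly two vertices are unmatched); $\Omega$ is the set of states. In a state $M$ an edge $e$ of $G$ is chosen uniformly at random. If $M$ is perfect, $e$ is deleted when $e\in M$, and otherwise nothing changes. If $M$ is near-perfect and at least one end of $e$ is unmatched, $e$ is added, and the edge of $M$ at the other end of $e$, if there is one, is removed. Otherwise nothing changes. Let $P$ be the transition matrix and $\pi\equiv 1/|\Omega|$ the stationary distribution; put $\pi_{\min}=\min_x\pi(x)$, $d(\pi,t)=\max_x\frac12\sum_y|\pi(y)-P^t(x,y)|$ and $\tau(\epsilon)=\min\{t: d(\pi,t)\le\epsilon\}$. Broder's chain is *rapidly mixing* on a class of graphs if there is a polynomial $p$ such that $\tau(\epsilon)\le p(n)\,(\ln\epsilon^{-1}+\ln\pi_{\min}^{-1})$ for all $\epsilon\in(0,1)$ and all graphs of the class that have a perfect matching and on which the chain is ergodic (irreducible and aperiodic). A *path system with flow* assigns to every ordered pair $x\ne y$ of states and every simple path $q$ from $x$ to $y$ in the state graph a number $f_1(q)\ge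 0$, such that for each pair these numbers add up to $\pi(x)\pi(y)$. (A system with exactly one path for each pair is the case where this path carries the whole of $\pi(x)\pi(y)$.) Its *maximum loading* is $\rho_1=\max_{a=(x,y)} \frac{\sum_{q\ni a}f_1(q)}{\pi(x)P(x,y)}$, the maximum over the arcs $a$ of the state graph. A bipartite graph is a *threshold* graph if, for some bipartition, it is the only bipartite graph with that bipartition and the same degree at each vertex. **Families.** 1. *Hexagon graphs*, $k\ge1$: hexagons $H_1,\dots,H_k$, each with two marked opposite corners, a left and a right one. The right corner of $H_i$ is joined to the left corner of $H_{i+1}$, the left corner of $H_1$ to an extra vertex $u$, and the right corner of $H_k$ to an extra vertex $v$. 2. *Odd triangle threshold graphs*, $n\ge3$ odd: vertices $u_1,\dots,u_n,v_1,\dots,v_n$, with $u_i$ and $v_j$ adjacent if and only if $i+j\le n+1$. 3. *Block graphs*, $k\ge1$. A block is a cube graph from which one edge has been deleted; it has bipartition classes $U,V$, and the ends of the deleted edge in $V$ and in $U$ are its left and its right port. A track is a sequence of $k$ blocks in which the right port of each block is joined to the left port of the next. There are two vertices $u,v$ and three tracks; the left port of the first block of each track is joined to $u$ and the right port of its last block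 to $v$. 4. *Block graphs with a ladder*, $k\ge2$ even: two vertices $u,v$, three tracks of $k$ blocks, and a ladder with $k+2$ rungs. The first rung has ends $v_l,u_l$ and the last rung has ends $u_l',v_l'$, where $v_l,u_l'$ lie on one rail and $u_l,v_l'$ on the other. The first track starts at $u$ and ends at $v_l'$, the second starts at $u_l$ and ends at $v$, and the third starts at $u$ and ends at $v$ (a track starts at the vertex joined to the left port of its first block and ends at the vertex joined to the right port of its last block). Moreover $u$ is joined to $v_l$, and $u_l'$ to $v$. **Theorem.** Broder's chain is not rapidly mixing on the class of planar bipartite graphs, nor on the class of regular bipartite graphs, nor on the class of Hamiltonian bipartite graphs, nor on the class of bipartite threshold graphs. In detail, the graphs of family 1 are planar and bipartite; those of family 2 are bipartite threshold graphs; those of family 3 are bipartite, regular and planar but not Hamiltonian; those of family 4 are bipartite, regular and Hamiltonian. For each of the four families Broder's chain is not rapidly mixing, and there are constants $C>1$ and $n_0$ such that for every graph of the family with $2n$ vertices, $n\ge n_0$, every path system with flow has maximum loading $\rho_1\ge C^n$; likewise there are constants $C>1$ and $n_0$ such that $\tau(\epsilon)\ge C^n\ln\frac1{2\epsilon}$ for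 every such graph and all $\epsilon\in(0,\tfrac12)$. -/

import Mathlib

/-! ### Finite Markov chains: mixing time, path flows and maximum loading -/

section MarkovChain

variable {Ω : Type} [Fintype Ω] [DecidableEq Ω]

/-- The variation distance between `π` and the law `p_x^t = (P ^ t) x ·` of the chain with
transition matrix `P` at time `t` when started in `x`. -/
noncomputable def variationDist (P : Matrix Ω Ω ℝ) (π : Ω → ℝ) (x : Ω) (t : ℕ) : ℝ :=
  1 / 2 * ∑ y, |π y - (P ^ t) x y|

/-- The total variation distance `d(π, t) = max_x d_tv(π, p_x^t)`. -/
noncomputable def totalVariationDist (P : Matrix Ω Ω ℝ) (π : Ω → ℝ) (t : ℕ) : ℝ :=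
  ⨆ x, variationDist P π x t

/-- The total mixing time `τ(ε) = min {t | d(π, t) ≤ ε}`
(it is `⊤` if there is no such `t`). -/
noncomputable def mixingTime (P : Matrix Ω Ω ℝ) (π : Ω → ℝ) (ε : ℝ) : ℕ∞ :=
  ⨅ t ∈ {t : ℕ | totalVariationDist P π t ≤ ε}, (t : ℕ∞)

/-- The state graph (without loops) of a chain. The relation is closed under symmetry, which
changes nothing for a reversible chain, where `0 < P x y ↔ 0 < P y x`. -/
def stateGraph (P : Matrix Ω Ω ℝ) : SimpleGraph Ω :=
  SimpleGraph.fromRel fun x y => 0 < P x y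

open Classical in
/-- A system of simple paths in the state graph with a flow `f₁` on it: every ordered pair
`(x, y)` of distinct states distributes its demand `π x * π y` among simple paths from `x` to `y`.
The path system is the set of paths with positive flow; in a system with exactly one path for
each pair that path carries the whole demand. -/
structure PathFlow (P : Matrix Ω Ω ℝ) (π : Ω → ℝ) where
  flow : ∀ x y : Ω, (stateGraph P).Path x y → ℝ
  flow_nonneg : ∀ x y p, 0 ≤ flow x y p
  sum_flow : ∀ x y, x ≠ y → ∑ p, flow x y p = π x * π y

open Classical in
/-- The flow `f₁(a)` through an arc `a`: the sum of the flows of all paths using `a`. -/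
noncomputable def PathFlow.arcFlow {P : Matrix Ω Ω ℝ} {π : Ω → ℝ} (f : PathFlow P π)
    (a : (stateGraph P).Dart) : ℝ :=
  ∑ x, ∑ y, ∑ p : (stateGraph P).Path x y, if a ∈ p.1.darts then f.flow x y p else 0

/-- The maximum loading `ρ₁ = max_a f₁(a) / Q(a)`, where `Q(a) = π x * P x y` for `a = (x, y)`.
(Loops of the state graph lie on no simple path, so they do not contribute.) -/
noncomputable def PathFlow.maxLoading {P : Matrix Ω Ω ℝ} {π : Ω → ℝ} (f : PathFlow P π) : ℝ :=
  ⨆ a : (stateGraph P).Dart, f.arcFlow a / (π a.fst * P a.fst a.snd)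

end MarkovChain

/-! ### Broder's chain -/

section Broder

variable {V : Type}

/-- `M` is (the edge set of) a matching of `G`. -/
def IsMatchingSet (G : SimpleGraph V) (M : Set (Sym2 V)) : Prop :=
  M ⊆ G.edgeSet ∧ ∀ e ∈ M, ∀ f ∈ M, ∀ w, w ∈ e → w ∈ f → e = f

/-- The vertices that are not covered by `M`. -/
def unmatched (M : Set (Sym2 V)) : Set V := {w | ∀ e ∈ M, w ∉ e}

/-- Perfect matchings of `G`. -/
def IsPerfectMatchingSet (G : SimpleGraph V) (M : Set (Sym2 V)) : Prop :=
  IsMatchingSet G M ∧ unmatched M = ∅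

/-- Near-perfect matchings of `G`: exactly two vertices are unmatched. (If `G` is bipartite and has
a perfect matching then these are one vertex on each side.) -/
def IsNearPerfectMatchingSet (G : SimpleGraph V) (M : Set (Sym2 V)) : Prop :=
  IsMatchingSet G M ∧ (unmatched M).ncard = 2

/-- The states of Broder's chain: all perfect and all near-perfect matchings. -/
def BroderState (G : SimpleGraph V) : Type :=
  {M : Set (Sym2 V) // IsPerfectMatchingSet G M ∨ IsNearPerfectMatchingSet G M}

noncomputable instance (G : SimpleGraph V) : DecidableEq (BroderState G) := Classical.decEq _

instance [Finite V] (G : SimpleGraph V) : Finite (BroderState G) :=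
  Subtype.finite

noncomputable instance [Finite V] (G : SimpleGraph V) : Fintype (BroderState G) :=
  Fintype.ofFinite _

open Classical in
/-- One move of Broder's chain in the state `M` when the edge `e` has been chosen.
* `M` perfect: `e` is deleted if it belongs to `M`, otherwise nothing happens.
* `M` near-perfect and some end of `e` is unmatched: `e` is added, and the edge of `M` at the
  other end of `e`, if there is one, is removed.
* Otherwise nothing happens. -/
noncomputable def broderMove (M : Set (Sym2 V)) (e : Sym2 V) : Set (Sym2 V) :=
  if unmatched M = ∅ then M \ {e}
  else if ∃ w ∈ e, w ∈ unmatched M then insert e {f ∈ M | ∀ w ∈ e, w ∉ f}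
  else M

/-- The transition matrix of Broder's chain: the edge `e` is uniform among the edges of `G`. -/
noncomputable def broderMatrix (G : SimpleGraph V) :
    Matrix (BroderState G) (BroderState G) ℝ := fun M M' =>
  ({e ∈ G.edgeSet | broderMove M.1 e = M'.1}.ncard : ℝ) / (G.edgeSet.ncard : ℝ)

/-- The stationary distribution of Broder's chain is uniform on the states. -/
noncomputable def broderPi [Finite V] (G : SimpleGraph V) : BroderState G → ℝ := fun _ =>
  1 / (Fintype.card (BroderState G) : ℝ)

end Broder

/-! ### Graph classes and rapid mixing -/

/-- Finite simple graphs; a graph class is a set of these. -/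
structure FinGraph where
  V : Type
  [fintype : Fintype V]
  graph : SimpleGraph V

attribute [instance] FinGraph.fintype

namespace FinGraph

/-- The size `n` of an input graph with `2 n` vertices. -/
def size (G : FinGraph) : ℕ := Fintype.card G.V / 2

/-- The graphs to which Broder's chain is applied: there is a perfect matching, and the chain is
ergodic (irreducible and aperiodic, that is, its transition matrix is primitive). -/
def IsBroderInput (G : FinGraph) : Prop :=
  (∃ M, IsPerfectMatchingSet G.graph M) ∧ (broderMatrix G.graph).IsPrimitive

/-- The total mixing time of Broder's chain on `G`. -/
noncomputable def tau (G : FinGraph) (ε : ℝ) : ℕ∞ :=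
  mixingTime (broderMatrix G.graph) (broderPi G.graph) ε

/-- The smallest component of the stationary distribution. -/
noncomputable def piMin (G : FinGraph) : ℝ := ⨅ M, broderPi G.graph M

end FinGraph

/-- Broder's chain is rapidly mixing on the class `𝒢`:
`τ(ε) ≤ p(n) (ln ε⁻¹ + ln π_min⁻¹)` for one polynomial `p` and all inputs from the class. -/
def BroderRapidlyMixing (𝒢 : Set FinGraph) : Prop :=
  ∃ p : Polynomial ℝ, ∀ G ∈ 𝒢, G.IsBroderInput → ∀ ε : ℝ, 0 < ε → ε < 1 →
    (G.tau ε : ENNReal) ≤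
      ENNReal.ofReal (p.eval (G.size : ℝ) * (Real.log ε⁻¹ + Real.log G.piMin⁻¹))

/-- On the class `𝒢` the maximum loading `ρ₁` of every path system grows exponentially with the
size of the graph. -/
def ExponentialLoading (𝒢 : Set FinGraph) : Prop :=
  ∃ C : ℝ, 1 < C ∧ ∃ n₀ : ℕ, ∀ G ∈ 𝒢, n₀ ≤ G.size →
    ∀ f : PathFlow (broderMatrix G.graph) (broderPi G.graph), C ^ G.size ≤ f.maxLoading

/-- On the class `𝒢` the mixing time grows exponentially with the size of the graph. -/
def ExponentialMixingTime (𝒢 : Set FinGraph) : Prop :=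
  ∃ C : ℝ, 1 < C ∧ ∃ n₀ : ℕ, ∀ G ∈ 𝒢, n₀ ≤ G.size →
    ∀ ε : ℝ, 0 < ε → ε < 1 / 2 →
      ENNReal.ofReal (C ^ G.size * Real.log (1 / (2 * ε))) ≤ (G.tau ε : ENNReal)

/-- An embedding of `G` in the plane: the vertices are distinct points, every edge is a simple arc
between its ends, no arc passes through a vertex, and different arcs do not cross. -/
structure PlaneEmbedding {V : Type} (G : SimpleGraph V) where
  point : V → ℝ × ℝ
  point_injective : Function.Injective point
  arc : G.edgeSet → C(unitInterval, ℝ × ℝ)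
  arc_injective : ∀ e, Function.Injective (arc e)
  arc_ends : ∀ e, s(arc e 0, arc e 1) = Sym2.map point e.1
  arc_avoids : ∀ e, ∀ t ∈ Set.Ioo (0 : unitInterval) 1, ∀ v, arc e t ≠ point v
  arc_disjoint : ∀ e f, e ≠ f → ∀ s ∈ Set.Ioo (0 : unitInterval) 1,
    ∀ t ∈ Set.Ioo (0 : unitInterval) 1, arc e s ≠ arc f t

/-- Planar graphs. -/
def IsPlanar {V : Type} (G : SimpleGraph V) : Prop := Nonempty (PlaneEmbedding G)

/-- Bipartite threshold graphs: for some bipartition, no other bipartite graph with the same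
bipartition has the same vertex degrees. -/
def IsBipartiteThreshold {V : Type} (G : SimpleGraph V) : Prop :=
  ∃ A : Set V, G.IsBipartiteWith A Aᶜ ∧ ∀ H : SimpleGraph V, H.IsBipartiteWith A Aᶜ →
    (∀ v, (H.neighborSet v).ncard = (G.neighborSet v).ncard) → H = G

/-- The class of planar bipartite graphs. -/
def planarBipartite : Set FinGraph := {G | G.graph.IsBipartite ∧ IsPlanar G.graph}

open Classical in
/-- The class of regular bipartite graphs. -/
def regularBipartite : Set FinGraph :=
  {G | G.graph.IsBipartite ∧ ∃ d, G.graph.IsRegularOfDegree d}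

open Classical in
/-- The class of Hamiltonian bipartite graphs. -/
def hamiltonianBipartite : Set FinGraph := {G | G.graph.IsBipartite ∧ G.graph.IsHamiltonian}

/-- The class of bipartite threshold graphs. -/
def thresholdBipartite : Set FinGraph := {G | IsBipartiteThreshold G.graph}

/-! ### Hexagon graphs -/

/-- Vertices of the chain of `k` hexagons between `u` and `v`. -/
inductive HexVertex (k : ℕ) where
  | u
  | v
  | hex (i : Fin k) (c : Fin 6)
  deriving DecidableEq, Fintype

/-- Each hexagon is the cycle `0, 1, …, 5`; its corner `0` is joined to the corner `3` of the
preceding hexagon (to `u` for the first hexagon), and `v` is joined to the corner `3` of the last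
hexagon. -/
def HexVertex.rel {k : ℕ} : HexVertex k → HexVertex k → Prop
  | .u, .hex i c => i.val = 0 ∧ c = 0
  | .hex i c, .hex j d => (i = j ∧ d = c + 1) ∨ (i.val + 1 = j.val ∧ c = 3 ∧ d = 0)
  | .hex i c, .v => i.val + 1 = k ∧ c = 3
  | _, _ => False

/-- The hexagon graph with `k` hexagons. -/
def hexagonGraph (k : ℕ) : SimpleGraph (HexVertex k) := SimpleGraph.fromRel HexVertex.rel

/-- All hexagon graphs, with `k ≥ 1` hexagons. -/
def hexagonGraphs : Set FinGraph := Set.range fun j : ℕ => ⟨HexVertex (j + 1), hexagonGraph (j + 1)⟩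

/-! ### Triangle threshold graphs -/

/-- The bipartite graph on `u_1, …, u_n` (left) and `v_1, …, v_n` (right) where `u_i` and `v_j` are
adjacent iff `j ≤ n - (i - 1)`; in terms of the indices `i - 1, j - 1 : Fin n` this says
`(i - 1) + (j - 1) < n`. -/
def triangleGraph (n : ℕ) : SimpleGraph (Fin n ⊕ Fin n) :=
  SimpleGraph.fromRel fun x y => ∃ i j, x = .inl i ∧ y = .inr j ∧ i.val + j.val < n

/-- The odd triangle threshold graphs, `n = 3, 5, 7, …`. -/
def oddTriangleGraphs : Set FinGraph :=
  Set.range fun j : ℕ => ⟨Fin (2 * j + 3) ⊕ Fin (2 * j + 3), triangleGraph (2 * j + 3)⟩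

/-! ### Block graphs -/

/-- A block has vertices `U_0, …, U_3` and `V_0, …, V_3`; it is a cube (`K_{4,4}` without the perfect
matching `U_a V_{3-a}`) from which the edge `U_0 V_0` has been deleted. The left port of a block is
`V_0` and its right port is `U_0`. -/
def blockRel (a b : Fin 4) : Prop := a.val + b.val ≠ 3 ∧ a.val + b.val ≠ 0

/-- Vertices of the graph with three tracks of `k` blocks between `u` and `v`: the vertices
`U_a` and `V_b` of the `i`-th block of the track `r`. -/
inductive BlockVertex (k : ℕ) where
  | u
  | v
  | blockU (r : Fin 3) (i : Fin k) (a : Fin 4)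
  | blockV (r : Fin 3) (i : Fin k) (b : Fin 4)
  deriving DecidableEq, Fintype

/-- On every track, `u` is joined to the left port of the first block, the right port of each block
to the left port of the next one, and the right port of the last block to `v`. -/
def BlockVertex.rel {k : ℕ} : BlockVertex k → BlockVertex k → Prop
  | .u, .blockV _ i b => i.val = 0 ∧ b = 0
  | .blockU r i a, .blockV s j b =>
      r = s ∧ ((i = j ∧ blockRel a b) ∨ (i.val + 1 = j.val ∧ a = 0 ∧ b = 0))
  | .blockU _ i a, .v => i.val + 1 = k ∧ a = 0
  | _, _ => False

/-- The block graph with three tracks of `k` blocks. -/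
def blockGraph (k : ℕ) : SimpleGraph (BlockVertex k) := SimpleGraph.fromRel BlockVertex.rel

/-- All block graphs, with `k ≥ 1` blocks on each track. -/
def blockGraphs : Set FinGraph := Set.range fun j : ℕ => ⟨BlockVertex (j + 1), blockGraph (j + 1)⟩

/-! ### Block graphs with a ladder -/

/-- Vertices of the block graph with an additional ladder with `k + 2` rungs; `lad i s` is the
vertex of the `i`-th rung on the rail `s`. -/
inductive LadderVertex (k : ℕ) where
  | u
  | v
  | blockU (r : Fin 3) (i : Fin k) (a : Fin 4)
  | blockV (r : Fin 3) (i : Fin k) (b : Fin 4)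
  | lad (i : Fin (k + 2)) (s : Bool)
  deriving DecidableEq, Fintype

/-- The corners of the ladder are `v_l = lad 0 true`, `u_l = lad 0 false` on the first rung and
`u_l' = lad (k + 1) true`, `v_l' = lad (k + 1) false` on the last rung.
* Track `0` runs from `u` to `v_l'`, track `1` from `u_l` to `v`, and track `2` from `u` to `v`.
* `u` is joined to `v_l`, and `u_l'` to `v`. -/
def LadderVertex.rel {k : ℕ} : LadderVertex k → LadderVertex k → Prop
  | .u, .blockV r i b => (r = 0 ∨ r = 2) ∧ i.val = 0 ∧ b = 0
  | .lad l s, .blockV r i b => l.val = 0 ∧ s = false ∧ r = 1 ∧ i.val = 0 ∧ b = 0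
  | .blockU r i a, .blockV s j b =>
      r = s ∧ ((i = j ∧ blockRel a b) ∨ (i.val + 1 = j.val ∧ a = 0 ∧ b = 0))
  | .blockU r i a, .v => (r = 1 ∨ r = 2) ∧ i.val + 1 = k ∧ a = 0
  | .blockU r i a, .lad l s => r = 0 ∧ i.val + 1 = k ∧ a = 0 ∧ l.val = k + 1 ∧ s = false
  | .u, .lad l s => l.val = 0 ∧ s = true
  | .lad l s, .v => l.val = k + 1 ∧ s = true
  | .lad l s, .lad l' s' => (l = l' ∧ s ≠ s') ∨ (l.val + 1 = l'.val ∧ s = s')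
  | _, _ => False

/-- The block graph with three tracks of `k` blocks and a ladder with `k + 2` rungs. -/
def ladderGraph (k : ℕ) : SimpleGraph (LadderVertex k) := SimpleGraph.fromRel LadderVertex.rel

/-- All block graphs with ladder, with an even number `k ≥ 2` of blocks on each track. -/
def ladderGraphs : Set FinGraph :=
  Set.range fun j : ℕ => ⟨LadderVertex (2 * j + 2), ladderGraph (2 * j + 2)⟩

/-! ### Rayleigh quotients and the mixing time -/

section MixingLowerBound

open Matrix

variable {Ω : Type} [Fintype Ω] [DecidableEq Ω]

/-! Both lower bounds come from one bad cut of the state space. Broder's chain is symmetric: two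
distinct states joined by a move are joined by exactly one edge choice in each direction. Let N be
the number of states, S a set of states and q the mass `cutWeight` that P carries out of S. The
sum-zero function N·1_S − |S| has Rayleigh quotient 1 − qN/(|S||Sᶜ|). So P has an eigenvector of sum
zero with an eigenvalue μ at least that large, and μ^t ≤ 2 d(π,t). This gives the mixing time
(`mixingTime_ge_of_cut`). The same cut gives the loading, because all demand from S to Sᶜ has to
cross it (`PathFlow.card_mul_card_le`).

The cuts have the form S = {M | F ⊆ M} for a fixed set F of edges. A move that leaves S destroys an
edge of F and thereby leaves an end of that edge unmatched. As the columns of P sum to one, q is at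
most the number of states with an unmatched vertex on F (`cutWeight_le_ncard`). It remains to find
an F for which such states are exponentially rarer than the states that contain F and also than
those that do not (`HasBottleneck`).

Hexagons and blocks are gadgets with two ports. A gadget has twice as many perfect matchings as
matchings that miss exactly the ports: 2 against 1 for the hexagon, 6 against 3 for the block. If u
and v are unmatched, each gadget can be matched perfectly and independently of the others, so there
are many states. Let F be one perfect matching of a gadget in the middle of a track. If a vertex of
this gadget is unmatched, the other unmatched vertex has the other colour, so the one of u, v with
the colour of the hole is matched. It is matched into some track, and counting both colours in each
gadget (`TrackSystem.balance`) shows that all gadgets between that end and the middle are passed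
through. Each of them costs a factor 2, about 2^(k/2) in total. The unmatched pair, the connections
between the parts and the at most two gadgets with holes contribute only a polynomial factor
(`TrackSystem.exists_bottleneck`).

With the ladder, u or v may instead be matched to a corner of the ladder. Then again a track is
entered, or the ladder is matched in one forced zigzag (`LadderMatching.zigzag_of_first`,
`LadderMatching.zigzag_of_last`). When u and v are unmatched, the ladder has at least 2^(k/2)
matchings to choose from, one for every sparse set of positions at which both rail edges are used
(`LadderMatching.rail_congr`, `LadderVertex.le_card_sparseSet`).

For the triangle graph with n = 2h+1, F is the edge between the two middle vertices. If a middle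
vertex is unmatched, the rows on one side of the middle are forced, and each remaining row has only
a binary choice (`MidFreeMatching.subset`), so there are at most 2·2^h such states. But at least
2^(2h−2) states contain F and as many avoid it (`TriangleGraph.le_ncard_states`).

Since ln(1/π_min) is polynomial in n, exponential mixing time contradicts rapid mixing once the
graphs are inputs of the chain. For this, every state reaches a fixed perfect matching, at which the
chain can also stay put (`broderMatrix_isPrimitive`). Membership in the classes is proved by integer
straight-line drawings whose edges are separated by linear functionals
(`isPlanar_of_segmentsSeparated`), by an explicit cyclic enumeration of the vertices, by the three
parts that remain without u and v, and by an induction over the rows of the triangle. -/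

/-- The supremum of the Rayleigh quotients of a symmetric operator on a finite-dimensional space is
itself an eigenvalue. -/
theorem Matrix.exists_eigenvalue_ge_rayleigh (T : Matrix Ω Ω ℝ) (hT : T.IsSymm) (g : Ω → ℝ)
    (hg : g ≠ 0) :
    ∃ (μ : ℝ) (f : Ω → ℝ), f ≠ 0 ∧ T *ᵥ f = μ • f ∧ g ⬝ᵥ T *ᵥ g ≤ μ * (g ⬝ᵥ g) := by
  have hH : T.IsHermitian := by
    rw [Matrix.IsHermitian, Matrix.conjTranspose_eq_transpose_of_trivial]; exact hT
  have hsym : (Matrix.toEuclideanLin T).IsSymmetric := Matrix.isSymmetric_toEuclideanLin_iff.2 hH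
  have : Nonempty Ω := by
    by_contra h
    rw [not_nonempty_iff] at h
    exact hg (Subsingleton.elim _ _)
  have : Nontrivial (EuclideanSpace ℝ Ω) := inferInstance
  have hev := hsym.hasEigenvalue_iSup_of_finiteDimensional
  set μ : ℝ := ⨆ x : { x : EuclideanSpace ℝ Ω // x ≠ 0 },
    RCLike.re (inner ℝ (Matrix.toEuclideanLin T x) (x : EuclideanSpace ℝ Ω)) /
      ‖(x : EuclideanSpace ℝ Ω)‖ ^ 2 with hμ
  obtain ⟨v, hv, hv0⟩ := hev.exists_hasEigenvector
  rw [Module.End.mem_eigenspace_iff] at hv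
  refine ⟨μ, WithLp.ofLp v, ?_, ?_, ?_⟩
  · intro h; exact hv0 (by ext i; exact congrFun h i)
  · have := congrArg WithLp.ofLp hv
    simpa [Matrix.toLpLin_apply] using this
  · set w : EuclideanSpace ℝ Ω := WithLp.toLp 2 g with hw
    have hw0 : w ≠ 0 := by
      intro h; apply hg; ext i; exact congrArg (fun z : EuclideanSpace ℝ Ω => z i) h
    have hnorm : ‖w‖ ^ 2 = g ⬝ᵥ g := by
      rw [EuclideanSpace.real_norm_sq_eq]; simp [dotProduct, hw, sq]
    have hpos : 0 < ‖w‖ ^ 2 := by positivity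
    have hbdd : BddAbove (Set.range fun x : { x : EuclideanSpace ℝ Ω // x ≠ 0 } =>
        RCLike.re (inner ℝ (Matrix.toEuclideanLin T x) (x : EuclideanSpace ℝ Ω)) /
          ‖(x : EuclideanSpace ℝ Ω)‖ ^ 2) := by
      refine ⟨‖(Matrix.toEuclideanLin T).toContinuousLinearMap‖, ?_⟩
      rintro _ ⟨⟨x, hx⟩, rfl⟩
      have hx' : 0 < ‖x‖ := norm_pos_iff.2 hx
      rw [div_le_iff₀ (by positivity : (0:ℝ) < ‖x‖ ^ 2)]
      calc _ ≤ ‖Matrix.toEuclideanLin T x‖ * ‖x‖ := by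
            simpa using real_inner_le_norm (Matrix.toEuclideanLin T x) x
        _ ≤ (‖(Matrix.toEuclideanLin T).toContinuousLinearMap‖ * ‖x‖) * ‖x‖ := by
            gcongr
            exact (Matrix.toEuclideanLin T).toContinuousLinearMap.le_opNorm x
        _ = _ := by ring
    have hle := le_ciSup hbdd ⟨w, hw0⟩
    rw [← hμ] at hle
    rw [div_le_iff₀ hpos, hnorm] at hle
    have hin : inner ℝ (Matrix.toEuclideanLin T w) w = g ⬝ᵥ T *ᵥ g := by
      rw [EuclideanSpace.inner_eq_star_dotProduct]
      rfl
    rw [← hin]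
    exact hle

/-- The mass that the cut between `S` and its complement carries in one step. -/
noncomputable def cutWeight (P : Matrix Ω Ω ℝ) (S : Finset Ω) : ℝ :=
  ∑ x ∈ S, ∑ y ∈ Sᶜ, P x y

theorem indicator_dotProduct_mulVec (P : Matrix Ω Ω ℝ) (hrow : ∀ x, ∑ y, P x y = 1)
    (S : Finset Ω) :
    (fun x => if x ∈ S then (1 : ℝ) else 0) ⬝ᵥ P *ᵥ (fun x => if x ∈ S then (1 : ℝ) else 0) =
      S.card - cutWeight P S := by
  have h : ∀ x, ∑ y ∈ Sᶜ, P x y = 1 - ∑ y ∈ S, P x y := fun x => by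
    rw [← hrow x, ← Finset.sum_add_sum_compl S]; ring
  simp only [cutWeight, h]
  simp [dotProduct, mulVec, Finset.sum_ite_mem]

/-- Subtracting the projection onto the constants gives `T`, which agrees with `P` on vectors of sum
zero. The sum-zero test vector `g`, N·1_S − |S|, satisfies g·g = |S||Sᶜ|N and g·Pg = g·g −
N²·`cutWeight P S`, so its Rayleigh quotient is at least 1 − δ and `T` has an eigenvalue of at least
this size. -/
theorem exists_eigenvector_of_cut (P : Matrix Ω Ω ℝ) (hP : P.IsSymm)
    (hrow : ∀ x, ∑ y, P x y = 1) (S : Finset Ω) (hS : S.Nonempty) (hS' : Sᶜ.Nonempty)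
    (δ : ℝ) (hδ : δ < 1)
    (hcut : cutWeight P S * Fintype.card Ω ≤ δ * (S.card * Sᶜ.card)) :
    ∃ (μ : ℝ) (f : Ω → ℝ), f ≠ 0 ∧ P *ᵥ f = μ • f ∧ ∑ x, f x = 0 ∧ 1 - δ ≤ μ := by
  set N : ℝ := ((Fintype.card Ω : ℕ) : ℝ) with hN
  have hNpos : 0 < N := by
    have : 0 < Fintype.card Ω := Fintype.card_pos_iff.2 ⟨hS.choose⟩
    rw [hN]; exact_mod_cast this
  have hs : (0 : ℝ) < S.card := by exact_mod_cast hS.card_pos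
  have hs' : (0 : ℝ) < Sᶜ.card := by exact_mod_cast hS'.card_pos
  have hsum : (S.card : ℝ) + Sᶜ.card = N := by
    rw [hN, ← Finset.card_add_card_compl S]; push_cast; rfl
  have hcol : ∀ y, ∑ x, P x y = 1 := fun y => by
    rw [← hrow y]; exact Finset.sum_congr rfl fun x _ => hP.apply y x ▸ rfl
  set T : Matrix Ω Ω ℝ := P - Matrix.of (fun _ _ => 1 / N) with hTdef
  have hTapp : ∀ x y, T x y = P x y - 1 / N := fun _ _ => rfl
  clear_value T
  have hT : T.IsSymm := by
    ext x y
    rw [transpose_apply, hTapp, hTapp, hP.apply]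
  set χ : Ω → ℝ := fun x => if x ∈ S then (1 : ℝ) else 0 with hχ
  have hχs : ∑ x, χ x = S.card := by simp [hχ]
  set g : Ω → ℝ := N • χ - (fun _ => (S.card : ℝ)) with hg
  have hg1 : ∑ x, g x = 0 := by
    simp [hg, Finset.sum_sub_distrib, ← Finset.mul_sum, hχs, hN]
  have hPone : P *ᵥ (fun _ => (S.card : ℝ)) = fun _ => (S.card : ℝ) := by
    ext x; simp [mulVec, dotProduct, ← Finset.sum_mul, hrow]
  have hPone' : ∀ v : Ω → ℝ, (fun _ => (S.card : ℝ)) ⬝ᵥ P *ᵥ v = S.card * ∑ y, v y := by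
    intro v
    simp only [mulVec, dotProduct, ← Finset.mul_sum]
    rw [Finset.sum_comm]
    congr 1
    exact Finset.sum_congr rfl fun y _ => by rw [← Finset.sum_mul, hcol, one_mul]
  have hTg : T *ᵥ g = P *ᵥ g := by
    ext x
    simp [hTapp, mulVec, dotProduct, sub_mul, Finset.sum_sub_distrib, ← Finset.mul_sum, hg1]
  have hgg : g ⬝ᵥ g = S.card * Sᶜ.card * N := by
    have h1 : χ ⬝ᵥ χ = S.card := by simp [dotProduct, hχ]
    have h2 : g ⬝ᵥ g = N * N * (χ ⬝ᵥ χ) - 2 * N * S.card * (∑ x, χ x) + S.card * S.card * N := by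
      have h3 : S.card * S.card * N = ∑ _x : Ω, (S.card * S.card : ℝ) := by
        simp [hN, mul_comm]
      rw [h3]
      simp only [dotProduct, hg, Pi.sub_apply, Pi.smul_apply, smul_eq_mul]
      rw [Finset.mul_sum, Finset.mul_sum, ← Finset.sum_sub_distrib, ← Finset.sum_add_distrib]
      exact Finset.sum_congr rfl fun x _ => by ring
    rw [h2, h1, hχs, ← hsum]; ring
  have hgPg : g ⬝ᵥ P *ᵥ g = N * N * (S.card - cutWeight P S) - S.card * S.card * N := by
    have h0 := indicator_dotProduct_mulVec P hrow S
    have h1 : χ ⬝ᵥ (fun _ => (S.card : ℝ)) = S.card * S.card := by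
      simp [dotProduct, ← Finset.sum_mul, hχs]
    have h2 : (fun _ : Ω => (S.card : ℝ)) ⬝ᵥ (fun _ => (S.card : ℝ)) = N * (S.card * S.card) := by
      simp [dotProduct, hN]
    rw [hg, mulVec_sub, hPone, sub_dotProduct, dotProduct_sub, dotProduct_sub, hPone', h2,
      mulVec_smul, dotProduct_smul, smul_dotProduct, smul_dotProduct, h0, h1]
    simp only [Pi.smul_apply, smul_eq_mul, ← Finset.mul_sum, hχs]
    ring
  have hg0 : g ≠ 0 := by
    intro h
    rw [h] at hgg
    simp only [dotProduct_zero] at hgg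
    have : 0 < (S.card : ℝ) * Sᶜ.card * N := by positivity
    linarith
  obtain ⟨μ, f, hf0, hf, hμ⟩ := T.exists_eigenvalue_ge_rayleigh hT g hg0
  rw [hTg, hgg, hgPg] at hμ
  have hμ1 : 1 - δ ≤ μ := by
    have hp : 0 < (S.card : ℝ) * Sᶜ.card * N := by positivity
    have : (1 - δ) * ((S.card : ℝ) * Sᶜ.card * N) ≤ μ * ((S.card : ℝ) * Sᶜ.card * N) := by
      refine le_trans ?_ hμ
      have h3 : N * (cutWeight P S * N) ≤ N * (δ * (S.card * Sᶜ.card)) := by gcongr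
      have h4 : N * N * (S.card - cutWeight P S) - S.card * S.card * N =
        (S.card : ℝ) * Sᶜ.card * N - N * (cutWeight P S * N) := by
        rw [show (Sᶜ.card : ℝ) = N - S.card by linarith]; ring
      rw [h4]; linarith
    exact le_of_mul_le_mul_right this hp
  -- The columns of `T` sum to 0, so μ·∑ f = 0. Here `δ < 1` enters: it makes μ positive.
  have hfs : ∑ x, f x = 0 := by
    have h1 : ∑ x, (T *ᵥ f) x = 0 := by
      simp only [mulVec, dotProduct]
      rw [Finset.sum_comm]
      refine Finset.sum_eq_zero fun y _ => ?_
      rw [← Finset.sum_mul]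
      simp only [hTapp, Finset.sum_sub_distrib, hcol]
      have : ∑ _x : Ω, 1 / N = 1 := by
        simp only [Finset.sum_const, Finset.card_univ, nsmul_eq_mul]
        rw [← hN]; field_simp
      rw [this]; ring
    rw [hf] at h1
    simp only [Pi.smul_apply, smul_eq_mul, ← Finset.mul_sum] at h1
    rcases mul_eq_zero.1 h1 with h | h
    · exfalso; linarith
    · exact h
  refine ⟨μ, f, hf0, ?_, hfs, hμ1⟩
  rw [← hf]
  ext x
  simp [hTapp, mulVec, dotProduct, sub_mul, Finset.sum_sub_distrib, ← Finset.mul_sum, hfs]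

/-- Start the chain where |f| is maximal. Since f has sum zero, P^t may be replaced by P^t − π in
(P^t f)(x) = μ^t f(x), and bounding |f y| by |f x| leaves twice the variation distance. -/
theorem eigenvalue_pow_le_totalVariationDist (P : Matrix Ω Ω ℝ) (μ : ℝ) (hμ : 0 ≤ μ) (f : Ω → ℝ)
    (hf0 : f ≠ 0) (hf : P *ᵥ f = μ • f) (hfs : ∑ x, f x = 0) (t : ℕ) :
    μ ^ t ≤ 2 * totalVariationDist P (fun _ => 1 / (Fintype.card Ω : ℝ)) t := by
  have hpow : ∀ t : ℕ, (P ^ t) *ᵥ f = μ ^ t • f := by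
    intro t
    induction t with
    | zero => simp
    | succ t ih => rw [pow_succ, ← mulVec_mulVec, hf, mulVec_smul, ih, smul_smul, pow_succ, mul_comm]
  have : Nonempty Ω := by
    by_contra h
    rw [not_nonempty_iff] at h
    exact hf0 (Subsingleton.elim _ _)
  obtain ⟨x, -, hx⟩ := Finset.exists_max_image Finset.univ (fun x => |f x|) Finset.univ_nonempty
  have hxpos : 0 < |f x| := by
    obtain ⟨y, hy⟩ := Function.ne_iff.1 hf0
    exact (abs_pos.2 hy).trans_le (hx y (Finset.mem_univ y))
  set π : Ω → ℝ := fun _ => 1 / (Fintype.card Ω : ℝ) with hπ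
  have h1 : μ ^ t * f x = ∑ y, ((P ^ t) x y - π y) * f y := by
    have := congrFun (hpow t) x
    simp only [mulVec, dotProduct, Pi.smul_apply, smul_eq_mul] at this
    rw [← this]
    simp only [sub_mul, Finset.sum_sub_distrib, hπ, ← Finset.mul_sum, hfs]
    ring
  have h2 : μ ^ t * |f x| ≤ (∑ y, |π y - (P ^ t) x y|) * |f x| := by
    calc μ ^ t * |f x| = |μ ^ t * f x| := by rw [abs_mul, abs_of_nonneg (pow_nonneg hμ t)]
      _ ≤ ∑ y, |((P ^ t) x y - π y) * f y| := by rw [h1]; exact Finset.abs_sum_le_sum_abs _ _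
      _ ≤ ∑ y, |π y - (P ^ t) x y| * |f x| := by
          refine Finset.sum_le_sum fun y _ => ?_
          rw [abs_mul, abs_sub_comm]
          exact mul_le_mul_of_nonneg_left (hx y (Finset.mem_univ y)) (abs_nonneg _)
      _ = _ := by rw [Finset.sum_mul]
  have h3 := le_of_mul_le_mul_right h2 hxpos
  have h4 : variationDist P π x t ≤ totalVariationDist P π t :=
    le_ciSup (f := fun x => variationDist P π x t) (Set.finite_range _).bddAbove x
  rw [variationDist] at h4
  linarith

theorem mixingTime_ge_of_cut (P : Matrix Ω Ω ℝ) (hP : P.IsSymm)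
    (hrow : ∀ x, ∑ y, P x y = 1) (S : Finset Ω) (hS : S.Nonempty) (hS' : Sᶜ.Nonempty)
    (δ : ℝ) (hδ0 : 0 < δ) (hδ : δ ≤ 1 / 2)
    (hcut : cutWeight P S * Fintype.card Ω ≤ δ * (S.card * Sᶜ.card))
    (ε : ℝ) (hε : 0 < ε) (hε' : ε < 1 / 2) :
    ENNReal.ofReal (1 / (2 * δ) * Real.log (1 / (2 * ε))) ≤
      (mixingTime P (fun _ => 1 / (Fintype.card Ω : ℝ)) ε : ENNReal) := by
  obtain ⟨μ, f, hf0, hf, hfs, hμ⟩ :=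
    exists_eigenvector_of_cut P hP hrow S hS hS' δ (by linarith) hcut
  have hμ0 : 0 < μ := by linarith
  have key : ∀ t : ℕ, totalVariationDist P (fun _ => 1 / (Fintype.card Ω : ℝ)) t ≤ ε →
      1 / (2 * δ) * Real.log (1 / (2 * ε)) ≤ t := by
    intro t ht
    have h1 := eigenvalue_pow_le_totalVariationDist P μ hμ0.le f hf0 hf hfs t
    have h2 : μ ^ t ≤ 2 * ε := by linarith
    have h3 : (t : ℝ) * Real.log μ ≤ Real.log (2 * ε) := by
      rw [← Real.log_pow]
      exact Real.log_le_log (by positivity) h2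
    -- From log μ ≥ 1 − 1/μ and μ ≥ 1 − δ; the inequality 1/(1 − δ) ≤ 1 + 2δ is where δ ≤ 1/2 is
    -- needed.
    have h4 : -(2 * δ) ≤ Real.log μ := by
      have h5 : Real.log μ ≥ 1 - μ⁻¹ := Real.one_sub_inv_le_log_of_pos hμ0
      have h6 : μ⁻¹ ≤ 1 + 2 * δ := by
        rw [inv_le_comm₀ hμ0 (by positivity), inv_le_iff_one_le_mul₀ (by positivity)]
        nlinarith
      linarith
    have h7 : Real.log (1 / (2 * ε)) = - Real.log (2 * ε) := by rw [one_div, Real.log_inv]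
    rw [h7, one_div, inv_mul_le_iff₀ (by positivity)]
    have h8 : (t : ℝ) * (-(2 * δ)) ≤ t * Real.log μ := by gcongr
    linarith
  -- Times are integers, so the bound may be rounded up. If no time is admissible, the infimum is
  -- `⊤` and the inequality holds as well.
  have hle : ((⌈1 / (2 * δ) * Real.log (1 / (2 * ε))⌉₊ : ℕ) : ℕ∞) ≤
      mixingTime P (fun _ => 1 / (Fintype.card Ω : ℝ)) ε := by
    refine le_iInf₂ fun t ht => ?_
    exact_mod_cast Nat.ceil_le.2 (key t ht)
  calc ENNReal.ofReal (1 / (2 * δ) * Real.log (1 / (2 * ε)))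
      ≤ ENNReal.ofReal ((⌈1 / (2 * δ) * Real.log (1 / (2 * ε))⌉₊ : ℕ) : ℝ) :=
        ENNReal.ofReal_le_ofReal (Nat.le_ceil _)
    _ = (((⌈1 / (2 * δ) * Real.log (1 / (2 * ε))⌉₊ : ℕ) : ℕ∞) : ENNReal) := by
        rw [ENNReal.ofReal_natCast]; simp
    _ ≤ _ := by exact_mod_cast hle

end MixingLowerBound

/-! ### Flows across a cut -/

section Loading

variable {Ω : Type} [Fintype Ω] [DecidableEq Ω]

omit [Fintype Ω] in
theorem SimpleGraph.Walk.exists_dart_crossing {G : SimpleGraph Ω} (S : Finset Ω) :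
    ∀ {x y : Ω} (w : G.Walk x y), x ∈ S → y ∉ S → ∃ a ∈ w.darts, a.fst ∈ S ∧ a.snd ∉ S
  | _, _, .nil, hx, hy => absurd hx hy
  | _, _, .cons (v := z) h w, hx, hy => by
      by_cases hz : z ∈ S
      · obtain ⟨a, ha, h1⟩ := w.exists_dart_crossing S hz hy
        exact ⟨a, by simp [ha], h1⟩
      · exact ⟨⟨(_, z), h⟩, by simp, hx, hz⟩

open Classical in
-- Every path from S to Sᶜ uses an arc that leaves S. So the total demand |S||Sᶜ|/N² is at most the
-- flow over these arcs, and each of them carries at most `maxLoading` times its capacity P/N.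
theorem PathFlow.card_mul_card_le (P : Matrix Ω Ω ℝ) (hP : P.IsSymm) (hP0 : ∀ x y, 0 ≤ P x y)
    (π : Ω → ℝ) (hπ : ∀ x, π x = 1 / (Fintype.card Ω : ℝ)) (f : PathFlow P π) (S : Finset Ω) :
    (S.card * Sᶜ.card : ℝ) ≤ f.maxLoading * (cutWeight P S * Fintype.card Ω) := by
  obtain ⟨N, hN⟩ : ∃ N : ℝ, N = (Fintype.card Ω : ℝ) := ⟨_, rfl⟩
  rw [← hN]
  simp only [← hN] at hπ
  rcases isEmpty_or_nonempty Ω with hE | hne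
  · have : S = ∅ := Finset.eq_empty_of_isEmpty S
    simp [this, cutWeight]
  have hNpos : 0 < N := by rw [hN]; exact_mod_cast Fintype.card_pos
  set D : Finset (stateGraph P).Dart := {a | a.fst ∈ S ∧ a.snd ∉ S} with hD
  have hstep : ∀ x ∈ S, ∀ y ∈ Sᶜ, 1 / N * (1 / N) ≤
      ∑ a ∈ D, ∑ p : (stateGraph P).Path x y, if a ∈ p.1.darts then f.flow x y p else 0 := by
    intro x hx y hy
    have hxy : x ≠ y := by rintro rfl; simp [hx] at hy
    have h0 := f.sum_flow x y hxy
    rw [hπ, hπ] at h0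
    rw [← h0, Finset.sum_comm]
    refine Finset.sum_le_sum fun p _ => ?_
    obtain ⟨a, ha, h1, h2⟩ := p.1.exists_dart_crossing S hx (by simpa using hy)
    -- One crossing arc already accounts for the flow of `p`; further crossings only increase the
    -- sum.
    refine le_trans ?_ (Finset.single_le_sum (f := fun a => if a ∈ p.1.darts then f.flow x y p else 0)
      (fun b _ => ?_) (show a ∈ D by simp [hD, h1, h2]))
    · simp [ha]
    · split_ifs
      · exact f.flow_nonneg _ _ _
      · exact le_rfl
  have hsum : (S.card * Sᶜ.card : ℝ) * (1 / N * (1 / N)) ≤ ∑ a ∈ D, f.arcFlow a := by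
    have h1 : (S.card * Sᶜ.card : ℝ) * (1 / N * (1 / N)) =
        ∑ x ∈ S, ∑ y ∈ Sᶜ, 1 / N * (1 / N) := by
      simp [mul_assoc]
    rw [h1]
    calc _ ≤ ∑ x ∈ S, ∑ y ∈ Sᶜ, ∑ a ∈ D, ∑ p : (stateGraph P).Path x y,
            (if a ∈ p.1.darts then f.flow x y p else 0) :=
          Finset.sum_le_sum fun x hx => Finset.sum_le_sum fun y hy => hstep x hx y hy
      _ ≤ ∑ x, ∑ y, ∑ a ∈ D, ∑ p : (stateGraph P).Path x y,
            (if a ∈ p.1.darts then f.flow x y p else 0) := by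
          have hnn : ∀ x y, 0 ≤ ∑ a ∈ D, ∑ p : (stateGraph P).Path x y,
            (if a ∈ p.1.darts then f.flow x y p else 0) := fun x y =>
              Finset.sum_nonneg fun a _ => Finset.sum_nonneg fun p _ => by
                split_ifs
                · exact f.flow_nonneg _ _ _
                · exact le_rfl
          refine (Finset.sum_le_sum fun x _ => Finset.sum_le_sum_of_subset_of_nonneg
            (Finset.subset_univ _) fun y _ _ => hnn x y).trans ?_
          exact Finset.sum_le_sum_of_subset_of_nonneg (Finset.subset_univ _)
            fun x _ _ => Finset.sum_nonneg fun y _ => hnn x y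
      _ = ∑ a ∈ D, f.arcFlow a := by
          simp only [PathFlow.arcFlow]
          rw [Finset.sum_comm (s := D)]
          refine Finset.sum_congr rfl fun x _ => ?_
          rw [Finset.sum_comm]
  have hpos : ∀ a : (stateGraph P).Dart, 0 < 1 / N * P a.fst a.snd := by
    intro a
    have : 0 < P a.fst a.snd := by
      have h := a.adj
      have h := (SimpleGraph.fromRel_adj _ _ _).1 h
      rcases h.2 with h | h
      · exact h
      · rwa [hP.apply] at h
    positivity
  have hload : ∀ a : (stateGraph P).Dart,
      f.arcFlow a ≤ f.maxLoading * (1 / N * P a.fst a.snd) := by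
    intro a
    rw [← div_le_iff₀ (hpos a)]
    have h0 := le_ciSup (f := fun a : (stateGraph P).Dart => f.arcFlow a /
      (π a.fst * P a.fst a.snd)) (Set.finite_range _).bddAbove a
    rw [hπ] at h0
    exact h0
  have harc : ∀ a, 0 ≤ f.arcFlow a := fun a => by
    refine Finset.sum_nonneg fun x _ => Finset.sum_nonneg fun y _ =>
      Finset.sum_nonneg fun p _ => ?_
    split_ifs
    · exact f.flow_nonneg _ _ _
    · exact le_rfl
  have hρ : 0 ≤ f.maxLoading := Real.iSup_nonneg fun a => div_nonneg (harc a) (by rw [hπ]; exact (hpos a).le)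
  -- An arc is determined by its pair of ends, so the arcs leaving S embed into S × Sᶜ.
  have hDsum : ∑ a ∈ D, P a.fst a.snd ≤ cutWeight P S := by
    have hprod : cutWeight P S = ∑ q ∈ S ×ˢ Sᶜ, P q.1 q.2 :=
      (Finset.sum_product' S Sᶜ fun x y => P x y).symm
    rw [hprod]
    have hinj : Function.Injective (fun a : (stateGraph P).Dart => a.toProd) :=
      fun a b h => SimpleGraph.Dart.ext _ _ h
    have himg := Finset.sum_image (s := D) (g := fun a : (stateGraph P).Dart => a.toProd)
      (f := fun q : Ω × Ω => P q.1 q.2) (fun a _ b _ h => hinj h)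
    rw [← himg]
    refine Finset.sum_le_sum_of_subset_of_nonneg ?_ fun q _ _ => hP0 _ _
    intro q hq
    obtain ⟨a, ha, rfl⟩ := Finset.mem_image.1 hq
    simp only [hD, Finset.mem_filter] at ha
    simp [ha.2.1, ha.2.2]
  have h5 : (S.card * Sᶜ.card : ℝ) * (1 / N * (1 / N)) ≤ f.maxLoading * (1 / N) * cutWeight P S := by
    refine hsum.trans ?_
    calc ∑ a ∈ D, f.arcFlow a ≤ ∑ a ∈ D, f.maxLoading * (1 / N * P a.fst a.snd) :=
          Finset.sum_le_sum fun a _ => hload a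
      _ = f.maxLoading * (1 / N) * ∑ a ∈ D, P a.fst a.snd := by
          rw [Finset.mul_sum]; exact Finset.sum_congr rfl fun a _ => by ring
      _ ≤ _ := by gcongr
  have h6 := mul_le_mul_of_nonneg_right h5 (show 0 ≤ N * N by positivity)
  have e1 : (S.card * Sᶜ.card : ℝ) * (1 / N * (1 / N)) * (N * N) = S.card * Sᶜ.card := by
    field_simp
  have e2 : f.maxLoading * (1 / N) * cutWeight P S * (N * N) =
      f.maxLoading * (cutWeight P S * N) := by field_simp
  rw [e1, e2] at h6
  exact h6

end Loading

/-! ### Broder's chain -/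

section BroderChain

variable {V : Type} {G : SimpleGraph V}

theorem mem_unmatched {M : Set (Sym2 V)} {w : V} : w ∈ unmatched M ↔ ∀ x, s(w, x) ∉ M := by
  constructor
  · intro h x hx
    exact h _ hx (Sym2.mem_mk_left _ _)
  · intro h e he hw
    obtain ⟨x, rfl⟩ := Sym2.mem_iff_exists.1 hw
    exact h x he

theorem not_mem_unmatched {M : Set (Sym2 V)} {w : V} : w ∉ unmatched M ↔ ∃ x, s(w, x) ∈ M := by
  rw [mem_unmatched]; push Not; rfl

theorem IsMatchingSet.mate_unique {M : Set (Sym2 V)} (h : IsMatchingSet G M) {x y z : V}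
    (hy : s(x, y) ∈ M) (hz : s(x, z) ∈ M) : y = z := by
  have := h.2 _ hy _ hz x (Sym2.mem_mk_left _ _) (Sym2.mem_mk_left _ _)
  rw [Sym2.congr_right] at this
  exact this

theorem IsMatchingSet.adj {M : Set (Sym2 V)} (h : IsMatchingSet G M) {x y : V}
    (hy : s(x, y) ∈ M) : G.Adj x y := h.1 hy

theorem isMatchingSet_iff {M : Set (Sym2 V)} : IsMatchingSet G M ↔
    (∀ x y, s(x, y) ∈ M → G.Adj x y) ∧ ∀ x y z, s(x, y) ∈ M → s(x, z) ∈ M → y = z := by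
  constructor
  · intro h
    exact ⟨fun x y => h.adj, fun x y z => h.mate_unique⟩
  · rintro ⟨h1, h2⟩
    refine ⟨?_, ?_⟩
    · intro e he
      induction e with | _ x y => exact h1 x y he
    · intro e he f hf w hw hw'
      obtain ⟨x, rfl⟩ := Sym2.mem_iff_exists.1 hw
      obtain ⟨y, rfl⟩ := Sym2.mem_iff_exists.1 hw'
      rw [h2 _ _ _ he hf]

theorem BroderState.isMatching (M : BroderState G) : IsMatchingSet G M.1 :=
  M.2.elim (fun h => h.1) (fun h => h.1)

theorem BroderState.unmatched_eq_empty_or (M : BroderState G) :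
    unmatched M.1 = ∅ ∨ ∃ a b, a ≠ b ∧ unmatched M.1 = {a, b} := by
  rcases M.2 with h | h
  · exact Or.inl h.2
  · right
    exact Set.ncard_eq_two.1 h.2

/-- The three ways in which a state can change when the edge `e` is chosen. -/
inductive BroderStep (M : Set (Sym2 V)) (e : Sym2 V) (M' : Set (Sym2 V)) : Prop where
  | remove (hM : unmatched M = ∅) (he : e ∈ M) (hM' : M' = M \ {e})
  | add (a w : V) (hw : e = s(a, w)) (hM : unmatched M = {a, w}) (hM' : M' = insert e M)
  | slide (a b w z : V) (hw : e = s(a, w)) (hab : a ≠ b) (hM : unmatched M = {a, b})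
      (hz : s(w, z) ∈ M) (hM' : M' = insert e (M \ {s(w, z)}))

/-- No edge of `M` meets the unmatched vertex `a`, and only one meets `w`, so avoiding both ends
discards just that one. -/
theorem IsMatchingSet.setOf_avoid {M : Set (Sym2 V)} (hmat : IsMatchingSet G M) {a w z : V}
    (ha : a ∈ unmatched M) (hz : s(w, z) ∈ M) :
    {f ∈ M | ∀ x ∈ s(a, w), x ∉ f} = M \ {s(w, z)} := by
  ext f
  simp only [Set.mem_ofPred_eq, Sym2.mem_iff, forall_eq_or_imp, forall_eq, Set.mem_sdiff,
    Set.mem_singleton_iff]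
  constructor
  · rintro ⟨h1, -, h3⟩
    refine ⟨h1, ?_⟩
    rintro rfl
    exact h3 (Sym2.mem_mk_left _ _)
  · rintro ⟨h1, h2⟩
    exact ⟨h1, ha f h1, fun hwf => h2 (hmat.2 _ h1 _ hz w hwf (Sym2.mem_mk_left _ _))⟩

theorem setOf_avoid_of_unmatched {M : Set (Sym2 V)} {a w : V}
    (ha : a ∈ unmatched M) (hw : w ∈ unmatched M) :
    {f ∈ M | ∀ x ∈ s(a, w), x ∉ f} = M := by
  ext f
  simp only [Set.mem_ofPred_eq, Sym2.mem_iff, forall_eq_or_imp, forall_eq]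
  exact ⟨fun h => h.1, fun h => ⟨h, ha f h, hw f h⟩⟩

theorem broderMove_of_mem_unmatched {M : Set (Sym2 V)} {a w : V} (ha : a ∈ unmatched M) :
    broderMove M s(a, w) = insert s(a, w) {f ∈ M | ∀ x ∈ s(a, w), x ∉ f} := by
  rw [broderMove, if_neg (Set.nonempty_iff_ne_empty.1 ⟨a, ha⟩),
    if_pos ⟨a, Sym2.mem_mk_left _ _, ha⟩]

theorem BroderStep.broderMove_eq {M M' : Set (Sym2 V)} {e : Sym2 V} (hmat : IsMatchingSet G M)
    (h : BroderStep M e M') : broderMove M e = M' := by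
  cases h with
  | remove hM he hM' => simp [broderMove, hM, hM']
  | add a w hw hM hM' =>
    rw [hw, broderMove_of_mem_unmatched (by simp [hM]), setOf_avoid_of_unmatched (by simp [hM])
      (by simp [hM]), hM', hw]
  | slide a b w z hw hab hM hz hM' =>
    rw [hw, broderMove_of_mem_unmatched (by simp [hM]), hmat.setOf_avoid (by simp [hM]) hz, hM', hw]

theorem broderMove_eq_or_step (M : BroderState G) {e : Sym2 V} (he : e ∈ G.edgeSet) :
    broderMove M.1 e = M.1 ∨ BroderStep M.1 e (broderMove M.1 e) := by
  rcases M.unmatched_eq_empty_or with h0 | ⟨a, b, hab, hM⟩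
  · by_cases heM : e ∈ M.1
    · right
      exact .remove h0 heM (by simp [broderMove, h0])
    · left
      simp [broderMove, h0, heM]
  · by_cases hex : ∃ w ∈ e, w ∈ unmatched M.1
    · right
      obtain ⟨a', ha', haM⟩ := hex
      wlog haa : a' = a generalizing a b
      · refine this b a hab.symm (by rw [hM, Set.pair_comm]) ?_
        rw [hM] at haM
        exact haM.resolve_left haa
      subst haa
      obtain ⟨w, rfl⟩ := Sym2.mem_iff_exists.1 ha'
      have haw : a' ≠ w := (G.mem_edgeSet.1 he).ne
      rw [broderMove_of_mem_unmatched haM]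
      by_cases hw : w ∈ unmatched M.1
      · refine .add a' w rfl ?_ ?_
        · rw [hM] at hw ⊢
          rcases hw with hw | hw
          · exact absurd hw.symm haw
          · rw [Set.mem_singleton_iff] at hw; rw [hw]
        · rw [setOf_avoid_of_unmatched haM hw]
      · obtain ⟨z, hz⟩ := not_mem_unmatched.1 hw
        exact .slide a' b w z rfl hab hM hz (by rw [M.isMatching.setOf_avoid haM hz])
    · left
      rw [broderMove, if_neg (by rw [hM]; exact (Set.insert_nonempty _ _).ne_empty), if_neg hex]

/-- The chosen edge can be read off from the two states: it is the only element of M \ M' if M is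
perfect and the only element of M' \ M otherwise. Hence a move between distinct states arises from
just one edge. -/
theorem BroderStep.eq_of_eq {M M' : Set (Sym2 V)} {e e' : Sym2 V} (h : BroderStep M e M')
    (h' : BroderStep M e' M') : e = e' := by
  have key : ∀ e, BroderStep M e M' → unmatched M ≠ ∅ → M' \ M = {e} := by
    intro e h hne
    have aux : ∀ a w, e = s(a, w) → a ∈ unmatched M → e ∉ M := fun a w hw ha he =>
      mem_unmatched.1 ha w (hw ▸ he)
    cases h with
    | remove hM he hM' => exact absurd hM hne
    | add a w hw hM hM' =>
      have := aux a w hw (by simp [hM])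
      ext f
      simp only [hM', Set.mem_sdiff, Set.mem_insert_iff, Set.mem_singleton_iff]
      constructor
      · tauto
      · rintro rfl; tauto
    | slide a b w z hw hab hM hz hM' =>
      have := aux a w hw (by simp [hM])
      ext f
      simp only [hM', Set.mem_sdiff, Set.mem_insert_iff, Set.mem_singleton_iff]
      constructor
      · tauto
      · rintro rfl; tauto
  by_cases hne : unmatched M = ∅
  · have key' : ∀ e, BroderStep M e M' → M \ M' = {e} := by
      intro e h
      cases h with
      | remove hM he hM' =>
        ext f
        simp only [hM', Set.mem_sdiff, Set.mem_singleton_iff]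
        constructor
        · tauto
        · rintro rfl; tauto
      | add a w hw hM hM' => rw [hM] at hne; exact absurd hne (Set.insert_nonempty _ _).ne_empty
      | slide a b w z hw hab hM hz hM' =>
        rw [hM] at hne; exact absurd hne (Set.insert_nonempty _ _).ne_empty
    exact Set.singleton_injective ((key' e h).symm.trans (key' e' h'))
  · exact Set.singleton_injective ((key e h hne).symm.trans (key e' h' hne))

/-- Removing and adding an edge undo each other, and a slide is undone by choosing the edge it
dropped: its far end `z` is now unmatched. Computing the unmatched vertices on the way shows that
the result is again a state. -/
theorem BroderStep.reverse {M M' : Set (Sym2 V)} {e : Sym2 V}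
    (hmat : IsMatchingSet G M) (he : e ∈ G.edgeSet) (h : BroderStep M e M') :
    (IsPerfectMatchingSet G M' ∨ IsNearPerfectMatchingSet G M') ∧
      ∃ e' ∈ G.edgeSet, BroderStep M' e' M := by
  cases h with
  | remove hM heM hM' =>
    induction e with | _ x y =>
    have hxy : x ≠ y := (G.mem_edgeSet.1 he).ne
    have hun : unmatched M' = {x, y} := by
      ext w
      rw [mem_unmatched, hM']
      simp only [Set.mem_sdiff, Set.mem_singleton_iff, not_and, not_not, Set.mem_insert_iff]
      constructor
      · intro h
        have hw : w ∉ unmatched M := by simp [hM]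
        obtain ⟨v, hv⟩ := not_mem_unmatched.1 hw
        have := h v hv
        rw [Sym2.eq_iff] at this
        tauto
      · intro h v hv
        rcases h with rfl | rfl
        · rw [hmat.mate_unique hv heM]
        · rw [Sym2.eq_swap] at heM
          rw [hmat.mate_unique hv heM, Sym2.eq_swap]
    refine ⟨Or.inr ⟨⟨?_, ?_⟩, ?_⟩, s(x, y), he, .add x y rfl hun ?_⟩
    · rw [hM']; exact Set.sdiff_subset.trans hmat.1
    · intro e he f hf
      rw [hM'] at he hf
      exact hmat.2 e he.1 f hf.1
    · rw [hun, Set.ncard_pair hxy]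
    · rw [hM', Set.insert_sdiff_singleton, Set.insert_eq_of_mem heM]
  | add a w hw hM hM' =>
    have ha := mem_unmatched.1 (show a ∈ unmatched M by simp [hM])
    have hw' := mem_unmatched.1 (show w ∈ unmatched M by simp [hM])
    have hun : unmatched M' = ∅ := by
      rw [Set.eq_empty_iff_forall_notMem]
      intro x hx
      rw [mem_unmatched, hM', hw] at hx
      simp only [Set.mem_insert_iff, not_or] at hx
      have : x ∈ unmatched M := mem_unmatched.2 fun y => (hx y).2
      rw [hM] at this
      rcases this with rfl | h
      · exact (hx w).1 rfl
      · rw [Set.mem_singleton_iff] at h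
        subst h
        exact (hx a).1 Sym2.eq_swap
    refine ⟨Or.inl ⟨isMatchingSet_iff.2 ⟨?_, ?_⟩, hun⟩, e, he, .remove hun (by simp [hM']) ?_⟩
    · intro x y h
      rw [hM'] at h
      rcases h with h | h
      · rw [← h] at he; exact he
      · exact hmat.adj h
    · intro x y z h1 h2
      rw [hM', hw] at h1 h2
      simp only [Set.mem_insert_iff, Sym2.eq_iff] at h1 h2
      have := @IsMatchingSet.mate_unique _ _ _ hmat x y z
      have e1 : ∀ t, s(w, t) ∉ M := hw'
      grind
    · rw [hM', Set.insert_sdiff_of_mem _ (Set.mem_singleton _), Set.sdiff_singleton_eq_self]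
      rw [hw]; exact ha w
  | slide a b w z hw hab hM hz hM' =>
    have ha := mem_unmatched.1 (show a ∈ unmatched M by simp [hM])
    have hb := mem_unmatched.1 (show b ∈ unmatched M by simp [hM])
    have hzb : z ≠ b := by rintro rfl; exact hb w (by rwa [Sym2.eq_swap])
    have hza : z ≠ a := by rintro rfl; exact ha w (by rwa [Sym2.eq_swap])
    have haw : a ≠ w := by rintro rfl; exact ha z hz
    have hwz : w ≠ z := (hmat.adj hz).ne
    have hun : unmatched M' = {z, b} := by
      ext x
      rw [mem_unmatched, hM', hw]
      simp only [Set.mem_sdiff, Set.mem_singleton_iff, not_and, not_not, Set.mem_insert_iff, not_or]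
      constructor
      · intro h
        by_cases hx : x ∈ unmatched M
        · rw [hM] at hx
          rcases hx with rfl | hx
          · exact absurd rfl (h w).1
          · exact Or.inr hx
        · obtain ⟨y, hy⟩ := not_mem_unmatched.1 hx
          have := (h y).2 hy
          rw [Sym2.eq_iff] at this
          rcases this with ⟨rfl, rfl⟩ | ⟨rfl, rfl⟩
          · exact absurd Sym2.eq_swap (h a).1
          · exact Or.inl rfl
      · rintro (rfl | rfl) y
        · refine ⟨?_, fun h => ?_⟩
          · simp only [Sym2.eq_iff]; grind
          · rw [Sym2.eq_swap] at hz
            rw [hmat.mate_unique h hz, Sym2.eq_swap]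
        · refine ⟨?_, fun h => absurd h (hb y)⟩
          simp only [Sym2.eq_iff]
          rintro (⟨rfl, -⟩ | ⟨rfl, -⟩)
          · exact hab rfl
          · exact hb _ hz
    refine ⟨Or.inr ⟨isMatchingSet_iff.2 ⟨?_, ?_⟩, ?_⟩, s(w, z), hmat.1 hz,
      .slide z b w a Sym2.eq_swap hzb hun ?_ ?_⟩
    · intro x y h
      rw [hM'] at h
      rcases h with h | h
      · rw [← h] at he; exact he
      · exact hmat.adj h.1
    · intro x y t h1 h2
      rw [hM', hw] at h1 h2
      simp only [Set.mem_insert_iff, Sym2.eq_iff, Set.mem_sdiff, Set.mem_singleton_iff] at h1 h2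
      have h3 := @IsMatchingSet.mate_unique _ _ _ hmat x y t
      have h4 := fun t => @IsMatchingSet.mate_unique _ _ _ hmat w z t hz
      grind
    · rw [hun, Set.ncard_pair hzb]
    · rw [hM', hw]; left; exact Sym2.eq_swap
    · rw [hM', hw, Sym2.eq_swap (a := w) (b := a), Set.insert_sdiff_of_mem _ (Set.mem_singleton _),
        Set.sdiff_singleton_eq_self, Set.insert_sdiff_singleton, Set.insert_eq_of_mem hz]
      exact fun h => ha w h.1

theorem broderMove_isState (M : BroderState G) {e : Sym2 V} (he : e ∈ G.edgeSet) :
    IsPerfectMatchingSet G (broderMove M.1 e) ∨ IsNearPerfectMatchingSet G (broderMove M.1 e) := by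
  rcases broderMove_eq_or_step M he with h | h
  · rw [h]; exact M.2
  · exact (h.reverse M.isMatching he).1

/-- The state after the edge `e` has been chosen. -/
noncomputable def BroderState.move (M : BroderState G) (e : G.edgeSet) : BroderState G :=
  ⟨broderMove M.1 e.1, broderMove_isState M e.2⟩

theorem BroderState.exists_move_symm {M M' : BroderState G} (h : ∃ e, M.move e = M') :
    ∃ e, M'.move e = M := by
  obtain ⟨e, rfl⟩ := h
  rcases broderMove_eq_or_step M e.2 with h | h
  · have : M.move e = M := Subtype.ext h
    rw [this]
    exact ⟨e, this⟩
  · obtain ⟨e', he', h'⟩ := (h.reverse M.isMatching e.2).2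
    exact ⟨⟨e', he'⟩, Subtype.ext (h'.broderMove_eq (M.move e).isMatching)⟩

theorem BroderState.move_injective {M : BroderState G} {e e' : G.edgeSet} (h : M.move e = M.move e')
    (hne : M.move e ≠ M) : e = e' := by
  have h1 := (broderMove_eq_or_step M e.2).resolve_left fun h => hne (Subtype.ext h)
  have h2 := (broderMove_eq_or_step M e'.2).resolve_left fun h2 => hne (h.trans (Subtype.ext h2))
  have h3 : broderMove M.1 e.1 = broderMove M.1 e'.1 := congrArg Subtype.val h
  rw [← h3] at h2
  exact Subtype.ext (h1.eq_of_eq h2)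

variable [Finite V]

omit [Finite V] in
theorem broderMatrix_apply (M M' : BroderState G) :
    broderMatrix G M M' = (Nat.card {e : G.edgeSet // M.move e = M'} : ℝ) / Nat.card G.edgeSet := by
  rw [broderMatrix, ← Nat.card_coe_set_eq, ← Nat.card_coe_set_eq]
  congr 2
  refine Nat.card_congr ⟨fun e => ⟨⟨e.1, e.2.1⟩, Subtype.ext e.2.2⟩,
    fun e => ⟨e.1.1, e.1.2, congrArg Subtype.val e.2⟩, fun _ => rfl, fun _ => rfl⟩

/-- Between distinct states each entry counts at most one edge (`BroderState.move_injective`), and a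
move in one direction exists exactly if one exists in the other. -/
theorem broderMatrix_isSymm : (broderMatrix G).IsSymm := by
  ext M M'
  rw [Matrix.transpose_apply]
  by_cases hne : M = M'
  · rw [hne]
  have hle : ∀ M M' : BroderState G, M ≠ M' →
      Nat.card {e : G.edgeSet // M.move e = M'} ≤ Nat.card {e : G.edgeSet // M'.move e = M} := by
    intro M M' hne
    rcases isEmpty_or_nonempty {e : G.edgeSet // M.move e = M'} with hE | ⟨⟨e, he⟩⟩
    · simp
    · obtain ⟨e', he'⟩ := BroderState.exists_move_symm ⟨e, he⟩
      have h1 : Subsingleton {e : G.edgeSet // M.move e = M'} := ⟨fun a b => Subtype.ext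
        (BroderState.move_injective (a.2.trans b.2.symm) (by rw [a.2]; exact hne.symm))⟩
      have h2 : Nonempty {e : G.edgeSet // M'.move e = M} := ⟨⟨e', he'⟩⟩
      exact (Finite.card_le_one_iff_subsingleton.2 h1).trans Nat.card_pos
  rw [broderMatrix_apply, broderMatrix_apply, le_antisymm (hle M M' hne) (hle M' M (Ne.symm hne))]

omit [Finite V] in
theorem broderMatrix_nonneg (M M' : BroderState G) : 0 ≤ broderMatrix G M M' := by
  rw [broderMatrix_apply]; positivity

theorem broderMatrix_pos_iff (M M' : BroderState G) :
    0 < broderMatrix G M M' ↔ ∃ e, M.move e = M' := by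
  rw [broderMatrix_apply]
  constructor
  · intro h
    by_contra hne
    have : IsEmpty {e : G.edgeSet // M.move e = M'} := ⟨fun e => hne ⟨e.1, e.2⟩⟩
    simp at h
  · rintro ⟨e, he⟩
    have h2 : Nonempty {e : G.edgeSet // M.move e = M'} := ⟨⟨e, he⟩⟩
    have h3 : Nonempty G.edgeSet := ⟨e⟩
    have := Nat.card_pos (α := {e : G.edgeSet // M.move e = M'})
    have := Nat.card_pos (α := G.edgeSet)
    positivity

theorem sum_broderMatrix (hG : G.edgeSet.Nonempty) (M : BroderState G) :
    ∑ M', broderMatrix G M M' = 1 := by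
  have h3 : Nonempty G.edgeSet := hG.to_subtype
  have h4 : (0 : ℝ) < Nat.card G.edgeSet := by exact_mod_cast Nat.card_pos
  simp only [broderMatrix_apply]
  rw [← Finset.sum_div, div_eq_one_iff_eq h4.ne', ← Nat.cast_sum, ← Nat.card_sigma]
  congr 1
  exact Nat.card_congr (Equiv.sigmaFiberEquiv M.move)

end BroderChain

/-! ### Irreducibility and aperiodicity of Broder's chain -/

section Ergodicity

variable {V : Type} {G : SimpleGraph V} [Finite V]

theorem broderMatrix_pow_pos {M M' : BroderState G}
    (h : Relation.ReflTransGen (fun M M' : BroderState G => ∃ e, M.move e = M') M M') :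
    ∃ k : ℕ, 0 < (broderMatrix G ^ k) M M' := by
  induction h with
  | refl => exact ⟨0, by simp⟩
  | @tail b c _ hbc ih =>
    obtain ⟨k, hk⟩ := ih
    refine ⟨k + 1, ?_⟩
    rw [pow_succ, Matrix.mul_apply]
    have hnn : ∀ (k : ℕ) (x y : BroderState G), 0 ≤ (broderMatrix G ^ k) x y := fun k x y =>
      Matrix.pow_apply_nonneg broderMatrix_nonneg k x y
    exact Finset.sum_pos' (fun x _ => mul_nonneg (hnn k _ _) (broderMatrix_nonneg _ _))
      ⟨b, Finset.mem_univ _, mul_pos hk ((broderMatrix_pos_iff _ _).2 hbc)⟩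

/-- The measure 2|M₀ \ M| + [M is perfect] decreases. A perfect M ≠ M₀ loses an edge outside M₀,
which turns the indicator off. A near-perfect M gains the edge of M₀ at an unmatched vertex, which
lowers the first term by at least 2 and raises the indicator by at most 1. -/
theorem BroderState.reaches_perfect (M₀ : BroderState G) (h₀ : unmatched M₀.1 = ∅) :
    ∀ (c : ℕ) (M : BroderState G), (M₀.1 \ M.1).ncard * 2 +
      (open Classical in if unmatched M.1 = ∅ then 1 else 0) ≤ c →
      Relation.ReflTransGen (fun M M' : BroderState G => ∃ e, M.move e = M') M M₀ := by
  intro c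
  induction c using Nat.strong_induction_on with
  | _ c ih =>
  intro M hM
  by_cases heq : M = M₀
  · rw [heq]
  by_cases hp : unmatched M.1 = ∅
  · rw [if_pos hp] at hM
    have : ¬ M.1 ⊆ M₀.1 := by
      intro hsub
      apply heq
      apply Subtype.ext
      refine hsub.antisymm fun e he => ?_
      induction e with | _ x y =>
      obtain ⟨z, hz⟩ := not_mem_unmatched.1 (show x ∉ unmatched M.1 by simp [hp])
      rwa [M₀.isMatching.mate_unique he (hsub hz)]
    obtain ⟨e, heM, he₀⟩ := Set.not_subset.1 this
    have heG := M.isMatching.1 heM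
    have hstep : BroderStep M.1 e (M.1 \ {e}) := .remove hp heM rfl
    have hmove : (M.move ⟨e, heG⟩).1 = M.1 \ {e} := hstep.broderMove_eq M.isMatching
    have hne : unmatched (M.move ⟨e, heG⟩).1 ≠ ∅ := by
      induction e with | _ x y =>
      rw [← Set.nonempty_iff_ne_empty]
      refine ⟨x, ?_⟩
      rw [hmove, mem_unmatched]
      rintro z ⟨hz, hz'⟩
      rw [M.isMatching.mate_unique hz heM] at hz'
      exact hz' rfl
    have hdiff : M₀.1 \ (M.move ⟨e, heG⟩).1 = M₀.1 \ M.1 := by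
      rw [hmove]
      ext f
      simp only [Set.mem_sdiff, Set.mem_singleton_iff]
      grind
    refine Relation.ReflTransGen.head ⟨⟨e, heG⟩, rfl⟩ (ih (c - 1) (by omega) _ ?_)
    rw [hdiff, if_neg hne]
    omega
  · rw [if_neg hp] at hM
    obtain ⟨a, ha⟩ := Set.nonempty_iff_ne_empty.2 hp
    obtain ⟨w, hw⟩ := not_mem_unmatched.1 (show a ∉ unmatched M₀.1 by simp [h₀])
    have heG := M₀.isMatching.1 hw
    have hnot : s(a, w) ∉ M.1 := mem_unmatched.1 ha w
    -- No edge of `M₀` other than the added one is lost, because `M₀` covers both ends of the added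
    -- edge by that edge itself.
    have hsub : M₀.1 \ (M.move ⟨_, heG⟩).1 ⊂ M₀.1 \ M.1 := by
      have hmove : (M.move ⟨_, heG⟩).1 = insert s(a, w) {f ∈ M.1 | ∀ x ∈ s(a, w), x ∉ f} :=
        broderMove_of_mem_unmatched ha
      rw [hmove]
      refine ⟨?_, fun h => ?_⟩
      · rintro f ⟨hf, hf'⟩
        refine ⟨hf, fun hfM => hf' ?_⟩
        by_cases hfe : ∀ x ∈ s(a, w), x ∉ f
        · exact Or.inr ⟨hfM, hfe⟩
        · push Not at hfe
          obtain ⟨x, hx, hxf⟩ := hfe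
          left
          exact M₀.isMatching.2 _ hf _ hw x hxf hx
      · exact (h ⟨hw, hnot⟩).2 (Set.mem_insert _ _)
    have hlt := Set.ncard_lt_ncard hsub (Set.toFinite _)
    refine Relation.ReflTransGen.head ⟨⟨_, heG⟩, rfl⟩ (ih (c - 1) (by omega) _ ?_)
    split_ifs <;> omega

/-- A vertex with two neighbours yields an edge outside `M₀`; choosing it leaves `M₀` unchanged.
Waiting at `M₀` makes all travel times to it equal to K + 1, and by symmetry the way back takes
equally long, so any two states are joined in exactly 2(K + 1) steps. -/
theorem broderMatrix_isPrimitive (M₀ : BroderState G) (h₀ : unmatched M₀.1 = ∅)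
    {x y z : V} (hy : G.Adj x y) (hz : G.Adj x z) (hyz : y ≠ z) :
    (broderMatrix G).IsPrimitive := by
  refine ⟨broderMatrix_nonneg, ?_⟩
  have hloop : 0 < broderMatrix G M₀ M₀ := by
    rw [broderMatrix_pos_iff]
    have : ∃ e ∈ G.edgeSet, e ∉ M₀.1 := by
      by_cases h : s(x, y) ∈ M₀.1
      · exact ⟨s(x, z), hz, fun h' => hyz (M₀.isMatching.mate_unique h h')⟩
      · exact ⟨s(x, y), hy, h⟩
    obtain ⟨e, he, heM⟩ := this
    exact ⟨⟨e, he⟩, Subtype.ext (by simp [BroderState.move, broderMove, h₀, heM])⟩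
  have hnn : ∀ (k : ℕ) (x y : BroderState G), 0 ≤ (broderMatrix G ^ k) x y := fun k x y =>
    Matrix.pow_apply_nonneg broderMatrix_nonneg k x y
  have hmul : ∀ (k l : ℕ) (x y z : BroderState G), 0 < (broderMatrix G ^ k) x y →
      0 < (broderMatrix G ^ l) y z → 0 < (broderMatrix G ^ (k + l)) x z := by
    intro k l x y z h1 h2
    rw [pow_add, Matrix.mul_apply]
    exact Finset.sum_pos' (fun w _ => mul_nonneg (hnn k _ _) (hnn l _ _))
      ⟨y, Finset.mem_univ _, mul_pos h1 h2⟩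
  have hloops : ∀ l : ℕ, 0 < (broderMatrix G ^ l) M₀ M₀ := by
    intro l
    induction l with
    | zero => simp
    | succ l ih => exact hmul l 1 _ _ _ ih (by rwa [pow_one])
  choose k hk using fun M : BroderState G =>
    broderMatrix_pow_pos (BroderState.reaches_perfect M₀ h₀ _ M le_rfl)
  set K := Finset.univ.sup k with hK
  have hK1 : ∀ M, 0 < (broderMatrix G ^ (K + 1)) M M₀ := by
    intro M
    have hle : k M ≤ K := Finset.le_sup (Finset.mem_univ M)
    have := hmul (k M) (K + 1 - k M) _ _ _ (hk M) (hloops _)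
    rwa [show k M + (K + 1 - k M) = K + 1 by omega] at this
  have hsymm : (broderMatrix G ^ (K + 1)).IsSymm := broderMatrix_isSymm.pow _
  refine ⟨(K + 1) + (K + 1), by omega, fun M M' => hmul _ _ _ M₀ _ (hK1 M) ?_⟩
  rw [hsymm.apply]
  exact hK1 M'

end Ergodicity

/-! ### Bottlenecks -/

section Bottleneck

variable {V : Type} {G : SimpleGraph V} [Finite V]

omit [Finite V] in
-- Leaving means that an edge of F disappears. If it is deleted, its ends become unmatched; if a
-- slide replaces it, its end away from the chosen edge does.
theorem exists_unmatched_of_leaves {M : BroderState G} {F : Set (Sym2 V)} (hF : F ⊆ M.1)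
    {e : G.edgeSet} (h : ¬ F ⊆ (M.move e).1) : ∃ f ∈ F, ∃ w ∈ f, w ∈ unmatched (M.move e).1 := by
  rcases broderMove_eq_or_step M e.2 with h' | h'
  · exact absurd (by rw [show (M.move e).1 = M.1 from h']; exact hF) h
  · change BroderStep M.1 e.1 (M.move e).1 at h'
    cases h' with
    | remove hM he hM' =>
      rw [hM'] at h
      obtain ⟨f, hf, hf'⟩ := Set.not_subset.1 h
      have hfe : f = e.1 := by
        by_contra hne
        exact hf' ⟨hF hf, hne⟩
      obtain ⟨x, hx⟩ : ∃ x, x ∈ f := by induction f with | _ a b => exact ⟨a, Sym2.mem_mk_left _ _⟩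
      refine ⟨f, hf, x, hx, ?_⟩
      rw [hM']
      rintro g ⟨hg, hge⟩ hxg
      exact hge (M.isMatching.2 g hg _ he x hxg (hfe ▸ hx))
    | add a w hw hM hM' =>
      rw [hM'] at h
      exact absurd (hF.trans (Set.subset_insert _ _)) h
    | slide a b w z hw hab hM hz hM' =>
      rw [hM'] at h
      obtain ⟨f, hf, hf'⟩ := Set.not_subset.1 h
      have hfe : f = s(w, z) := by
        by_contra hne
        exact hf' (Or.inr ⟨hF hf, hne⟩)
      refine ⟨f, hf, z, by rw [hfe]; exact Sym2.mem_mk_right _ _, ?_⟩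
      rw [hM']
      rintro g (rfl | ⟨hg, hge⟩) hxg
      · rw [hw, Sym2.mem_iff] at hxg
        rcases hxg with rfl | rfl
        · exact mem_unmatched.1 (show z ∈ unmatched M.1 by simp [hM]) w (by rwa [Sym2.eq_swap])
        · exact (M.isMatching.adj hz).ne rfl
      · exact hge (M.isMatching.2 g hg _ hz z hxg (Sym2.mem_mk_right _ _))

open Classical in
-- Arcs that leave {M | F ⊆ M} end in states with a hole on F, and the mass entering any state is
-- one, because the symmetric matrix has column sums one.
theorem cutWeight_le_ncard (hG : G.edgeSet.Nonempty) (F : Set (Sym2 V)) :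
    cutWeight (broderMatrix G) {M | F ⊆ M.1} ≤
      {M : BroderState G | ∃ f ∈ F, ∃ w ∈ f, w ∈ unmatched M.1}.ncard := by
  set S : Finset (BroderState G) := {M | F ⊆ M.1} with hS
  set B : Finset (BroderState G) := {M | ∃ f ∈ F, ∃ w ∈ f, w ∈ unmatched M.1} with hB
  have hBc : {M : BroderState G | ∃ f ∈ F, ∃ w ∈ f, w ∈ unmatched M.1}.ncard = B.card := by
    rw [← Set.ncard_coe_finset]; congr 1; ext M; simp [hB]
  rw [hBc, cutWeight]
  calc ∑ x ∈ S, ∑ y ∈ Sᶜ, broderMatrix G x y ≤ ∑ x ∈ S, ∑ y ∈ B, broderMatrix G x y := by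
        refine Finset.sum_le_sum fun x hx => ?_
        rw [← Finset.sum_filter_of_ne (s := Sᶜ) (p := fun y => 0 < broderMatrix G x y)
          (fun y _ hy => lt_of_le_of_ne (broderMatrix_nonneg _ _) hy.symm)]
        refine Finset.sum_le_sum_of_subset_of_nonneg ?_ fun y _ _ => broderMatrix_nonneg _ _
        intro y hy
        obtain ⟨hy1, hy2⟩ := Finset.mem_filter.1 hy
        obtain ⟨e, rfl⟩ := (broderMatrix_pos_iff _ _).1 hy2
        simp only [hS, Finset.mem_compl, Finset.mem_filter, Finset.mem_univ, true_and] at hx hy1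
        simp only [hB, Finset.mem_filter, Finset.mem_univ, true_and]
        exact exists_unmatched_of_leaves hx hy1
    _ ≤ ∑ x, ∑ y ∈ B, broderMatrix G x y :=
        Finset.sum_le_sum_of_subset_of_nonneg (Finset.subset_univ _)
          fun x _ _ => Finset.sum_nonneg fun y _ => broderMatrix_nonneg _ _
    _ = ∑ y ∈ B, ∑ x, broderMatrix G x y := Finset.sum_comm
    _ = ∑ y ∈ B, (1 : ℝ) := by
        refine Finset.sum_congr rfl fun y _ => ?_
        rw [← sum_broderMatrix hG y]
        exact Finset.sum_congr rfl fun x _ => broderMatrix_isSymm.apply _ _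
    _ = B.card := by simp

end Bottleneck

/-! ### From bottlenecks to exponential loading, exponential mixing time and failure of rapid mixing
-/

theorem exists_forall_polynomial_lt_exp (Q : Polynomial ℝ) {C c : ℝ} (hC : 1 < C) (hc : 0 < c) :
    ∃ N : ℕ, ∀ n : ℕ, N ≤ n → Q.eval (n : ℝ) < c * C ^ n := by
  have h1 : (fun x : ℝ => Q.eval x) =O[Filter.atTop] fun x : ℝ => x ^ Q.natDegree := by
    refine (Polynomial.isEquivalent_atTop_lead Q).isBigO.trans ?_
    exact (Asymptotics.isBigO_refl _ _).const_mul_left _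
  have h2 : (fun n : ℕ => Q.eval (n : ℝ)) =O[Filter.atTop] fun n : ℕ => (n : ℝ) ^ Q.natDegree :=
    h1.comp_tendsto tendsto_natCast_atTop_atTop
  have h3 := h2.trans_isLittleO (isLittleO_pow_const_const_pow_of_one_lt (R := ℝ) Q.natDegree hC)
  have h4 := h3.bound (show 0 < c / 2 by positivity)
  obtain ⟨N, hN⟩ := Filter.eventually_atTop.1 h4
  refine ⟨N, fun n hn => ?_⟩
  have h5 := hN n hn
  have hp : 0 < C ^ n := by positivity
  rw [Real.norm_eq_abs, Real.norm_eq_abs, abs_of_pos hp] at h5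
  have h6 := le_abs_self (Q.eval (n : ℝ))
  nlinarith

/-- On every large graph of the class some edge set `F` is contained in exponentially many more
states, and missed by exponentially many more states, than there are states with an unmatched vertex
covered by `F`. -/
def HasBottleneck (𝒢 : Set FinGraph) : Prop :=
  ∃ C : ℝ, 1 < C ∧ ∃ n₀ : ℕ, ∀ G ∈ 𝒢, n₀ ≤ G.size → ∃ F : Set (Sym2 G.V),
    C ^ G.size * ({M : BroderState G.graph | ∃ f ∈ F, ∃ w ∈ f, w ∈ unmatched M.1}.ncard + 1) ≤
      {M : BroderState G.graph | F ⊆ M.1}.ncard ∧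
    C ^ G.size * ({M : BroderState G.graph | ∃ f ∈ F, ∃ w ∈ f, w ∈ unmatched M.1}.ncard + 1) ≤
      {M : BroderState G.graph | ¬ F ⊆ M.1}.ncard

open Classical in
-- Write b for the number of states with a hole on F and D = √C^n. As |S| and |Sᶜ| are at least D²(b
-- + 1), D²(b + 1)(|S| + |Sᶜ|) ≤ 2|S||Sᶜ|. One factor D pays for the constants as soon as D ≥ 4,
-- which is why √C replaces C. The summand 1 beside b makes both sides of the cut nonempty even if b
-- = 0.
theorem HasBottleneck.exists_cut {𝒢 : Set FinGraph} (h : HasBottleneck 𝒢) :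
    ∃ C : ℝ, 1 < C ∧ ∃ n₀ : ℕ, ∀ G ∈ 𝒢, n₀ ≤ G.size → G.graph.edgeSet.Nonempty ∧
      ∃ S : Finset (BroderState G.graph), S.Nonempty ∧ Sᶜ.Nonempty ∧ 4 ≤ C ^ G.size ∧
        cutWeight (broderMatrix G.graph) S * Fintype.card (BroderState G.graph) ≤
          1 / (2 * C ^ G.size) * (S.card * Sᶜ.card) := by
  obtain ⟨C, hC, n₀, h⟩ := h
  have hs : 1 < Real.sqrt C := by rw [Real.lt_sqrt zero_le_one]; simpa using hC
  obtain ⟨N, hN⟩ := pow_unbounded_of_one_lt 4 hs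
  refine ⟨Real.sqrt C, hs, max n₀ N, fun G hG hn => ?_⟩
  obtain ⟨F, h1, h2⟩ := h G hG (le_trans (le_max_left _ _) hn)
  set n := G.size
  set b : ℝ := (({M : BroderState G.graph | ∃ f ∈ F, ∃ w ∈ f, w ∈ unmatched M.1}.ncard : ℕ) : ℝ) with hb
  set S : Finset (BroderState G.graph) := {M | F ⊆ M.1} with hS
  have hSc : {M : BroderState G.graph | F ⊆ M.1}.ncard = S.card := by
    rw [← Set.ncard_coe_finset]; congr 1; ext M; simp [hS]
  have hSc' : {M : BroderState G.graph | ¬ F ⊆ M.1}.ncard = Sᶜ.card := by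
    rw [← Set.ncard_coe_finset]; congr 1; ext M; simp [hS]
  rw [hSc] at h1
  rw [hSc'] at h2
  have hb0 : 0 ≤ b := Nat.cast_nonneg _
  have hCn : 0 < C ^ n := by positivity
  have hp : 0 < C ^ n * (b + 1) := by positivity
  have hSp : 0 < S.card := by exact_mod_cast hp.trans_le h1
  have hSp' : 0 < Sᶜ.card := by exact_mod_cast hp.trans_le h2
  have hne := Finset.card_pos.1 hSp
  have hne' := Finset.card_pos.1 hSp'
  have hE : G.graph.edgeSet.Nonempty := by
    obtain ⟨M, hM⟩ := hne
    obtain ⟨M', hM'⟩ := hne'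
    simp only [hS, Finset.mem_compl, Finset.mem_filter, Finset.mem_univ, true_and] at hM hM'
    obtain ⟨f, hf, -⟩ := Set.not_subset.1 hM'
    exact ⟨f, M.isMatching.1 (hM hf)⟩
  have h4 : 4 ≤ Real.sqrt C ^ n := hN.le.trans (pow_le_pow_right₀ hs.le ((le_max_right _ _).trans hn))
  have hsq : C ^ n = Real.sqrt C ^ n * Real.sqrt C ^ n := by
    rw [← mul_pow, Real.mul_self_sqrt (by linarith)]
  refine ⟨hE, S, hne, hne', h4, ?_⟩
  have hq : cutWeight (broderMatrix G.graph) S ≤ b := cutWeight_le_ncard hE F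
  have hΩ : (Fintype.card (BroderState G.graph) : ℝ) = S.card + Sᶜ.card := by
    rw [← Finset.card_add_card_compl S]; push_cast; rfl
  set D := Real.sqrt C ^ n
  rw [hΩ, one_div, inv_mul_eq_div, le_div_iff₀ (by positivity)]
  rw [hsq] at h1 h2
  have hS0 : (0 : ℝ) < S.card := by exact_mod_cast hSp
  have hS0' : (0 : ℝ) < Sᶜ.card := by exact_mod_cast hSp'
  have e1 : D * D * (b + 1) * Sᶜ.card ≤ S.card * Sᶜ.card := by gcongr
  have e2 : D * D * (b + 1) * S.card ≤ Sᶜ.card * S.card := by gcongr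
  have e3 : cutWeight (broderMatrix G.graph) S * (S.card + Sᶜ.card) * (2 * D) ≤
      (b + 1) * (S.card + Sᶜ.card) * (2 * D) := by
    gcongr; linarith
  have e4 : (b + 1) * (S.card + Sᶜ.card) * (4 * D) ≤ (b + 1) * (S.card + Sᶜ.card) * (D * D) := by
    gcongr
  nlinarith

theorem HasBottleneck.exponentialLoading {𝒢 : Set FinGraph} (h : HasBottleneck 𝒢) :
    ExponentialLoading 𝒢 := by
  obtain ⟨C, hC, n₀, h⟩ := h.exists_cut
  refine ⟨C, hC, n₀, fun G hG hn f => ?_⟩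
  obtain ⟨hE, S, hS, hS', h4, hcut⟩ := h G hG hn
  have key := f.card_mul_card_le _ broderMatrix_isSymm broderMatrix_nonneg (broderPi G.graph)
    (fun _ => rfl) S
  have hs : (0 : ℝ) < S.card := by exact_mod_cast hS.card_pos
  have hs' : (0 : ℝ) < Sᶜ.card := by exact_mod_cast hS'.card_pos
  have hp : (0 : ℝ) < S.card * Sᶜ.card := by positivity
  set q := cutWeight (broderMatrix G.graph) S * Fintype.card (BroderState G.graph)
  have hq : 0 ≤ q := mul_nonneg (Finset.sum_nonneg fun x _ => Finset.sum_nonneg fun y _ =>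
    broderMatrix_nonneg _ _) (Nat.cast_nonneg _)
  -- A negative loading would make the right side of `key` nonpositive, although |S||Sᶜ| is
  -- positive.
  have hρ : 0 ≤ f.maxLoading := by
    by_contra hneg
    push Not at hneg
    nlinarith [mul_nonneg hq (neg_nonneg.2 hneg.le)]
  have h1 : (S.card * Sᶜ.card : ℝ) ≤
      f.maxLoading * (1 / (2 * C ^ G.size) * (S.card * Sᶜ.card)) :=
    key.trans (by gcongr)
  have h2 : 1 * (S.card * Sᶜ.card : ℝ) ≤ f.maxLoading * (1 / (2 * C ^ G.size)) * (S.card * Sᶜ.card) := by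
    linarith
  have h3 := le_of_mul_le_mul_right h2 hp
  rw [mul_one_div, le_div_iff₀ (by positivity)] at h3
  linarith

theorem HasBottleneck.exponentialMixingTime {𝒢 : Set FinGraph} (h : HasBottleneck 𝒢) :
    ExponentialMixingTime 𝒢 := by
  obtain ⟨C, hC, n₀, h⟩ := h.exists_cut
  refine ⟨C, hC, n₀, fun G hG hn ε hε hε' => ?_⟩
  obtain ⟨hE, S, hS, hS', h4, hcut⟩ := h G hG hn
  have hCn : 0 < C ^ G.size := by linarith
  have key := mixingTime_ge_of_cut _ broderMatrix_isSymm (sum_broderMatrix hE) S hS hS'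
    (1 / (2 * C ^ G.size)) (by positivity)
    (by rw [div_le_div_iff₀ (by positivity) (by norm_num)]; linarith) hcut ε hε hε'
  have e : 1 / (2 * (1 / (2 * C ^ G.size))) = C ^ G.size := by field_simp
  rw [e] at key
  exact key

/-- A state is a set of unordered pairs of vertices, so there are at most 2^(|V|²) of them. The
bound |V| ≤ 2·`size` + 1 allows for the rounding in `FinGraph.size`. -/
theorem log_inv_piMin_le (G : FinGraph) (hne : Nonempty (BroderState G.graph)) :
    Real.log G.piMin⁻¹ ≤ (2 * G.size + 1) ^ 2 * Real.log 2 := by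
  classical
  have h1 : G.piMin = 1 / (Fintype.card (BroderState G.graph) : ℝ) := by
    unfold FinGraph.piMin broderPi
    exact ciInf_const
  have hpos : 0 < Fintype.card (BroderState G.graph) := Fintype.card_pos
  rw [h1, one_div, inv_inv]
  have h2 : Fintype.card (BroderState G.graph) ≤ 2 ^ (2 * G.size + 1) ^ 2 := by
    calc Fintype.card (BroderState G.graph) ≤ Fintype.card (Set (Sym2 G.V)) :=
          Fintype.card_le_of_injective (fun M => M.1) Subtype.val_injective
      _ = 2 ^ Fintype.card (Sym2 G.V) := Fintype.card_set
      _ ≤ 2 ^ (Fintype.card (G.V × G.V)) := by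
          apply Nat.pow_le_pow_right (by norm_num)
          exact Fintype.card_le_of_surjective (fun p : G.V × G.V => s(p.1, p.2))
            (fun e => by induction e with | _ a b => exact ⟨(a, b), rfl⟩)
      _ ≤ 2 ^ (2 * G.size + 1) ^ 2 := by
          apply Nat.pow_le_pow_right (by norm_num)
          rw [Fintype.card_prod, ← sq]
          apply Nat.pow_le_pow_left
          unfold FinGraph.size
          omega
  have h3 : ((2 * G.size + 1 : ℝ)) ^ 2 * Real.log 2 =
      Real.log ((2 ^ (2 * G.size + 1) ^ 2 : ℕ) : ℝ) := by
    push_cast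
    rw [Real.log_pow]
    push_cast
    rfl
  rw [h3]
  exact Real.log_le_log (by exact_mod_cast hpos) (by exact_mod_cast h2)

/-- The case ε = 1/4 suffices: the lower bound becomes C^n·ln 2, and the upper bound is at most the
polynomial `Q`, because ln(1/π_min) is at most quadratic in n up to a constant. -/
theorem not_broderRapidlyMixing {𝒢 : Set FinGraph} (h : ExponentialMixingTime 𝒢)
    (hin : ∀ N : ℕ, ∃ G ∈ 𝒢, N ≤ G.size ∧ G.IsBroderInput) : ¬ BroderRapidlyMixing 𝒢 := by
  rintro ⟨p, hp⟩
  obtain ⟨C, hC, n₀, h⟩ := h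
  set Q : Polynomial ℝ := p * (Polynomial.C (Real.log 4) +
    (2 * Polynomial.X + 1) ^ 2 * Polynomial.C (Real.log 2)) with hQ
  have hlog2 : 0 < Real.log 2 := Real.log_pos (by norm_num)
  obtain ⟨N, hN⟩ := exists_forall_polynomial_lt_exp Q hC hlog2
  obtain ⟨G, hG, hsize, hGin⟩ := hin (max n₀ N)
  have h1 := h G hG ((le_max_left _ _).trans hsize) (1 / 4) (by norm_num) (by norm_num)
  have h2 := h1.trans (hp G hG hGin (1 / 4) (by norm_num) (by norm_num))
  have h3 := hN G.size ((le_max_right _ _).trans hsize)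
  have hCn : 0 < C ^ G.size := by positivity
  rw [show (1 / (2 * (1 / 4)) : ℝ) = 2 by norm_num, show ((1 / 4 : ℝ)⁻¹) = 4 by norm_num] at h2
  rcases ENNReal.ofReal_le_ofReal_iff'.1 h2 with h4 | h4
  · have hne : Nonempty (BroderState G.graph) := by
      obtain ⟨M, hM⟩ := hGin.1
      exact ⟨⟨M, Or.inl hM⟩⟩
    have h5 := log_inv_piMin_le G hne
    have h6 : Q.eval (G.size : ℝ) = p.eval (G.size : ℝ) *
        (Real.log 4 + (2 * G.size + 1) ^ 2 * Real.log 2) := by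
      simp [hQ]
    have hpi : 0 ≤ Real.log G.piMin⁻¹ := by
      unfold FinGraph.piMin broderPi
      rw [ciInf_const, one_div, inv_inv]
      exact Real.log_natCast_nonneg _
    have hlog4 : 0 < Real.log 4 := Real.log_pos (by norm_num)
    -- The estimate of π_min may be multiplied by p(n) only if this is nonnegative; otherwise the
    -- claimed upper bound is not even positive.
    by_cases hpn : 0 ≤ p.eval (G.size : ℝ)
    · have h7 : p.eval (G.size : ℝ) * (Real.log 4 + Real.log G.piMin⁻¹) ≤ Q.eval (G.size : ℝ) := by
        rw [h6]; gcongr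
      linarith
    · push Not at hpn
      have h8 : 0 < C ^ G.size * Real.log 2 := by positivity
      nlinarith
  · have h8 : 0 < C ^ G.size * Real.log 2 := by positivity
    linarith

theorem BroderRapidlyMixing.mono {𝒢 ℋ : Set FinGraph} (h : 𝒢 ⊆ ℋ) (hℋ : BroderRapidlyMixing ℋ) :
    BroderRapidlyMixing 𝒢 := by
  obtain ⟨p, hp⟩ := hℋ
  exact ⟨p, fun G hG => hp G (h hG)⟩

theorem FinGraph.isBroderInput (G : FinGraph) {M : Set (Sym2 G.V)}
    (hM : IsPerfectMatchingSet G.graph M) {x y z : G.V} (hy : G.graph.Adj x y)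
    (hz : G.graph.Adj x z) (hyz : y ≠ z) : G.IsBroderInput :=
  ⟨⟨M, hM⟩, broderMatrix_isPrimitive ⟨M, Or.inl hM⟩ hM.2 hy hz hyz⟩

/-! ### Balance of the two sides -/

section Balance

variable {V : Type} {G : SimpleGraph V}

open Classical in
/-- Between two families of vertices as many vertices of either family are matched to the other. -/
theorem IsMatchingSet.card_matched_eq {M : Set (Sym2 V)} (hM : IsMatchingSet G M)
    {α β : Type} [Fintype α] [Fintype β] (U : α → V) (W : β → V) (hU : Function.Injective U)
    (hW : Function.Injective W) :
    (Finset.univ.filter fun a => ∃ b, s(U a, W b) ∈ M).card =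
      (Finset.univ.filter fun b => ∃ a, s(U a, W b) ∈ M).card := by
  refine Finset.card_bij (fun a ha => ((Finset.mem_filter.1 ha).2).choose) ?_ ?_ ?_
  · intro a ha
    exact Finset.mem_filter.2 ⟨Finset.mem_univ _, a, ((Finset.mem_filter.1 ha).2).choose_spec⟩
  · intro a ha a' ha' h
    have h1 := ((Finset.mem_filter.1 ha).2).choose_spec
    have h2 := ((Finset.mem_filter.1 ha').2).choose_spec
    rw [← h, Sym2.eq_swap] at h2
    rw [Sym2.eq_swap] at h1
    exact hU (hM.mate_unique h1 h2)
  · intro b hb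
    obtain ⟨a, ha⟩ := (Finset.mem_filter.1 hb).2
    refine ⟨a, Finset.mem_filter.2 ⟨Finset.mem_univ _, b, ha⟩, ?_⟩
    have hex : ∃ b, s(U a, W b) ∈ M := ⟨b, ha⟩
    exact hW (hM.mate_unique hex.choose_spec ha)

/-- In a graph with a perfect matching and a proper colouring `side` with two colours, the two
vertices that a state leaves unmatched have different colours. -/
theorem BroderState.side_ne_of_unmatched [Finite V] {side : V → Bool}
    (hside : ∀ x y, G.Adj x y → side x ≠ side y) {M₀ : Set (Sym2 V)}
    (h₀ : IsPerfectMatchingSet G M₀) (M : BroderState G) {a b : V} (ha : a ∈ unmatched M.1)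
    (hb : b ∈ unmatched M.1) (hab : a ≠ b) : side a ≠ side b := by
  classical
  have := Fintype.ofFinite V
  -- A matching covers equally many vertices of both colours. For the perfect matching this says
  -- that the colour classes have equal size; hence every state has equally many holes of either
  -- colour.
  have key : ∀ N : Set (Sym2 V), IsMatchingSet G N →
      Nat.card {x // side x = true} + Nat.card {x // side x = false ∧ x ∈ unmatched N} =
      Nat.card {x // side x = false} + Nat.card {x // side x = true ∧ x ∈ unmatched N} := by
    intro N hN
    have h1 := hN.card_matched_eq (fun a : {x // side x = true} => a.1)
      (fun a : {x // side x = false} => a.1) Subtype.val_injective Subtype.val_injective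
    have h2 : ∀ c : Bool, Nat.card {x // side x = c} =
        (Finset.univ.filter fun a : {x // side x = c} => ∃ b : {x // side x = !c},
          s(a.1, b.1) ∈ N).card + Nat.card {x // side x = c ∧ x ∈ unmatched N} := by
      intro c
      rw [Nat.card_eq_fintype_card, ← Finset.card_univ,
        ← Finset.card_filter_add_card_filter_not (s := (Finset.univ : Finset {x // side x = c}))
          (fun a : {x // side x = c} => ∃ b : {x // side x = !c}, s(a.1, b.1) ∈ N)]
      congr 1
      rw [← Fintype.card_subtype, Nat.card_eq_fintype_card]
      refine Fintype.card_congr ⟨fun a => ⟨a.1.1, a.1.2, ?_⟩, fun a => ⟨⟨a.1, a.2.1⟩, ?_⟩,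
        fun _ => rfl, fun _ => rfl⟩
      · rw [mem_unmatched]
        intro y hy
        refine a.2 ⟨⟨y, ?_⟩, hy⟩
        have := hside _ _ (hN.adj hy)
        rw [a.1.2] at this
        revert this
        cases side y <;> cases c <;> simp
      · rintro ⟨b, hb⟩
        exact mem_unmatched.1 a.2.2 _ hb
    have h3 : Nat.card {x // side x = true} =
        (Finset.univ.filter fun a : {x // side x = true} => ∃ b : {x // side x = false},
          s(a.1, b.1) ∈ N).card + Nat.card {x // side x = true ∧ x ∈ unmatched N} := h2 true
    have h4 : Nat.card {x // side x = false} =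
        (Finset.univ.filter fun a : {x // side x = false} => ∃ b : {x // side x = true},
          s(a.1, b.1) ∈ N).card + Nat.card {x // side x = false ∧ x ∈ unmatched N} := h2 false
    have h5 : (Finset.univ.filter fun a : {x // side x = false} => ∃ b : {x // side x = true},
          s(a.1, b.1) ∈ N) = (Finset.univ.filter fun b : {x // side x = false} =>
            ∃ a : {x // side x = true}, s(a.1, b.1) ∈ N) := by
      ext x
      simp only [Finset.mem_filter, Finset.mem_univ, true_and]
      exact exists_congr fun y => by rw [Sym2.eq_swap]
    rw [h5] at h4
    omega
  have k0 := key M₀ h₀.1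
  have k1 := key M.1 M.isMatching
  simp only [h₀.2, Set.mem_empty_iff_false, and_false, Nat.card_of_isEmpty, add_zero] at k0
  have hun : unmatched M.1 = {a, b} := by
    rcases M.unmatched_eq_empty_or with h | ⟨c, d, -, h⟩
    · rw [h] at ha; exact absurd ha (Set.notMem_empty _)
    · rw [h] at ha hb ⊢
      ext x
      simp only [Set.mem_insert_iff, Set.mem_singleton_iff] at ha hb ⊢
      grind
  intro heq
  have hsame : ∀ c, c = side a → Nat.card {x // side x = c ∧ x ∈ unmatched M.1} = 2 := by
    rintro c rfl
    have : {x | side x = side a ∧ x ∈ unmatched M.1} = {a, b} := by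
      rw [hun]; ext x; simp only [Set.mem_ofPred_eq, Set.mem_insert_iff, Set.mem_singleton_iff]
      grind
    have h2 := Set.ncard_pair hab
    rw [← this] at h2
    exact h2
  have hother : ∀ c, c ≠ side a → Nat.card {x // side x = c ∧ x ∈ unmatched M.1} = 0 := by
    intro c hc
    have : IsEmpty {x // side x = c ∧ x ∈ unmatched M.1} := by
      refine ⟨fun x => ?_⟩
      have : x.1 ∈ ({a, b} : Set V) := hun ▸ x.2.2
      rcases this with h | h
      · exact hc (by rw [← h, x.2.1])
      · rw [Set.mem_singleton_iff] at h
        exact hc (by rw [heq, ← h, x.2.1])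
    exact Nat.card_of_isEmpty
  cases hc : side a
  · rw [hsame false hc.symm, hother true (by simp [hc])] at k1
    omega
  · rw [hsame true hc.symm, hother false (by simp [hc])] at k1
    omega

end Balance

/-! ### Tracks of gadgets -/

/-- A family of disjoint tracks in `G`, indexed by `R`, each consisting of `k` gadgets. A gadget has
vertices `U a` and `W b` with `U a` and `W b` adjacent iff `rel a b`; its ports `W 0` and `U 0` are
joined to the preceding vertex `prv` and the following vertex `nxt` of the track. -/
structure TrackSystem {V : Type} (G : SimpleGraph V) (R : Type) (k p : ℕ)
    (rel : Fin (p + 1) → Fin (p + 1) → Prop) where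
  U : R → Fin k → Fin (p + 1) → V
  W : R → Fin k → Fin (p + 1) → V
  prv : R → Fin k → V
  nxt : R → Fin k → V
  U_inj : ∀ {r i a r' i' a'}, U r i a = U r' i' a' → r = r' ∧ i = i' ∧ a = a'
  W_inj : ∀ {r i a r' i' a'}, W r i a = W r' i' a' → r = r' ∧ i = i' ∧ a = a'
  U_ne_W : ∀ {r i a r' i' a'}, U r i a ≠ W r' i' a'
  adj_U : ∀ {r i a y}, G.Adj (U r i a) y ↔ (∃ b, rel a b ∧ y = W r i b) ∨ (a = 0 ∧ y = nxt r i)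
  adj_W : ∀ {r i b y}, G.Adj (W r i b) y ↔ (∃ a, rel a b ∧ y = U r i a) ∨ (b = 0 ∧ y = prv r i)
  nxt_ne : ∀ {r i b}, nxt r i ≠ W r i b
  prv_ne : ∀ {r i a}, prv r i ≠ U r i a
  nxt_eq : ∀ {r} {i j : Fin k}, i.val + 1 = j.val → nxt r i = W r j 0
  prv_eq : ∀ {r} {i j : Fin k}, i.val + 1 = j.val → prv r j = U r i 0

/-- Partial matchings of a gadget, as functions on the vertices `U a`. -/
abbrev GadgetConfig (p : ℕ) := Fin (p + 1) → Option (Fin (p + 1))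

/-- The perfect matchings of a gadget. -/
def insideConfigs {p : ℕ} (rel : Fin (p + 1) → Fin (p + 1) → Prop) [DecidableRel rel] :
    Finset (GadgetConfig p) :=
  {c | Function.Injective c ∧ ∀ a, ∃ b, c a = some b ∧ rel a b}

/-- The matchings of a gadget that leave exactly the two ports unmatched. -/
def throughConfigs {p : ℕ} (rel : Fin (p + 1) → Fin (p + 1) → Prop) [DecidableRel rel] :
    Finset (GadgetConfig p) :=
  {c | Function.Injective c ∧ c 0 = none ∧ ∀ a, a ≠ 0 → ∃ b, c a = some b ∧ b ≠ 0 ∧ rel a b}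

namespace TrackSystem

variable {V : Type} {G : SimpleGraph V} {R : Type} {k p : ℕ}
  {rel : Fin (p + 1) → Fin (p + 1) → Prop} (T : TrackSystem G R k p rel)

/-- The bridge before the gadget `i` of the track `r` belongs to `M`. -/
def Enters (M : BroderState G) (r : R) (i : Fin k) : Prop := s(T.prv r i, T.W r i 0) ∈ M.1

/-- The bridge after the gadget `i` of the track `r` belongs to `M`. -/
def Leaves (M : BroderState G) (r : R) (i : Fin k) : Prop := s(T.U r i 0, T.nxt r i) ∈ M.1

/-- Some vertex of the gadget is unmatched. -/
def HasHole (M : BroderState G) (r : R) (i : Fin k) : Prop :=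
  ∃ a, T.U r i a ∈ unmatched M.1 ∨ T.W r i a ∈ unmatched M.1

/-- Both bridges at the gadget are matched and it has no unmatched vertex. -/
def Through (M : BroderState G) (r : R) (i : Fin k) : Prop :=
  T.Enters M r i ∧ T.Leaves M r i ∧ ¬ T.HasHole M r i

open Classical in
/-- The part of a state inside a gadget. -/
noncomputable def config (M : BroderState G) (r : R) (i : Fin k) : GadgetConfig p := fun a =>
  if h : ∃ b, s(T.U r i a, T.W r i b) ∈ M.1 then some h.choose else none

theorem config_eq_some {M : BroderState G} {r : R} {i : Fin k} {a b : Fin (p + 1)} :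
    T.config M r i a = some b ↔ s(T.U r i a, T.W r i b) ∈ M.1 := by
  unfold config
  constructor
  · intro h
    split_ifs at h with hex
    rw [Option.some_inj] at h
    rw [← h]
    exact hex.choose_spec
  · intro h
    have hex : ∃ b, s(T.U r i a, T.W r i b) ∈ M.1 := ⟨b, h⟩
    rw [dif_pos hex, Option.some_inj]
    exact (T.W_inj (M.isMatching.mate_unique hex.choose_spec h)).2.2

theorem enters_iff_leaves {M : BroderState G} {r : R} {i j : Fin k} (hij : i.val + 1 = j.val) :
    T.Enters M r j ↔ T.Leaves M r i := by
  rw [Enters, Leaves, T.prv_eq hij, T.nxt_eq hij]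

open Classical in
-- Each vertex `U a` is matched inside the gadget, or unmatched, or it is the port `U 0` matched
-- along the bridge; likewise for the `W b`. There are p + 1 vertices of each kind, and equally many
-- of either kind are matched inside.
theorem balance (M : BroderState G) (r : R) (i : Fin k) :
    (Finset.univ.filter fun a => T.U r i a ∈ unmatched M.1).card +
        (if T.Leaves M r i then 1 else 0) =
      (Finset.univ.filter fun b => T.W r i b ∈ unmatched M.1).card +
        (if T.Enters M r i then 1 else 0) := by
  have h : (Finset.univ.filter fun a => ∃ b, s(T.U r i a, T.W r i b) ∈ M.1).card =
      (Finset.univ.filter fun b => ∃ a, s(T.U r i a, T.W r i b) ∈ M.1).card := by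
    convert M.isMatching.card_matched_eq (T.U r i) (T.W r i)
      (fun a a' h => (T.U_inj h).2.2) (fun a a' h => (T.W_inj h).2.2)
  have e1 : (Finset.univ.filter fun a => ∃ b, s(T.U r i a, T.W r i b) ∈ M.1).card +
      ((Finset.univ.filter fun a => T.U r i a ∈ unmatched M.1).card +
        (if T.Leaves M r i then 1 else 0)) = p + 1 := by
    have hl : (if T.Leaves M r i then 1 else 0) =
        (Finset.univ.filter fun a : Fin (p + 1) => a = 0 ∧ T.Leaves M r i).card := by
      split_ifs with hL
      · simp [hL, Finset.filter_eq']
      · simp [hL]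
    rw [hl, ← Finset.card_union_of_disjoint, ← Finset.card_union_of_disjoint]
    · conv_rhs => rw [← Finset.card_fin (p + 1)]
      congr 1
      ext a
      simp only [Finset.mem_union, Finset.mem_filter, Finset.mem_univ, true_and, iff_true]
      by_cases ha : T.U r i a ∈ unmatched M.1
      · tauto
      · obtain ⟨y, hy⟩ := not_mem_unmatched.1 ha
        rcases T.adj_U.1 (M.isMatching.adj hy) with ⟨b, hb, rfl⟩ | ⟨rfl, rfl⟩
        · exact Or.inl ⟨b, hy⟩
        · exact Or.inr (Or.inr ⟨rfl, hy⟩)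
    · rw [Finset.disjoint_left]
      rintro a ha ha'
      simp only [Finset.mem_union, Finset.mem_filter, Finset.mem_univ, true_and] at ha ha'
      obtain ⟨b, hb⟩ := ha
      rcases ha' with h | ⟨rfl, h⟩
      · exact mem_unmatched.1 h _ hb
      · exact T.nxt_ne (M.isMatching.mate_unique h hb)
    · rw [Finset.disjoint_left]
      rintro a ha ha'
      simp only [Finset.mem_filter, Finset.mem_univ, true_and] at ha ha'
      obtain ⟨rfl, h⟩ := ha'
      exact mem_unmatched.1 ha _ h
  have e2 : (Finset.univ.filter fun b => ∃ a, s(T.U r i a, T.W r i b) ∈ M.1).card +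
      ((Finset.univ.filter fun a => T.W r i a ∈ unmatched M.1).card +
        (if T.Enters M r i then 1 else 0)) = p + 1 := by
    have hl : (if T.Enters M r i then 1 else 0) =
        (Finset.univ.filter fun a : Fin (p + 1) => a = 0 ∧ T.Enters M r i).card := by
      split_ifs with hL
      · simp [hL, Finset.filter_eq']
      · simp [hL]
    rw [hl, ← Finset.card_union_of_disjoint, ← Finset.card_union_of_disjoint]
    · conv_rhs => rw [← Finset.card_fin (p + 1)]
      congr 1
      ext a
      simp only [Finset.mem_union, Finset.mem_filter, Finset.mem_univ, true_and, iff_true]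
      by_cases ha : T.W r i a ∈ unmatched M.1
      · tauto
      · obtain ⟨y, hy⟩ := not_mem_unmatched.1 ha
        rcases T.adj_W.1 (M.isMatching.adj hy) with ⟨b, hb, rfl⟩ | ⟨rfl, rfl⟩
        · exact Or.inl ⟨b, by rwa [Sym2.eq_swap]⟩
        · exact Or.inr (Or.inr ⟨rfl, by rwa [Sym2.eq_swap] at hy⟩)
    · rw [Finset.disjoint_left]
      rintro a ha ha'
      simp only [Finset.mem_union, Finset.mem_filter, Finset.mem_univ, true_and] at ha ha'
      obtain ⟨b, hb⟩ := ha
      rw [Sym2.eq_swap] at hb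
      rcases ha' with h | ⟨rfl, h⟩
      · exact mem_unmatched.1 h _ hb
      · rw [Enters, Sym2.eq_swap] at h
        exact T.prv_ne (M.isMatching.mate_unique h hb)
    · rw [Finset.disjoint_left]
      rintro a ha ha'
      simp only [Finset.mem_filter, Finset.mem_univ, true_and] at ha ha'
      obtain ⟨rfl, h⟩ := ha'
      rw [Enters, Sym2.eq_swap] at h
      exact mem_unmatched.1 ha _ h
  omega

/-- With an entering bridge and no hole among the `U a`, `balance` reads [leaves] = #(holes among
the `W b`) + 1, so the other bridge is used and there is no hole at all. -/
theorem through_of_enters {M : BroderState G} {r : R} {i : Fin k} (hin : T.Enters M r i)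
    (hU : ∀ a, T.U r i a ∉ unmatched M.1) : T.Through M r i := by
  classical
  have h := T.balance M r i
  rw [if_pos hin, Finset.filter_false_of_mem (fun a _ => hU a), Finset.card_empty] at h
  have hl : T.Leaves M r i := by
    by_contra hl
    rw [if_neg hl] at h
    omega
  rw [if_pos hl] at h
  refine ⟨hin, hl, ?_⟩
  rintro ⟨a, ha | ha⟩
  · exact hU a ha
  · have : 0 < (Finset.univ.filter fun b => T.W r i b ∈ unmatched M.1).card :=
      Finset.card_pos.2 ⟨a, by simpa using ha⟩
    omega

theorem through_of_leaves {M : BroderState G} {r : R} {i : Fin k} (hout : T.Leaves M r i)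
    (hW : ∀ a, T.W r i a ∉ unmatched M.1) : T.Through M r i := by
  classical
  have h := T.balance M r i
  rw [if_pos hout, Finset.filter_false_of_mem (s := Finset.univ)
    (p := fun b => T.W r i b ∈ unmatched M.1) (fun a _ => hW a), Finset.card_empty] at h
  have hl : T.Enters M r i := by
    by_contra hl
    rw [if_neg hl] at h
    omega
  rw [if_pos hl] at h
  refine ⟨hl, hout, ?_⟩
  rintro ⟨a, ha | ha⟩
  · have : 0 < (Finset.univ.filter fun b => T.U r i b ∈ unmatched M.1).card :=
      Finset.card_pos.2 ⟨a, by simpa using ha⟩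
    omega
  · exact hW a ha

/-- Passing propagates along the track, since the bridge that leaves one gadget enters the next. -/
theorem through_of_enters_first {M : BroderState G} {r : R} {m : ℕ}
    (hin : ∀ i : Fin k, i.val = 0 → T.Enters M r i)
    (hU : ∀ i : Fin k, i.val < m → ∀ a, T.U r i a ∉ unmatched M.1) :
    ∀ i : Fin k, i.val < m → T.Through M r i := by
  rintro ⟨i, hi⟩
  induction i with
  | zero => exact fun h => T.through_of_enters (hin _ rfl) (hU _ h)
  | succ i ih =>
    intro h
    have h1 := ih (by omega) (show i < m by simp only at h; omega)
    exact T.through_of_enters ((T.enters_iff_leaves (i := ⟨i, by omega⟩) rfl).2 h1.2.1) (hU _ h)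

theorem through_of_leaves_last {M : BroderState G} {r : R} {m : ℕ}
    (hout : ∀ i : Fin k, i.val + 1 = k → T.Leaves M r i)
    (hW : ∀ i : Fin k, m ≤ i.val → ∀ a, T.W r i a ∉ unmatched M.1) :
    ∀ i : Fin k, m ≤ i.val → T.Through M r i := by
  have : ∀ d : ℕ, ∀ i : Fin k, i.val + 1 + d = k → m ≤ i.val → T.Through M r i := by
    intro d
    induction d with
    | zero => exact fun i hi h => T.through_of_leaves (hout i hi) (hW i h)
    | succ d ih =>
      intro i hi h
      have hj : i.val + 1 < k := by omega
      have h1 := ih ⟨i.val + 1, hj⟩ (by simp only; omega) (by simp only; omega)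
      exact T.through_of_leaves ((T.enters_iff_leaves (i := i) (j := ⟨i.val + 1, hj⟩) rfl).1 h1.1) (hW _ h)
  intro i h
  exact this (k - 1 - i.val) i (by omega) h

/-- The bridges of a state are determined by the unmatched vertices and the first bridges. -/
theorem enters_leaves_congr {M M' : BroderState G} (hun : unmatched M.1 = unmatched M'.1) {r : R}
    (h0 : ∀ i : Fin k, i.val = 0 → (T.Enters M r i ↔ T.Enters M' r i)) (i : Fin k) :
    (T.Enters M r i ↔ T.Enters M' r i) ∧ (T.Leaves M r i ↔ T.Leaves M' r i) := by
  classical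
  have step : ∀ i : Fin k, (T.Enters M r i ↔ T.Enters M' r i) →
      (T.Leaves M r i ↔ T.Leaves M' r i) := by
    intro i hi
    have h1 := T.balance M r i
    have h2 := T.balance M' r i
    rw [hun] at h1
    simp only [hi] at h1
    by_cases a1 : T.Leaves M r i <;> by_cases a2 : T.Leaves M' r i <;> simp only [a1, a2, if_true,
      if_false] at h1 h2 ⊢ <;> omega
  obtain ⟨i, hi⟩ := i
  induction i with
  | zero => exact ⟨h0 _ rfl, step _ (h0 _ rfl)⟩
  | succ i ih =>
    have h1 := (ih (by omega)).2
    have h2 : T.Enters M r ⟨i + 1, hi⟩ ↔ T.Enters M' r ⟨i + 1, hi⟩ := by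
      rw [T.enters_iff_leaves (i := ⟨i, by omega⟩) rfl, T.enters_iff_leaves (i := ⟨i, by omega⟩) rfl]
      exact h1
    exact ⟨h2, step _ h2⟩

end TrackSystem

/-! ### Counting states by their configurations in the gadgets -/

namespace TrackSystem

variable {V : Type} {G : SimpleGraph V} {R : Type} {k p : ℕ}
  {rel : Fin (p + 1) → Fin (p + 1) → Prop} (T : TrackSystem G R k p rel)

theorem config_injective_of {M : BroderState G} {r : R} {i : Fin k} {a a' : Fin (p + 1)}
    {b : Fin (p + 1)} (h : T.config M r i a = some b) (h' : T.config M r i a' = some b) :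
    a = a' := by
  rw [T.config_eq_some, Sym2.eq_swap] at h h'
  exact (T.U_inj (M.isMatching.mate_unique h h')).2.2

theorem config_mem_insideConfigs [DecidableRel rel] {M : BroderState G} {r : R} {i : Fin k}
    (hl : ¬ T.Leaves M r i) (hh : ¬ T.HasHole M r i) :
    T.config M r i ∈ insideConfigs rel := by
  have key : ∀ a, ∃ b, T.config M r i a = some b ∧ rel a b := by
    intro a
    have ha : T.U r i a ∉ unmatched M.1 := fun h => hh ⟨a, Or.inl h⟩
    obtain ⟨y, hy⟩ := not_mem_unmatched.1 ha
    rcases T.adj_U.1 (M.isMatching.adj hy) with ⟨b, hb, rfl⟩ | ⟨rfl, rfl⟩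
    · exact ⟨b, T.config_eq_some.2 hy, hb⟩
    · exact absurd hy hl
  refine Finset.mem_filter.2 ⟨Finset.mem_univ _, ?_, key⟩
  intro a a' h
  obtain ⟨b, hb, -⟩ := key a
  exact T.config_injective_of hb (h ▸ hb)

theorem config_mem_throughConfigs [DecidableRel rel] {M : BroderState G} {r : R} {i : Fin k}
    (h : T.Through M r i) : T.config M r i ∈ throughConfigs rel := by
  obtain ⟨hin, hout, hh⟩ := h
  have h0 : T.config M r i 0 = none := by
    rw [Option.eq_none_iff_forall_ne_some]
    intro b hb
    exact T.nxt_ne (M.isMatching.mate_unique hout (T.config_eq_some.1 hb))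
  have key : ∀ a, a ≠ 0 → ∃ b, T.config M r i a = some b ∧ b ≠ 0 ∧ rel a b := by
    intro a ha0
    have ha : T.U r i a ∉ unmatched M.1 := fun h => hh ⟨a, Or.inl h⟩
    obtain ⟨y, hy⟩ := not_mem_unmatched.1 ha
    rcases T.adj_U.1 (M.isMatching.adj hy) with ⟨b, hb, rfl⟩ | ⟨rfl, rfl⟩
    · refine ⟨b, T.config_eq_some.2 hy, ?_, hb⟩
      rintro rfl
      rw [Enters, Sym2.eq_swap] at hin
      rw [Sym2.eq_swap] at hy
      exact T.prv_ne (M.isMatching.mate_unique hin hy)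
    · exact absurd rfl ha0
  refine Finset.mem_filter.2 ⟨Finset.mem_univ _, ?_, h0, key⟩
  intro a a' h
  by_cases ha : a = 0
  · by_contra hne
    obtain ⟨b, hb, -⟩ := key a' (by rintro rfl; exact hne ha)
    rw [← h, ha, h0] at hb
    cases hb
  · obtain ⟨b, hb, -⟩ := key a ha
    exact T.config_injective_of hb (h ▸ hb)

/-- Without holes, a gadget with one used bridge would have both used and be passed through. So
neither is used, and the gadget is perfectly matched in itself. -/
theorem config_mem_insideConfigs_of_not_through [DecidableRel rel] {M : BroderState G} {r : R}
    {i : Fin k} (ht : ¬ T.Through M r i) (hh : ¬ T.HasHole M r i) :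
    T.config M r i ∈ insideConfigs rel := by
  refine T.config_mem_insideConfigs (fun hl => ht ?_) hh
  exact T.through_of_leaves hl fun a ha => hh ⟨a, Or.inr ha⟩

theorem ncard_hasHole_le (M : BroderState G) :
    {q : R × Fin k | T.HasHole M q.1 q.2}.ncard ≤ 2 := by
  classical
  have hfin : (unmatched M.1).Finite ∧ (unmatched M.1).ncard ≤ 2 := by
    rcases M.unmatched_eq_empty_or with h | ⟨a, b, hab, h⟩
    · rw [h]; simp
    · rw [h, Set.ncard_pair hab]; exact ⟨Set.toFinite _, le_rfl⟩
  -- A gadget with a hole is sent to one of its unmatched vertices; gadgets are disjoint and at most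
  -- two vertices are unmatched. The last alternative never occurs for a gadget with a hole.
  refine le_trans (Set.ncard_le_ncard_of_injOn
    (fun q => if h : ∃ a, T.U q.1 q.2 a ∈ unmatched M.1 then T.U q.1 q.2 h.choose else
      if h : ∃ a, T.W q.1 q.2 a ∈ unmatched M.1 then T.W q.1 q.2 h.choose else T.U q.1 q.2 0)
    ?_ ?_ hfin.1) hfin.2
  · rintro q ⟨a, ha⟩
    split_ifs with h1 h2
    · exact h1.choose_spec
    · exact h2.choose_spec
    · rcases ha with ha | ha
      · exact absurd ⟨a, ha⟩ h1
      · exact absurd ⟨a, ha⟩ h2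
  · rintro ⟨r, i⟩ - ⟨r', i'⟩ - h
    dsimp only at h
    split_ifs at h <;>
    first
    | exact Prod.ext (T.U_inj h).1 (T.U_inj h).2.1
    | exact Prod.ext (T.W_inj h).1 (T.W_inj h).2.1
    | exact absurd h T.U_ne_W
    | exact absurd h.symm T.U_ne_W

/-- Compared with the number of perfect matchings of a gadget, a passed gadget saves a factor 2, and
a gadget with a hole costs at most (p + 2)^(p + 1), the number of all functions in `GadgetConfig p`.
-/
theorem prod_card_mul_le [Fintype R] [DecidableRel rel]
    (hIns : 2 * (throughConfigs rel).card ≤ (insideConfigs rel).card)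
    (hpos : 0 < (insideConfigs rel).card) (A B : R × Fin k → Prop) [DecidablePred A]
    [DecidablePred B] (hB : (Finset.univ.filter B).card ≤ 2) :
    (∏ q, (if A q then throughConfigs rel else if B q then Finset.univ else insideConfigs rel).card) *
      2 ^ (Finset.univ.filter A).card ≤
      (insideConfigs rel).card ^ (Fintype.card R * k) * ((p + 2) ^ (p + 1)) ^ 2 := by
  have hK : (Finset.univ : Finset (GadgetConfig p)).card = (p + 2) ^ (p + 1) := by
    simp [GadgetConfig, Finset.card_univ]
  have h2 : (2 : ℕ) ^ (Finset.univ.filter A).card = ∏ q, if A q then 2 else 1 := by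
    rw [Finset.prod_ite]; simp
  rw [h2, ← Finset.prod_mul_distrib]
  calc _ ≤ ∏ q : R × Fin k, ((insideConfigs rel).card * if B q then (p + 2) ^ (p + 1) else 1) := by
        refine Finset.prod_le_prod' fun q _ => ?_
        have hK1 : 1 ≤ (p + 2) ^ (p + 1) := Nat.one_le_pow _ _ (by omega)
        by_cases hA : A q <;> by_cases hBq : B q <;> simp only [hA, hBq, if_true, if_false, hK]
        · nlinarith
        · omega
        · nlinarith
        · omega
    _ = (insideConfigs rel).card ^ (Fintype.card R * k) *
          ((p + 2) ^ (p + 1)) ^ (Finset.univ.filter B).card := by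
        rw [Finset.prod_mul_distrib, Finset.prod_const, Finset.prod_ite]
        simp [Finset.card_univ, Fintype.card_prod]
    _ ≤ _ := by
        apply Nat.mul_le_mul_left
        exact Nat.pow_le_pow_right (Nat.pow_pos (by omega)) hB

section Counting

variable [Finite V] [Fintype R] [DecidableRel rel] {E D : Type}
  (ext : BroderState G → E) (rest : BroderState G → D)

/-- The bridges, the rest of the graph and the unmatched vertices determine a state up to its
configurations in the gadgets. -/
def Determines : Prop :=
  (∀ M M' : BroderState G, ext M = ext M' → ∀ r, ∀ i : Fin k, i.val = 0 →
    (T.Enters M r i ↔ T.Enters M' r i)) ∧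
  ∀ M M' : BroderState G, unmatched M.1 = unmatched M'.1 → ext M = ext M' → rest M = rest M' →
    (∀ r i a y, s(T.U r i a, y) ∈ M.1 ↔ s(T.U r i a, y) ∈ M'.1) →
    (∀ r i a y, s(T.W r i a, y) ∈ M.1 ↔ s(T.W r i a, y) ∈ M'.1) → M = M'

omit [Finite V] [Fintype R] [DecidableRel rel] in
variable {ext rest} in
-- By `enters_leaves_congr` the first bridges and the holes fix all bridges; together with the
-- configurations they fix every edge at a gadget vertex.
theorem Determines.eq_of_config (h : T.Determines ext rest) {M M' : BroderState G}
    (hun : unmatched M.1 = unmatched M'.1) (hext : ext M = ext M') (hrest : rest M = rest M')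
    (hcfg : ∀ r i, T.config M r i = T.config M' r i) : M = M' := by
  have hb := fun r i => T.enters_leaves_congr hun (r := r) (h.1 M M' hext r) i
  refine h.2 M M' hun hext hrest ?_ ?_
  · intro r i a y
    have key : ∀ N N' : BroderState G, (T.Leaves N r i ↔ T.Leaves N' r i) →
        T.config N r i = T.config N' r i → s(T.U r i a, y) ∈ N.1 → s(T.U r i a, y) ∈ N'.1 := by
      intro N N' hl hc hy
      rcases T.adj_U.1 (N.isMatching.adj hy) with ⟨b, -, rfl⟩ | ⟨rfl, rfl⟩
      · rw [← T.config_eq_some] at hy ⊢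
        rwa [← hc]
      · exact hl.1 hy
    exact ⟨key _ _ (hb r i).2 (hcfg r i), key _ _ (hb r i).2.symm (hcfg r i).symm⟩
  · intro r i b y
    have key : ∀ N N' : BroderState G, (T.Enters N r i ↔ T.Enters N' r i) →
        T.config N r i = T.config N' r i → s(T.W r i b, y) ∈ N.1 → s(T.W r i b, y) ∈ N'.1 := by
      intro N N' hl hc hy
      rcases T.adj_W.1 (N.isMatching.adj hy) with ⟨a, -, rfl⟩ | ⟨rfl, rfl⟩
      · rw [Sym2.eq_swap, ← T.config_eq_some] at hy ⊢
        rwa [← hc]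
      · rw [Sym2.eq_swap] at hy ⊢
        exact hl.1 hy
    exact ⟨key _ _ (hb r i).1 (hcfg r i), key _ _ (hb r i).1.symm (hcfg r i).symm⟩

omit [Finite V] in
variable {ext rest} in
open Classical in
-- All states of `Y` share holes and first bridges with `M₁`, so they pass the same gadgets and have
-- holes in the same gadgets. Hence they inject into `D'` times a product of configuration sets, in
-- which each of the at least L passed gadgets gains a factor 2.
theorem card_fiber_mul_le (hdet : T.Determines ext rest)
    (hIns : 2 * (throughConfigs rel).card ≤ (insideConfigs rel).card)
    (hpos : 0 < (insideConfigs rel).card) (D' : Finset D) (L : ℕ) (M₁ : BroderState G)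
    (hL : L ≤ {q : R × Fin k | T.Through M₁ q.1 q.2}.ncard)
    (Y : Finset (BroderState G)) (hY : ∀ M ∈ Y, unmatched M.1 = unmatched M₁.1 ∧ ext M = ext M₁ ∧
      rest M ∈ D') :
    Y.card * 2 ^ L ≤
      D'.card * ((insideConfigs rel).card ^ (Fintype.card R * k) * ((p + 2) ^ (p + 1)) ^ 2) := by
  set A : R × Fin k → Prop := fun q => T.Through M₁ q.1 q.2 with hA
  set B : R × Fin k → Prop := fun q => T.HasHole M₁ q.1 q.2 with hB
  set allowed : R × Fin k → Finset (GadgetConfig p) := fun q =>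
    if A q then throughConfigs rel else if B q then Finset.univ else insideConfigs rel with hall
  have hcard : Y.card ≤ (D' ×ˢ Fintype.piFinset allowed).card := by
    refine Finset.card_le_card_of_injOn
      (fun M => (rest M, fun q : R × Fin k => T.config M q.1 q.2)) ?_ ?_
    · intro M hM
      obtain ⟨h1, h2, h3⟩ := hY M hM
      simp only [Finset.coe_product, Set.mem_prod, Finset.mem_coe, Fintype.mem_piFinset]
      refine ⟨h3, fun q => ?_⟩
      have hb := T.enters_leaves_congr h1 (r := q.1) (hdet.1 M M₁ h2 q.1) q.2
      have hhole : T.HasHole M q.1 q.2 ↔ B q := by simp only [HasHole, hB, h1]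
      have hthr : T.Through M q.1 q.2 ↔ A q := by
        simp only [Through, hA, hb.1, hb.2]
        rw [hhole]
      simp only [hall]
      split_ifs with c1 c2
      · exact T.config_mem_throughConfigs (hthr.2 c1)
      · exact Finset.mem_univ _
      · exact T.config_mem_insideConfigs_of_not_through (fun h => c1 (hthr.1 h))
          (fun h => c2 (hhole.1 h))
    · intro M hM M' hM' h
      obtain ⟨h1, h2, h3⟩ := hY M hM
      obtain ⟨h1', h2', h3'⟩ := hY M' hM'
      have hr : rest M = rest M' := congrArg Prod.fst h
      have hc := congrArg Prod.snd h
      exact hdet.eq_of_config T (h1.trans h1'.symm) (h2.trans h2'.symm) hr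
        fun r i => congrFun hc (r, i)
  rw [Finset.card_product, Fintype.card_piFinset] at hcard
  have hBc : (Finset.univ.filter B).card ≤ 2 := by
    have := T.ncard_hasHole_le M₁
    rw [← Set.ncard_coe_finset]
    simpa [hB] using this
  have hAc : L ≤ (Finset.univ.filter A).card := by
    rw [← Set.ncard_coe_finset]
    simpa [hA] using hL
  have hprod := prod_card_mul_le (rel := rel) hIns hpos A B hBc
  calc Y.card * 2 ^ L ≤ (D'.card * ∏ q, (allowed q).card) * 2 ^ (Finset.univ.filter A).card :=
        Nat.mul_le_mul hcard (Nat.pow_le_pow_right (by norm_num) hAc)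
    _ = D'.card * ((∏ q, (allowed q).card) * 2 ^ (Finset.univ.filter A).card) := by ring
    _ ≤ _ := Nat.mul_le_mul_left _ hprod

variable {ext rest} in
/-- The number of near-perfect matchings that pass through at least `L` gadgets. -/
theorem ncard_mul_le [Fintype E] (hdet : T.Determines ext rest)
    (hIns : 2 * (throughConfigs rel).card ≤ (insideConfigs rel).card)
    (hpos : 0 < (insideConfigs rel).card) (D' : Finset D) (L : ℕ) (X : Set (BroderState G))
    (hX : ∀ M ∈ X, (unmatched M.1).Nonempty ∧ rest M ∈ D' ∧
      L ≤ {q : R × Fin k | T.Through M q.1 q.2}.ncard) :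
    X.ncard * 2 ^ L ≤ Nat.card V ^ 2 * Fintype.card E *
      (D'.card * ((insideConfigs rel).card ^ (Fintype.card R * k) * ((p + 2) ^ (p + 1)) ^ 2)) := by
  classical
  have := Fintype.ofFinite V
  set f : BroderState G → Set V × E := fun M => (unmatched M.1, ext M) with hf
  set Xf : Finset (BroderState G) := X.toFinite.toFinset with hXf
  rw [show X.ncard = Xf.card from Set.ncard_eq_toFinset_card X, Finset.card_eq_sum_card_image f,
    Finset.sum_mul]
  -- There are at most |V|² unmatched pairs; the states of `X` are not perfect, so the unmatched set
  -- is such a pair.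
  have himg : (Xf.image f).card ≤ Nat.card V ^ 2 * Fintype.card E := by
    have hsub : Xf.image f ⊆ (Finset.univ : Finset ((V × V) × E)).image
        (fun q => (({q.1.1, q.1.2} : Set V), q.2)) := by
      intro z hz
      obtain ⟨M, hM, rfl⟩ := Finset.mem_image.1 hz
      rw [hXf, Set.Finite.mem_toFinset] at hM
      rcases M.unmatched_eq_empty_or with h | ⟨a, b, -, h⟩
      · exact absurd h (hX M hM).1.ne_empty
      · exact Finset.mem_image.2 ⟨((a, b), ext M), Finset.mem_univ _, by simp [hf, h]⟩
    refine (Finset.card_le_card hsub).trans (Finset.card_image_le.trans ?_)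
    rw [Finset.card_univ, Fintype.card_prod, Fintype.card_prod, Nat.card_eq_fintype_card, sq]
  refine le_trans (Finset.sum_le_card_nsmul _ _
    (D'.card * ((insideConfigs rel).card ^ (Fintype.card R * k) * ((p + 2) ^ (p + 1)) ^ 2)) ?_) ?_
  · intro z hz
    obtain ⟨M₁, hM₁, rfl⟩ := Finset.mem_image.1 hz
    rw [hXf, Set.Finite.mem_toFinset] at hM₁
    refine T.card_fiber_mul_le hdet hIns hpos D' L M₁ (hX M₁ hM₁).2.2 _ fun M hM => ?_
    obtain ⟨hM, hfM⟩ := Finset.mem_filter.1 hM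
    rw [hXf, Set.Finite.mem_toFinset] at hM
    exact ⟨congrArg Prod.fst hfM, congrArg Prod.snd hfM, (hX M hM).2.1⟩
  · rw [smul_eq_mul]
    exact Nat.mul_le_mul_right _ himg

variable {rest} in
/-- The number of states with a given perfect matching in one gadget. -/
theorem card_le_ncard_config_eq [Fintype D]
    (hmk : ∀ c : R → Fin k → GadgetConfig p, (∀ r i, c r i ∈ insideConfigs rel) → ∀ d : D,
      ∃ M : BroderState G, (∀ r i, T.config M r i = c r i) ∧ rest M = d)
    (r₀ : R) (m : Fin k) {γ : GadgetConfig p} (hγ : γ ∈ insideConfigs rel) :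
    (insideConfigs rel).card ^ (Fintype.card R * k) * Fintype.card D ≤
      (insideConfigs rel).card * {M : BroderState G | T.config M r₀ m = γ}.ncard := by
  classical
  set I := (insideConfigs rel).card with hI
  set allowed : R × Fin k → Finset (GadgetConfig p) := fun q =>
    if q = (r₀, m) then {γ} else insideConfigs rel with hall
  have hsub : ∀ q, allowed q ⊆ insideConfigs rel := by
    intro q
    simp only [hall]
    split_ifs
    · simpa using hγ
    · exact Finset.Subset.refl _
  have hprod : I * ∏ q, (allowed q).card = I ^ (Fintype.card R * k) := by
    have e1 := Finset.mul_prod_erase Finset.univ (fun q => (allowed q).card) (Finset.mem_univ (r₀, m))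
    have e2 := Finset.mul_prod_erase Finset.univ (fun _ : R × Fin k => I) (Finset.mem_univ (r₀, m))
    have e3 : ∏ q ∈ Finset.univ.erase (r₀, m), (allowed q).card =
        ∏ q ∈ Finset.univ.erase (r₀, m), I := by
      refine Finset.prod_congr rfl fun q hq => ?_
      simp only [hall, if_neg (Finset.ne_of_mem_erase hq), hI]
    have e4 : (allowed (r₀, m)).card = 1 := by simp [hall]
    rw [← e1, e4, one_mul, e3, e2]
    simp [Finset.card_univ, Fintype.card_prod]
  choose mk hmk1 hmk2 using hmk
  have hcard : (Fintype.piFinset allowed ×ˢ (Finset.univ : Finset D)).card ≤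
      {M : BroderState G | T.config M r₀ m = γ}.ncard := by
    rw [Set.ncard_eq_toFinset_card]
    -- On the allowed families the first alternative always applies; the second only makes the
    -- function total. Injectivity holds because the configurations and `rest` of the chosen state
    -- return its data.
    refine Finset.card_le_card_of_injOn (fun z =>
      if h : ∀ r i, z.1 (r, i) ∈ insideConfigs rel then mk (fun r i => z.1 (r, i)) h z.2 else
        mk (fun _ _ => γ) (fun _ _ => hγ) z.2) ?_ ?_
    · rintro ⟨c, d⟩ hz
      simp only [Finset.coe_product, Set.mem_prod, Finset.mem_coe, Fintype.mem_piFinset] at hz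
      have h : ∀ r i, c (r, i) ∈ insideConfigs rel := fun r i => hsub _ (hz.1 (r, i))
      simp only [Finset.mem_coe, Set.Finite.mem_toFinset, Set.mem_ofPred_eq, dif_pos h]
      rw [hmk1]
      have := hz.1 (r₀, m)
      simpa [hall] using this
    · rintro ⟨c, d⟩ hz ⟨c', d'⟩ hz' heq
      simp only [Finset.coe_product, Set.mem_prod, Finset.mem_coe, Fintype.mem_piFinset] at hz hz'
      have h : ∀ r i, c (r, i) ∈ insideConfigs rel := fun r i => hsub _ (hz.1 (r, i))
      have h' : ∀ r i, c' (r, i) ∈ insideConfigs rel := fun r i => hsub _ (hz'.1 (r, i))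
      simp only [dif_pos h, dif_pos h'] at heq
      have hd : d = d' := by
        have e1 := hmk2 _ h d
        rw [heq, hmk2 _ h' d'] at e1
        exact e1.symm
      have hc : c = c' := by
        funext q
        have e1 := hmk1 _ h d q.1 q.2
        rw [heq, hmk1 _ h' d' q.1 q.2] at e1
        exact e1.symm
      rw [hc, hd]
  rw [Finset.card_product, Fintype.card_piFinset, Finset.card_univ] at hcard
  calc I ^ (Fintype.card R * k) * Fintype.card D
      = I * ((∏ q, (allowed q).card) * Fintype.card D) := by rw [← hprod]; ring
    _ ≤ _ := Nat.mul_le_mul_left _ hcard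

variable {ext rest} in
/-- Let every state with an unmatched vertex in the gadget `(r₀, m)` pass through at least `L`
gadgets, or have its `rest` in a set that is smaller by the factor `2 ^ L` than the set of all
possible `rest`s. Then the states with this property are exponentially rare. -/
theorem exists_bottleneck [Fintype E] [Fintype D] [Nonempty D] (hdet : T.Determines ext rest)
    (hIns : 2 * (throughConfigs rel).card ≤ (insideConfigs rel).card)
    (hcard : 1 < (insideConfigs rel).card)
    (hmk : ∀ c : R → Fin k → GadgetConfig p, (∀ r i, c r i ∈ insideConfigs rel) → ∀ d : D,
      ∃ M : BroderState G, (∀ r i, T.config M r i = c r i) ∧ rest M = d)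
    (r₀ : R) (m : Fin k) (L : ℕ) (hLk : L ≤ Fintype.card R * k) (D₀ : Finset D)
    (hD₀ : D₀.card * 2 ^ L ≤ Fintype.card D)
    (hhole : ∀ M : BroderState G, T.HasHole M r₀ m →
      L ≤ {q : R × Fin k | T.Through M q.1 q.2}.ncard ∨ rest M ∈ D₀) :
    ∃ F : Set (Sym2 V),
      ({M : BroderState G | ∃ f ∈ F, ∃ w ∈ f, w ∈ unmatched M.1}.ncard + 1) * 2 ^ L ≤
        (2 * (Nat.card V ^ 2 * Fintype.card E * ((p + 2) ^ (p + 1)) ^ 2) + 1) *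
          (insideConfigs rel).card * {M : BroderState G | F ⊆ M.1}.ncard ∧
      ({M : BroderState G | ∃ f ∈ F, ∃ w ∈ f, w ∈ unmatched M.1}.ncard + 1) * 2 ^ L ≤
        (2 * (Nat.card V ^ 2 * Fintype.card E * ((p + 2) ^ (p + 1)) ^ 2) + 1) *
          (insideConfigs rel).card * {M : BroderState G | ¬ F ⊆ M.1}.ncard := by
  classical
  obtain ⟨α, hα, β, hβ, hαβ⟩ := Finset.one_lt_card.1 hcard
  -- F is one perfect matching of the gadget `(r₀, m)`. A state contains F exactly if its
  -- configuration there is `α`; states with the configuration `β` provide the other side of the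
  -- cut.
  set F : Set (Sym2 V) := {e | ∃ a b, α a = some b ∧ e = s(T.U r₀ m a, T.W r₀ m b)} with hF
  have hFM : ∀ M : BroderState G, F ⊆ M.1 ↔ T.config M r₀ m = α := by
    intro M
    have hα' := (Finset.mem_filter.1 hα).2.2
    constructor
    · intro h
      funext a
      obtain ⟨b, hb, -⟩ := hα' a
      rw [hb]
      exact T.config_eq_some.2 (h ⟨a, b, hb, rfl⟩)
    · rintro h e ⟨a, b, hb, rfl⟩
      rw [← T.config_eq_some, h, hb]
  set I := (insideConfigs rel).card with hI
  set N := I ^ (Fintype.card R * k) * Fintype.card D with hN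
  set A := Nat.card V ^ 2 * Fintype.card E * ((p + 2) ^ (p + 1)) ^ 2 with hA
  have hS : N ≤ I * {M : BroderState G | F ⊆ M.1}.ncard := by
    simp only [hFM]
    exact T.card_le_ncard_config_eq hmk r₀ m hα
  have hS' : N ≤ I * {M : BroderState G | ¬ F ⊆ M.1}.ncard := by
    refine (T.card_le_ncard_config_eq hmk r₀ m hβ).trans (Nat.mul_le_mul_left _ ?_)
    refine Set.ncard_le_ncard ?_ (Set.toFinite _)
    intro M hM
    simp only [Set.mem_ofPred_eq, hFM] at hM ⊢
    rw [hM]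
    exact hαβ.symm
  set b := {M : BroderState G | ∃ f ∈ F, ∃ w ∈ f, w ∈ unmatched M.1}.ncard with hb
  set X₁ : Set (BroderState G) := {M | T.HasHole M r₀ m ∧
    L ≤ {q : R × Fin k | T.Through M q.1 q.2}.ncard} with hX₁
  set X₂ : Set (BroderState G) := {M | T.HasHole M r₀ m ∧ rest M ∈ D₀} with hX₂
  have hne : ∀ M : BroderState G, T.HasHole M r₀ m → (unmatched M.1).Nonempty := by
    rintro M ⟨a, h | h⟩ <;> exact ⟨_, h⟩
  have hbX : b ≤ X₁.ncard + X₂.ncard := by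
    refine le_trans (Set.ncard_le_ncard ?_ (Set.toFinite _)) (Set.ncard_union_le _ _)
    rintro M ⟨f, ⟨a, c, -, rfl⟩, w, hw, hun⟩
    have : T.HasHole M r₀ m := by
      rcases Sym2.mem_iff.1 hw with rfl | rfl
      · exact ⟨a, Or.inl hun⟩
      · exact ⟨c, Or.inr hun⟩
    rcases hhole M this with h | h
    · exact Or.inl ⟨this, h⟩
    · exact Or.inr ⟨this, h⟩
  have h1 : X₁.ncard * 2 ^ L ≤ A * N := by
    refine (T.ncard_mul_le hdet hIns (by omega) Finset.univ L X₁ fun M hM =>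
      ⟨hne M hM.1, Finset.mem_univ _, hM.2⟩).trans (le_of_eq ?_)
    rw [Finset.card_univ, hA, hN]; ring
  -- Here no passed gadget is counted; the factor 2^L comes from the smallness of `D₀` instead.
  have h2 : X₂.ncard * 2 ^ L ≤ A * N := by
    have := T.ncard_mul_le hdet hIns (by omega) D₀ 0 X₂ fun M hM =>
      ⟨hne M hM.1, hM.2, Nat.zero_le _⟩
    rw [pow_zero, mul_one] at this
    calc X₂.ncard * 2 ^ L ≤ _ := Nat.mul_le_mul_right _ this
      _ = Nat.card V ^ 2 * Fintype.card E * (I ^ (Fintype.card R * k) * ((p + 2) ^ (p + 1)) ^ 2) *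
          (D₀.card * 2 ^ L) := by ring
      _ ≤ Nat.card V ^ 2 * Fintype.card E * (I ^ (Fintype.card R * k) * ((p + 2) ^ (p + 1)) ^ 2) *
          Fintype.card D := Nat.mul_le_mul_left _ hD₀
      _ = A * N := by rw [hA, hN]; ring
  -- This pays for the summand 1 beside the number of states with a hole on F.
  have h3 : 2 ^ L ≤ N := by
    have hD1 : 0 < Fintype.card D := Fintype.card_pos
    calc 2 ^ L ≤ 2 ^ (Fintype.card R * k) := Nat.pow_le_pow_right (by norm_num) hLk
      _ ≤ I ^ (Fintype.card R * k) := Nat.pow_le_pow_left hcard _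
      _ ≤ N := Nat.le_mul_of_pos_right _ hD1
  have h4 : (b + 1) * 2 ^ L ≤ (2 * A + 1) * N := by
    calc (b + 1) * 2 ^ L ≤ (X₁.ncard + X₂.ncard + 1) * 2 ^ L := by gcongr
      _ = X₁.ncard * 2 ^ L + X₂.ncard * 2 ^ L + 2 ^ L := by ring
      _ ≤ A * N + A * N + N := by gcongr
      _ = _ := by ring
  refine ⟨F, ?_, ?_⟩
  · rw [mul_assoc]
    exact h4.trans (Nat.mul_le_mul_left _ hS)
  · rw [mul_assoc]
    exact h4.trans (Nat.mul_le_mul_left _ hS')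

end Counting

end TrackSystem

/-! ### States assembled from gadget matchings, and gadgets passed because of a hole -/

namespace TrackSystem

variable {V : Type} {G : SimpleGraph V} {R : Type} {k p : ℕ}
  {rel : Fin (p + 1) → Fin (p + 1) → Prop} (T : TrackSystem G R k p rel)

/-- The edges of a family of matchings of the gadgets. -/
def gadgetEdges (c : R → Fin k → GadgetConfig p) : Set (Sym2 V) :=
  {e | ∃ r i a b, c r i a = some b ∧ e = s(T.U r i a, T.W r i b)}

variable [DecidableRel rel]

omit [DecidableRel rel] in
theorem mem_gadgetEdges_U {c : R → Fin k → GadgetConfig p} {r : R} {i : Fin k} {a : Fin (p + 1)}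
    {y : V} : s(T.U r i a, y) ∈ T.gadgetEdges c ↔ ∃ b, c r i a = some b ∧ y = T.W r i b := by
  constructor
  · rintro ⟨r', i', a', b', h, he⟩
    rw [Sym2.eq_iff] at he
    rcases he with ⟨h1, rfl⟩ | ⟨h1, rfl⟩
    · obtain ⟨rfl, rfl, rfl⟩ := T.U_inj h1
      exact ⟨b', h, rfl⟩
    · exact absurd h1 T.U_ne_W
  · rintro ⟨b, h, rfl⟩
    exact ⟨r, i, a, b, h, rfl⟩

omit [DecidableRel rel] in
theorem mem_gadgetEdges_W {c : R → Fin k → GadgetConfig p} {r : R} {i : Fin k} {b : Fin (p + 1)}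
    {y : V} : s(T.W r i b, y) ∈ T.gadgetEdges c ↔ ∃ a, c r i a = some b ∧ y = T.U r i a := by
  constructor
  · rintro ⟨r', i', a', b', h, he⟩
    rw [Sym2.eq_iff] at he
    rcases he with ⟨h1, rfl⟩ | ⟨h1, rfl⟩
    · exact absurd h1.symm T.U_ne_W
    · obtain ⟨rfl, rfl, rfl⟩ := T.W_inj h1
      exact ⟨a', h, rfl⟩
  · rintro ⟨a, h, rfl⟩
    exact ⟨r, i, a, b, h, Sym2.eq_swap⟩

variable {c : R → Fin k → GadgetConfig p} (hc : ∀ r i, c r i ∈ insideConfigs rel)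
  {N : Set (Sym2 V)} (hN : IsMatchingSet G N) (hU : ∀ r i a, T.U r i a ∈ unmatched N)
  (hW : ∀ r i a, T.W r i a ∈ unmatched N)

include hc in
-- A perfect configuration is an injective map of a finite set into a set of the same size, hence
-- onto.
theorem exists_config_eq (r : R) (i : Fin k) (b : Fin (p + 1)) : ∃ a, c r i a = some b := by
  obtain ⟨-, hinj, hrel⟩ := Finset.mem_filter.1 (hc r i)
  choose f hf _ using hrel
  have hfi : Function.Injective f := fun a a' h => hinj (by rw [hf, hf, h])
  obtain ⟨a, rfl⟩ := (Finite.injective_iff_surjective.1 hfi) b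
  exact ⟨a, hf a⟩

include hc hN hU hW in
theorem isMatchingSet_gadgetEdges_union : IsMatchingSet G (T.gadgetEdges c ∪ N) := by
  rw [isMatchingSet_iff]
  have hinj := fun r i => (Finset.mem_filter.1 (hc r i)).2.1
  have hrel := fun r i => (Finset.mem_filter.1 (hc r i)).2.2
  constructor
  · rintro x y (⟨r, i, a, b, h, he⟩ | h)
    · obtain ⟨b', hb', hr⟩ := hrel r i a
      rw [h, Option.some_inj] at hb'
      subst hb'
      have hadj : G.Adj (T.U r i a) (T.W r i b) := T.adj_U.2 (Or.inl ⟨b, hr, rfl⟩)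
      rw [← SimpleGraph.mem_edgeSet] at hadj ⊢
      rwa [he]
    · exact hN.adj h
  · have aux : ∀ x y z, s(x, y) ∈ T.gadgetEdges c → s(x, z) ∈ T.gadgetEdges c ∪ N → y = z := by
      rintro x y z ⟨r, i, a, b, h, he⟩ h2
      rw [Sym2.eq_iff] at he
      rcases he with ⟨rfl, rfl⟩ | ⟨rfl, rfl⟩
      · rcases h2 with h2 | h2
        · obtain ⟨b', hb', rfl⟩ := T.mem_gadgetEdges_U.1 h2
          rw [h, Option.some_inj] at hb'
          rw [hb']
        · exact absurd h2 (mem_unmatched.1 (hU r i a) _)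
      · rcases h2 with h2 | h2
        · obtain ⟨a', ha', rfl⟩ := T.mem_gadgetEdges_W.1 h2
          rw [hinj r i (h.trans ha'.symm)]
        · exact absurd h2 (mem_unmatched.1 (hW r i b) _)
    rintro x y z (h1 | h1) h2
    · exact aux x y z h1 h2
    · rcases h2 with h2 | h2
      · exact (aux x z y h2 (Or.inr h1)).symm
      · exact hN.mate_unique h1 h2

include hc in
theorem mem_unmatched_gadgetEdges_union {z : V} : z ∈ unmatched (T.gadgetEdges c ∪ N) ↔
    z ∈ unmatched N ∧ ∀ r i a, z ≠ T.U r i a ∧ z ≠ T.W r i a := by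
  have hrel := fun r i => (Finset.mem_filter.1 (hc r i)).2.2
  constructor
  · intro h
    refine ⟨fun e he => h e (Or.inr he), fun r i a => ⟨?_, ?_⟩⟩
    · rintro rfl
      obtain ⟨b, hb, -⟩ := hrel r i a
      exact mem_unmatched.1 h _ (Or.inl (T.mem_gadgetEdges_U.2 ⟨b, hb, rfl⟩))
    · rintro rfl
      obtain ⟨b, hb⟩ := exists_config_eq hc r i a
      exact mem_unmatched.1 h _ (Or.inl (T.mem_gadgetEdges_W.2 ⟨b, hb, rfl⟩))
  · rintro ⟨h1, h2⟩ e (⟨r, i, a, b, -, rfl⟩ | he) hz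
    · rcases Sym2.mem_iff.1 hz with rfl | rfl
      · exact (h2 r i a).1 rfl
      · exact (h2 r i b).2 rfl
    · exact h1 e he hz

omit [DecidableRel rel] in
include hU in
theorem config_eq_of_gadgetEdges_union {M : BroderState G} (hM : M.1 = T.gadgetEdges c ∪ N)
    (r : R) (i : Fin k) : T.config M r i = c r i := by
  funext a
  refine Option.ext fun b => ?_
  rw [T.config_eq_some, hM]
  constructor
  · rintro (h | h)
    · obtain ⟨b', hb', h'⟩ := T.mem_gadgetEdges_U.1 h
      rw [hb', (T.W_inj h').2.2]
    · exact absurd h (mem_unmatched.1 (hU r i a) _)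
  · intro h
    exact Or.inl (T.mem_gadgetEdges_U.2 ⟨b, h, rfl⟩)

include hc hN hU hW in
/-- A matching of the rest of the graph that leaves two vertices unmatched and perfect matchings of
the gadgets together form a state. -/
theorem exists_state_of_gadgetEdges {x y : V} (hxy : x ≠ y)
    (hun : ∀ z, (∀ r i a, z ≠ T.U r i a ∧ z ≠ T.W r i a) → (z ∈ unmatched N ↔ z = x ∨ z = y))
    (hx : ∀ r i a, x ≠ T.U r i a ∧ x ≠ T.W r i a) (hy : ∀ r i a, y ≠ T.U r i a ∧ y ≠ T.W r i a) :
    ∃ M : BroderState G, M.1 = T.gadgetEdges c ∪ N ∧ ∀ r i, T.config M r i = c r i := by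
  have hmat := T.isMatchingSet_gadgetEdges_union hc hN hU hW
  have h2 : unmatched (T.gadgetEdges c ∪ N) = {x, y} := by
    ext z
    rw [T.mem_unmatched_gadgetEdges_union hc, Set.mem_insert_iff, Set.mem_singleton_iff]
    constructor
    · rintro ⟨h1, h2⟩
      exact (hun z h2).1 h1
    · rintro (rfl | rfl)
      · exact ⟨(hun z hx).2 (Or.inl rfl), hx⟩
      · exact ⟨(hun z hy).2 (Or.inr rfl), hy⟩
  refine ⟨⟨_, Or.inr ⟨hmat, by rw [h2, Set.ncard_pair hxy]⟩⟩, rfl, ?_⟩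
  exact T.config_eq_of_gadgetEdges_union hU rfl

omit [DecidableRel rel] in
theorem le_ncard_through_of_lt [Finite R] {M : BroderState G} {r : R} {m : ℕ} (hm : m ≤ k)
    (h : ∀ i : Fin k, i.val < m → T.Through M r i) :
    m ≤ {q : R × Fin k | T.Through M q.1 q.2}.ncard := by
  have h1 := Set.ncard_le_ncard_of_injOn (s := (Set.univ : Set (Fin m)))
    (t := {q : R × Fin k | T.Through M q.1 q.2}) (fun i => (r, Fin.castLE hm i))
    (fun i _ => h _ i.2) (fun i _ j _ hij => Fin.castLE_injective hm (Prod.mk.inj hij).2)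
    (Set.toFinite _)
  rwa [Set.ncard_univ, Nat.card_eq_fintype_card, Fintype.card_fin] at h1

omit [DecidableRel rel] in
theorem le_ncard_through_of_le [Finite R] {M : BroderState G} {r : R} {m : ℕ}
    (h : ∀ i : Fin k, m ≤ i.val → T.Through M r i) :
    k - m ≤ {q : R × Fin k | T.Through M q.1 q.2}.ncard := by
  have h1 := Set.ncard_le_ncard_of_injOn (s := (Set.univ : Set (Fin (k - m))))
    (t := {q : R × Fin k | T.Through M q.1 q.2}) (fun i => (r, ⟨m + i, by omega⟩))
    (fun i _ => h _ (by simp))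
    (fun i _ j _ hij => by
      have := congrArg Fin.val (Prod.mk.inj hij).2
      simp only at this
      exact Fin.ext (by omega))
    (Set.toFinite _)
  rwa [Set.ncard_univ, Nat.card_eq_fintype_card, Fintype.card_fin] at h1

section Holes

variable [Finite V] [Finite R] {side : V → Bool} (hside : ∀ x y, G.Adj x y → side x ≠ side y)
  {M₀ : Set (Sym2 V)} (h₀ : IsPerfectMatchingSet G M₀)

omit [DecidableRel rel] in
include hside h₀ in
-- The second unmatched vertex has the other colour, so the given hole is the only one among all
-- `U`. The gadgets before position `m` of the track `r` therefore have no hole of this kind, and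
-- the first bridge forces a passage through each of them. Position `m` itself is not counted, as
-- `r` may be `r₀`.
theorem le_ncard_through_of_hole_U {M : BroderState G} {r₀ r : R} {m : Fin k} {a : Fin (p + 1)}
    (hsU : ∀ r i a r' i' a', side (T.U r i a) = side (T.U r' i' a'))
    (hun : T.U r₀ m a ∈ unmatched M.1) (hr : ∀ i : Fin k, i.val = 0 → T.Enters M r i) :
    m.val ≤ {q : R × Fin k | T.Through M q.1 q.2}.ncard := by
  refine T.le_ncard_through_of_lt (r := r) m.2.le
    (T.through_of_enters_first hr fun i hi a' ha' => ?_)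
  have hne : T.U r i a' ≠ T.U r₀ m a := by
    intro h
    have := (T.U_inj h).2.1
    rw [this] at hi
    omega
  exact M.side_ne_of_unmatched hside h₀ ha' hun hne (hsU _ _ _ _ _ _)

omit [DecidableRel rel] in
include hside h₀ in
-- The mirror image: from the last bridge backwards, the k − (m + 1) gadgets after position `m` are
-- passed.
theorem le_ncard_through_of_hole_W {M : BroderState G} {r₀ r : R} {m : Fin k} {a : Fin (p + 1)}
    (hsW : ∀ r i a r' i' a', side (T.W r i a) = side (T.W r' i' a'))
    (hun : T.W r₀ m a ∈ unmatched M.1) (hr : ∀ i : Fin k, i.val + 1 = k → T.Leaves M r i) :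
    k - (m.val + 1) ≤ {q : R × Fin k | T.Through M q.1 q.2}.ncard := by
  refine T.le_ncard_through_of_le (r := r)
    (T.through_of_leaves_last hr fun i hi a' ha' => ?_)
  have hne : T.W r i a' ≠ T.W r₀ m a := by
    intro h
    have := (T.W_inj h).2.1
    rw [this] at hi
    omega
  exact M.side_ne_of_unmatched hside h₀ ha' hun hne (hsW _ _ _ _ _ _)

end Holes

end TrackSystem

/-! ### Matchings given by relations, and bottlenecks obtained from counting -/

section MatchingOfRel

variable {V : Type} {G : SimpleGraph V} {q : V → V → Prop}

/-- A relation from one side of a bipartite graph to the other that is a partial injective function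
gives a matching. -/
theorem isMatchingSet_of_rel {side : V → Bool} (hadj : ∀ x y, q x y → G.Adj x y)
    (hs : ∀ x y, q x y → side x = true ∧ side y = false)
    (h1 : ∀ x y z, q x y → q x z → y = z) (h2 : ∀ x y z, q y x → q z x → y = z) :
    IsMatchingSet G {e | ∃ x y, q x y ∧ e = s(x, y)} := by
  refine isMatchingSet_iff.2 ⟨?_, ?_⟩
  · rintro x y ⟨x', y', h, he⟩
    rw [Sym2.eq_iff] at he
    rcases he with ⟨rfl, rfl⟩ | ⟨rfl, rfl⟩
    · exact hadj _ _ h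
    · exact (hadj _ _ h).symm
  · rintro x y z ⟨a, b, h, he⟩ ⟨a', b', h', he'⟩
    rw [Sym2.eq_iff] at he he'
    rcases he with ⟨rfl, rfl⟩ | ⟨rfl, rfl⟩ <;> rcases he' with ⟨rfl, rfl⟩ | ⟨rfl, rfl⟩
    · exact h1 _ _ _ h h'
    · exact absurd ((hs _ _ h).1.symm.trans (hs _ _ h').2) (by decide)
    · exact absurd ((hs _ _ h').1.symm.trans (hs _ _ h).2) (by decide)
    · exact h2 _ _ _ h h'

theorem mem_setOf_rel {x y : V} : s(x, y) ∈ {e | ∃ x y, q x y ∧ e = s(x, y)} ↔ q x y ∨ q y x := by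
  constructor
  · rintro ⟨a, b, h, he⟩
    rw [Sym2.eq_iff] at he
    rcases he with ⟨rfl, rfl⟩ | ⟨rfl, rfl⟩
    · exact Or.inl h
    · exact Or.inr h
  · rintro (h | h)
    · exact ⟨x, y, h, rfl⟩
    · exact ⟨y, x, h, Sym2.eq_swap⟩

theorem mem_unmatched_setOf_rel {x : V} :
    x ∈ unmatched {e | ∃ x y, q x y ∧ e = s(x, y)} ↔ ∀ y, ¬ q x y ∧ ¬ q y x := by
  rw [mem_unmatched]
  refine forall_congr' fun y => ?_
  rw [mem_setOf_rel, not_or]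

end MatchingOfRel

/-- Rare states whose number is smaller by an exponential factor form a bottleneck. -/
theorem hasBottleneck_of_polynomial {𝒢 : Set FinGraph} (Q : Polynomial ℝ) (d : ℕ) (hd : 0 < d)
    (h : ∀ G ∈ 𝒢, ∃ (L : ℕ) (F : Set (Sym2 G.V)), G.size ≤ d * (L + 1) ∧
      (({M : BroderState G.graph | ∃ f ∈ F, ∃ w ∈ f, w ∈ unmatched M.1}.ncard : ℝ) + 1) * 2 ^ L ≤
        Q.eval (G.size : ℝ) * {M : BroderState G.graph | F ⊆ M.1}.ncard ∧
      (({M : BroderState G.graph | ∃ f ∈ F, ∃ w ∈ f, w ∈ unmatched M.1}.ncard : ℝ) + 1) * 2 ^ L ≤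
        Q.eval (G.size : ℝ) * {M : BroderState G.graph | ¬ F ⊆ M.1}.ncard) :
    HasBottleneck 𝒢 := by
  -- Then C^(2d) = 2, and n ≤ d(L + 1) gives C^(2n) ≤ 2·2^L. Of the two factors C^n, one absorbs the
  -- polynomial and the other is the asserted gain.
  set C : ℝ := (2 : ℝ) ^ (1 / (2 * d : ℝ)) with hC
  have hd' : (0 : ℝ) < d := by exact_mod_cast hd
  have hC1 : 1 < C := Real.one_lt_rpow (by norm_num) (by positivity)
  obtain ⟨N, hN⟩ := exists_forall_polynomial_lt_exp Q hC1 (show (0 : ℝ) < 1 / 2 by norm_num)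
  refine ⟨C, hC1, N, fun G hG hn => ?_⟩
  obtain ⟨L, F, hsize, h1, h2⟩ := h G hG
  have hQ := hN G.size hn
  have hCn : 0 < C ^ G.size := by positivity
  have hpow : C ^ G.size * C ^ G.size ≤ 2 * 2 ^ L := by
    have e1 : C ^ (2 * d) = 2 := by
      rw [hC, ← Real.rpow_natCast, ← Real.rpow_mul (by norm_num)]
      push_cast
      rw [one_div, inv_mul_cancel₀ (by positivity), Real.rpow_one]
    calc C ^ G.size * C ^ G.size = C ^ (2 * G.size) := by rw [two_mul, pow_add]
      _ ≤ C ^ (2 * d * (L + 1)) := pow_le_pow_right₀ hC1.le (by nlinarith)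
      _ = 2 * 2 ^ L := by rw [pow_mul, e1, pow_succ, mul_comm]
  have key : ∀ b S : ℝ, 0 ≤ b → 0 ≤ S → (b + 1) * 2 ^ L ≤ Q.eval (G.size : ℝ) * S →
      C ^ G.size * (b + 1) ≤ S := by
    intro b S hb hS hle
    have e2 : (b + 1) * (C ^ G.size * C ^ G.size) ≤ (b + 1) * (2 * 2 ^ L) := by gcongr
    have e3 : Q.eval (G.size : ℝ) * S ≤ 1 / 2 * C ^ G.size * S := by gcongr
    have e4 : C ^ G.size * (C ^ G.size * (b + 1)) ≤ C ^ G.size * S := by linarith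
    exact le_of_mul_le_mul_left e4 hCn
  exact ⟨F, key _ _ (Nat.cast_nonneg _) (Nat.cast_nonneg _) h1,
    key _ _ (Nat.cast_nonneg _) (Nat.cast_nonneg _) h2⟩

/-- The form in which `TrackSystem.exists_bottleneck` delivers its estimate: E bounds the number of
connection patterns, K the configurations in the two gadgets with holes, and I is the number of
perfect matchings of a gadget. -/
theorem hasBottleneck_of_card_sq {𝒢 : Set FinGraph} (E K I d : ℕ) (hd : 0 < d)
    (h : ∀ G ∈ 𝒢, ∃ (L : ℕ) (F : Set (Sym2 G.V)), G.size ≤ d * (L + 1) ∧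
      ({M : BroderState G.graph | ∃ f ∈ F, ∃ w ∈ f, w ∈ unmatched M.1}.ncard + 1) * 2 ^ L ≤
        (2 * (Nat.card G.V ^ 2 * E * K) + 1) * I * {M : BroderState G.graph | F ⊆ M.1}.ncard ∧
      ({M : BroderState G.graph | ∃ f ∈ F, ∃ w ∈ f, w ∈ unmatched M.1}.ncard + 1) * 2 ^ L ≤
        (2 * (Nat.card G.V ^ 2 * E * K) + 1) * I * {M : BroderState G.graph | ¬ F ⊆ M.1}.ncard) :
    HasBottleneck 𝒢 := by
  refine hasBottleneck_of_polynomial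
    ((2 * ((2 * Polynomial.X + 1) ^ 2 * (E : Polynomial ℝ) * (K : Polynomial ℝ)) + 1) *
      (I : Polynomial ℝ)) d hd fun G hG => ?_
  obtain ⟨L, F, hs, h1, h2⟩ := h G hG
  have hV : Nat.card G.V ≤ 2 * G.size + 1 := by
    rw [Nat.card_eq_fintype_card, FinGraph.size]; omega
  have hA : (2 * (Nat.card G.V ^ 2 * E * K) + 1) * I ≤
      (2 * ((2 * G.size + 1) ^ 2 * E * K) + 1) * I := by gcongr
  have h1' := h1.trans (Nat.mul_le_mul_right _ hA)
  have h2' := h2.trans (Nat.mul_le_mul_right _ hA)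
  refine ⟨L, F, hs, ?_, ?_⟩
  · simpa using (by exact_mod_cast h1' : (_ : ℝ) ≤ _)
  · simpa using (by exact_mod_cast h2' : (_ : ℝ) ≤ _)

/-! ### The bottleneck of tracks between two end vertices -/

namespace TrackSystem

variable {V : Type} {G : SimpleGraph V} {R : Type} {k p : ℕ}
  {rel : Fin (p + 1) → Fin (p + 1) → Prop} (T : TrackSystem G R k p rel)

theorem enters_first_iff {M : BroderState G} {r : R} {i : Fin k} (hi : i.val = 0) :
    (∃ i : Fin k, i.val = 0 ∧ T.Enters M r i) ↔ T.Enters M r i := by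
  constructor
  · rintro ⟨j, hj, h⟩
    rwa [← Fin.ext (hj.trans hi.symm)]
  · exact fun h => ⟨i, hi, h⟩

open Classical in
/-- The tracks whose first bridge belongs to `M`. -/
noncomputable def firstBridges (M : BroderState G) (r : R) : Bool :=
  decide (∃ i : Fin k, i.val = 0 ∧ T.Enters M r i)

theorem enters_congr_of_firstBridges {M M' : BroderState G}
    (h : T.firstBridges M = T.firstBridges M') (r : R) (i : Fin k) (hi : i.val = 0) :
    T.Enters M r i ↔ T.Enters M' r i := by
  have h1 := congrFun h r
  simp only [firstBridges, decide_eq_decide] at h1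
  rwa [T.enters_first_iff hi, T.enters_first_iff hi] at h1

/-- The bottleneck of a graph that consists of tracks between two vertices. -/
theorem exists_bottleneck_of_two_ends [Finite V] [Fintype R] [DecidableRel rel] (u v : V)
    (huv : u ≠ v) (hcov : ∀ z, z = u ∨ z = v ∨ ∃ r i a, z = T.U r i a ∨ z = T.W r i a)
    (hu : ∀ y, G.Adj u y → ∃ r, ∃ i : Fin k, i.val = 0 ∧ y = T.W r i 0 ∧ T.prv r i = u)
    (hv : ∀ y, G.Adj v y → ∃ r, ∃ i : Fin k, i.val + 1 = k ∧ y = T.U r i 0 ∧ T.nxt r i = v)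
    (hu' : ∀ r i a, u ≠ T.U r i a ∧ u ≠ T.W r i a) (hv' : ∀ r i a, v ≠ T.U r i a ∧ v ≠ T.W r i a)
    (side : V → Bool) (hside : ∀ x y, G.Adj x y → side x ≠ side y)
    (hsu : side u = true) (hsv : side v = false)
    (hsU : ∀ r i a, side (T.U r i a) = true) (hsW : ∀ r i a, side (T.W r i a) = false)
    {M₀ : Set (Sym2 V)} (h₀ : IsPerfectMatchingSet G M₀)
    (hIns : 2 * (throughConfigs rel).card ≤ (insideConfigs rel).card)
    (hcard : 1 < (insideConfigs rel).card) (r₀ : R) (hk : 0 < k) :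
    ∃ F : Set (Sym2 V),
      ({M : BroderState G | ∃ f ∈ F, ∃ w ∈ f, w ∈ unmatched M.1}.ncard + 1) * 2 ^ ((k - 1) / 2) ≤
        (2 * (Nat.card V ^ 2 * 2 ^ Fintype.card R * ((p + 2) ^ (p + 1)) ^ 2) + 1) *
          (insideConfigs rel).card * {M : BroderState G | F ⊆ M.1}.ncard ∧
      ({M : BroderState G | ∃ f ∈ F, ∃ w ∈ f, w ∈ unmatched M.1}.ncard + 1) * 2 ^ ((k - 1) / 2) ≤
        (2 * (Nat.card V ^ 2 * 2 ^ Fintype.card R * ((p + 2) ^ (p + 1)) ^ 2) + 1) *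
          (insideConfigs rel).card * {M : BroderState G | ¬ F ⊆ M.1}.ncard := by
  classical
  have hdet : T.Determines T.firstBridges (fun _ => ()) := by
    refine ⟨fun M M' h r i hi => T.enters_congr_of_firstBridges h r i hi, ?_⟩
    intro M M' _ _ _ hU hW
    have key : ∀ N N' : BroderState G,
        (∀ r i a y, s(T.U r i a, y) ∈ N.1 → s(T.U r i a, y) ∈ N'.1) →
        (∀ r i a y, s(T.W r i a, y) ∈ N.1 → s(T.W r i a, y) ∈ N'.1) → N.1 ⊆ N'.1 := by
      intro N N' hU hW e he
      induction e with | _ x y =>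
      rcases hcov x with rfl | rfl | ⟨r, i, a, rfl | rfl⟩
      · obtain ⟨r, i, -, rfl, -⟩ := hu y (N.isMatching.adj he)
        rw [Sym2.eq_swap] at he ⊢
        exact hW _ _ _ _ he
      · obtain ⟨r, i, -, rfl, -⟩ := hv y (N.isMatching.adj he)
        rw [Sym2.eq_swap] at he ⊢
        exact hU _ _ _ _ he
      · exact hU _ _ _ _ he
      · exact hW _ _ _ _ he
    exact Subtype.ext ((key M M' (fun r i a y => (hU r i a y).1) fun r i a y => (hW r i a y).1).antisymm
      (key M' M (fun r i a y => (hU r i a y).2) fun r i a y => (hW r i a y).2))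
  have hemp : ∀ z : V, z ∈ unmatched (∅ : Set (Sym2 V)) := fun z e he => absurd he (Set.notMem_empty _)
  -- Leaving exactly `u` and `v` unmatched allows every combination of perfect matchings of the
  -- gadgets.
  have hmk : ∀ c : R → Fin k → GadgetConfig p, (∀ r i, c r i ∈ insideConfigs rel) → ∀ d : Unit,
      ∃ M : BroderState G, (∀ r i, T.config M r i = c r i) ∧ (fun _ => ()) M = d := by
    intro c hc d
    obtain ⟨M, -, hM⟩ := T.exists_state_of_gadgetEdges (N := ∅) hc
      ⟨Set.empty_subset _, fun e he => absurd he (Set.notMem_empty _)⟩ (fun _ _ _ => hemp _)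
      (fun _ _ _ => hemp _) huv (fun z hz => by
        refine ⟨fun _ => ?_, fun _ => hemp _⟩
        rcases hcov z with h | h | ⟨r, i, a, h⟩
        · exact Or.inl h
        · exact Or.inr h
        · rcases h with h | h
          · exact absurd h (hz r i a).1
          · exact absurd h (hz r i a).2) hu' hv'
    exact ⟨M, hM, rfl⟩
  -- A hole at some `U` has the colour of `u`, so `u` is matched into a track, whose gadgets before
  -- position k/2 are passed. A hole at some `W` has the colour of `v`, and then the k − (k/2 + 1)
  -- gadgets after that position are passed in a track that ends at `v`. Both numbers are at least
  -- (k − 1)/2.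
  have hhole : ∀ M : BroderState G, T.HasHole M r₀ ⟨k / 2, by omega⟩ →
      (k - 1) / 2 ≤ {q : R × Fin k | T.Through M q.1 q.2}.ncard := by
    rintro M ⟨a, ha | ha⟩
    · have hun : u ∉ unmatched M.1 := fun h =>
        M.side_ne_of_unmatched hside h₀ h ha (hu' _ _ _).1 (by rw [hsu, hsU])
      obtain ⟨y, hy⟩ := not_mem_unmatched.1 hun
      obtain ⟨r, i, hi, rfl, hp⟩ := hu y (M.isMatching.adj hy)
      refine le_trans ?_ (T.le_ncard_through_of_hole_U (r := r) hside h₀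
        (fun _ _ _ _ _ _ => by rw [hsU, hsU]) ha ?_)
      · simp only; omega
      · intro j hj
        rw [Fin.ext (hj.trans hi.symm), Enters, hp]
        exact hy
    · have hun : v ∉ unmatched M.1 := fun h =>
        M.side_ne_of_unmatched hside h₀ h ha (hv' _ _ _).2 (by rw [hsv, hsW])
      obtain ⟨y, hy⟩ := not_mem_unmatched.1 hun
      obtain ⟨r, i, hi, rfl, hp⟩ := hv y (M.isMatching.adj hy)
      refine le_trans ?_ (T.le_ncard_through_of_hole_W (r := r) hside h₀
        (fun _ _ _ _ _ _ => by rw [hsW, hsW]) ha ?_)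
      · simp only; omega
      · intro j hj
        have : j = i := Fin.ext (by omega)
        rw [this, Leaves, hp, Sym2.eq_swap]
        exact hy
  have hLk : (k - 1) / 2 ≤ Fintype.card R * k := by
    have : 0 < Fintype.card R := Fintype.card_pos_iff.2 ⟨r₀⟩
    nlinarith [Nat.div_le_self (k - 1) 2, Nat.sub_le k 1]
  have := T.exists_bottleneck hdet hIns hcard hmk r₀ ⟨k / 2, by omega⟩ ((k - 1) / 2) hLk ∅ (by simp)
    (fun M hM => Or.inl (hhole M hM))
  simpa using this

end TrackSystem

/-! ### Hexagon graphs: the bottleneck -/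

namespace HexVertex

variable {k : ℕ}

theorem adj_hex_hex {i j : Fin k} {c d : Fin 6} : (hexagonGraph k).Adj (.hex i c) (.hex j d) ↔
    (i = j ∧ (d = c + 1 ∨ c = d + 1)) ∨ (i.val + 1 = j.val ∧ c = 3 ∧ d = 0) ∨
      (j.val + 1 = i.val ∧ d = 3 ∧ c = 0) := by
  rw [hexagonGraph, SimpleGraph.fromRel_adj]
  simp only [HexVertex.rel, ne_eq, HexVertex.hex.injEq, not_and]
  have h : ∀ c : Fin 6, c ≠ c + 1 := by decide
  constructor
  · rintro ⟨-, (⟨rfl, h⟩ | h) | (⟨rfl, h⟩ | h)⟩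
    · exact Or.inl ⟨rfl, Or.inl h⟩
    · exact Or.inr (Or.inl h)
    · exact Or.inl ⟨rfl, Or.inr h⟩
    · exact Or.inr (Or.inr h)
  · rintro (⟨rfl, rfl | rfl⟩ | ⟨h1, rfl, rfl⟩ | ⟨h1, rfl, rfl⟩)
    · exact ⟨fun _ => h c, Or.inl (Or.inl ⟨rfl, rfl⟩)⟩
    · exact ⟨fun _ => (h d).symm, Or.inr (Or.inl ⟨rfl, rfl⟩)⟩
    · exact ⟨by rintro rfl; omega, Or.inl (Or.inr ⟨h1, rfl, rfl⟩)⟩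
    · exact ⟨by rintro rfl; omega, Or.inr (Or.inr ⟨h1, rfl, rfl⟩)⟩

theorem adj_hex_u {i : Fin k} {c : Fin 6} :
    (hexagonGraph k).Adj (.hex i c) .u ↔ i.val = 0 ∧ c = 0 := by
  simp [hexagonGraph, SimpleGraph.fromRel_adj, HexVertex.rel]

theorem adj_hex_v {i : Fin k} {c : Fin 6} :
    (hexagonGraph k).Adj (.hex i c) .v ↔ i.val + 1 = k ∧ c = 3 := by
  simp [hexagonGraph, SimpleGraph.fromRel_adj, HexVertex.rel]

theorem not_adj_u_v : ¬ (hexagonGraph k).Adj .u .v := by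
  simp [hexagonGraph, SimpleGraph.fromRel_adj, HexVertex.rel]

/-- The corners of a hexagon with odd number, beginning with the right one. -/
def cornerU : Fin 3 → Fin 6 := ![3, 1, 5]

/-- The corners of a hexagon with even number, beginning with the left one. -/
def cornerW : Fin 3 → Fin 6 := ![0, 2, 4]

/-- Adjacency in a hexagon in terms of `cornerU` and `cornerW`. -/
def gadgetRel (a b : Fin 3) : Prop := a + b ≠ 0

instance : DecidableRel gadgetRel := fun a b => inferInstanceAs (Decidable (a + b ≠ 0))

/-- The vertex that follows the hexagon `i`. -/
def nxt (i : Fin k) : HexVertex k := if h : i.val + 1 < k then .hex ⟨i.val + 1, h⟩ 0 else .v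

/-- The vertex that precedes the hexagon `i`. -/
def prv (i : Fin k) : HexVertex k := if h : i.val = 0 then .u else .hex ⟨i.val - 1, by omega⟩ 3

theorem eq_nxt {i : Fin k} {y : HexVertex k} :
    y = nxt i ↔ (∃ j : Fin k, i.val + 1 = j.val ∧ y = .hex j 0) ∨ (i.val + 1 = k ∧ y = .v) := by
  have hi := i.2
  unfold nxt
  split_ifs with h
  · constructor
    · rintro rfl; exact Or.inl ⟨_, rfl, rfl⟩
    · rintro (⟨j, hj, rfl⟩ | ⟨h1, -⟩)
      · congr 1; exact Fin.ext hj.symm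
      · omega
  · constructor
    · rintro rfl; exact Or.inr ⟨by omega, rfl⟩
    · rintro (⟨j, hj, rfl⟩ | ⟨-, rfl⟩)
      · have := j.2; omega
      · rfl

theorem eq_prv {i : Fin k} {y : HexVertex k} :
    y = prv i ↔ (∃ j : Fin k, j.val + 1 = i.val ∧ y = .hex j 3) ∨ (i.val = 0 ∧ y = .u) := by
  have hi := i.2
  unfold prv
  split_ifs with h
  · constructor
    · rintro rfl; exact Or.inr ⟨h, rfl⟩
    · rintro (⟨j, hj, rfl⟩ | ⟨-, rfl⟩)
      · omega
      · rfl
  · constructor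
    · rintro rfl; exact Or.inl ⟨_, by simp only; omega, rfl⟩
    · rintro (⟨j, hj, rfl⟩ | ⟨h1, -⟩)
      · congr 1; exact Fin.ext (by simp only; omega)
      · omega

theorem adj_cornerU {i : Fin k} {a : Fin 3} {y : HexVertex k} :
    (hexagonGraph k).Adj (.hex i (cornerU a)) y ↔
      (∃ b, gadgetRel a b ∧ y = .hex i (cornerW b)) ∨ (a = 0 ∧ y = nxt i) := by
  rw [eq_nxt]
  have e0 : ∀ a : Fin 3, cornerU a ≠ 0 := by decide
  have e3 : ∀ a : Fin 3, cornerU a = 3 ↔ a = 0 := by decide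
  have e : ∀ (a : Fin 3) (d : Fin 6), (d = cornerU a + 1 ∨ cornerU a = d + 1) ↔
      ∃ b, gadgetRel a b ∧ d = cornerW b := by decide
  rcases y with _ | _ | ⟨j, d⟩
  · simp [adj_hex_u, e0]
  · simp [adj_hex_v, e3, and_comm]
  · simp only [adj_hex_hex, e, e3, e0, HexVertex.hex.injEq, reduceCtorEq, and_false, or_false]
    constructor
    · rintro (⟨rfl, b, h1, h2⟩ | ⟨h1, h2, h3⟩)
      · exact Or.inl ⟨b, h1, rfl, h2⟩
      · exact Or.inr ⟨h2, j, h1, rfl, h3⟩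
    · rintro (⟨b, h1, rfl, h2⟩ | ⟨h2, j', h1, rfl, h3⟩)
      · exact Or.inl ⟨rfl, b, h1, h2⟩
      · exact Or.inr ⟨h1, h2, h3⟩

theorem adj_cornerW {i : Fin k} {b : Fin 3} {y : HexVertex k} :
    (hexagonGraph k).Adj (.hex i (cornerW b)) y ↔
      (∃ a, gadgetRel a b ∧ y = .hex i (cornerU a)) ∨ (b = 0 ∧ y = prv i) := by
  rw [eq_prv]
  have e0 : ∀ a : Fin 3, cornerW a ≠ 3 := by decide
  have e3 : ∀ a : Fin 3, cornerW a = 0 ↔ a = 0 := by decide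
  have e : ∀ (a : Fin 3) (d : Fin 6), (d = cornerW a + 1 ∨ cornerW a = d + 1) ↔
      ∃ b, gadgetRel b a ∧ d = cornerU b := by decide
  rcases y with _ | _ | ⟨j, d⟩
  · simp [adj_hex_u, e3, and_comm]
  · simp [adj_hex_v, e0]
  · simp only [adj_hex_hex, e, e3, e0, HexVertex.hex.injEq, reduceCtorEq, and_false, or_false,
      false_and, false_or]
    constructor
    · rintro (⟨rfl, b, h1, h2⟩ | ⟨h1, h2, h3⟩)
      · exact Or.inl ⟨b, h1, rfl, h2⟩
      · exact Or.inr ⟨h3, j, h1, rfl, h2⟩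
    · rintro (⟨b, h1, rfl, h2⟩ | ⟨h2, j', h1, rfl, h3⟩)
      · exact Or.inl ⟨rfl, b, h1, h2⟩
      · exact Or.inr ⟨h1, h3, h2⟩

/-- The hexagon graph as a track. -/
def trackSystem (k : ℕ) : TrackSystem (hexagonGraph k) Unit k 2 gadgetRel where
  U _ i a := .hex i (cornerU a)
  W _ i b := .hex i (cornerW b)
  prv _ i := prv i
  nxt _ i := nxt i
  U_inj {_ _ a _ _ a'} h := by
    rw [HexVertex.hex.injEq] at h
    exact ⟨rfl, h.1, (show ∀ a a', cornerU a = cornerU a' → a = a' by decide) a a' h.2⟩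
  W_inj {_ _ a _ _ a'} h := by
    rw [HexVertex.hex.injEq] at h
    exact ⟨rfl, h.1, (show ∀ a a', cornerW a = cornerW a' → a = a' by decide) a a' h.2⟩
  U_ne_W {_ _ a _ _ a'} h := by
    rw [HexVertex.hex.injEq] at h
    exact (show ∀ a a', cornerU a ≠ cornerW a' by decide) a a' h.2
  adj_U := adj_cornerU
  adj_W := adj_cornerW
  nxt_ne {_ i b} h := by
    rcases eq_nxt.1 h.symm with ⟨j, h1, h2⟩ | ⟨-, h2⟩
    · rw [HexVertex.hex.injEq] at h2
      rw [h2.1] at h1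
      omega
    · cases h2
  prv_ne {_ i b} h := by
    rcases eq_prv.1 h.symm with ⟨j, h1, h2⟩ | ⟨-, h2⟩
    · rw [HexVertex.hex.injEq] at h2
      rw [h2.1] at h1
      omega
    · cases h2
  nxt_eq {_ i j} h := (eq_nxt.2 (Or.inl ⟨j, h, rfl⟩)).symm
  prv_eq {_ i j} h := (eq_prv.2 (Or.inl ⟨i, h, rfl⟩)).symm

/-- The colour class of `u`. -/
def side : HexVertex k → Bool
  | .u => true
  | .v => false
  | .hex _ c => c.val % 2 == 1

theorem side_ne_of_adj (x y : HexVertex k) (h : (hexagonGraph k).Adj x y) : side x ≠ side y := by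
  have key : ∀ x y : HexVertex k, HexVertex.rel x y → side x ≠ side y := by
    intro x y h
    rcases x with _ | _ | ⟨i, c⟩ <;> rcases y with _ | _ | ⟨j, d⟩ <;>
      simp only [HexVertex.rel] at h
    · simp [side, h.2]
    · simp [side, h.2]
    · rcases h with ⟨-, rfl⟩ | ⟨-, rfl, rfl⟩
      · simp only [side]; revert c; decide
      · simp [side]
  rw [hexagonGraph, SimpleGraph.fromRel_adj] at h
  rcases h.2 with h | h
  · exact key _ _ h
  · exact (key _ _ h).symm

theorem isBipartite : (hexagonGraph k).IsBipartite := by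
  refine ⟨SimpleGraph.Coloring.mk (fun x => if side x then 0 else 1) ?_⟩
  intro x y h
  have := side_ne_of_adj x y h
  cases h1 : side x <;> cases h2 : side y <;> simp_all

/-- The pairs of matched vertices in the perfect matching of the hexagon graph. -/
def Mates : HexVertex k → HexVertex k → Prop
  | .u, .hex i c => i.val = 0 ∧ c = 0
  | .hex i c, .hex j d => (i = j ∧ (c = 1 ∧ d = 2 ∨ c = 5 ∧ d = 4)) ∨
      (i.val + 1 = j.val ∧ c = 3 ∧ d = 0)
  | .hex i c, .v => i.val + 1 = k ∧ c = 3
  | _, _ => False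

theorem exists_perfectMatching (hk : 0 < k) : ∃ M, IsPerfectMatchingSet (hexagonGraph k) M := by
  have hrel : ∀ x y : HexVertex k, Mates x y → (hexagonGraph k).Adj x y := by
    intro x y h
    rcases x with _ | _ | ⟨i, c⟩ <;> rcases y with _ | _ | ⟨j, d⟩ <;> simp only [Mates] at h
    · exact (adj_hex_u.2 h).symm
    · exact adj_hex_v.2 h
    · rw [adj_hex_hex]
      rcases h with ⟨h1, ⟨rfl, rfl⟩ | ⟨rfl, rfl⟩⟩ | h
      · exact Or.inl ⟨h1, Or.inl rfl⟩
      · exact Or.inl ⟨h1, Or.inr rfl⟩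
      · exact Or.inr (Or.inl h)
  refine ⟨{e | ∃ x y, Mates x y ∧ e = s(x, y)},
    isMatchingSet_of_rel (side := side) hrel ?_ ?_ ?_, ?_⟩
  · intro x y h
    rcases x with _ | _ | ⟨i, c⟩ <;> rcases y with _ | _ | ⟨j, d⟩ <;> simp only [Mates] at h
    · simp [side, h.2]
    · simp [side, h.2]
    · rcases h with ⟨h1, ⟨rfl, rfl⟩ | ⟨rfl, rfl⟩⟩ | ⟨-, rfl, rfl⟩ <;> simp [side]
  · intro x y z h h'
    rcases x with _ | _ | ⟨i, c⟩ <;> rcases y with _ | _ | ⟨j, d⟩ <;>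
      rcases z with _ | _ | ⟨j', d'⟩ <;> simp only [Mates] at h h' <;> try rfl
    · rw [h.2, h'.2, Fin.ext (h.1.trans h'.1.symm)]
    · have := j'.2
      rcases h' with ⟨-, h' | h'⟩ | h'
      · rw [h.2] at h'; exact absurd h'.1 (by decide)
      · rw [h.2] at h'; exact absurd h'.1 (by decide)
      · omega
    · have := j.2
      rcases h with ⟨-, h | h⟩ | h
      · rw [h'.2] at h; exact absurd h.1 (by decide)
      · rw [h'.2] at h; exact absurd h.1 (by decide)
      · omega
    · rcases h with ⟨rfl, ⟨rfl, rfl⟩ | ⟨rfl, rfl⟩⟩ | ⟨h1, rfl, rfl⟩ <;>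
      rcases h' with ⟨rfl, ⟨h2, rfl⟩ | ⟨h2, rfl⟩⟩ | ⟨h1', h2, rfl⟩ <;>
      first
      | rfl
      | exact absurd h2 (by decide)
      | (rw [Fin.ext (h1.symm.trans h1')])
  · intro x y z h h'
    rcases x with _ | _ | ⟨i, c⟩ <;> rcases y with _ | _ | ⟨j, d⟩ <;>
      rcases z with _ | _ | ⟨j', d'⟩ <;> simp only [Mates] at h h' <;> try rfl
    · rw [h.2, h'.2, Fin.ext (Nat.succ_injective (h.1.trans h'.1.symm))]
    · rcases h' with ⟨-, h' | h'⟩ | h'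
      · rw [h.2] at h'; exact absurd h'.2 (by decide)
      · rw [h.2] at h'; exact absurd h'.2 (by decide)
      · omega
    · rcases h with ⟨-, h | h⟩ | h
      · rw [h'.2] at h; exact absurd h.2 (by decide)
      · rw [h'.2] at h; exact absurd h.2 (by decide)
      · omega
    · rcases h with ⟨rfl, ⟨rfl, rfl⟩ | ⟨rfl, rfl⟩⟩ | ⟨h1, rfl, rfl⟩ <;>
      rcases h' with ⟨rfl, ⟨rfl, h2⟩ | ⟨rfl, h2⟩⟩ | ⟨h1', rfl, h2⟩ <;>
      first
      | rfl
      | exact absurd h2 (by decide)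
      | (rw [Fin.ext (Nat.succ_injective (h1.trans h1'.symm))])
  · rw [Set.eq_empty_iff_forall_notMem]
    intro x hx
    rw [mem_unmatched_setOf_rel] at hx
    have hx1 : ∀ y, ¬ Mates x y := fun y => (hx y).1
    have hx2 : ∀ y, ¬ Mates y x := fun y => (hx y).2
    rcases x with _ | _ | ⟨i, c⟩
    · exact hx1 (.hex ⟨0, hk⟩ 0) ⟨rfl, rfl⟩
    · exact hx2 (.hex ⟨k - 1, by omega⟩ 3) ⟨by simp only; omega, rfl⟩
    · have hi := i.2
      fin_cases c
      · by_cases h : i.val = 0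
        · exact hx2 .u ⟨h, rfl⟩
        · exact hx2 (.hex ⟨i.val - 1, by omega⟩ 3) (Or.inr ⟨by simp only; omega, rfl, rfl⟩)
      · exact hx1 (.hex i 2) (Or.inl ⟨rfl, Or.inl ⟨rfl, rfl⟩⟩)
      · exact hx2 (.hex i 1) (Or.inl ⟨rfl, Or.inl ⟨rfl, rfl⟩⟩)
      · by_cases h : i.val + 1 = k
        · exact hx1 .v ⟨h, rfl⟩
        · exact hx1 (.hex ⟨i.val + 1, by omega⟩ 0) (Or.inr ⟨by simp only, rfl, rfl⟩)
      · exact hx2 (.hex i 5) (Or.inl ⟨rfl, Or.inr ⟨rfl, rfl⟩⟩)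
      · exact hx1 (.hex i 4) (Or.inl ⟨rfl, Or.inr ⟨rfl, rfl⟩⟩)

theorem card_eq : Fintype.card (HexVertex k) = 6 * k + 2 := by
  have e : HexVertex k ≃ (Fin k × Fin 6) ⊕ Bool :=
    { toFun := fun x => match x with
        | .u => .inr true
        | .v => .inr false
        | .hex i c => .inl (i, c)
      invFun := fun x => match x with
        | .inr true => .u
        | .inr false => .v
        | .inl (i, c) => .hex i c
      left_inv := by rintro (_ | _ | ⟨i, c⟩) <;> rfl
      right_inv := by rintro (⟨i, c⟩ | (_ | _)) <;> rfl }
  rw [Fintype.card_congr e]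
  simp; ring

theorem eq_cornerU_or_cornerW (c : Fin 6) : ∃ a, c = cornerU a ∨ c = cornerW a := by
  revert c; decide

/-- A hexagon has two perfect matchings, but only one matching that misses exactly two opposite
corners. The factors 2, 4³ and 2 are the states of the first bridge, the functions in `GadgetConfig
2` and the perfect matchings. -/
theorem exists_bottleneck (hk : 0 < k) :
    ∃ F : Set (Sym2 (HexVertex k)),
      ({M : BroderState (hexagonGraph k) | ∃ f ∈ F, ∃ w ∈ f, w ∈ unmatched M.1}.ncard + 1) *
          2 ^ ((k - 1) / 2) ≤
        (2 * (Nat.card (HexVertex k) ^ 2 * 2 * (4 ^ 3) ^ 2) + 1) * 2 *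
          {M : BroderState (hexagonGraph k) | F ⊆ M.1}.ncard ∧
      ({M : BroderState (hexagonGraph k) | ∃ f ∈ F, ∃ w ∈ f, w ∈ unmatched M.1}.ncard + 1) *
          2 ^ ((k - 1) / 2) ≤
        (2 * (Nat.card (HexVertex k) ^ 2 * 2 * (4 ^ 3) ^ 2) + 1) * 2 *
          {M : BroderState (hexagonGraph k) | ¬ F ⊆ M.1}.ncard := by
  obtain ⟨M₀, h₀⟩ := exists_perfectMatching hk
  have hI : (insideConfigs gadgetRel).card = 2 := by decide +kernel
  have hJ : (throughConfigs gadgetRel).card = 1 := by decide +kernel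
  have sU : ∀ a, (cornerU a).val % 2 = 1 := by decide
  have sW : ∀ a, (cornerW a).val % 2 = 0 := by decide
  have := (trackSystem k).exists_bottleneck_of_two_ends .u .v (by simp) ?_ ?_ ?_ ?_ ?_ side
    side_ne_of_adj rfl rfl ?_ ?_ h₀ (by rw [hI, hJ]) (by rw [hI]; norm_num) () hk
  · rw [hI] at this
    simpa using this
  · rintro (_ | _ | ⟨i, c⟩)
    · exact Or.inl rfl
    · exact Or.inr (Or.inl rfl)
    · obtain ⟨a, ha⟩ := eq_cornerU_or_cornerW c
      exact Or.inr (Or.inr ⟨(), i, a, by simpa [trackSystem] using ha⟩)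
  · intro y h
    rcases y with _ | _ | ⟨i, c⟩
    · exact absurd h (SimpleGraph.irrefl _)
    · exact absurd h not_adj_u_v
    · obtain ⟨hi, rfl⟩ := adj_hex_u.1 h.symm
      exact ⟨(), i, hi, rfl, (eq_prv.2 (Or.inr ⟨hi, rfl⟩)).symm⟩
  · intro y h
    rcases y with _ | _ | ⟨i, c⟩
    · exact absurd h.symm not_adj_u_v
    · exact absurd h (SimpleGraph.irrefl _)
    · obtain ⟨hi, rfl⟩ := adj_hex_v.1 h.symm
      exact ⟨(), i, hi, rfl, (eq_nxt.2 (Or.inr ⟨hi, rfl⟩)).symm⟩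
  · simp [trackSystem]
  · simp [trackSystem]
  · intro r i a; simp [trackSystem, side, sU]
  · intro r i a; simp [trackSystem, side, sW]

end HexVertex

theorem hexagonGraphs_hasBottleneck : HasBottleneck hexagonGraphs := by
  -- The size is 3k + 1 and L = (k − 1)/2, rounded down, so d = 8 is large enough.
  refine hasBottleneck_of_card_sq 2 ((4 ^ 3) ^ 2) 2 8 (by norm_num) ?_
  rintro _ ⟨j, rfl⟩
  obtain ⟨F, h⟩ := HexVertex.exists_bottleneck (k := j + 1) (Nat.succ_pos j)
  refine ⟨(j + 1 - 1) / 2, F, ?_, h⟩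
  simp only [FinGraph.size, HexVertex.card_eq]
  omega

theorem hexagonGraphs_inputs (N : ℕ) : ∃ G ∈ hexagonGraphs, N ≤ G.size ∧ G.IsBroderInput := by
  refine ⟨_, ⟨N, rfl⟩, ?_, ?_⟩
  · simp only [FinGraph.size, HexVertex.card_eq]; omega
  · obtain ⟨M, hM⟩ := HexVertex.exists_perfectMatching (k := N + 1) (Nat.succ_pos N)
    refine FinGraph.isBroderInput _ hM (x := .hex 0 0) (y := .hex 0 1) (z := .hex 0 5) ?_ ?_ (by simp)
    · exact HexVertex.adj_hex_hex.2 (Or.inl ⟨rfl, Or.inl rfl⟩)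
    · exact HexVertex.adj_hex_hex.2 (Or.inl ⟨rfl, Or.inr rfl⟩)

/-! ### Blocks -/

instance : DecidableRel blockRel := fun a b =>
  inferInstanceAs (Decidable (a.val + b.val ≠ 3 ∧ a.val + b.val ≠ 0))

/-- The cube has 9 perfect matchings (derangements of 4 elements), 3 of which contain the deleted
edge. The other 6 are the perfect matchings of the block; those 3, without that edge, are its
matchings that miss just the ports. -/
theorem card_insideConfigs_blockRel : (insideConfigs blockRel).card = 6 := by decide +kernel

theorem card_throughConfigs_blockRel : (throughConfigs blockRel).card = 3 := by decide +kernel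

theorem ncard_neighborSet_eq_three {V : Type} {G : SimpleGraph V} {x : V} (f : Fin 3 → V)
    (hf : Function.Injective f) (h : ∀ y, G.Adj x y ↔ ∃ i, y = f i) :
    (G.neighborSet x).ncard = 3 := by
  have : G.neighborSet x = f '' Set.univ := by
    ext y
    rw [SimpleGraph.mem_neighborSet, h]
    simp [eq_comm]
  rw [this, Set.ncard_image_of_injective _ hf, Set.ncard_univ]
  simp

open Classical in
theorem isRegularOfDegree_of_ncard {V : Type} [Fintype V] {G : SimpleGraph V} {d : ℕ}
    (h : ∀ x, (G.neighborSet x).ncard = d) : G.IsRegularOfDegree d := by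
  intro x
  rw [← h x, Set.ncard_eq_toFinset_card', SimpleGraph.degree, SimpleGraph.neighborFinset]

/-! ### Vertex degrees in tracks of blocks -/

namespace TrackSystem

variable {V : Type} {G : SimpleGraph V} {R : Type} {k : ℕ} (T : TrackSystem G R k 3 blockRel)

theorem ncard_neighborSet_U (r : R) (i : Fin k) (a : Fin 4) :
    (G.neighborSet (T.U r i a)).ncard = 3 := by
  by_cases ha : a = 0
  · subst ha
    refine ncard_neighborSet_eq_three ![T.W r i 1, T.W r i 2, T.nxt r i] ?_ fun y => ?_
    · intro x y h
      fin_cases x <;> fin_cases y <;> simp at h ⊢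
      · exact absurd (T.W_inj h).2.2 (by decide)
      · exact absurd h.symm T.nxt_ne
      · exact absurd (T.W_inj h).2.2 (by decide)
      · exact absurd h.symm T.nxt_ne
      · exact absurd h T.nxt_ne
      · exact absurd h T.nxt_ne
    · rw [T.adj_U]
      simp [Fin.exists_fin_succ, blockRel]
      tauto
  · obtain ⟨f, hf, h⟩ : ∃ f : Fin 3 → Fin 4, Function.Injective f ∧ ∀ b, blockRel a b ↔ ∃ i, b = f i := by
      revert a; decide +kernel
    refine ncard_neighborSet_eq_three (fun j => T.W r i (f j)) ?_ fun y => ?_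
    · exact fun x y h' => hf (T.W_inj h').2.2
    · rw [T.adj_U]
      simp only [ha, false_and, or_false, h]
      constructor
      · rintro ⟨_, ⟨j, rfl⟩, rfl⟩
        exact ⟨j, rfl⟩
      · rintro ⟨j, rfl⟩
        exact ⟨_, ⟨j, rfl⟩, rfl⟩

theorem ncard_neighborSet_W (r : R) (i : Fin k) (b : Fin 4) :
    (G.neighborSet (T.W r i b)).ncard = 3 := by
  by_cases hb : b = 0
  · subst hb
    refine ncard_neighborSet_eq_three ![T.U r i 1, T.U r i 2, T.prv r i] ?_ fun y => ?_
    · intro x y h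
      fin_cases x <;> fin_cases y <;> simp at h ⊢
      · exact absurd (T.U_inj h).2.2 (by decide)
      · exact absurd h.symm T.prv_ne
      · exact absurd (T.U_inj h).2.2 (by decide)
      · exact absurd h.symm T.prv_ne
      · exact absurd h T.prv_ne
      · exact absurd h T.prv_ne
    · rw [T.adj_W]
      simp [Fin.exists_fin_succ, blockRel]
      tauto
  · obtain ⟨f, hf, h⟩ : ∃ f : Fin 3 → Fin 4, Function.Injective f ∧ ∀ a, blockRel a b ↔ ∃ i, a = f i := by
      revert b; decide +kernel
    refine ncard_neighborSet_eq_three (fun j => T.U r i (f j)) ?_ fun y => ?_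
    · exact fun x y h' => hf (T.U_inj h').2.2
    · rw [T.adj_W]
      simp only [hb, false_and, or_false, h]
      constructor
      · rintro ⟨_, ⟨j, rfl⟩, rfl⟩
        exact ⟨j, rfl⟩
      · rintro ⟨j, rfl⟩
        exact ⟨_, ⟨j, rfl⟩, rfl⟩

end TrackSystem

/-- A perfect matching of the block, or one of the block without its ports. -/
def blockMate (through : Bool) (a b : Fin 4) : Prop :=
  if through then a ≠ 0 ∧ a = b else a.val + b.val = 1 ∨ a.val + b.val = 5

instance (t : Bool) : DecidableRel (blockMate t) := fun a b => by
  unfold blockMate; infer_instance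

/-! ### Block graphs: the bottleneck -/

namespace BlockVertex

variable {k : ℕ}

theorem adj_blockU_blockV {r s : Fin 3} {i j : Fin k} {a b : Fin 4} :
    (blockGraph k).Adj (.blockU r i a) (.blockV s j b) ↔
      r = s ∧ ((i = j ∧ blockRel a b) ∨ (i.val + 1 = j.val ∧ a = 0 ∧ b = 0)) := by
  simp [blockGraph, SimpleGraph.fromRel_adj, BlockVertex.rel]

theorem adj_blockV_u {r : Fin 3} {i : Fin k} {b : Fin 4} :
    (blockGraph k).Adj (.blockV r i b) .u ↔ i.val = 0 ∧ b = 0 := by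
  simp [blockGraph, SimpleGraph.fromRel_adj, BlockVertex.rel]

theorem adj_blockU_v {r : Fin 3} {i : Fin k} {a : Fin 4} :
    (blockGraph k).Adj (.blockU r i a) .v ↔ i.val + 1 = k ∧ a = 0 := by
  simp [blockGraph, SimpleGraph.fromRel_adj, BlockVertex.rel]

theorem not_adj_u_v : ¬ (blockGraph k).Adj .u .v := by
  simp [blockGraph, SimpleGraph.fromRel_adj, BlockVertex.rel]

theorem not_adj_blockU_u {r : Fin 3} {i : Fin k} {a : Fin 4} :
    ¬ (blockGraph k).Adj (.blockU r i a) .u := by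
  simp [blockGraph, SimpleGraph.fromRel_adj, BlockVertex.rel]

theorem not_adj_blockV_v {r : Fin 3} {i : Fin k} {b : Fin 4} :
    ¬ (blockGraph k).Adj (.blockV r i b) .v := by
  simp [blockGraph, SimpleGraph.fromRel_adj, BlockVertex.rel]

theorem not_adj_blockU_blockU {r s : Fin 3} {i j : Fin k} {a b : Fin 4} :
    ¬ (blockGraph k).Adj (.blockU r i a) (.blockU s j b) := by
  simp [blockGraph, SimpleGraph.fromRel_adj, BlockVertex.rel]

theorem not_adj_blockV_blockV {r s : Fin 3} {i j : Fin k} {a b : Fin 4} :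
    ¬ (blockGraph k).Adj (.blockV r i a) (.blockV s j b) := by
  simp [blockGraph, SimpleGraph.fromRel_adj, BlockVertex.rel]

/-- The vertex that follows the block `i` of the track `r`. -/
def nxt (r : Fin 3) (i : Fin k) : BlockVertex k :=
  if h : i.val + 1 < k then .blockV r ⟨i.val + 1, h⟩ 0 else .v

/-- The vertex that precedes the block `i` of the track `r`. -/
def prv (r : Fin 3) (i : Fin k) : BlockVertex k :=
  if h : i.val = 0 then .u else .blockU r ⟨i.val - 1, by omega⟩ 0

theorem eq_nxt {r : Fin 3} {i : Fin k} {y : BlockVertex k} : y = nxt r i ↔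
    (∃ j : Fin k, i.val + 1 = j.val ∧ y = .blockV r j 0) ∨ (i.val + 1 = k ∧ y = .v) := by
  have hi := i.2
  unfold nxt
  split_ifs with h
  · constructor
    · rintro rfl; exact Or.inl ⟨_, rfl, rfl⟩
    · rintro (⟨j, hj, rfl⟩ | ⟨h1, -⟩)
      · congr 1; exact Fin.ext hj.symm
      · omega
  · constructor
    · rintro rfl; exact Or.inr ⟨by omega, rfl⟩
    · rintro (⟨j, hj, rfl⟩ | ⟨-, rfl⟩)
      · have := j.2; omega
      · rfl

theorem eq_prv {r : Fin 3} {i : Fin k} {y : BlockVertex k} : y = prv r i ↔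
    (∃ j : Fin k, j.val + 1 = i.val ∧ y = .blockU r j 0) ∨ (i.val = 0 ∧ y = .u) := by
  have hi := i.2
  unfold prv
  split_ifs with h
  · constructor
    · rintro rfl; exact Or.inr ⟨h, rfl⟩
    · rintro (⟨j, hj, rfl⟩ | ⟨-, rfl⟩)
      · omega
      · rfl
  · constructor
    · rintro rfl; exact Or.inl ⟨_, by simp only; omega, rfl⟩
    · rintro (⟨j, hj, rfl⟩ | ⟨h1, -⟩)
      · congr 1; exact Fin.ext (by simp only; omega)
      · omega

/-- The block graph as a system of tracks. -/
def trackSystem (k : ℕ) : TrackSystem (blockGraph k) (Fin 3) k 3 blockRel where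
  U := .blockU
  W := .blockV
  prv := prv
  nxt := nxt
  U_inj h := by simpa using h
  W_inj h := by simpa using h
  U_ne_W := by simp
  adj_U {r i a y} := by
    rw [eq_nxt]
    rcases y with _ | _ | ⟨s, j, b⟩ | ⟨s, j, b⟩
    · simp [not_adj_blockU_u]
    · simp [adj_blockU_v, and_comm]
    · simp [not_adj_blockU_blockU]
    · simp only [adj_blockU_blockV, BlockVertex.blockV.injEq, reduceCtorEq, and_false, or_false]
      constructor
      · rintro ⟨rfl, ⟨rfl, h⟩ | ⟨h, rfl, rfl⟩⟩
        · exact Or.inl ⟨b, h, rfl, rfl, rfl⟩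
        · exact Or.inr ⟨rfl, j, h, rfl, rfl, rfl⟩
      · rintro (⟨_, h, rfl, rfl, rfl⟩ | ⟨rfl, _, h, rfl, rfl, rfl⟩)
        · exact ⟨rfl, Or.inl ⟨rfl, h⟩⟩
        · exact ⟨rfl, Or.inr ⟨h, rfl, rfl⟩⟩
  adj_W {r i b y} := by
    rw [eq_prv]
    rcases y with _ | _ | ⟨s, j, a⟩ | ⟨s, j, a⟩
    · simp [adj_blockV_u, and_comm]
    · simp [not_adj_blockV_v]
    · rw [SimpleGraph.adj_comm]
      simp only [adj_blockU_blockV, BlockVertex.blockU.injEq, reduceCtorEq, and_false, or_false]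
      constructor
      · rintro ⟨rfl, ⟨rfl, h⟩ | ⟨h, rfl, rfl⟩⟩
        · exact Or.inl ⟨a, h, rfl, rfl, rfl⟩
        · exact Or.inr ⟨rfl, j, h, rfl, rfl, rfl⟩
      · rintro (⟨_, h, rfl, rfl, rfl⟩ | ⟨rfl, _, h, rfl, rfl, rfl⟩)
        · exact ⟨rfl, Or.inl ⟨rfl, h⟩⟩
        · exact ⟨rfl, Or.inr ⟨h, rfl, rfl⟩⟩
    · simp [not_adj_blockV_blockV]
  nxt_ne {r i b} h := by
    rcases eq_nxt.1 h.symm with ⟨j, h1, h2⟩ | ⟨-, h2⟩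
    · rw [BlockVertex.blockV.injEq] at h2
      rw [h2.2.1] at h1
      omega
    · cases h2
  prv_ne {r i b} h := by
    rcases eq_prv.1 h.symm with ⟨j, h1, h2⟩ | ⟨-, h2⟩
    · rw [BlockVertex.blockU.injEq] at h2
      rw [h2.2.1] at h1
      omega
    · cases h2
  nxt_eq {_ i j} h := (eq_nxt.2 (Or.inl ⟨j, h, rfl⟩)).symm
  prv_eq {_ i j} h := (eq_prv.2 (Or.inl ⟨i, h, rfl⟩)).symm

/-- The colour class of `u`. -/
def side : BlockVertex k → Bool
  | .u => true
  | .v => false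
  | .blockU _ _ _ => true
  | .blockV _ _ _ => false

theorem side_ne_of_adj (x y : BlockVertex k) (h : (blockGraph k).Adj x y) : side x ≠ side y := by
  have key : ∀ x y : BlockVertex k, BlockVertex.rel x y → side x ≠ side y := by
    intro x y h
    cases x <;> cases y <;> simp_all [BlockVertex.rel, side]
  rw [blockGraph, SimpleGraph.fromRel_adj] at h
  rcases h.2 with h | h
  · exact key _ _ h
  · exact (key _ _ h).symm

theorem isBipartite : (blockGraph k).IsBipartite := by
  refine ⟨SimpleGraph.Coloring.mk (fun x => if side x then 0 else 1) ?_⟩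
  intro x y h
  have := side_ne_of_adj x y h
  cases h1 : side x <;> cases h2 : side y <;> simp_all

open Classical in
theorem isRegularOfDegree (hk : 0 < k) : (blockGraph k).IsRegularOfDegree 3 := by
  refine isRegularOfDegree_of_ncard fun x => ?_
  rcases x with _ | _ | ⟨r, i, a⟩ | ⟨r, i, b⟩
  · refine ncard_neighborSet_eq_three (fun r => .blockV r ⟨0, hk⟩ 0) (fun r s h => by simpa using h)
      fun y => ?_
    rw [SimpleGraph.adj_comm]
    rcases y with _ | _ | ⟨s, j, a⟩ | ⟨s, j, a⟩
    · simp
    · simp [SimpleGraph.adj_comm, not_adj_u_v]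
    · simp [not_adj_blockU_u]
    · rw [adj_blockV_u]
      constructor
      · rintro ⟨h, rfl⟩
        exact ⟨s, by rw [Fin.ext (a := j) (b := ⟨0, hk⟩) h]⟩
      · rintro ⟨_, h⟩
        obtain ⟨-, rfl, rfl⟩ := BlockVertex.blockV.inj h
        exact ⟨rfl, rfl⟩
  · refine ncard_neighborSet_eq_three (fun r => .blockU r ⟨k - 1, by omega⟩ 0)
      (fun r s h => by simpa using h) fun y => ?_
    rw [SimpleGraph.adj_comm]
    rcases y with _ | _ | ⟨s, j, a⟩ | ⟨s, j, a⟩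
    · simp [not_adj_u_v]
    · simp
    · rw [adj_blockU_v]
      constructor
      · rintro ⟨h, rfl⟩
        exact ⟨s, by rw [Fin.ext (a := j) (b := ⟨k - 1, by omega⟩) (by simp only; omega)]⟩
      · rintro ⟨_, h⟩
        obtain ⟨-, rfl, rfl⟩ := BlockVertex.blockU.inj h
        exact ⟨by simp only; omega, rfl⟩
    · simp [not_adj_blockV_v]
  · exact (trackSystem k).ncard_neighborSet_U r i a
  · exact (trackSystem k).ncard_neighborSet_W r i b

/-- The pairs of matched vertices in a perfect matching of the block graph, which runs through the
first track. -/
def Mates : BlockVertex k → BlockVertex k → Prop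
  | .u, .blockV r i b => r = 0 ∧ i.val = 0 ∧ b = 0
  | .blockU r i a, .blockV s j b => r = s ∧ ((i = j ∧ blockMate (r = 0) a b) ∨
      (r = 0 ∧ i.val + 1 = j.val ∧ a = 0 ∧ b = 0))
  | .blockU r i a, .v => r = 0 ∧ i.val + 1 = k ∧ a = 0
  | _, _ => False

theorem exists_perfectMatching (hk : 0 < k) : ∃ M, IsPerfectMatchingSet (blockGraph k) M := by
  have h1 : ∀ a : Fin 4, ∀ b b' t, blockMate t a b → blockMate t a b' → b = b' := by decide
  have h2 : ∀ a : Fin 4, ∀ b b' t, blockMate t b a → blockMate t b' a → b = b' := by decide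
  have h3 : ∀ a b t, blockMate t a b → blockRel a b := by decide
  have h4 : ∀ a b, blockMate true a b → a ≠ 0 ∧ b ≠ 0 := by decide
  have h5 : ∀ a t, (∃ b, blockMate t a b) ∨ (t = true ∧ a = 0) := by decide
  have h6 : ∀ a t, (∃ b, blockMate t b a) ∨ (t = true ∧ a = 0) := by decide
  refine ⟨{e | ∃ x y, Mates x y ∧ e = s(x, y)},
    isMatchingSet_of_rel (side := side) ?_ ?_ ?_ ?_, ?_⟩
  · intro x y h
    rcases x with _ | _ | ⟨r, i, a⟩ | ⟨r, i, a⟩ <;> rcases y with _ | _ | ⟨s, j, b⟩ | ⟨s, j, b⟩ <;>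
      simp only [Mates] at h
    · exact (adj_blockV_u.2 h.2).symm
    · exact adj_blockU_v.2 h.2
    · rw [adj_blockU_blockV]
      exact ⟨h.1, h.2.imp (fun h => ⟨h.1, h3 _ _ _ h.2⟩) fun h => h.2⟩
  · intro x y h
    rcases x with _ | _ | ⟨r, i, a⟩ | ⟨r, i, a⟩ <;> rcases y with _ | _ | ⟨s, j, b⟩ | ⟨s, j, b⟩ <;>
      simp only [Mates] at h <;> simp [side]
  · intro x y z h h'
    rcases x with _ | _ | ⟨r, i, a⟩ | ⟨r, i, a⟩ <;> rcases y with _ | _ | ⟨s, j, b⟩ | ⟨s, j, b⟩ <;>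
      rcases z with _ | _ | ⟨s', j', b'⟩ | ⟨s', j', b'⟩ <;> simp only [Mates] at h h' <;> try rfl
    · obtain ⟨rfl, hj, rfl⟩ := h
      obtain ⟨rfl, hj', rfl⟩ := h'
      rw [Fin.ext (hj.trans hj'.symm)]
    · have := j'.2
      obtain ⟨rfl, hi, rfl⟩ := h
      rcases h' with ⟨-, h' | h'⟩
      · exact absurd rfl (h4 _ _ h'.2).1
      · omega
    · have := j.2
      obtain ⟨rfl, hi, rfl⟩ := h'
      rcases h with ⟨-, h | h⟩
      · exact absurd rfl (h4 _ _ h.2).1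
      · omega
    · rcases h with ⟨rfl, ⟨rfl, h⟩ | ⟨rfl, h, rfl, rfl⟩⟩ <;>
        rcases h' with ⟨rfl, ⟨rfl, h'⟩ | ⟨hr, h', ha, rfl⟩⟩
      · rw [h1 _ _ _ _ h h']
      · subst hr ha
        exact absurd rfl (h4 _ _ h).1
      · exact absurd rfl (h4 _ _ h').1
      · rw [Fin.ext (h.symm.trans h')]
  · intro x y z h h'
    rcases x with _ | _ | ⟨r, i, a⟩ | ⟨r, i, a⟩ <;> rcases y with _ | _ | ⟨s, j, b⟩ | ⟨s, j, b⟩ <;>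
      rcases z with _ | _ | ⟨s', j', b'⟩ | ⟨s', j', b'⟩ <;> simp only [Mates] at h h' <;> try rfl
    · obtain ⟨rfl, hj, rfl⟩ := h
      obtain ⟨rfl, hj', rfl⟩ := h'
      rw [Fin.ext (Nat.succ_injective (hj.trans hj'.symm))]
    · obtain ⟨rfl, hi, rfl⟩ := h
      rcases h' with ⟨rfl, h' | h'⟩
      · exact absurd rfl (h4 _ _ h'.2).2
      · omega
    · obtain ⟨rfl, hi, rfl⟩ := h'
      rcases h with ⟨rfl, h | h⟩
      · exact absurd rfl (h4 _ _ h.2).2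
      · omega
    · rcases h with ⟨rfl, ⟨rfl, h⟩ | ⟨rfl, h, rfl, rfl⟩⟩ <;>
        rcases h' with ⟨rfl, ⟨rfl, h'⟩ | ⟨hr, h', rfl, ha⟩⟩
      · rw [h2 _ _ _ _ h h']
      · subst hr ha
        exact absurd rfl (h4 _ _ h).2
      · exact absurd rfl (h4 _ _ h').2
      · rw [Fin.ext (Nat.succ_injective (h.trans h'.symm))]
  · rw [Set.eq_empty_iff_forall_notMem]
    intro x hx
    rw [mem_unmatched_setOf_rel] at hx
    have hx1 : ∀ y, ¬ Mates x y := fun y => (hx y).1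
    have hx2 : ∀ y, ¬ Mates y x := fun y => (hx y).2
    rcases x with _ | _ | ⟨r, i, a⟩ | ⟨r, i, b⟩
    · exact hx1 (.blockV 0 ⟨0, hk⟩ 0) ⟨rfl, rfl, rfl⟩
    · exact hx2 (.blockU 0 ⟨k - 1, by omega⟩ 0) ⟨rfl, by simp only; omega, rfl⟩
    · rcases h5 a (r = 0) with ⟨b, hb⟩ | ⟨hr, rfl⟩
      · exact hx1 (.blockV r i b) ⟨rfl, Or.inl ⟨rfl, hb⟩⟩
      · have hr : r = 0 := by simpa using hr
        by_cases h : i.val + 1 = k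
        · exact hx1 .v ⟨hr, h, rfl⟩
        · exact hx1 (.blockV r ⟨i.val + 1, by omega⟩ 0) ⟨rfl, Or.inr ⟨hr, rfl, rfl, rfl⟩⟩
    · rcases h6 b (r = 0) with ⟨a, ha⟩ | ⟨hr, rfl⟩
      · exact hx2 (.blockU r i a) ⟨rfl, Or.inl ⟨rfl, ha⟩⟩
      · have hr : r = 0 := by simpa using hr
        by_cases h : i.val = 0
        · exact hx2 .u ⟨hr, h, rfl⟩
        · exact hx2 (.blockU r ⟨i.val - 1, by omega⟩ 0)
            ⟨rfl, Or.inr ⟨hr, by simp only; omega, rfl, rfl⟩⟩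

theorem card_eq : Fintype.card (BlockVertex k) = 24 * k + 2 := by
  have e : BlockVertex k ≃ (Bool × Fin 3 × Fin k × Fin 4) ⊕ Bool :=
    { toFun := fun x => match x with
        | .u => .inr true
        | .v => .inr false
        | .blockU r i c => .inl (true, r, i, c)
        | .blockV r i c => .inl (false, r, i, c)
      invFun := fun x => match x with
        | .inr true => .u
        | .inr false => .v
        | .inl (true, r, i, c) => .blockU r i c
        | .inl (false, r, i, c) => .blockV r i c
      left_inv := by rintro (_ | _ | ⟨r, i, c⟩ | ⟨r, i, c⟩) <;> rfl
      right_inv := by rintro (⟨_ | _, r, i, c⟩ | (_ | _)) <;> rfl }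
  rw [Fintype.card_congr e]
  simp; ring

theorem exists_bottleneck (hk : 0 < k) :
    ∃ F : Set (Sym2 (BlockVertex k)),
      ({M : BroderState (blockGraph k) | ∃ f ∈ F, ∃ w ∈ f, w ∈ unmatched M.1}.ncard + 1) *
          2 ^ ((k - 1) / 2) ≤
        (2 * (Nat.card (BlockVertex k) ^ 2 * 2 ^ 3 * (5 ^ 4) ^ 2) + 1) * 6 *
          {M : BroderState (blockGraph k) | F ⊆ M.1}.ncard ∧
      ({M : BroderState (blockGraph k) | ∃ f ∈ F, ∃ w ∈ f, w ∈ unmatched M.1}.ncard + 1) *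
          2 ^ ((k - 1) / 2) ≤
        (2 * (Nat.card (BlockVertex k) ^ 2 * 2 ^ 3 * (5 ^ 4) ^ 2) + 1) * 6 *
          {M : BroderState (blockGraph k) | ¬ F ⊆ M.1}.ncard := by
  obtain ⟨M₀, h₀⟩ := exists_perfectMatching hk
  have hI := card_insideConfigs_blockRel
  have hJ := card_throughConfigs_blockRel
  have := (trackSystem k).exists_bottleneck_of_two_ends .u .v (by simp) ?_ ?_ ?_ ?_ ?_ side
    side_ne_of_adj rfl rfl ?_ ?_ h₀ (by rw [hI, hJ]) (by rw [hI]; norm_num) 0 hk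
  · rw [hI, Fintype.card_fin] at this
    exact this
  · rintro (_ | _ | ⟨r, i, c⟩ | ⟨r, i, c⟩)
    · exact Or.inl rfl
    · exact Or.inr (Or.inl rfl)
    · exact Or.inr (Or.inr ⟨r, i, c, Or.inl rfl⟩)
    · exact Or.inr (Or.inr ⟨r, i, c, Or.inr rfl⟩)
  · intro y h
    rcases y with _ | _ | ⟨r, i, c⟩ | ⟨r, i, c⟩
    · exact absurd h (SimpleGraph.irrefl _)
    · exact absurd h not_adj_u_v
    · exact absurd h.symm not_adj_blockU_u
    · obtain ⟨hi, rfl⟩ := adj_blockV_u.1 h.symm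
      exact ⟨r, i, hi, rfl, (eq_prv.2 (Or.inr ⟨hi, rfl⟩)).symm⟩
  · intro y h
    rcases y with _ | _ | ⟨r, i, c⟩ | ⟨r, i, c⟩
    · exact absurd h.symm not_adj_u_v
    · exact absurd h (SimpleGraph.irrefl _)
    · obtain ⟨hi, rfl⟩ := adj_blockU_v.1 h.symm
      exact ⟨r, i, hi, rfl, (eq_nxt.2 (Or.inr ⟨hi, rfl⟩)).symm⟩
    · exact absurd h.symm not_adj_blockV_v
  · simp [trackSystem]
  · simp [trackSystem]
  · intro r i a; rfl
  · intro r i a; rfl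

end BlockVertex

theorem blockGraphs_hasBottleneck : HasBottleneck blockGraphs := by
  refine hasBottleneck_of_card_sq (2 ^ 3) ((5 ^ 4) ^ 2) 6 30 (by norm_num) ?_
  rintro _ ⟨j, rfl⟩
  obtain ⟨F, h⟩ := BlockVertex.exists_bottleneck (k := j + 1) (Nat.succ_pos j)
  refine ⟨(j + 1 - 1) / 2, F, ?_, h⟩
  simp only [FinGraph.size, BlockVertex.card_eq]
  omega

theorem blockGraphs_inputs (N : ℕ) : ∃ G ∈ blockGraphs, N ≤ G.size ∧ G.IsBroderInput := by
  refine ⟨_, ⟨N, rfl⟩, ?_, ?_⟩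
  · simp only [FinGraph.size, BlockVertex.card_eq]; omega
  · obtain ⟨M, hM⟩ := BlockVertex.exists_perfectMatching (k := N + 1) (Nat.succ_pos N)
    refine FinGraph.isBroderInput _ hM (x := .blockU 0 0 0) (y := .blockV 0 0 1)
      (z := .blockV 0 0 2) ?_ ?_ (by simp)
    · exact BlockVertex.adj_blockU_blockV.2 ⟨rfl, Or.inl ⟨rfl, by decide⟩⟩
    · exact BlockVertex.adj_blockU_blockV.2 ⟨rfl, Or.inl ⟨rfl, by decide⟩⟩

/-! ### Block graphs with a ladder: structure -/

namespace LadderVertex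

variable {k : ℕ}

theorem adj_blockU_blockV {r s : Fin 3} {i j : Fin k} {a b : Fin 4} :
    (ladderGraph k).Adj (.blockU r i a) (.blockV s j b) ↔
      r = s ∧ ((i = j ∧ blockRel a b) ∨ (i.val + 1 = j.val ∧ a = 0 ∧ b = 0)) := by
  simp [ladderGraph, SimpleGraph.fromRel_adj, LadderVertex.rel]

theorem adj_blockV_u {r : Fin 3} {i : Fin k} {b : Fin 4} :
    (ladderGraph k).Adj (.blockV r i b) .u ↔ (r = 0 ∨ r = 2) ∧ i.val = 0 ∧ b = 0 := by
  simp [ladderGraph, SimpleGraph.fromRel_adj, LadderVertex.rel]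

theorem adj_blockU_v {r : Fin 3} {i : Fin k} {a : Fin 4} :
    (ladderGraph k).Adj (.blockU r i a) .v ↔ (r = 1 ∨ r = 2) ∧ i.val + 1 = k ∧ a = 0 := by
  simp [ladderGraph, SimpleGraph.fromRel_adj, LadderVertex.rel]

theorem adj_blockV_lad {r : Fin 3} {i : Fin k} {b : Fin 4} {l : Fin (k + 2)} {s : Bool} :
    (ladderGraph k).Adj (.blockV r i b) (.lad l s) ↔
      r = 1 ∧ i.val = 0 ∧ b = 0 ∧ l.val = 0 ∧ s = false := by
  simp only [ladderGraph, SimpleGraph.fromRel_adj, LadderVertex.rel]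
  simp only [ne_eq, reduceCtorEq, not_false_eq_true, true_and, false_or]
  tauto

theorem adj_blockU_lad {r : Fin 3} {i : Fin k} {a : Fin 4} {l : Fin (k + 2)} {s : Bool} :
    (ladderGraph k).Adj (.blockU r i a) (.lad l s) ↔
      r = 0 ∧ i.val + 1 = k ∧ a = 0 ∧ l.val = k + 1 ∧ s = false := by
  simp [ladderGraph, SimpleGraph.fromRel_adj, LadderVertex.rel]

theorem adj_lad_u {l : Fin (k + 2)} {s : Bool} :
    (ladderGraph k).Adj (.lad l s) .u ↔ l.val = 0 ∧ s = true := by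
  simp [ladderGraph, SimpleGraph.fromRel_adj, LadderVertex.rel]

theorem adj_lad_v {l : Fin (k + 2)} {s : Bool} :
    (ladderGraph k).Adj (.lad l s) .v ↔ l.val = k + 1 ∧ s = true := by
  simp [ladderGraph, SimpleGraph.fromRel_adj, LadderVertex.rel]

theorem adj_lad_lad {l l' : Fin (k + 2)} {s s' : Bool} :
    (ladderGraph k).Adj (.lad l s) (.lad l' s') ↔
      (l = l' ∧ s ≠ s') ∨ (s = s' ∧ (l.val + 1 = l'.val ∨ l'.val + 1 = l.val)) := by
  rw [ladderGraph, SimpleGraph.fromRel_adj]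
  simp only [LadderVertex.rel, ne_eq, LadderVertex.lad.injEq, not_and]
  constructor
  · rintro ⟨-, (⟨rfl, h⟩ | ⟨h, rfl⟩) | (⟨rfl, h⟩ | ⟨h, rfl⟩)⟩
    · exact Or.inl ⟨rfl, h⟩
    · exact Or.inr ⟨rfl, Or.inl h⟩
    · exact Or.inl ⟨rfl, fun e => h e.symm⟩
    · exact Or.inr ⟨rfl, Or.inr h⟩
  · rintro (⟨rfl, h⟩ | ⟨rfl, h | h⟩)
    · exact ⟨fun _ => h, Or.inl (Or.inl ⟨rfl, h⟩)⟩
    · exact ⟨by rintro rfl; omega, Or.inl (Or.inr ⟨h, rfl⟩)⟩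
    · exact ⟨by rintro rfl; omega, Or.inr (Or.inr ⟨h, rfl⟩)⟩

theorem not_adj_u_v : ¬ (ladderGraph k).Adj .u .v := by
  simp [ladderGraph, SimpleGraph.fromRel_adj, LadderVertex.rel]

theorem not_adj_blockU_u {r : Fin 3} {i : Fin k} {a : Fin 4} :
    ¬ (ladderGraph k).Adj (.blockU r i a) .u := by
  simp [ladderGraph, SimpleGraph.fromRel_adj, LadderVertex.rel]

theorem not_adj_blockV_v {r : Fin 3} {i : Fin k} {b : Fin 4} :
    ¬ (ladderGraph k).Adj (.blockV r i b) .v := by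
  simp [ladderGraph, SimpleGraph.fromRel_adj, LadderVertex.rel]

theorem not_adj_blockU_blockU {r s : Fin 3} {i j : Fin k} {a b : Fin 4} :
    ¬ (ladderGraph k).Adj (.blockU r i a) (.blockU s j b) := by
  simp [ladderGraph, SimpleGraph.fromRel_adj, LadderVertex.rel]

theorem not_adj_blockV_blockV {r s : Fin 3} {i j : Fin k} {a b : Fin 4} :
    ¬ (ladderGraph k).Adj (.blockV r i a) (.blockV s j b) := by
  simp [ladderGraph, SimpleGraph.fromRel_adj, LadderVertex.rel]

/-- The vertex that follows the block `i` of the track `r`. -/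
def nxt (r : Fin 3) (i : Fin k) : LadderVertex k :=
  if h : i.val + 1 < k then .blockV r ⟨i.val + 1, h⟩ 0
  else if r = 0 then .lad (Fin.last _) false else .v

/-- The vertex that precedes the block `i` of the track `r`. -/
def prv (r : Fin 3) (i : Fin k) : LadderVertex k :=
  if h : i.val = 0 then if r = 1 then .lad 0 false else .u else .blockU r ⟨i.val - 1, by omega⟩ 0

theorem eq_nxt {r : Fin 3} {i : Fin k} {y : LadderVertex k} : y = nxt r i ↔
    (∃ j : Fin k, i.val + 1 = j.val ∧ y = .blockV r j 0) ∨
      (i.val + 1 = k ∧ ((r = 0 ∧ y = .lad (Fin.last _) false) ∨ (r ≠ 0 ∧ y = .v))) := by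
  have hi := i.2
  unfold nxt
  split_ifs with h h'
  · constructor
    · rintro rfl; exact Or.inl ⟨_, rfl, rfl⟩
    · rintro (⟨j, hj, rfl⟩ | ⟨h1, -⟩)
      · congr 1; exact Fin.ext hj.symm
      · omega
  · constructor
    · rintro rfl; exact Or.inr ⟨by omega, Or.inl ⟨h', rfl⟩⟩
    · rintro (⟨j, hj, rfl⟩ | ⟨-, ⟨-, rfl⟩ | ⟨h2, -⟩⟩)
      · have := j.2; omega
      · rfl
      · exact absurd h' h2
  · constructor
    · rintro rfl; exact Or.inr ⟨by omega, Or.inr ⟨h', rfl⟩⟩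
    · rintro (⟨j, hj, rfl⟩ | ⟨-, ⟨h2, -⟩ | ⟨-, rfl⟩⟩)
      · have := j.2; omega
      · exact absurd h2 h'
      · rfl

theorem eq_prv {r : Fin 3} {i : Fin k} {y : LadderVertex k} : y = prv r i ↔
    (∃ j : Fin k, j.val + 1 = i.val ∧ y = .blockU r j 0) ∨
      (i.val = 0 ∧ ((r = 1 ∧ y = .lad 0 false) ∨ (r ≠ 1 ∧ y = .u))) := by
  have hi := i.2
  unfold prv
  split_ifs with h h'
  · constructor
    · rintro rfl; exact Or.inr ⟨h, Or.inl ⟨h', rfl⟩⟩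
    · rintro (⟨j, hj, rfl⟩ | ⟨-, ⟨-, rfl⟩ | ⟨h2, -⟩⟩)
      · omega
      · rfl
      · exact absurd h' h2
  · constructor
    · rintro rfl; exact Or.inr ⟨h, Or.inr ⟨h', rfl⟩⟩
    · rintro (⟨j, hj, rfl⟩ | ⟨-, ⟨h2, -⟩ | ⟨-, rfl⟩⟩)
      · omega
      · exact absurd h2 h'
      · rfl
  · constructor
    · rintro rfl; exact Or.inl ⟨_, by simp only; omega, rfl⟩
    · rintro (⟨j, hj, rfl⟩ | ⟨h1, -⟩)
      · congr 1; exact Fin.ext (by simp only; omega)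
      · omega

theorem ne_zero_iff (r : Fin 3) : r ≠ 0 ↔ r = 1 ∨ r = 2 := by revert r; decide

theorem ne_one_iff (r : Fin 3) : r ≠ 1 ↔ r = 0 ∨ r = 2 := by revert r; decide

/-- The blocks of the ladder graph as a system of tracks. -/
def trackSystem (k : ℕ) : TrackSystem (ladderGraph k) (Fin 3) k 3 blockRel where
  U := .blockU
  W := .blockV
  prv := prv
  nxt := nxt
  U_inj h := by simpa using h
  W_inj h := by simpa using h
  U_ne_W := by simp
  adj_U {r i a y} := by
    rw [eq_nxt, ne_zero_iff]
    rcases y with _ | _ | ⟨s, j, b⟩ | ⟨s, j, b⟩ | ⟨l, s⟩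
    · simp [not_adj_blockU_u]
    · simp only [adj_blockU_v, reduceCtorEq, and_false, false_or, exists_false, and_true]
      tauto
    · simp [not_adj_blockU_blockU]
    · simp only [adj_blockU_blockV, LadderVertex.blockV.injEq, reduceCtorEq, and_false, or_false]
      constructor
      · rintro ⟨rfl, ⟨rfl, h⟩ | ⟨h, rfl, rfl⟩⟩
        · exact Or.inl ⟨b, h, rfl, rfl, rfl⟩
        · exact Or.inr ⟨rfl, j, h, rfl, rfl, rfl⟩
      · rintro (⟨_, h, rfl, rfl, rfl⟩ | ⟨rfl, _, h, rfl, rfl, rfl⟩)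
        · exact ⟨rfl, Or.inl ⟨rfl, h⟩⟩
        · exact ⟨rfl, Or.inr ⟨h, rfl, rfl⟩⟩
    · have : l = Fin.last (k + 1) ↔ l.val = k + 1 := by rw [Fin.ext_iff]; rfl
      simp only [adj_blockU_lad, LadderVertex.lad.injEq, reduceCtorEq, and_false, or_false,
        false_or, exists_false, this]
      tauto
  adj_W {r i b y} := by
    rw [eq_prv, ne_one_iff]
    rcases y with _ | _ | ⟨s, j, a⟩ | ⟨s, j, a⟩ | ⟨l, s⟩
    · simp only [adj_blockV_u, reduceCtorEq, and_false, false_or, exists_false, and_true]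
      tauto
    · simp [not_adj_blockV_v]
    · rw [SimpleGraph.adj_comm]
      simp only [adj_blockU_blockV, LadderVertex.blockU.injEq, reduceCtorEq, and_false, or_false]
      constructor
      · rintro ⟨rfl, ⟨rfl, h⟩ | ⟨h, rfl, rfl⟩⟩
        · exact Or.inl ⟨a, h, rfl, rfl, rfl⟩
        · exact Or.inr ⟨rfl, j, h, rfl, rfl, rfl⟩
      · rintro (⟨_, h, rfl, rfl, rfl⟩ | ⟨rfl, _, h, rfl, rfl, rfl⟩)
        · exact ⟨rfl, Or.inl ⟨rfl, h⟩⟩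
        · exact ⟨rfl, Or.inr ⟨h, rfl, rfl⟩⟩
    · simp [not_adj_blockV_blockV]
    · have : l = 0 ↔ l.val = 0 := by rw [Fin.ext_iff]; rfl
      simp only [adj_blockV_lad, LadderVertex.lad.injEq, reduceCtorEq, and_false, or_false,
        false_or, exists_false, this]
      tauto
  nxt_ne {r i b} h := by
    rcases eq_nxt.1 h.symm with ⟨j, h1, h2⟩ | ⟨-, ⟨-, h2⟩ | ⟨-, h2⟩⟩
    · rw [LadderVertex.blockV.injEq] at h2
      rw [h2.2.1] at h1
      omega
    · cases h2
    · cases h2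
  prv_ne {r i b} h := by
    rcases eq_prv.1 h.symm with ⟨j, h1, h2⟩ | ⟨-, ⟨-, h2⟩ | ⟨-, h2⟩⟩
    · rw [LadderVertex.blockU.injEq] at h2
      rw [h2.2.1] at h1
      omega
    · cases h2
    · cases h2
  nxt_eq {_ i j} h := (eq_nxt.2 (Or.inl ⟨j, h, rfl⟩)).symm
  prv_eq {_ i j} h := (eq_prv.2 (Or.inl ⟨i, h, rfl⟩)).symm

/-- The rail of the vertex of the rung `i` that has the colour of `u`. -/
def rail (i : ℕ) : Bool := i % 2 == 1

theorem rail_succ (i : ℕ) : rail (i + 1) = !rail i := by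
  unfold rail
  rcases Nat.mod_two_eq_zero_or_one i with h | h
  · simp [h, show (i + 1) % 2 = 1 by omega]
  · simp [h, show (i + 1) % 2 = 0 by omega]

/-- The colour class of `u`. -/
def side : LadderVertex k → Bool
  | .u => true
  | .v => false
  | .blockU _ _ _ => true
  | .blockV _ _ _ => false
  | .lad i s => s == rail i

/-- The ladder is coloured like a chessboard. For even k the number k + 1 of the last rung is odd,
so `lad (k + 1) true`, the neighbour of `v`, gets the colour of `u`, and the end `lad (k + 1) false`
of the first track gets the other. -/
theorem side_ne_of_adj (hk : Even k) (x y : LadderVertex k) (h : (ladderGraph k).Adj x y) :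
    side x ≠ side y := by
  have hl : rail (k + 1) = true := by
    rw [rail, show (k + 1) % 2 = 1 by have := Nat.even_iff.1 hk; omega]; rfl
  have key : ∀ x y : LadderVertex k, LadderVertex.rel x y → side x ≠ side y := by
    intro x y h
    cases x <;> cases y <;> simp only [LadderVertex.rel] at h
    case lad.lad l s l' s' =>
      rcases h with ⟨rfl, h⟩ | ⟨h, rfl⟩
      · simp only [side]
        revert h
        cases s <;> cases s' <;> cases rail l <;> decide
      · simp only [side, ← h, rail_succ]
        cases s <;> cases rail l <;> decide
    all_goals simp_all [side, show rail 0 = false from rfl]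
  rw [ladderGraph, SimpleGraph.fromRel_adj] at h
  rcases h.2 with h | h
  · exact key _ _ h
  · exact (key _ _ h).symm

theorem isBipartite (hk : Even k) : (ladderGraph k).IsBipartite := by
  refine ⟨SimpleGraph.Coloring.mk (fun x => if side x then 0 else 1) ?_⟩
  intro x y h
  have := side_ne_of_adj hk x y h
  cases h1 : side x <;> cases h2 : side y <;> simp_all

/-- The neighbour of a vertex of the ladder on the side of the first rung. -/
def ladPrv (hk : 0 < k) (i : Fin (k + 2)) (s : Bool) : LadderVertex k :=
  if i.val = 0 then if s then .u else .blockV 1 ⟨0, hk⟩ 0 else .lad ⟨i.val - 1, by omega⟩ s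

/-- The neighbour of a vertex of the ladder on the side of the last rung. -/
def ladNxt (hk : 0 < k) (i : Fin (k + 2)) (s : Bool) : LadderVertex k :=
  if h : i.val = k + 1 then if s then .v else .blockU 0 ⟨k - 1, by omega⟩ 0
  else .lad ⟨i.val + 1, by omega⟩ s

theorem adj_lad (hk : 0 < k) {i : Fin (k + 2)} {s : Bool} {y : LadderVertex k} :
    (ladderGraph k).Adj (.lad i s) y ↔ y = .lad i (!s) ∨ y = ladPrv hk i s ∨ y = ladNxt hk i s := by
  have hi := i.2
  have hprv : y = ladPrv hk i s ↔ (∃ j : Fin (k + 2), j.val + 1 = i.val ∧ y = .lad j s) ∨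
      (i.val = 0 ∧ (s = true ∧ y = .u ∨ s = false ∧ y = .blockV 1 ⟨0, hk⟩ 0)) := by
    unfold ladPrv
    split_ifs with h h'
    · simp [h, h']
    · simp [h, h']
    · simp only [h, false_and, or_false]
      constructor
      · rintro rfl; exact ⟨_, by simp only; omega, rfl⟩
      · rintro ⟨j, hj, rfl⟩; congr 1; exact Fin.ext (by simp only; omega)
  have hnxt : y = ladNxt hk i s ↔ (∃ j : Fin (k + 2), i.val + 1 = j.val ∧ y = .lad j s) ∨
      (i.val = k + 1 ∧ (s = true ∧ y = .v ∨ s = false ∧ y = .blockU 0 ⟨k - 1, by omega⟩ 0)) := by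
    unfold ladNxt
    split_ifs with h h'
    · have : ∀ j : Fin (k + 2), ¬ (k + 1 + 1 = j.val) := fun j => by omega
      simp [h, h', this]
    · have : ∀ j : Fin (k + 2), ¬ (k + 1 + 1 = j.val) := fun j => by omega
      simp [h, h', this]
    · simp only [h, false_and, or_false]
      constructor
      · rintro rfl; exact ⟨_, by simp only, rfl⟩
      · rintro ⟨j, hj, rfl⟩; congr 1; exact Fin.ext (by simp only; omega)
  rw [hprv, hnxt]
  rcases y with _ | _ | ⟨r, j, b⟩ | ⟨r, j, b⟩ | ⟨l, t⟩
  · simp [adj_lad_u]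
  · simp [adj_lad_v]
  · rw [SimpleGraph.adj_comm, adj_blockU_lad]
    simp only [reduceCtorEq, and_false, exists_false, false_or, LadderVertex.blockU.injEq, Fin.ext_iff]
    constructor
    · rintro ⟨h1, h2, h3, h4, h5⟩
      exact ⟨h4, h5, by omega, by omega, by omega⟩
    · rintro ⟨h1, h2, h3, h4, h5⟩
      exact ⟨by omega, by omega, by omega, h1, h2⟩
  · rw [SimpleGraph.adj_comm, adj_blockV_lad]
    simp only [reduceCtorEq, and_false, exists_false, false_or, or_false,
      LadderVertex.blockV.injEq, Fin.ext_iff]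
    constructor
    · rintro ⟨h1, h2, h3, h4, h5⟩
      exact ⟨h4, h5, h1, h2, h3⟩
    · rintro ⟨h1, h2, h3, h4, h5⟩
      exact ⟨h3, h4, h5, h1, h2⟩
  · simp only [adj_lad_lad, reduceCtorEq, and_false, or_false, LadderVertex.lad.injEq]
    constructor
    · rintro (⟨rfl, h⟩ | ⟨rfl, h | h⟩)
      · exact Or.inl ⟨rfl, by revert h; cases s <;> cases t <;> decide⟩
      · exact Or.inr (Or.inr ⟨l, h, rfl, rfl⟩)
      · exact Or.inr (Or.inl ⟨l, h, rfl, rfl⟩)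
    · rintro (⟨rfl, rfl⟩ | ⟨_, h, rfl, rfl⟩ | ⟨_, h, rfl, rfl⟩)
      · exact Or.inl ⟨rfl, by cases s <;> decide⟩
      · exact Or.inr ⟨rfl, Or.inr h⟩
      · exact Or.inr ⟨rfl, Or.inl h⟩

theorem ncard_neighborSet_lad (hk : 0 < k) (i : Fin (k + 2)) (s : Bool) :
    ((ladderGraph k).neighborSet (.lad i s)).ncard = 3 := by
  have h1 : ladPrv hk i s ≠ .lad i (!s) := by
    unfold ladPrv
    split_ifs with h h' <;> cases s <;> simp
  have h2 : ladNxt hk i s ≠ .lad i (!s) := by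
    unfold ladNxt
    split_ifs with h h' <;> cases s <;> simp
  have h3 : ladPrv hk i s ≠ ladNxt hk i s := by
    unfold ladPrv ladNxt
    split_ifs <;> simp
  refine ncard_neighborSet_eq_three ![.lad i (!s), ladPrv hk i s, ladNxt hk i s] ?_ fun y => ?_
  · intro x y h
    fin_cases x <;> fin_cases y <;> simp at h ⊢
    · exact h1 h.symm
    · exact h2 h.symm
    · exact h1 h
    · exact h3 h
    · exact h2 h
    · exact h3 h.symm
  · rw [adj_lad hk]
    simp [Fin.exists_fin_succ]

open Classical in
theorem isRegularOfDegree (hk : 0 < k) : (ladderGraph k).IsRegularOfDegree 3 := by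
  refine isRegularOfDegree_of_ncard fun x => ?_
  rcases x with _ | _ | ⟨r, i, a⟩ | ⟨r, i, b⟩ | ⟨l, s⟩
  · refine ncard_neighborSet_eq_three ![.blockV 0 ⟨0, hk⟩ 0, .blockV 2 ⟨0, hk⟩ 0, .lad 0 true]
      (fun x y h => ?_) fun y => ?_
    · fin_cases x <;> fin_cases y <;> simp at h ⊢
    rw [SimpleGraph.adj_comm]
    rcases y with _ | _ | ⟨s, j, a⟩ | ⟨s, j, a⟩ | ⟨l, s⟩
    · simp [Fin.exists_fin_succ]
    · simp [SimpleGraph.adj_comm, not_adj_u_v, Fin.exists_fin_succ]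
    · simp [not_adj_blockU_u, Fin.exists_fin_succ]
    · have : j = ⟨0, hk⟩ ↔ j.val = 0 := Fin.ext_iff
      simp only [adj_blockV_u, Fin.exists_fin_succ, Matrix.cons_val_zero, Matrix.cons_val_succ,
        LadderVertex.blockV.injEq, this]
      simp
      tauto
    · simp [adj_lad_u, Fin.exists_fin_succ]
  · refine ncard_neighborSet_eq_three
      ![.blockU 1 ⟨k - 1, by omega⟩ 0, .blockU 2 ⟨k - 1, by omega⟩ 0, .lad (Fin.last _) true]
      (fun x y h => ?_) fun y => ?_
    · fin_cases x <;> fin_cases y <;> simp at h ⊢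
    rw [SimpleGraph.adj_comm]
    rcases y with _ | _ | ⟨s, j, a⟩ | ⟨s, j, a⟩ | ⟨l, s⟩
    · simp [not_adj_u_v, Fin.exists_fin_succ]
    · simp [Fin.exists_fin_succ]
    · have : j = ⟨k - 1, by omega⟩ ↔ j.val + 1 = k := by
        rw [Fin.ext_iff]; simp only; omega
      simp only [adj_blockU_v, Fin.exists_fin_succ, Matrix.cons_val_zero, Matrix.cons_val_succ,
        LadderVertex.blockU.injEq, this]
      simp
      tauto
    · simp [not_adj_blockV_v, Fin.exists_fin_succ]
    · have : l = Fin.last (k + 1) ↔ l.val = k + 1 := by rw [Fin.ext_iff]; rfl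
      simp [adj_lad_v, Fin.exists_fin_succ, this]
  · exact (trackSystem k).ncard_neighborSet_U r i a
  · exact (trackSystem k).ncard_neighborSet_W r i b
  · exact ncard_neighborSet_lad hk l s

theorem card_eq : Fintype.card (LadderVertex k) = 26 * k + 6 := by
  have e : LadderVertex k ≃ ((Bool × Fin 3 × Fin k × Fin 4) ⊕ Bool) ⊕ (Fin (k + 2) × Bool) :=
    { toFun := fun x => match x with
        | .u => .inl (.inr true)
        | .v => .inl (.inr false)
        | .blockU r i c => .inl (.inl (true, r, i, c))
        | .blockV r i c => .inl (.inl (false, r, i, c))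
        | .lad i s => .inr (i, s)
      invFun := fun x => match x with
        | .inl (.inr true) => .u
        | .inl (.inr false) => .v
        | .inl (.inl (true, r, i, c)) => .blockU r i c
        | .inl (.inl (false, r, i, c)) => .blockV r i c
        | .inr (i, s) => .lad i s
      left_inv := by rintro (_ | _ | ⟨r, i, c⟩ | ⟨r, i, c⟩ | ⟨i, s⟩) <;> rfl
      right_inv := by rintro ((⟨_ | _, r, i, c⟩ | (_ | _)) | ⟨i, s⟩) <;> rfl }
  rw [Fintype.card_congr e]
  simp; ring

end LadderVertex

/-! ### Matchings of a ladder -/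

/-- A matching of a ladder with the rungs `0, …, n`: the rung `i` is matched iff `g i`, the rail edge
between `(i, s)` and `(i + 1, s)` iff `h i s`, and the vertices with `W i s` are not covered. -/
structure LadderMatching (n : ℕ) (W h : ℕ → Bool → Prop) (g : ℕ → Prop) : Prop where
  cover : ∀ i ≤ n, ∀ s, W i s ∨ g i ∨ h i s ∨ ∃ j, j + 1 = i ∧ h j s
  lt_of_rail : ∀ {i s}, h i s → i < n
  not_rung : ∀ {i s}, W i s → ¬ g i
  not_rail : ∀ {i s}, W i s → ¬ h i s
  not_rail_succ : ∀ {i s}, W (i + 1) s → ¬ h i s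
  rung_not_rail : ∀ {i s}, g i → ¬ h i s
  rung_not_rail_succ : ∀ {i s}, g (i + 1) → ¬ h i s
  rail_not_rail : ∀ {i s}, h (i + 1) s → ¬ h i s

namespace LadderMatching

variable {n : ℕ} {W h h' : ℕ → Bool → Prop} {g g' : ℕ → Prop}

/-- Call a vertex available if it is neither exempt nor covered from the preceding rung. If only one
vertex of a rung is available, it has to go on along its rail; if both are, they use their rung or
both rail edges. So beyond availability one bit per rung decides, which makes the recursion in
`rail_congr` possible. -/
theorem rail_iff (L : LadderMatching n W h g) {i : ℕ} (hi : i ≤ n) (s : Bool) :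
    h i s ↔ (¬ W i s ∧ ¬ ∃ j, j + 1 = i ∧ h j s) ∧
      (¬ (¬ W i (!s) ∧ ¬ ∃ j, j + 1 = i ∧ h j (!s)) ∨ (h i false ∧ h i true)) := by
  have hb : h i false ∧ h i true ↔ h i s ∧ h i (!s) := by cases s <;> simp [and_comm]
  rw [hb]
  constructor
  · intro hs
    refine ⟨⟨fun hW => L.not_rail hW hs, ?_⟩, ?_⟩
    · rintro ⟨j, rfl, hj⟩
      exact L.rail_not_rail hs hj
    · by_cases hav : ¬ W i (!s) ∧ ¬ ∃ j, j + 1 = i ∧ h j (!s)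
      · rcases L.cover i hi (!s) with h1 | h1 | h1 | h1
        · exact absurd h1 hav.1
        · exact absurd hs (L.rung_not_rail h1)
        · exact Or.inr ⟨hs, h1⟩
        · exact absurd h1 hav.2
      · exact Or.inl hav
  · rintro ⟨⟨h1, h2⟩, h3⟩
    rcases L.cover i hi s with h4 | h4 | h4 | h4
    · exact absurd h4 h1
    · rcases h3 with h3 | h3
      · refine absurd ⟨fun hW => L.not_rung hW h4, ?_⟩ h3
        rintro ⟨j, rfl, hj⟩
        exact L.rung_not_rail_succ h4 hj
      · exact h3.1
    · exact h4
    · exact absurd h4 h2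

theorem rung_iff (L : LadderMatching n W h g) {i : ℕ} (hi : i ≤ n) (s : Bool) :
    g i ↔ ¬ W i s ∧ ¬ h i s ∧ ¬ ∃ j, j + 1 = i ∧ h j s := by
  constructor
  · intro hg
    refine ⟨fun hW => L.not_rung hW hg, L.rung_not_rail hg, ?_⟩
    rintro ⟨j, rfl, hj⟩
    exact L.rung_not_rail_succ hg hj
  · rintro ⟨h1, h2, h3⟩
    rcases L.cover i hi s with h4 | h4 | h4 | h4
    · exact absurd h4 h1
    · exact h4
    · exact absurd h4 h2
    · exact absurd h4 h3

/-- The uncovered vertices and the positions where both rail edges are matched determine the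
matching. -/
theorem rail_congr (L : LadderMatching n W h g) (L' : LadderMatching n W h' g')
    (hb : ∀ i, (h i false ∧ h i true) ↔ (h' i false ∧ h' i true)) :
    ∀ i ≤ n, ∀ s, h i s ↔ h' i s := by
  intro i
  induction i with
  | zero =>
    intro hi s
    rw [L.rail_iff hi, L'.rail_iff hi, hb]
    simp
  | succ i ih =>
    intro hi s
    have key : ∀ s, (∃ j, j + 1 = i + 1 ∧ h j s) ↔ ∃ j, j + 1 = i + 1 ∧ h' j s := by
      intro s
      refine exists_congr fun j => and_congr_right fun hj => ?_
      obtain rfl := Nat.succ_injective hj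
      exact ih (by omega) s
    rw [L.rail_iff hi, L'.rail_iff hi, hb, key, key]

theorem rung_congr (L : LadderMatching n W h g) (L' : LadderMatching n W h' g')
    (hb : ∀ i, (h i false ∧ h i true) ↔ (h' i false ∧ h' i true)) {i : ℕ} (hi : i ≤ n) :
    g i ↔ g' i := by
  have hc := L.rail_congr L' hb
  rw [L.rung_iff hi true, L'.rung_iff hi true, hc i hi]
  have : (∃ j, j + 1 = i ∧ h j true) ↔ ∃ j, j + 1 = i ∧ h' j true :=
    exists_congr fun j => and_congr_right fun hj => hc j (by omega) true
  rw [this]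

/-- If the first vertex of the other colour is not covered in the ladder, and the vertices of the
first colour are, then the matching is a zigzag. -/
theorem zigzag_of_first (L : LadderMatching n W h g) {c : ℕ → Bool}
    (hc : ∀ i, c (i + 1) = !c i) (h0 : W 0 (!c 0)) (hW : ∀ i < n, ¬ W i (c i)) :
    ∀ i < n, h i (c i) ∧ ¬ h i (!c i) := by
  intro i
  induction i with
  | zero =>
    intro hi
    refine ⟨?_, L.not_rail h0⟩
    rcases L.cover 0 (Nat.zero_le _) (c 0) with h1 | h1 | h1 | ⟨j, hj, -⟩
    · exact absurd h1 (hW 0 hi)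
    · exact absurd h1 (L.not_rung h0)
    · exact h1
    · omega
  | succ i ih =>
    intro hi
    obtain ⟨h1, h2⟩ := ih (by omega)
    have hcc : (!c (i + 1)) = c i := by rw [hc, Bool.not_not]
    refine ⟨?_, fun h3 => ?_⟩
    · rcases L.cover (i + 1) hi.le (c (i + 1)) with h4 | h4 | h4 | ⟨j, hj, h4⟩
      · exact absurd h4 (hW _ hi)
      · exact absurd h1 (L.rung_not_rail_succ h4)
      · exact h4
      · obtain rfl := Nat.succ_injective hj
        rw [hc] at h4
        exact absurd h4 h2
    · rw [hcc] at h3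
      exact L.rail_not_rail h3 h1

/-- The mirror image of `zigzag_of_first`, by induction from the last rung downwards. That no rail
edge leaves the last rung is `lt_of_rail`. -/
theorem zigzag_of_last (L : LadderMatching n W h g) {c : ℕ → Bool}
    (hc : ∀ i, c (i + 1) = !c i) (h0 : W n (c n)) (hW : ∀ i < n, ¬ W (i + 1) (c i)) :
    ∀ i < n, h i (c i) ∧ ¬ h i (!c i) := by
  have key : ∀ d i, i + d + 1 = n → h i (c i) ∧ ¬ h i (!c i) := by
    intro d
    induction d using Nat.strong_induction_on with
    | _ d ih =>
      intro i hi
      have hn : h (i + 1) (c (i + 1)) ∧ i + 1 < n ∨ W (i + 1) (c (i + 1)) ∧ i + 1 = n := by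
        rcases d with _ | d
        · have : i + 1 = n := by omega
          exact Or.inr ⟨this ▸ h0, this⟩
        · exact Or.inl ⟨(ih d (by omega) (i + 1) (by omega)).1, by omega⟩
      have hn2 : ¬ h (i + 1) (!c (i + 1)) := by
        rcases d with _ | d
        · intro h1
          have := L.lt_of_rail h1
          omega
        · exact (ih d (by omega) (i + 1) (by omega)).2
      refine ⟨?_, fun h1 => ?_⟩
      · rcases L.cover (i + 1) (by omega) (c i) with h4 | h4 | h4 | ⟨j, hj, h4⟩
        · exact absurd h4 (hW i (by omega))
        · rcases hn with hn | hn
          · exact absurd hn.1 (L.rung_not_rail h4)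
          · exact absurd h4 (L.not_rung hn.1)
        · rw [hc, Bool.not_not] at hn2
          exact absurd h4 hn2
        · obtain rfl := Nat.succ_injective hj
          exact h4
      · rw [← hc] at h1
        rcases hn with hn | hn
        · exact L.rail_not_rail hn.1 h1
        · exact L.not_rail_succ hn.1 h1
  exact fun i hi => key (n - i - 1) i (by omega)

end LadderMatching

/-! ### Ladder matchings as edge sets, and the restriction of a state to the ladder -/

namespace LadderVertex

variable {k : ℕ}

/-- The edges of a matching of the ladder. -/
def ladderEdges (h : ℕ → Bool → Prop) (g : ℕ → Prop) : Set (Sym2 (LadderVertex k)) :=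
  {e | (∃ (i j : Fin (k + 2)) (s : Bool), i.val + 1 = j.val ∧ h i s ∧ e = s(.lad i s, .lad j s)) ∨
    ∃ (i : Fin (k + 2)) (s : Bool), g i ∧ e = s(.lad i s, .lad i (!s))}

theorem mem_ladderEdges {h : ℕ → Bool → Prop} {g : ℕ → Prop} {i : Fin (k + 2)} {s : Bool}
    {y : LadderVertex k} : s(.lad i s, y) ∈ ladderEdges (k := k) h g ↔
      (∃ j : Fin (k + 2), i.val + 1 = j.val ∧ h i s ∧ y = .lad j s) ∨
      (∃ j : Fin (k + 2), j.val + 1 = i.val ∧ h j s ∧ y = .lad j s) ∨ (g i ∧ y = .lad i (!s)) := by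
  constructor
  · rintro (⟨i', j', s', hij, hh, he⟩ | ⟨i', s', hg, he⟩)
    · rw [Sym2.eq_iff] at he
      rcases he with ⟨h1, rfl⟩ | ⟨h1, rfl⟩
      · obtain ⟨rfl, rfl⟩ := LadderVertex.lad.inj h1
        exact Or.inl ⟨j', hij, hh, rfl⟩
      · obtain ⟨rfl, rfl⟩ := LadderVertex.lad.inj h1
        exact Or.inr (Or.inl ⟨i', hij, hh, rfl⟩)
    · rw [Sym2.eq_iff] at he
      rcases he with ⟨h1, rfl⟩ | ⟨h1, rfl⟩
      · obtain ⟨rfl, rfl⟩ := LadderVertex.lad.inj h1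
        exact Or.inr (Or.inr ⟨hg, rfl⟩)
      · obtain ⟨rfl, rfl⟩ := LadderVertex.lad.inj h1
        exact Or.inr (Or.inr ⟨hg, by rw [Bool.not_not]⟩)
  · rintro (⟨j, hij, hh, rfl⟩ | ⟨j, hij, hh, rfl⟩ | ⟨hg, rfl⟩)
    · exact Or.inl ⟨i, j, s, hij, hh, rfl⟩
    · exact Or.inl ⟨j, i, s, hij, hh, Sym2.eq_swap⟩
    · exact Or.inr ⟨i, s, hg, rfl⟩

theorem exists_lad_of_mem_ladderEdges {h : ℕ → Bool → Prop} {g : ℕ → Prop} {x y : LadderVertex k}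
    (hxy : s(x, y) ∈ ladderEdges (k := k) h g) : ∃ i s, x = .lad i s := by
  rcases hxy with (⟨i', j', s', hij, hh, he⟩ | ⟨i', s', hg, he⟩) <;>
    rw [Sym2.eq_iff] at he <;> rcases he with ⟨rfl, rfl⟩ | ⟨rfl, rfl⟩ <;> exact ⟨_, _, rfl⟩

section

variable {W h : ℕ → Bool → Prop} {g : ℕ → Prop} (L : LadderMatching (k + 1) W h g)

include L

theorem isMatchingSet_ladderEdges : IsMatchingSet (ladderGraph k) (ladderEdges h g) := by
  rw [isMatchingSet_iff]
  constructor
  · intro x y hxy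
    obtain ⟨i, s, rfl⟩ := exists_lad_of_mem_ladderEdges hxy
    rcases mem_ladderEdges.1 hxy with ⟨j, hij, hh, rfl⟩ | ⟨j, hij, hh, rfl⟩ | ⟨hg, rfl⟩
    · exact adj_lad_lad.2 (Or.inr ⟨rfl, Or.inl hij⟩)
    · exact adj_lad_lad.2 (Or.inr ⟨rfl, Or.inr hij⟩)
    · exact adj_lad_lad.2 (Or.inl ⟨rfl, by cases s <;> decide⟩)
  · intro x y z hxy hxz
    obtain ⟨i, s, rfl⟩ := exists_lad_of_mem_ladderEdges hxy
    have e1 : ∀ {j : Fin (k + 2)}, j.val + 1 = i.val → h j s → ¬ h i s := by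
      intro j hj hh hi
      rw [← hj] at hi
      exact L.rail_not_rail hi hh
    have e2 : ∀ {j : Fin (k + 2)}, j.val + 1 = i.val → h j s → ¬ g i := by
      intro j hj hh hi
      rw [← hj] at hi
      exact L.rung_not_rail_succ hi hh
    rcases mem_ladderEdges.1 hxy with ⟨j, hij, hh, rfl⟩ | ⟨j, hij, hh, rfl⟩ | ⟨hg, rfl⟩ <;>
      rcases mem_ladderEdges.1 hxz with ⟨j', hij', hh', rfl⟩ | ⟨j', hij', hh', rfl⟩ | ⟨hg', rfl⟩
    · rw [Fin.ext (hij.symm.trans hij')]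
    · exact absurd hh (e1 hij' hh')
    · exact absurd hh (L.rung_not_rail hg')
    · exact absurd hh' (e1 hij hh)
    · rw [Fin.ext (Nat.succ_injective (hij.trans hij'.symm))]
    · exact absurd hg' (e2 hij hh)
    · exact absurd hh' (L.rung_not_rail hg)
    · exact absurd hg (e2 hij' hh')
    · rfl

theorem mem_unmatched_ladderEdges {i : Fin (k + 2)} {s : Bool} :
    .lad i s ∈ unmatched (ladderEdges (k := k) h g) ↔ W i s := by
  have hi := i.2
  rw [mem_unmatched]
  constructor
  · intro hun
    rcases L.cover i (by omega) s with h1 | h1 | h1 | ⟨j, hj, h1⟩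
    · exact h1
    · exact absurd (mem_ladderEdges.2 (Or.inr (Or.inr ⟨h1, rfl⟩))) (hun _)
    · have := L.lt_of_rail h1
      exact absurd (mem_ladderEdges.2 (Or.inl ⟨⟨i.val + 1, by omega⟩, rfl, h1, rfl⟩)) (hun _)
    · exact absurd (mem_ladderEdges.2 (Or.inr (Or.inl ⟨⟨j, by omega⟩, hj, h1, rfl⟩))) (hun _)
  · intro hW y hy
    rcases mem_ladderEdges.1 hy with ⟨j, hij, hh, rfl⟩ | ⟨j, hij, hh, rfl⟩ | ⟨hg, rfl⟩
    · exact L.not_rail hW hh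
    · rw [← hij] at hW
      exact L.not_rail_succ hW hh
    · exact L.not_rung hW hg

end

theorem mem_unmatched_ladderEdges_of_ne {h : ℕ → Bool → Prop} {g : ℕ → Prop} {x : LadderVertex k}
    (hx : ∀ i s, x ≠ .lad i s) : x ∈ unmatched (ladderEdges (k := k) h g) := by
  rw [mem_unmatched]
  intro y hy
  obtain ⟨i, s, rfl⟩ := exists_lad_of_mem_ladderEdges hy
  exact hx i s rfl

section Restriction

variable (M : BroderState (ladderGraph k))

/-- The rail edge between `lad i s` and `lad (i + 1) s` belongs to the state. -/
def Rail (i : ℕ) (s : Bool) : Prop :=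
  ∃ x y : Fin (k + 2), x.val = i ∧ y.val = i + 1 ∧ s(.lad x s, .lad y s) ∈ M.1

/-- The rung `i` belongs to the state. -/
def Rung (i : ℕ) : Prop := ∃ x : Fin (k + 2), x.val = i ∧ s(.lad x false, .lad x true) ∈ M.1

/-- The vertex `lad i s` is not matched to a vertex of the ladder. -/
def Free (i : ℕ) (s : Bool) : Prop := ∀ x : Fin (k + 2), x.val = i → ∀ l t, s(.lad x s, .lad l t) ∉ M.1

variable {M}

theorem rail_iff {x y : Fin (k + 2)} (h : x.val + 1 = y.val) {s : Bool} :
    Rail M x s ↔ s(.lad x s, .lad y s) ∈ M.1 := by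
  constructor
  · rintro ⟨x', y', h1, h2, h3⟩
    rwa [Fin.ext h1, Fin.ext (h2.trans h)] at h3
  · exact fun h1 => ⟨x, y, rfl, h.symm, h1⟩

theorem rung_iff {x : Fin (k + 2)} (s : Bool) : Rung M x ↔ s(.lad x s, .lad x (!s)) ∈ M.1 := by
  have : Rung M x ↔ s(.lad x false, .lad x true) ∈ M.1 := by
    constructor
    · rintro ⟨x', h1, h3⟩
      rwa [Fin.ext h1] at h3
    · exact fun h1 => ⟨x, rfl, h1⟩
  rw [this]
  cases s
  · rfl
  · rw [Sym2.eq_swap]; rfl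

theorem free_iff {x : Fin (k + 2)} {s : Bool} : Free M x s ↔ ∀ l t, s(.lad x s, .lad l t) ∉ M.1 := by
  constructor
  · exact fun h => h x rfl
  · rintro h x' hx'
    rwa [Fin.ext hx']

theorem ladderMatching : LadderMatching (k + 1) (Free M) (Rail M) (Rung M) where
  cover i hi s := by
    obtain ⟨x, rfl⟩ : ∃ x : Fin (k + 2), x.val = i := ⟨⟨i, by omega⟩, rfl⟩
    by_cases hf : Free M x s
    · exact Or.inl hf
    rw [free_iff] at hf
    push Not at hf
    obtain ⟨l, t, h⟩ := hf
    rcases adj_lad_lad.1 (M.isMatching.adj h) with ⟨rfl, hst⟩ | ⟨rfl, hl | hl⟩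
    · obtain rfl : t = !s := by revert hst; cases s <;> cases t <;> decide
      exact Or.inr (Or.inl ((rung_iff s).2 h))
    · exact Or.inr (Or.inr (Or.inl ((rail_iff hl).2 h)))
    · rw [Sym2.eq_swap] at h
      exact Or.inr (Or.inr (Or.inr ⟨l, hl, (rail_iff hl).2 h⟩))
  lt_of_rail := by
    rintro i s ⟨x, y, hx, hy, -⟩
    have := y.2
    omega
  not_rung := by
    rintro i s hW ⟨x, rfl, h⟩
    exact free_iff.1 hW _ _ ((rung_iff s).1 ⟨x, rfl, h⟩)
  not_rail := by
    rintro i s hW ⟨x, y, rfl, hy, h⟩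
    exact free_iff.1 hW _ _ h
  not_rail_succ := by
    rintro i s hW ⟨x, y, rfl, hy, h⟩
    rw [Sym2.eq_swap] at h
    rw [← hy] at hW
    exact free_iff.1 hW _ _ h
  rung_not_rail := by
    rintro i s hg ⟨x, y, rfl, hy, h⟩
    have := M.isMatching.mate_unique ((rung_iff s).1 hg) h
    obtain ⟨-, h2⟩ := LadderVertex.lad.inj this
    revert h2; cases s <;> decide
  rung_not_rail_succ := by
    rintro i s hg ⟨x, y, rfl, hy, h⟩
    rw [← hy] at hg
    rw [Sym2.eq_swap] at h
    have := M.isMatching.mate_unique ((rung_iff s).1 hg) h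
    obtain ⟨-, h2⟩ := LadderVertex.lad.inj this
    revert h2; cases s <;> decide
  rail_not_rail := by
    rintro i s ⟨x, y, hx, hy, h⟩ ⟨x', y', hx', hy', h'⟩
    rw [Sym2.eq_swap, Fin.ext (hy'.trans hx.symm)] at h'
    have := M.isMatching.mate_unique h h'
    obtain ⟨h2, -⟩ := LadderVertex.lad.inj this
    rw [h2] at hy
    omega

end Restriction

end LadderVertex

/-! ### Block graphs with a ladder: the bottleneck -/

namespace LadderVertex

variable {k : ℕ}

theorem prv_first {r : Fin 3} {i : Fin k} (hi : i.val = 0) :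
    prv r i = if r = 1 then .lad 0 false else .u := by
  unfold prv; rw [dif_pos hi]

theorem nxt_last {r : Fin 3} {i : Fin k} (hi : i.val + 1 = k) :
    nxt r i = if r = 0 then .lad (Fin.last _) false else .v := by
  unfold nxt; rw [dif_neg (by omega)]

/-- Only the four corners have neighbours outside the ladder. So what happens outside the ladder
affects its matching only through the holes and the data collected in `connections`. -/
theorem free_iff_unmatched_or {M : BroderState (ladderGraph k)} {x : Fin (k + 2)} {s : Bool} :
    Free M x s ↔ .lad x s ∈ unmatched M.1 ∨
      (x.val = 0 ∧ s = true ∧ s(.u, .lad 0 true) ∈ M.1) ∨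
      (x.val = k + 1 ∧ s = true ∧ s(.v, .lad (Fin.last _) true) ∈ M.1) ∨
      (x.val = 0 ∧ s = false ∧ ∃ i : Fin k, i.val = 0 ∧ (trackSystem k).Enters M 1 i) ∨
      (x.val = k + 1 ∧ s = false ∧ ∃ i : Fin k, i.val + 1 = k ∧ (trackSystem k).Leaves M 0 i) := by
  have e0 : x.val = 0 → x = 0 := fun h => Fin.ext h
  have e1 : x.val = k + 1 → x = Fin.last (k + 1) := fun h => Fin.ext h
  rw [free_iff]
  constructor
  · intro hf
    by_cases hun : .lad x s ∈ unmatched M.1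
    · exact Or.inl hun
    obtain ⟨y, hy⟩ := not_mem_unmatched.1 hun
    refine Or.inr ?_
    have hadj := M.isMatching.adj hy
    rcases y with _ | _ | ⟨r, i, b⟩ | ⟨r, i, b⟩ | ⟨l, t⟩
    · obtain ⟨h1, rfl⟩ := adj_lad_u.1 hadj
      obtain rfl := e0 h1
      rw [Sym2.eq_swap] at hy
      exact Or.inl ⟨h1, rfl, hy⟩
    · obtain ⟨h1, rfl⟩ := adj_lad_v.1 hadj
      obtain rfl := e1 h1
      rw [Sym2.eq_swap] at hy
      exact Or.inr (Or.inl ⟨h1, rfl, hy⟩)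
    · obtain ⟨rfl, h2, rfl, h4, rfl⟩ := adj_blockU_lad.1 hadj.symm
      obtain rfl := e1 h4
      refine Or.inr (Or.inr (Or.inr ⟨h4, rfl, i, h2, ?_⟩))
      rw [Sym2.eq_swap] at hy
      simpa [TrackSystem.Leaves, trackSystem, nxt_last h2] using hy
    · obtain ⟨rfl, h2, rfl, h4, rfl⟩ := adj_blockV_lad.1 hadj.symm
      obtain rfl := e0 h4
      refine Or.inr (Or.inr (Or.inl ⟨h4, rfl, i, h2, ?_⟩))
      simpa [TrackSystem.Enters, trackSystem, prv_first h2] using hy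
    · exact absurd hy (hf l t)
  · rintro (h | ⟨h1, rfl, h3⟩ | ⟨h1, rfl, h3⟩ | ⟨h1, rfl, i, hi, h3⟩ | ⟨h1, rfl, i, hi, h3⟩) l t h'
    · exact mem_unmatched.1 h _ h'
    · obtain rfl := e0 h1
      rw [Sym2.eq_swap] at h3
      cases M.isMatching.mate_unique h3 h'
    · obtain rfl := e1 h1
      rw [Sym2.eq_swap] at h3
      cases M.isMatching.mate_unique h3 h'
    · obtain rfl := e0 h1
      simp only [TrackSystem.Enters, trackSystem, prv_first hi, if_true] at h3
      cases M.isMatching.mate_unique h3 h'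
    · obtain rfl := e1 h1
      simp only [TrackSystem.Leaves, trackSystem, nxt_last hi, if_true] at h3
      rw [Sym2.eq_swap] at h3
      cases M.isMatching.mate_unique h3 h'

open Classical in
/-- The part of a state that joins the tracks, the ladder, `u` and `v`. -/
noncomputable def connections (M : BroderState (ladderGraph k)) :
    (Fin 3 → Bool) × (Fin 3 → Bool) × Bool × Bool :=
  ((trackSystem k).firstBridges M,
    fun r => decide (∃ i : Fin k, i.val + 1 = k ∧ (trackSystem k).Leaves M r i),
    decide (s(.u, .lad 0 true) ∈ M.1), decide (s(.v, .lad (Fin.last _) true) ∈ M.1))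

/-- Sets of positions on a rail of which no two are adjacent. -/
abbrev SparseSet (k : ℕ) : Type :=
  {b : Fin (k + 1) → Bool // ∀ i j : Fin (k + 1), i.val + 1 = j.val → b i = true → b j = false}

/-- Arbitrary subsets of the even positions 0, 2, …, 2(k/2) − 2 have no two adjacent elements. -/
theorem le_card_sparseSet : 2 ^ (k / 2) ≤ Fintype.card (SparseSet k) := by
  let f : (Fin (k / 2) → Bool) → SparseSet k := fun a =>
    ⟨fun i => if h : i.val % 2 = 0 ∧ i.val / 2 < k / 2 then a ⟨i.val / 2, h.2⟩ else false, by
      intro i j hij hi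
      have : ¬ (j.val % 2 = 0) := by
        intro hj
        simp only at hi
        rw [dif_neg (by omega)] at hi
        exact absurd hi (by decide)
      simp only
      rw [dif_neg (fun h => this h.1)]⟩
  have hf : Function.Injective f := by
    intro a a' h
    funext i
    have h1 := congrFun (congrArg Subtype.val h) ⟨2 * i.val, by have := i.2; omega⟩
    simpa [f] using h1
  have := Fintype.card_le_of_injective f hf
  simpa using this

open Classical in
/-- The positions where both rail edges of the ladder belong to the state. -/
noncomputable def railPairs (M : BroderState (ladderGraph k)) : SparseSet k :=
  ⟨fun i => decide (Rail M i false ∧ Rail M i true), by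
    intro i j hij hi
    rw [decide_eq_true_eq] at hi
    rw [decide_eq_false_iff_not, ← hij]
    exact fun h => ladderMatching.rail_not_rail h.1 hi.1⟩

theorem rails_congr {M M' : BroderState (ladderGraph k)} (h : railPairs M = railPairs M') (i : ℕ) :
    (Rail M i false ∧ Rail M i true) ↔ (Rail M' i false ∧ Rail M' i true) := by
  by_cases hi : i < k + 1
  · have := congrFun (congrArg Subtype.val h) ⟨i, hi⟩
    simpa only [railPairs, decide_eq_decide] using this
  · constructor
    · exact fun h => absurd (ladderMatching.lt_of_rail h.1) hi
    · exact fun h => absurd (ladderMatching.lt_of_rail h.1) hi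

/-- Holes and connections tell which ladder vertices are not matched within the ladder;
`LadderMatching.rail_congr` and `LadderMatching.rung_congr` then recover all edges of the ladder
from `railPairs`. -/
theorem determines : (trackSystem k).Determines connections railPairs := by
  refine ⟨fun M M' h r i hi =>
    (trackSystem k).enters_congr_of_firstBridges (congrArg Prod.fst h) r i hi, ?_⟩
  intro M M' hun hext hrest hU hW
  simp only [connections, Prod.mk.injEq, decide_eq_decide] at hext
  obtain ⟨h1, h2, h3, h4⟩ := hext
  have h2' := fun r => congrFun h2 r
  simp only [decide_eq_decide] at h2'
  have h1' := fun r => congrFun h1 r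
  simp only [TrackSystem.firstBridges, decide_eq_decide] at h1'
  have hfree : ∀ i s, Free M i s ↔ Free M' i s := by
    intro i s
    by_cases hi : i < k + 2
    · rw [show i = (⟨i, hi⟩ : Fin (k + 2)).val from rfl, free_iff_unmatched_or, free_iff_unmatched_or,
        hun, h3, h4, h1', h2']
    · constructor <;> intro _ x hx <;> exact absurd x.2 (by omega)
  have hFM : LadderMatching (k + 1) (Free M) (Rail M') (Rung M') := by
    have : Free M = Free M' := by funext i s; exact propext (hfree i s)
    rw [this]
    exact ladderMatching
  have hb := rails_congr hrest
  have hrail := ladderMatching.rail_congr hFM hb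
  have hrung := fun i hi => ladderMatching.rung_congr hFM hb (i := i) hi
  have hlad : ∀ i s l t, s(.lad i s, .lad l t) ∈ M.1 ↔ s(.lad i s, .lad l t) ∈ M'.1 := by
    intro i s l t
    have hi := i.2
    have hl := l.2
    by_cases hadj : (ladderGraph k).Adj (.lad i s) (.lad l t)
    · rcases adj_lad_lad.1 hadj with ⟨rfl, hst⟩ | ⟨rfl, h | h⟩
      · obtain rfl : t = !s := by revert hst; cases s <;> cases t <;> decide
        rw [← rung_iff s, ← rung_iff s]
        exact hrung _ (by omega)
      · rw [← rail_iff h, ← rail_iff h]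
        exact hrail _ (by omega) _
      · rw [Sym2.eq_swap, ← rail_iff h, ← rail_iff h]
        exact hrail _ (by omega) _
    · exact ⟨fun h => absurd (M.isMatching.adj h) hadj, fun h => absurd (M'.isMatching.adj h) hadj⟩
  have huv : ∀ y, (s(.u, y) ∈ M.1 ↔ s(.u, y) ∈ M'.1) ∧ (s(.v, y) ∈ M.1 ↔ s(.v, y) ∈ M'.1) := by
    intro y
    rcases y with _ | _ | ⟨r, i, b⟩ | ⟨r, i, b⟩ | ⟨l, t⟩
    · exact ⟨⟨fun h => absurd (M.isMatching.adj h) (SimpleGraph.irrefl _),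
        fun h => absurd (M'.isMatching.adj h) (SimpleGraph.irrefl _)⟩,
        ⟨fun h => absurd (M.isMatching.adj h).symm not_adj_u_v,
        fun h => absurd (M'.isMatching.adj h).symm not_adj_u_v⟩⟩
    · exact ⟨⟨fun h => absurd (M.isMatching.adj h) not_adj_u_v,
        fun h => absurd (M'.isMatching.adj h) not_adj_u_v⟩,
        ⟨fun h => absurd (M.isMatching.adj h) (SimpleGraph.irrefl _),
        fun h => absurd (M'.isMatching.adj h) (SimpleGraph.irrefl _)⟩⟩
    · rw [Sym2.eq_swap, Sym2.eq_swap (a := LadderVertex.v)]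
      exact ⟨hU r i b _, hU r i b _⟩
    · rw [Sym2.eq_swap, Sym2.eq_swap (a := LadderVertex.v)]
      exact ⟨hW r i b _, hW r i b _⟩
    · have aux : ∀ N N' : BroderState (ladderGraph k),
          (s(.u, .lad 0 true) ∈ N.1 → s(.u, .lad 0 true) ∈ N'.1) →
          (s(.v, .lad (Fin.last _) true) ∈ N.1 → s(.v, .lad (Fin.last _) true) ∈ N'.1) →
          (s(.u, .lad l t) ∈ N.1 → s(.u, .lad l t) ∈ N'.1) ∧
          (s(.v, .lad l t) ∈ N.1 → s(.v, .lad l t) ∈ N'.1) := by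
        intro N N' hu hv
        constructor
        · intro h
          obtain ⟨hl, rfl⟩ := adj_lad_u.1 (N.isMatching.adj h).symm
          obtain rfl : l = 0 := Fin.ext hl
          exact hu h
        · intro h
          obtain ⟨hl, rfl⟩ := adj_lad_v.1 (N.isMatching.adj h).symm
          obtain rfl : l = Fin.last (k + 1) := Fin.ext hl
          exact hv h
      have a1 := aux M M' h3.1 h4.1
      have a2 := aux M' M h3.2 h4.2
      exact ⟨⟨a1.1, a2.1⟩, ⟨a1.2, a2.2⟩⟩
  apply Subtype.ext
  ext e
  induction e with | _ x y =>
  rcases x with _ | _ | ⟨r, i, b⟩ | ⟨r, i, b⟩ | ⟨l, t⟩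
  · exact (huv y).1
  · exact (huv y).2
  · exact hU r i b y
  · exact hW r i b y
  · rcases y with _ | _ | ⟨r, i, b⟩ | ⟨r, i, b⟩ | ⟨l', t'⟩
    · rw [Sym2.eq_swap]; exact (huv _).1
    · rw [Sym2.eq_swap]; exact (huv _).2
    · rw [Sym2.eq_swap]; exact hU r i b _
    · rw [Sym2.eq_swap]; exact hW r i b _
    · exact hlad _ _ _ _

/-- The matching of the whole ladder with given pairs of rail edges. -/
theorem ladderMatching_of_sparseSet (d : SparseSet k) :
    LadderMatching (k + 1) (fun _ _ => False) (fun i _ => ∃ x : Fin (k + 1), x.val = i ∧ d.1 x = true)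
      (fun i => ∀ x : Fin (k + 1), x.val = i ∨ x.val + 1 = i → d.1 x = false) where
  cover i hi s := by
    by_cases h : ∃ x : Fin (k + 1), (x.val = i ∨ x.val + 1 = i) ∧ d.1 x = true
    · obtain ⟨x, hx | hx, hd⟩ := h
      · exact Or.inr (Or.inr (Or.inl ⟨x, hx, hd⟩))
      · exact Or.inr (Or.inr (Or.inr ⟨x, hx, x, rfl, hd⟩))
    · push Not at h
      exact Or.inr (Or.inl fun x hx => by simpa using h x hx)
  lt_of_rail := by
    rintro i s ⟨x, rfl, -⟩
    exact x.2
  not_rung h := h.elim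
  not_rail h := h.elim
  not_rail_succ h := h.elim
  rung_not_rail := by
    rintro i s hg ⟨x, hx, hd⟩
    rw [hg x (Or.inl hx)] at hd
    exact absurd hd (by decide)
  rung_not_rail_succ := by
    rintro i s hg ⟨x, hx, hd⟩
    rw [hg x (Or.inr (by omega))] at hd
    exact absurd hd (by decide)
  rail_not_rail := by
    rintro i s ⟨x, hx, hd⟩ ⟨y, hy, hd'⟩
    rw [d.2 y x (by omega) hd'] at hd
    exact absurd hd (by decide)

theorem mem_union_lad_iff {c : Fin 3 → Fin k → GadgetConfig 3} {N : Set (Sym2 (LadderVertex k))}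
    {i l : Fin (k + 2)} {s t : Bool} : s(.lad i s, .lad l t) ∈ (trackSystem k).gadgetEdges c ∪ N ↔
      s(.lad i s, .lad l t) ∈ N := by
  constructor
  · rintro (⟨r, i', a, b, -, he⟩ | h)
    · rw [Sym2.eq_iff] at he
      rcases he with ⟨h, -⟩ | ⟨h, -⟩ <;> cases h
    · exact h
  · exact Or.inr

/-- With `u` and `v` unmatched the blocks and the ladder do not interact, so every choice of perfect
block matchings combines with every sparse set. -/
theorem exists_state (c : Fin 3 → Fin k → GadgetConfig 3) (hc : ∀ r i, c r i ∈ insideConfigs blockRel)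
    (d : SparseSet k) : ∃ M : BroderState (ladderGraph k),
      (∀ r i, (trackSystem k).config M r i = c r i) ∧ railPairs M = d := by
  have L := ladderMatching_of_sparseSet d
  have hun : ∀ z : LadderVertex k,
      (∀ r i a, z ≠ (trackSystem k).U r i a ∧ z ≠ (trackSystem k).W r i a) →
      (z ∈ unmatched (ladderEdges (fun i _ => ∃ x : Fin (k + 1), x.val = i ∧ d.1 x = true)
        (fun i => ∀ x : Fin (k + 1), x.val = i ∨ x.val + 1 = i → d.1 x = false)) ↔
        z = .u ∨ z = .v) := by
    intro z hz
    rcases z with _ | _ | ⟨r, i, b⟩ | ⟨r, i, b⟩ | ⟨l, t⟩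
    · exact ⟨fun _ => Or.inl rfl, fun _ => mem_unmatched_ladderEdges_of_ne (by simp)⟩
    · exact ⟨fun _ => Or.inr rfl, fun _ => mem_unmatched_ladderEdges_of_ne (by simp)⟩
    · exact absurd rfl (hz r i b).1
    · exact absurd rfl (hz r i b).2
    · rw [mem_unmatched_ladderEdges L]; simp
  obtain ⟨M, hM, hcM⟩ := (trackSystem k).exists_state_of_gadgetEdges hc (isMatchingSet_ladderEdges L)
    (fun r i a => mem_unmatched_ladderEdges_of_ne (by simp [trackSystem]))
    (fun r i a => mem_unmatched_ladderEdges_of_ne (by simp [trackSystem]))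
    (x := .u) (y := .v) (by simp) hun (by simp [trackSystem]) (by simp [trackSystem])
  · refine ⟨M, hcM, Subtype.ext (funext fun i => ?_)⟩
    have hr : ∀ s, Rail M i s ↔ d.1 i = true := by
      intro s
      have := rail_iff (M := M) (x := i.castSucc) (y := i.succ) (by simp) (s := s)
      rw [hM, mem_union_lad_iff, mem_ladderEdges] at this
      rw [show i.val = i.castSucc.val from rfl, this]
      constructor
      · rintro (⟨j, hj, ⟨x, hx, hd⟩, -⟩ | ⟨j, hj, -, h2⟩ | ⟨-, h2⟩)
        · rwa [Fin.ext (a := x) (b := i) (by simpa using hx)] at hd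
        · obtain ⟨rfl, -⟩ := LadderVertex.lad.inj h2
          simp at hj
          omega
        · obtain ⟨-, h3⟩ := LadderVertex.lad.inj h2
          exact absurd h3 (by cases s <;> decide)
      · intro hd
        exact Or.inl ⟨i.succ, by simp, ⟨i, by simp, hd⟩, rfl⟩
    simp only [railPairs, hr, and_self, Bool.decide_eq_true]

/-- Only rail edges are used, one between any two consecutive rungs and on alternating rails. This
leaves uncovered just one vertex of the first rung and one of the last. -/
theorem ladderMatching_zigzag (n : ℕ) : LadderMatching n
    (fun i s => i = 0 ∧ s = !rail 0 ∨ i = n ∧ s = rail n) (fun i s => i < n ∧ s = rail i)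
    (fun _ => False) where
  cover i hi s := by
    by_cases hs : s = rail i
    · rcases Nat.lt_or_ge i n with h | h
      · exact Or.inr (Or.inr (Or.inl ⟨h, hs⟩))
      · obtain rfl : i = n := by omega
        exact Or.inl (Or.inr ⟨rfl, hs⟩)
    · have hs' : s = !rail i := by revert hs; cases s <;> cases rail i <;> decide
      rcases i with _ | i
      · exact Or.inl (Or.inl ⟨rfl, hs'⟩)
      · rw [rail_succ, Bool.not_not] at hs'
        exact Or.inr (Or.inr (Or.inr ⟨i, rfl, by omega, hs'⟩))
  lt_of_rail h := h.1
  not_rung _ := id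
  not_rail := by
    rintro i s (⟨rfl, rfl⟩ | ⟨rfl, rfl⟩) ⟨h1, h2⟩
    · exact absurd h2 (by decide)
    · omega
  not_rail_succ := by
    rintro i s (⟨h, rfl⟩ | ⟨rfl, rfl⟩) ⟨h1, h2⟩
    · omega
    · rw [rail_succ] at h2
      revert h2; cases rail i <;> decide
  rung_not_rail h := h.elim
  rung_not_rail_succ h := h.elim
  rail_not_rail := by
    rintro i s ⟨-, rfl⟩ ⟨-, h2⟩
    rw [rail_succ] at h2
    revert h2; cases rail i <;> decide

/-- All blocks are matched perfectly in themselves, and the zigzag of the ladder leaves two corners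
for `u` and `v`. Since k is even, the uncovered corner of the last rung is the one adjacent to `v`.
-/
theorem exists_perfectMatching (hk : Even k) : ∃ M, IsPerfectMatchingSet (ladderGraph k) M := by
  have hl : rail (k + 1) = true := by
    rw [rail, show (k + 1) % 2 = 1 by have := Nat.even_iff.1 hk; omega]; rfl
  have L := ladderMatching_zigzag (k + 1)
  have hI : (insideConfigs blockRel).Nonempty := by
    rw [← Finset.card_pos, card_insideConfigs_blockRel]; norm_num
  obtain ⟨c, hc⟩ := hI
  set N₁ : Set (Sym2 (LadderVertex k)) := ladderEdges (fun i s => i < k + 1 ∧ s = rail i)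
    (fun _ => False) with hN₁
  set N : Set (Sym2 (LadderVertex k)) :=
    N₁ ∪ {s(.u, .lad 0 true), s(.lad (Fin.last _) true, .v)} with hN
  have f1 : .lad 0 true ∈ unmatched N₁ := (mem_unmatched_ladderEdges L).2 (Or.inl ⟨rfl, rfl⟩)
  have f2 : .lad (Fin.last _) true ∈ unmatched N₁ :=
    (mem_unmatched_ladderEdges L).2 (Or.inr ⟨rfl, hl.symm⟩)
  have f3 : .u ∈ unmatched N₁ := mem_unmatched_ladderEdges_of_ne (by simp)
  have f4 : .v ∈ unmatched N₁ := mem_unmatched_ladderEdges_of_ne (by simp)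
  have h0 : (0 : Fin (k + 2)) ≠ Fin.last (k + 1) := by
    intro h; exact absurd (congrArg Fin.val h) (by simp)
  have hNm : IsMatchingSet (ladderGraph k) N := by
    refine ⟨Set.union_subset (isMatchingSet_ladderEdges L).1 ?_, ?_⟩
    · rintro e (rfl | rfl)
      · exact (adj_lad_u.2 ⟨rfl, rfl⟩).symm
      · exact adj_lad_v.2 ⟨rfl, rfl⟩
    · have key : ∀ e ∈ N₁, ∀ f ∈ ({s(.u, .lad 0 true), s(.lad (Fin.last _) true, .v)} :
          Set (Sym2 (LadderVertex k))), ∀ w, w ∈ e → w ∈ f → False := by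
        rintro e he f (rfl | rfl) w hwe hwf
        · rcases Sym2.mem_iff.1 hwf with rfl | rfl
          · exact f3 e he hwe
          · exact f1 e he hwe
        · rcases Sym2.mem_iff.1 hwf with rfl | rfl
          · exact f2 e he hwe
          · exact f4 e he hwe
      rintro e (he | he) f (hf | hf) w hwe hwf
      · exact (isMatchingSet_ladderEdges L).2 e he f hf w hwe hwf
      · exact (key e he f hf w hwe hwf).elim
      · exact (key f hf e he w hwf hwe).elim
      · rcases he with rfl | rfl <;> rcases hf with rfl | rfl
        · rfl
        · exfalso
          rcases Sym2.mem_iff.1 hwe with rfl | rfl <;> rcases Sym2.mem_iff.1 hwf with h | h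
          · cases h
          · cases h
          · exact h0 (LadderVertex.lad.inj h).1
          · cases h
        · exfalso
          rcases Sym2.mem_iff.1 hwf with rfl | rfl <;> rcases Sym2.mem_iff.1 hwe with h | h
          · cases h
          · cases h
          · exact h0 (LadderVertex.lad.inj h).1
          · cases h
        · rfl
  have hblock : ∀ z, (∀ e ∈ N, z ∉ e) ↔ z ∈ unmatched N₁ ∧ z ≠ .u ∧ z ≠ .v ∧ z ≠ .lad 0 true ∧
      z ≠ .lad (Fin.last _) true := by
    intro z
    constructor
    · intro h
      have h1 := h _ (Or.inr (Or.inl rfl))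
      have h2 := h _ (Or.inr (Or.inr rfl))
      rw [Sym2.mem_iff, not_or] at h1 h2
      exact ⟨fun e he => h e (Or.inl he), h1.1, h2.2, h1.2, h2.1⟩
    · rintro ⟨h1, h2, h3, h4, h5⟩ e (he | rfl | rfl)
      · exact h1 e he
      · rw [Sym2.mem_iff, not_or]; exact ⟨h2, h4⟩
      · rw [Sym2.mem_iff, not_or]; exact ⟨h5, h3⟩
  have hU : ∀ r i a, (trackSystem k).U r i a ∈ unmatched N := fun r i a =>
    (hblock _).2 ⟨mem_unmatched_ladderEdges_of_ne (by simp [trackSystem]), by simp [trackSystem]⟩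
  have hW : ∀ r i a, (trackSystem k).W r i a ∈ unmatched N := fun r i a =>
    (hblock _).2 ⟨mem_unmatched_ladderEdges_of_ne (by simp [trackSystem]), by simp [trackSystem]⟩
  refine ⟨(trackSystem k).gadgetEdges (fun _ _ => c) ∪ N,
    (trackSystem k).isMatchingSet_gadgetEdges_union (fun _ _ => hc) hNm hU hW, ?_⟩
  rw [Set.eq_empty_iff_forall_notMem]
  intro z hz
  rw [(trackSystem k).mem_unmatched_gadgetEdges_union (fun _ _ => hc)] at hz
  obtain ⟨hz1, hz2⟩ := hz
  obtain ⟨g1, g2, g3, g4, g5⟩ := (hblock z).1 hz1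
  rcases z with _ | _ | ⟨r, i, b⟩ | ⟨r, i, b⟩ | ⟨l, t⟩
  · exact g2 rfl
  · exact g3 rfl
  · exact (hz2 r i b).1 rfl
  · exact (hz2 r i b).2 rfl
  · rcases (mem_unmatched_ladderEdges L).1 g1 with ⟨h1, rfl⟩ | ⟨h1, rfl⟩
    · exact g4 (by rw [Fin.ext (a := l) (b := 0) h1]; rfl)
    · exact g5 (by rw [Fin.ext (a := l) (b := Fin.last _) h1, hl])

/-- A state with an unmatched vertex in the middle of the third track passes through the blocks of
half a track, or through the ladder. -/
theorem through_or_railPairs_of_hasHole (hk : Even k) (h0 : 0 < k)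
    (M : BroderState (ladderGraph k)) (hM : (trackSystem k).HasHole M 2 ⟨k / 2, by omega⟩) :
    (k - 1) / 2 ≤ {q : Fin 3 × Fin k | (trackSystem k).Through M q.1 q.2}.ncard ∨
      railPairs M = ⟨fun _ => false, fun _ _ _ _ => rfl⟩ := by
  obtain ⟨M₀, hM₀⟩ := exists_perfectMatching hk
  have hside := side_ne_of_adj hk
  have hl : rail (k + 1) = true := by
    rw [rail, show (k + 1) % 2 = 1 by have := Nat.even_iff.1 hk; omega]; rfl
  have hzig : (∀ i < k + 1, Rail M i (rail i) ∧ ¬ Rail M i (!rail i)) →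
      railPairs M = ⟨fun _ => false, fun _ _ _ _ => rfl⟩ := by
    intro h
    refine Subtype.ext (funext fun i => ?_)
    simp only [railPairs, decide_eq_false_iff_not]
    rintro ⟨h1, h2⟩
    refine (h i i.2).2 ?_
    cases rail i <;> assumption
  obtain ⟨a, ha | ha⟩ := hM
  -- The hole has the colour of `u`, so every other vertex of this colour is matched, in particular
  -- `u` and half of the ladder.
  · have hne : ∀ z, side z = true → (∀ r i a, z ≠ .blockU r i a) → z ∉ unmatched M.1 :=
      fun z hz hz' h => M.side_ne_of_unmatched hside hM₀ h ha (hz' _ _ _) (by rw [hz]; rfl)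
    have hthrough : ∀ r, (∃ i : Fin k, i.val = 0 ∧ (trackSystem k).Enters M r i) →
        (k - 1) / 2 ≤ {q : Fin 3 × Fin k | (trackSystem k).Through M q.1 q.2}.ncard := by
      intro r hr
      refine le_trans ?_ ((trackSystem k).le_ncard_through_of_hole_U (r := r) hside hM₀
        (fun _ _ _ _ _ _ => rfl) ha fun i hi => ((trackSystem k).enters_first_iff hi).1 hr)
      simp only; omega
    obtain ⟨y, hy⟩ := not_mem_unmatched.1 (hne .u rfl (by simp))
    have hadj := M.isMatching.adj hy
    rcases y with _ | _ | ⟨r, i, b⟩ | ⟨r, i, b⟩ | ⟨l, t⟩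
    · exact absurd hadj (SimpleGraph.irrefl _)
    · exact absurd hadj not_adj_u_v
    · exact absurd hadj.symm not_adj_blockU_u
    · obtain ⟨hr, hi, rfl⟩ := adj_blockV_u.1 hadj.symm
      refine Or.inl (hthrough r ⟨i, hi, ?_⟩)
      simpa [TrackSystem.Enters, trackSystem, prv_first hi, (ne_one_iff r).2 hr] using hy
    · obtain ⟨hl0, rfl⟩ := adj_lad_u.1 hadj.symm
      obtain rfl : l = 0 := Fin.ext hl0
      -- The corner `lad 0 true` is matched to `u`. If `lad 0 false` goes into the second track,
      -- half of that track is passed. Otherwise no ladder vertex `lad i (rail i)` before the last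
      -- rung is free, and the zigzag is forced.
      by_cases hent : ∃ i : Fin k, i.val = 0 ∧ (trackSystem k).Enters M 1 i
      · exact Or.inl (hthrough 1 hent)
      refine Or.inr (hzig (ladderMatching.zigzag_of_first rail_succ ?_ ?_))
      · exact (free_iff_unmatched_or (x := 0)).2 (Or.inr (Or.inl ⟨rfl, rfl, hy⟩))
      · intro i hi hf
        rcases (free_iff_unmatched_or (x := ⟨i, by omega⟩)).1 hf with h | ⟨h, h', -⟩ | ⟨h, -⟩ |
          ⟨-, -, h⟩ | ⟨h, -⟩
        · exact hne _ (by simp [side]) (by simp) h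
        · simp only at h
          subst h
          exact absurd h' (by decide)
        · simp only at h; omega
        · exact hent h
        · simp only at h; omega
  · have hne : ∀ z, side z = false → (∀ r i a, z ≠ .blockV r i a) → z ∉ unmatched M.1 :=
      fun z hz hz' h => M.side_ne_of_unmatched hside hM₀ h ha (hz' _ _ _) (by rw [hz]; rfl)
    have hthrough : ∀ r, (∃ i : Fin k, i.val + 1 = k ∧ (trackSystem k).Leaves M r i) →
        (k - 1) / 2 ≤ {q : Fin 3 × Fin k | (trackSystem k).Through M q.1 q.2}.ncard := by
      rintro r ⟨i, hi, hr⟩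
      refine le_trans ?_ ((trackSystem k).le_ncard_through_of_hole_W (r := r) hside hM₀
        (fun _ _ _ _ _ _ => rfl) ha fun j hj => ?_)
      · simp only; omega
      · rwa [Fin.ext (a := j) (b := i) (by omega)]
    obtain ⟨y, hy⟩ := not_mem_unmatched.1 (hne .v rfl (by simp))
    have hadj := M.isMatching.adj hy
    rcases y with _ | _ | ⟨r, i, b⟩ | ⟨r, i, b⟩ | ⟨l, t⟩
    · exact absurd hadj.symm not_adj_u_v
    · exact absurd hadj (SimpleGraph.irrefl _)
    · obtain ⟨hr, hi, rfl⟩ := adj_blockU_v.1 hadj.symm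
      refine Or.inl (hthrough r ⟨i, hi, ?_⟩)
      rw [Sym2.eq_swap] at hy
      simpa [TrackSystem.Leaves, trackSystem, nxt_last hi, (ne_zero_iff r).2 hr] using hy
    · exact absurd hadj.symm not_adj_blockV_v
    · obtain ⟨hl0, rfl⟩ := adj_lad_v.1 hadj.symm
      obtain rfl : l = Fin.last (k + 1) := Fin.ext hl0
      by_cases hent : ∃ i : Fin k, i.val + 1 = k ∧ (trackSystem k).Leaves M 0 i
      · exact Or.inl (hthrough 0 hent)
      refine Or.inr (hzig (ladderMatching.zigzag_of_last rail_succ ?_ ?_))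
      · rw [hl]
        exact (free_iff_unmatched_or (x := Fin.last (k + 1))).2 (Or.inr (Or.inr (Or.inl ⟨rfl, rfl, hy⟩)))
      · intro i hi hf
        rcases (free_iff_unmatched_or (x := ⟨i + 1, by omega⟩)).1 hf with h | ⟨h, -⟩ | ⟨h, h', -⟩ |
          ⟨h, -⟩ | ⟨-, -, h⟩
        · refine hne _ ?_ (by simp) h
          simp only [side, rail_succ]
          cases rail i <;> rfl
        · simp only at h; omega
        · simp only at h
          rw [← h, rail_succ, h'] at hl
          exact absurd hl (by decide)
        · simp only at h; omega
        · exact hent h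

theorem exists_bottleneck (hk : Even k) (h0 : 0 < k) :
    ∃ F : Set (Sym2 (LadderVertex k)),
      ({M : BroderState (ladderGraph k) | ∃ f ∈ F, ∃ w ∈ f, w ∈ unmatched M.1}.ncard + 1) *
          2 ^ ((k - 1) / 2) ≤
        (2 * (Nat.card (LadderVertex k) ^ 2 * 256 * (5 ^ 4) ^ 2) + 1) * 6 *
          {M : BroderState (ladderGraph k) | F ⊆ M.1}.ncard ∧
      ({M : BroderState (ladderGraph k) | ∃ f ∈ F, ∃ w ∈ f, w ∈ unmatched M.1}.ncard + 1) *
          2 ^ ((k - 1) / 2) ≤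
        (2 * (Nat.card (LadderVertex k) ^ 2 * 256 * (5 ^ 4) ^ 2) + 1) * 6 *
          {M : BroderState (ladderGraph k) | ¬ F ⊆ M.1}.ncard := by
  classical
  have hI := card_insideConfigs_blockRel
  have hJ := card_throughConfigs_blockRel
  have : Nonempty (SparseSet k) := ⟨⟨fun _ => false, fun _ _ _ _ => rfl⟩⟩
  have := (trackSystem k).exists_bottleneck determines (by rw [hI, hJ]) (by rw [hI]; norm_num)
    exists_state 2 ⟨k / 2, by omega⟩ ((k - 1) / 2) (by rw [Fintype.card_fin]; omega)
    {⟨fun _ => false, fun _ _ _ _ => rfl⟩} ?_ fun M hM => ?_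
  · rw [hI] at this
    simpa using this
  · rw [Finset.card_singleton, one_mul]
    -- The exceptional set consists of the empty sparse set alone, against at least 2^(k/2) sparse
    -- sets.
    exact (Nat.pow_le_pow_right (by norm_num) (by omega)).trans le_card_sparseSet
  · rw [Finset.mem_singleton]
    exact through_or_railPairs_of_hasHole hk h0 M hM

end LadderVertex

theorem ladderGraphs_hasBottleneck : HasBottleneck ladderGraphs := by
  refine hasBottleneck_of_card_sq 256 ((5 ^ 4) ^ 2) 6 60 (by norm_num) ?_
  rintro _ ⟨j, rfl⟩
  obtain ⟨F, h⟩ := LadderVertex.exists_bottleneck (k := 2 * j + 2) ⟨j + 1, by ring⟩ (Nat.succ_pos _)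
  refine ⟨(2 * j + 2 - 1) / 2, F, ?_, h⟩
  simp only [FinGraph.size, LadderVertex.card_eq]
  omega

theorem ladderGraphs_inputs (N : ℕ) : ∃ G ∈ ladderGraphs, N ≤ G.size ∧ G.IsBroderInput := by
  refine ⟨_, ⟨N, rfl⟩, ?_, ?_⟩
  · simp only [FinGraph.size, LadderVertex.card_eq]; omega
  · obtain ⟨M, hM⟩ := LadderVertex.exists_perfectMatching (k := 2 * N + 2) ⟨N + 1, by ring⟩
    refine FinGraph.isBroderInput _ hM (x := .blockU 0 0 0) (y := .blockV 0 0 1)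
      (z := .blockV 0 0 2) ?_ ?_ (by simp)
    · exact LadderVertex.adj_blockU_blockV.2 ⟨rfl, Or.inl ⟨rfl, by decide⟩⟩
    · exact LadderVertex.adj_blockU_blockV.2 ⟨rfl, Or.inl ⟨rfl, by decide⟩⟩

/-! ### Triangle threshold graphs: the bottleneck -/

/-- A partial matching of the triangle on `{0, …, 2 h} × {0, …, 2 h}` that covers all rows except
the middle one. -/
structure MidFreeMatching (h : ℕ) (m : ℕ → ℕ → Prop) : Prop where
  lt : ∀ {i j}, m i j → i + j < 2 * h + 1
  unique : ∀ {i j j'}, m i j → m i j' → j = j'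
  unique' : ∀ {i i' j}, m i j → m i' j → i = i'
  cover : ∀ {i}, i < 2 * h + 1 → i ≠ h → ∃ j, m i j
  free : ∀ j, ¬ m h j

namespace MidFreeMatching

variable {h : ℕ} {m m' : ℕ → ℕ → Prop}

/-- Row 2h − d extends over the columns 0, …, d only, and by induction the columns smaller than d
are taken by the rows below it. -/
theorem below (T : MidFreeMatching h m) : ∀ d < h, m (2 * h - d) d := by
  intro d
  induction d using Nat.strong_induction_on with
  | _ d ih =>
    intro hd
    obtain ⟨j, hj⟩ := T.cover (i := 2 * h - d) (by omega) (by omega)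
    have h1 := T.lt hj
    rcases Nat.lt_or_ge j d with h2 | h2
    · have h3 := T.unique' hj (ih j h2 (by omega))
      omega
    · rwa [show j = d by omega] at hj

/-- Whether each row is matched with its last column determines the matching. -/
theorem subset (T : MidFreeMatching h m) (T' : MidFreeMatching h m')
    (hb : ∀ i < h, m i (2 * h - i) ↔ m' i (2 * h - i)) :
    ∀ d i, i + d = 2 * h → ∀ j, m i j → m' i j := by
  intro d
  induction d using Nat.strong_induction_on with
  | _ d ih =>
    intro i hi j hm
    have hlt := T.lt hm
    rcases Nat.lt_trichotomy i h with h1 | rfl | h1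
    · obtain ⟨j', hm'⟩ := T'.cover (i := i) (by omega) (by omega)
      have hlt' := T'.lt hm'
      by_cases hj : j = 2 * h - i
      · subst hj
        exact (hb i h1).1 hm
      have hj' : j' ≠ 2 * h - i := by
        rintro rfl
        exact hj (T.unique hm ((hb i h1).2 hm'))
      by_contra hne
      have hjj : j ≠ j' := by rintro rfl; exact hne hm'
      -- By `below`, the columns smaller than h belong to the rows beyond the middle.
      have above : ∀ (m : ℕ → ℕ → Prop), MidFreeMatching h m → ∀ j, m i j → h ≤ j := by
        intro m T j hm
        by_contra hjh
        have := T.unique' hm (T.below j (by omega))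
        omega
      have hge := above m T j hm
      have hge' := above m' T' j' hm'
      have hex : ∀ r : ℕ, ∃ c, r ∈ Finset.Ioo i h → m r c := by
        intro r
        by_cases hr : r ∈ Finset.Ioo i h
        · rw [Finset.mem_Ioo] at hr
          obtain ⟨c, hc⟩ := T.cover (i := r) (by omega) (by omega)
          exact ⟨c, fun _ => hc⟩
        · exact ⟨0, fun h => absurd h hr⟩
      choose f hf using hex
      have hinj : Set.InjOn f (Finset.Ioo i h) := by
        intro r hr r' hr' hrr
        have h2 := hf r hr
        rw [hrr] at h2
        exact T.unique' h2 (hf r' hr')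
      -- Apart from the last column of row `i`, the columns h, …, 2h − i − 1 are available. The h −
      -- i − 1 rows between `i` and the middle, on which both matchings agree by induction, occupy
      -- all but one of them. If `j` and `j'` were different, these rows would have to avoid two of
      -- the h − i columns.
      have hsub : (Finset.Ioo i h).image f ⊆ ((Finset.Ico h (2 * h - i)).erase j).erase j' := by
        intro c hc
        obtain ⟨r, hr, rfl⟩ := Finset.mem_image.1 hc
        have h2 := hf r hr
        have hr' := Finset.mem_Ioo.1 hr
        have h3 := T.lt h2
        rw [Finset.mem_erase, Finset.mem_erase, Finset.mem_Ico]
        refine ⟨?_, ?_, ?_, by omega⟩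
        · intro he
          have h4 := ih (2 * h - r) (by omega) r (by omega) _ h2
          rw [he] at h4
          have := T'.unique' h4 hm'
          omega
        · intro he
          rw [he] at h2
          have := T.unique' h2 hm
          omega
        · by_contra hlt2
          have := T.unique' h2 (T.below (f r) (by omega))
          omega
      have hcard := Finset.card_le_card hsub
      rw [Finset.card_image_of_injOn hinj, Finset.card_erase_of_mem, Finset.card_erase_of_mem,
        Nat.card_Ioo, Nat.card_Ico] at hcard
      · omega
      · rw [Finset.mem_Ico]; omega
      · rw [Finset.mem_erase, Finset.mem_Ico]; exact ⟨hjj.symm, by omega, by omega⟩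
    · exact absurd hm (T.free j)
    · have h2 := T.below d (by omega)
      have h3 := T'.below d (by omega)
      rw [show 2 * h - d = i by omega] at h2 h3
      rwa [T.unique hm h2]

theorem iff_of_last (T : MidFreeMatching h m) (T' : MidFreeMatching h m')
    (hb : ∀ i < h, m i (2 * h - i) ↔ m' i (2 * h - i)) (i j : ℕ) : m i j ↔ m' i j := by
  constructor
  · intro hm
    have := T.lt hm
    exact T.subset T' hb (2 * h - i) i (by omega) j hm
  · intro hm
    have := T'.lt hm
    exact T'.subset T (fun i hi => (hb i hi).symm) (2 * h - i) i (by omega) j hm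

end MidFreeMatching

namespace TriangleGraph

theorem adj_inl_inr {n : ℕ} {i j : Fin n} :
    (triangleGraph n).Adj (.inl i) (.inr j) ↔ i.val + j.val < n := by
  simp [triangleGraph, SimpleGraph.fromRel_adj]

theorem not_adj_inl_inl {n : ℕ} {i j : Fin n} : ¬ (triangleGraph n).Adj (.inl i) (.inl j) := by
  simp [triangleGraph, SimpleGraph.fromRel_adj]

theorem not_adj_inr_inr {n : ℕ} {i j : Fin n} : ¬ (triangleGraph n).Adj (.inr i) (.inr j) := by
  simp [triangleGraph, SimpleGraph.fromRel_adj]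

theorem side_ne_of_adj {n : ℕ} (x y : Fin n ⊕ Fin n) (h : (triangleGraph n).Adj x y) :
    x.isLeft ≠ y.isLeft := by
  rcases x with i | i <;> rcases y with j | j
  · exact absurd h not_adj_inl_inl
  · simp
  · simp
  · exact absurd h not_adj_inr_inr

theorem exists_perfectMatching (n : ℕ) : ∃ M, IsPerfectMatchingSet (triangleGraph n) M := by
  refine ⟨{e | ∃ x y, (∃ i j : Fin n, x = .inl i ∧ y = .inr j ∧ i.val + j.val + 1 = n) ∧ e = s(x, y)},
    isMatchingSet_of_rel (side := Sum.isLeft) ?_ ?_ ?_ ?_, ?_⟩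
  · rintro _ _ ⟨i, j, rfl, rfl, h⟩
    exact adj_inl_inr.2 (by omega)
  · rintro _ _ ⟨i, j, rfl, rfl, h⟩
    exact ⟨rfl, rfl⟩
  · rintro _ _ _ ⟨i, j, rfl, rfl, h⟩ ⟨i', j', h1, rfl, h'⟩
    obtain rfl := Sum.inl_injective h1
    rw [Fin.ext (a := j) (b := j') (by omega)]
  · rintro _ _ _ ⟨i, j, rfl, rfl, h⟩ ⟨i', j', rfl, h1, h'⟩
    obtain rfl := Sum.inr_injective h1
    rw [Fin.ext (a := i) (b := i') (by omega)]
  · rw [Set.eq_empty_iff_forall_notMem]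
    intro x hx
    rw [mem_unmatched_setOf_rel] at hx
    rcases x with i | i
    · have := i.2
      exact (hx (.inr ⟨n - 1 - i.val, by omega⟩)).1 ⟨i, _, rfl, rfl, by simp only; omega⟩
    · have := i.2
      exact (hx (.inl ⟨n - 1 - i.val, by omega⟩)).2 ⟨_, i, rfl, rfl, by simp only; omega⟩

/-! ### States with an unmatched middle vertex -/

section Rare

variable {h : ℕ}

/-- The rows and columns matched by a state. -/
def matchRel (M : BroderState (triangleGraph (2 * h + 1))) (i j : ℕ) : Prop :=
  ∃ (hi : i < 2 * h + 1) (hj : j < 2 * h + 1), s(.inl ⟨i, hi⟩, .inr ⟨j, hj⟩) ∈ M.1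

theorem matchRel_iff {M : BroderState (triangleGraph (2 * h + 1))} {i j : Fin (2 * h + 1)} :
    matchRel M i j ↔ s(.inl i, .inr j) ∈ M.1 :=
  ⟨fun ⟨_, _, h⟩ => h, fun h => ⟨i.2, j.2, h⟩⟩

theorem matchRel_unique {M : BroderState (triangleGraph (2 * h + 1))} {i j j' : ℕ}
    (h1 : matchRel M i j) (h2 : matchRel M i j') : j = j' := by
  obtain ⟨hi, hj, h1⟩ := h1
  obtain ⟨hi', hj', h2⟩ := h2
  exact congrArg Fin.val (Sum.inr_injective (M.isMatching.mate_unique h1 h2))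

theorem matchRel_unique' {M : BroderState (triangleGraph (2 * h + 1))} {i i' j : ℕ}
    (h1 : matchRel M i j) (h2 : matchRel M i' j) : i = i' := by
  obtain ⟨hi, hj, h1⟩ := h1
  obtain ⟨hi', hj', h2⟩ := h2
  rw [Sym2.eq_swap] at h1 h2
  exact congrArg Fin.val (Sum.inl_injective (M.isMatching.mate_unique h1 h2))

theorem matchRel_lt {M : BroderState (triangleGraph (2 * h + 1))} {i j : ℕ} (h1 : matchRel M i j) :
    i + j < 2 * h + 1 := by
  obtain ⟨hi, hj, h1⟩ := h1
  exact adj_inl_inr.1 (M.isMatching.adj h1)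

theorem eq_of_matchRel {M M' : BroderState (triangleGraph (2 * h + 1))}
    (hm : ∀ i j, matchRel M i j ↔ matchRel M' i j) : M = M' := by
  apply Subtype.ext
  ext e
  induction e with | _ x y =>
  rcases x with i | i <;> rcases y with j | j
  · exact ⟨fun h => absurd (M.isMatching.adj h) not_adj_inl_inl,
      fun h => absurd (M'.isMatching.adj h) not_adj_inl_inl⟩
  · rw [← matchRel_iff, ← matchRel_iff]
    exact hm _ _
  · rw [Sym2.eq_swap, ← matchRel_iff, ← matchRel_iff]
    exact hm _ _
  · exact ⟨fun h => absurd (M.isMatching.adj h) not_adj_inr_inr,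
      fun h => absurd (M'.isMatching.adj h) not_adj_inr_inr⟩

/-- The middle index. -/
def mid (h : ℕ) : Fin (2 * h + 1) := ⟨h, by omega⟩

/-- The second hole lies on the right side, so every row except the middle one is matched. -/
theorem midFreeMatching_left {M : BroderState (triangleGraph (2 * h + 1))}
    (hM : .inl (mid h) ∈ unmatched M.1) : MidFreeMatching h (matchRel M) where
  lt := matchRel_lt
  unique := matchRel_unique
  unique' := matchRel_unique'
  cover {i} hi hne := by
    obtain ⟨M₀, h₀⟩ := exists_perfectMatching (2 * h + 1)
    have : .inl ⟨i, hi⟩ ∉ unmatched M.1 := fun h1 =>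
      M.side_ne_of_unmatched side_ne_of_adj h₀ h1 hM (by simpa [mid] using hne) rfl
    obtain ⟨y, hy⟩ := not_mem_unmatched.1 this
    rcases y with j | j
    · exact absurd (M.isMatching.adj hy) not_adj_inl_inl
    · exact ⟨j, hi, j.2, hy⟩
  free j := by
    rintro ⟨hi, hj, h1⟩
    exact mem_unmatched.1 hM _ h1

/-- The triangle is symmetric, so the transposed relation has a free middle row. -/
theorem midFreeMatching_right {M : BroderState (triangleGraph (2 * h + 1))}
    (hM : .inr (mid h) ∈ unmatched M.1) : MidFreeMatching h (fun i j => matchRel M j i) where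
  lt {i j} h1 := by have := matchRel_lt h1; omega
  unique := matchRel_unique'
  unique' := matchRel_unique
  cover {i} hi hne := by
    obtain ⟨M₀, h₀⟩ := exists_perfectMatching (2 * h + 1)
    have : .inr ⟨i, hi⟩ ∉ unmatched M.1 := fun h1 =>
      M.side_ne_of_unmatched side_ne_of_adj h₀ h1 hM (by simpa [mid] using hne) rfl
    obtain ⟨y, hy⟩ := not_mem_unmatched.1 this
    rcases y with j | j
    · rw [Sym2.eq_swap] at hy
      exact ⟨j, j.2, hi, hy⟩
    · exact absurd (M.isMatching.adj hy) not_adj_inr_inr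
  free j := by
    rintro ⟨hi, hj, h1⟩
    rw [Sym2.eq_swap] at h1
    exact mem_unmatched.1 hM _ h1

theorem ncard_le_of_midFreeMatching (S : Set (BroderState (triangleGraph (2 * h + 1))))
    (f : BroderState (triangleGraph (2 * h + 1)) → ℕ → ℕ → Prop)
    (hf : ∀ M M', (∀ i j, f M i j ↔ f M' i j) → M = M') (hS : ∀ M ∈ S, MidFreeMatching h (f M)) :
    S.ncard ≤ 2 ^ h := by
  classical
  have := Set.ncard_le_ncard_of_injOn (s := S) (t := (Set.univ : Set (Fin h → Bool)))
    (fun M i => decide (f M i (2 * h - i))) (fun _ _ => Set.mem_univ _) ?_ (Set.toFinite _)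
  · rw [Set.ncard_univ, Nat.card_eq_fintype_card] at this
    simpa using this
  · intro M hM M' hM' heq
    refine hf _ _ ((hS M hM).iff_of_last (hS M' hM') fun i hi => ?_)
    simpa only [decide_eq_decide] using congrFun heq ⟨i, hi⟩

theorem ncard_mid_unmatched_le :
    {M : BroderState (triangleGraph (2 * h + 1)) |
      .inl (mid h) ∈ unmatched M.1 ∨ .inr (mid h) ∈ unmatched M.1}.ncard ≤ 2 * 2 ^ h := by
  refine (Set.ncard_union_le {M : BroderState (triangleGraph (2 * h + 1)) |
    .inl (mid h) ∈ unmatched M.1} {M | .inr (mid h) ∈ unmatched M.1}).trans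
    ((Nat.add_le_add ?_ ?_).trans_eq (two_mul _).symm)
  · exact ncard_le_of_midFreeMatching _ matchRel (fun _ _ => eq_of_matchRel)
      fun M hM => midFreeMatching_left hM
  · exact ncard_le_of_midFreeMatching _ (fun M i j => matchRel M j i)
      (fun _ _ hm => eq_of_matchRel fun i j => hm j i) fun M hM => midFreeMatching_right hM

end Rare

/-! #### Many states -/

/-- The first element of the run of `D` that ends before `s`. -/
def runStart (D : ℕ → Bool) : ℕ → ℕ
  | 0 => 0
  | s + 1 => if D s then runStart D s else s + 1

theorem runStart_le (D : ℕ → Bool) (s : ℕ) : runStart D s ≤ s := by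
  induction s with
  | zero => exact le_rfl
  | succ s ih => rw [runStart]; split_ifs <;> omega

theorem mem_of_runStart_le (D : ℕ → Bool) (s : ℕ) : ∀ x, runStart D s ≤ x → x < s → D x = true := by
  induction s with
  | zero => intro x _ h; omega
  | succ s ih =>
    intro x h1 h2
    rw [runStart] at h1
    split_ifs at h1 with h
    · rcases Nat.lt_or_ge x s with h3 | h3
      · exact ih x h1 h3
      · rwa [show x = s by omega]
    · omega

theorem not_mem_of_runStart_eq (D : ℕ → Bool) {s a : ℕ} (h : runStart D s = a + 1) : D a = false := by
  induction s with
  | zero => exact absurd h (by simp [runStart])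
  | succ s ih =>
    rw [runStart] at h
    split_ifs at h with h1
    · exact ih h
    · rw [← Nat.succ_injective h]; simpa using h1

/-- The permutation that shifts the elements of `D` by one and closes every run to a cycle. -/
def runPerm (D : ℕ → Bool) (s : ℕ) : ℕ := if D s then s + 1 else runStart D s

/-- The start of a run is never the successor of an element of `D`. Of two elements outside `D` with
the same run start, the smaller would lie in the run before the larger and so belong to `D`. -/
theorem runPerm_injective (D : ℕ → Bool) : Function.Injective (runPerm D) := by
  intro s s' h
  unfold runPerm at h
  split_ifs at h with h1 h2 h2
  · exact Nat.succ_injective h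
  · have := not_mem_of_runStart_eq D h.symm
    rw [this] at h1
    cases h1
  · have := not_mem_of_runStart_eq D h
    rw [this] at h2
    cases h2
  · have a1 := runStart_le D s
    have a2 := runStart_le D s'
    rcases Nat.lt_trichotomy s s' with h3 | h3 | h3
    · exact absurd (mem_of_runStart_le D s' s (by omega) h3) h1
    · exact h3
    · exact absurd (mem_of_runStart_le D s s' (by omega) h3) h2

theorem runPerm_le (D : ℕ → Bool) (s : ℕ) : runPerm D s ≤ s + 1 := by
  unfold runPerm
  have := runStart_le D s
  split_ifs <;> omega

theorem runPerm_eq_succ_iff (D : ℕ → Bool) (s : ℕ) : runPerm D s = s + 1 ↔ D s = true := by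
  unfold runPerm
  have := runStart_le D s
  split_ifs with h
  · simp [h]
  · simp only [h]; constructor
    · intro h'; omega
    · intro h'; cases h'

/-- Row l − s is matched with column `runPerm D s`, which is at most s + 1, so the pair lies in the
triangle. The condition `D l = false` keeps the permutation within {0, …, l}; only the last row and
the last column stay unmatched. -/
theorem exists_state_of_runs {l : ℕ} (D : ℕ → Bool) (hD : D l = false) :
    ∃ M : BroderState (triangleGraph (l + 2)), ∀ i j : Fin (l + 2), s(.inl i, .inr j) ∈ M.1 ↔
      ∃ s ≤ l, i.val + s = l ∧ j.val = runPerm D s := by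
  have hlt : ∀ s ≤ l, runPerm D s < l + 1 := by
    intro s hs
    rcases Nat.lt_or_ge s l with h | h
    · have := runPerm_le D s; omega
    · rw [show s = l by omega, runPerm, hD]
      have := runStart_le D l
      simp; omega
  set q : (Fin (l + 2) ⊕ Fin (l + 2)) → (Fin (l + 2) ⊕ Fin (l + 2)) → Prop := fun x y =>
    ∃ i j : Fin (l + 2), x = .inl i ∧ y = .inr j ∧ ∃ s ≤ l, i.val + s = l ∧ j.val = runPerm D s
    with hq
  have hmat : IsMatchingSet (triangleGraph (l + 2)) {e | ∃ x y, q x y ∧ e = s(x, y)} := by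
    refine isMatchingSet_of_rel (side := Sum.isLeft) ?_ ?_ ?_ ?_
    · rintro _ _ ⟨i, j, rfl, rfl, s, hs, h1, h2⟩
      have := runPerm_le D s
      exact adj_inl_inr.2 (by omega)
    · rintro _ _ ⟨i, j, rfl, rfl, h⟩
      exact ⟨rfl, rfl⟩
    · rintro _ _ _ ⟨i, j, rfl, rfl, s, hs, h1, h2⟩ ⟨i', j', h, rfl, s', hs', h1', h2'⟩
      obtain rfl := Sum.inl_injective h
      obtain rfl : s = s' := by omega
      rw [Fin.ext (h2.trans h2'.symm)]
    · rintro _ _ _ ⟨i, j, rfl, rfl, s, hs, h1, h2⟩ ⟨i', j', rfl, h, s', hs', h1', h2'⟩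
      obtain rfl := Sum.inr_injective h
      obtain rfl : s = s' := runPerm_injective D (h2.symm.trans h2')
      rw [Fin.ext (a := i) (b := i') (by omega)]
  have hsurj : ∀ c < l + 1, ∃ s ≤ l, runPerm D s = c := by
    let f : Fin (l + 1) → Fin (l + 1) := fun s => ⟨runPerm D s, hlt s (by omega)⟩
    have hf : Function.Injective f := fun a b h =>
      Fin.ext (runPerm_injective D (congrArg Fin.val h))
    intro c hc
    obtain ⟨s, hs⟩ := (Finite.injective_iff_surjective.1 hf) ⟨c, hc⟩
    exact ⟨s, by omega, congrArg Fin.val hs⟩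
  have hun : unmatched {e | ∃ x y, q x y ∧ e = s(x, y)} =
      {.inl (Fin.last (l + 1)), .inr (Fin.last (l + 1))} := by
    ext x
    rw [mem_unmatched_setOf_rel, Set.mem_insert_iff, Set.mem_singleton_iff]
    rcases x with i | i
    · constructor
      · intro h
        refine Or.inl ?_
        by_contra hne
        have hi : i.val ≤ l := by
          have h1 : i ≠ Fin.last (l + 1) := fun e => hne (by rw [e])
          have := Fin.val_lt_last h1
          omega
        have h2 := hlt (l - i.val) (by omega)
        exact (h (.inr ⟨runPerm D (l - i.val), by omega⟩)).1
          ⟨i, _, rfl, rfl, l - i.val, by omega, by omega, rfl⟩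
      · rintro (h | h) y
        · obtain rfl := Sum.inl_injective h
          constructor
          · rintro ⟨i, j, h1, rfl, s, hs, h2, h3⟩
            obtain rfl := Sum.inl_injective h1
            simp at h2
            omega
          · rintro ⟨i, j, rfl, h1, -⟩
            cases h1
        · cases h
    · constructor
      · intro h
        refine Or.inr ?_
        by_contra hne
        have hi : i.val < l + 1 := by
          have h1 : i ≠ Fin.last (l + 1) := fun e => hne (by rw [e])
          exact Fin.val_lt_last h1
        obtain ⟨s, hs, hsi⟩ := hsurj i hi
        exact (h (.inl ⟨l - s, by omega⟩)).2 ⟨_, i, rfl, rfl, s, hs, by simp only; omega, hsi.symm⟩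
      · rintro (h | h) y
        · cases h
        · obtain rfl := Sum.inr_injective h
          constructor
          · rintro ⟨i, j, h1, rfl, -⟩
            cases h1
          · rintro ⟨i, j, rfl, h1, s, hs, h2, h3⟩
            obtain rfl := Sum.inr_injective h1
            have := hlt s hs
            simp at h3
            omega
  refine ⟨⟨_, Or.inr ⟨hmat, by rw [hun, Set.ncard_pair (by simp)]⟩⟩, fun i j => ?_⟩
  rw [mem_setOf_rel]
  constructor
  · rintro (⟨i', j', h1, h2, h3⟩ | ⟨i', j', h1, h2, h3⟩)
    · obtain rfl := Sum.inl_injective h1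
      obtain rfl := Sum.inr_injective h2
      exact h3
    · cases h1
  · exact fun h => Or.inl ⟨i, j, rfl, rfl, h⟩

/-- Row l − s meets its last column s + 1 exactly if s ∈ `D`, so different `D` give different
states. With l = 2j + 1 the middle edge belongs to s = j. Fixing this bit to `b` leaves 2j free
bits. -/
theorem le_ncard_states (j : ℕ) (b : Bool) :
    2 ^ (2 * j) ≤ {M : BroderState (triangleGraph (2 * (j + 1) + 1)) |
      s(.inl (mid (j + 1)), .inr (mid (j + 1))) ∈ M.1 ↔ b = true}.ncard := by
  classical
  let D : (Fin (2 * j) → Bool) → ℕ → Bool := fun E s =>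
    if h : s < 2 * j + 1 then (Fin.insertNth (α := fun _ => Bool) ⟨j, by omega⟩ b E) ⟨s, h⟩ else false
  have hDj : ∀ E, D E j = b := by
    intro E
    simp only [D]
    rw [dif_pos (by omega)]
    exact Fin.insertNth_apply_same (α := fun _ => Bool) ⟨j, by omega⟩ b E
  have hDinj : Function.Injective D := by
    intro E E' h
    refine Fin.insertNth_right_injective (α := fun _ => Bool) (p := ⟨j, by omega⟩) b ?_
    funext s
    have := congrFun h s.val
    simp only [D] at this
    rwa [dif_pos s.2, dif_pos s.2] at this
  have hex : ∀ E, ∃ M : BroderState (triangleGraph (2 * j + 1 + 2)),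
      ∀ i c : Fin (2 * j + 1 + 2), s(.inl i, .inr c) ∈ M.1 ↔
      ∃ s ≤ 2 * j + 1, i.val + s = 2 * j + 1 ∧ c.val = runPerm (D E) s :=
    fun E => exists_state_of_runs (D E) (by simp [D])
  choose M hM using hex
  have key : ∀ E s, (hs : s ≤ 2 * j + 1) →
      (s(.inl ⟨2 * j + 1 - s, by omega⟩, .inr ⟨s + 1, by omega⟩) ∈ (M E).1 ↔ D E s = true) := by
    intro E s hs
    rw [hM, ← runPerm_eq_succ_iff (D E) s]
    constructor
    · rintro ⟨s', hs', h1, h2⟩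
      simp only at h1 h2
      obtain rfl : s' = s := by omega
      exact h2.symm
    · intro h
      exact ⟨s, hs, by simp only; omega, h.symm⟩
  have := Set.ncard_le_ncard_of_injOn (s := (Set.univ : Set (Fin (2 * j) → Bool)))
    (t := {M : BroderState (triangleGraph (2 * (j + 1) + 1)) |
      s(.inl (mid (j + 1)), .inr (mid (j + 1))) ∈ M.1 ↔ b = true}) M ?_ ?_ (Set.toFinite _)
  · rw [Set.ncard_univ, Nat.card_eq_fintype_card] at this
    simpa using this
  · intro E _
    rw [Set.mem_ofPred_eq, ← hDj E, ← key E j (by omega)]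
    have : (⟨2 * j + 1 - j, by omega⟩ : Fin (2 * j + 1 + 2)) = mid (j + 1) :=
      Fin.ext (by simp only [mid]; omega)
    rw [this]
    rfl
  · intro E _ E' _ h
    refine hDinj (funext fun s => ?_)
    by_cases hs : s ≤ 2 * j + 1
    · rw [Bool.eq_iff_iff, ← key E s hs, ← key E' s hs, h]
    · simp only [D]
      rw [dif_neg (by omega), dif_neg (by omega)]

/-- F consists of the middle edge alone. At most 2·2^(j + 1) states have a hole at one of its ends,
while 2^(2j) contain it and 2^(2j) do not. -/
theorem exists_bottleneck (j : ℕ) : ∃ F : Set (Sym2 (Fin (2 * j + 3) ⊕ Fin (2 * j + 3))),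
    ({M : BroderState (triangleGraph (2 * j + 3)) | ∃ f ∈ F, ∃ w ∈ f, w ∈ unmatched M.1}.ncard + 1) *
        2 ^ (j - 1) ≤ 16 * {M : BroderState (triangleGraph (2 * j + 3)) | F ⊆ M.1}.ncard ∧
    ({M : BroderState (triangleGraph (2 * j + 3)) | ∃ f ∈ F, ∃ w ∈ f, w ∈ unmatched M.1}.ncard + 1) *
        2 ^ (j - 1) ≤ 16 * {M : BroderState (triangleGraph (2 * j + 3)) | ¬ F ⊆ M.1}.ncard := by
  set F : Set (Sym2 (Fin (2 * (j + 1) + 1) ⊕ Fin (2 * (j + 1) + 1))) :=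
    {s(.inl (mid (j + 1)), .inr (mid (j + 1)))} with hF
  have hB : {M : BroderState (triangleGraph (2 * (j + 1) + 1)) |
      ∃ f ∈ F, ∃ w ∈ f, w ∈ unmatched M.1}.ncard ≤ 2 * 2 ^ (j + 1) := by
    refine (congrArg Set.ncard (Set.ext fun M => ?_)).trans_le (ncard_mid_unmatched_le (h := j + 1))
    simp [hF]
  have hT := le_ncard_states j true
  have hT' := le_ncard_states j false
  simp only [iff_true, Bool.false_eq_true, iff_false] at hT hT'
  have hle : (2 * 2 ^ (j + 1) + 1) * 2 ^ (j - 1) ≤ 16 * 2 ^ (2 * j) := by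
    have e1 : 2 ^ (j - 1) ≤ 2 ^ j := Nat.pow_le_pow_right (by norm_num) (by omega)
    have e2 : (2 : ℕ) ^ (2 * j) = 2 ^ j * 2 ^ j := by rw [two_mul, pow_add]
    have e3 : 1 ≤ 2 ^ j := Nat.one_le_two_pow
    rw [e2, pow_succ]
    nlinarith
  refine ⟨F, ?_, ?_⟩
  · refine (Nat.mul_le_mul_right _ (Nat.add_le_add_right hB 1)).trans (hle.trans ?_)
    simp only [hF, Set.singleton_subset_iff]
    exact Nat.mul_le_mul_left 16 hT
  · refine (Nat.mul_le_mul_right _ (Nat.add_le_add_right hB 1)).trans (hle.trans ?_)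
    simp only [hF, Set.singleton_subset_iff]
    exact Nat.mul_le_mul_left 16 hT'

end TriangleGraph

theorem oddTriangleGraphs_hasBottleneck : HasBottleneck oddTriangleGraphs := by
  refine hasBottleneck_of_polynomial (16 : Polynomial ℝ) 8 (by norm_num) ?_
  rintro _ ⟨j, rfl⟩
  obtain ⟨F, h1, h2⟩ := TriangleGraph.exists_bottleneck j
  refine ⟨j - 1, F, ?_, ?_, ?_⟩
  · simp [FinGraph.size]; omega
  · have : ∀ x : ℝ, Polynomial.eval x 16 = 16 := Polynomial.eval_ofNat 16
    rw [this]
    exact_mod_cast h1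
  · have : ∀ x : ℝ, Polynomial.eval x 16 = 16 := Polynomial.eval_ofNat 16
    rw [this]
    exact_mod_cast h2

theorem oddTriangleGraphs_inputs (N : ℕ) :
    ∃ G ∈ oddTriangleGraphs, N ≤ G.size ∧ G.IsBroderInput := by
  refine ⟨_, ⟨N, rfl⟩, ?_, ?_⟩
  · simp [FinGraph.size]; omega
  · obtain ⟨M, hM⟩ := TriangleGraph.exists_perfectMatching (2 * N + 3)
    refine FinGraph.isBroderInput _ hM (x := .inl 0) (y := .inr 0) (z := .inr 1) ?_ ?_ (by simp)
    · exact TriangleGraph.adj_inl_inr.2 (by simp)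
    · exact TriangleGraph.adj_inl_inr.2 (by simp)

/-! ### Triangle graphs are threshold graphs -/

namespace TriangleGraph

/-- Rows are treated in increasing order. Suppose H joins row i to a column j outside the triangle.
All rows adjacent to j in the triangle graph precede i, so by induction they are adjacent to j in H
as well; since the degrees of j agree, H has no further neighbour of j, a contradiction. So H has no
extra edges at row i, and the degree of the row gives equality. -/
theorem isBipartiteThreshold (n : ℕ) : IsBipartiteThreshold (triangleGraph n) := by
  refine ⟨Set.range Sum.inl, ⟨disjoint_compl_right, ?_⟩, ?_⟩
  · intro x y h
    rcases x with i | i <;> rcases y with j | j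
    · exact absurd h not_adj_inl_inl
    · simp
    · simp
    · exact absurd h not_adj_inr_inr
  intro H hH hdeg
  have hll : ∀ i j : Fin n, ¬ H.Adj (.inl i) (.inl j) := fun i j h => by
    have := hH.mem_of_adj h
    simp at this
  have hrr : ∀ i j : Fin n, ¬ H.Adj (.inr i) (.inr j) := fun i j h => by
    have := hH.mem_of_adj h
    simp at this
  have key : ∀ d, ∀ i : Fin n, i.val = d →
      H.neighborSet (.inl i) = (triangleGraph n).neighborSet (.inl i) := by
    intro d
    induction d using Nat.strong_induction_on with
    | _ d ih =>
      rintro i rfl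
      refine Set.eq_of_subset_of_ncard_le ?_ (hdeg _).ge (Set.toFinite _)
      rintro (j | j) hj
      · exact absurd hj (hll i j)
      rw [SimpleGraph.mem_neighborSet] at hj ⊢
      by_contra hij
      have hsub : (triangleGraph n).neighborSet (.inr j) ⊆ H.neighborSet (.inr j) := by
        rintro (i' | i') hi' <;> rw [SimpleGraph.mem_neighborSet] at hi'
        · have h1 : i'.val + j.val < n := adj_inl_inr.1 hi'.symm
          have h2 : ¬ i.val + j.val < n := fun h => hij (adj_inl_inr.2 h)
          have h3 : .inr j ∈ H.neighborSet (.inl i') := by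
            rw [ih i' (by omega) i' rfl]
            exact hi'.symm
          exact SimpleGraph.Adj.symm h3
        · exact absurd hi' not_adj_inr_inr
      have heq := Set.eq_of_subset_of_ncard_le hsub (hdeg _).le (Set.toFinite _)
      have : .inl i ∈ (triangleGraph n).neighborSet (.inr j) := by
        rw [heq]
        exact hj.symm
      exact hij (SimpleGraph.Adj.symm this)
  ext x y
  rcases x with i | i <;> rcases y with j | j
  · exact ⟨fun h => absurd h (hll i j), fun h => absurd h not_adj_inl_inl⟩
  · exact Set.ext_iff.1 (key i i rfl) _
  · rw [SimpleGraph.adj_comm, SimpleGraph.adj_comm (triangleGraph n)]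
    exact Set.ext_iff.1 (key j j rfl) _
  · exact ⟨fun h => absurd h (hrr i j), fun h => absurd h not_adj_inr_inr⟩

end TriangleGraph

theorem oddTriangleGraphs_subset : oddTriangleGraphs ⊆ thresholdBipartite := by
  rintro _ ⟨j, rfl⟩
  exact TriangleGraph.isBipartiteThreshold _

/-! ### Straight-line drawings -/

/-- A linear functional with integer coefficients separates the segment `p q` from the segment
`r s`. -/
def SegmentsSeparated (p q r s : ℤ × ℤ) : Prop :=
  ∃ α β : ℤ, α * p.1 + β * p.2 ≤ α * r.1 + β * r.2 ∧ α * p.1 + β * p.2 ≤ α * s.1 + β * s.2 ∧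
    α * q.1 + β * q.2 ≤ α * r.1 + β * r.2 ∧ α * q.1 + β * q.2 ≤ α * s.1 + β * s.2 ∧
    α * p.1 + β * p.2 + (α * q.1 + β * q.2) < α * r.1 + β * r.2 + (α * s.1 + β * s.2)

namespace SegmentsSeparated

variable {p q r s : ℤ × ℤ}

theorem swap_left (h : SegmentsSeparated p q r s) : SegmentsSeparated q p r s := by
  obtain ⟨α, β, h1, h2, h3, h4, h5⟩ := h
  exact ⟨α, β, h3, h4, h1, h2, by linarith⟩

theorem swap_right (h : SegmentsSeparated p q r s) : SegmentsSeparated p q s r := by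
  obtain ⟨α, β, h1, h2, h3, h4, h5⟩ := h
  exact ⟨α, β, h2, h1, h4, h3, by linarith⟩

theorem symm (h : SegmentsSeparated p q r s) : SegmentsSeparated r s p q := by
  obtain ⟨α, β, h1, h2, h3, h4, h5⟩ := h
  exact ⟨-α, -β, by linarith, by linarith, by linarith, by linarith, by linarith⟩

/-- The points of the segment. -/
def segmentPoint (p q : ℤ × ℤ) (t : ℝ) : ℝ × ℝ :=
  ((1 - t) * p.1 + t * q.1, (1 - t) * p.2 + t * q.2)

/-- The functional takes on the two points values whose difference is a combination, with positive
weights, of four nonnegative differences between ends, and two of these have a positive sum. Ends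
may coincide, as the inequalities at the ends are weak. -/
theorem segmentPoint_ne (h : SegmentsSeparated p q r s) {t u : ℝ} (ht : 0 < t) (ht' : t < 1)
    (hu : 0 < u) (hu' : u < 1) : segmentPoint p q t ≠ segmentPoint r s u := by
  obtain ⟨α, β, h1, h2, h3, h4, h5⟩ := h
  intro he
  simp only [segmentPoint, Prod.mk.injEq] at he
  obtain ⟨e1, e2⟩ := he
  have k1 : (0 : ℝ) ≤ (α * r.1 + β * r.2) - (α * p.1 + β * p.2) := by
    rw [sub_nonneg]; exact_mod_cast h1
  have k2 : (0 : ℝ) ≤ (α * s.1 + β * s.2) - (α * p.1 + β * p.2) := by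
    rw [sub_nonneg]; exact_mod_cast h2
  have k3 : (0 : ℝ) ≤ (α * r.1 + β * r.2) - (α * q.1 + β * q.2) := by
    rw [sub_nonneg]; exact_mod_cast h3
  have k4 : (0 : ℝ) ≤ (α * s.1 + β * s.2) - (α * q.1 + β * q.2) := by
    rw [sub_nonneg]; exact_mod_cast h4
  have k5 : (0 : ℝ) < ((α * r.1 + β * r.2) - (α * p.1 + β * p.2)) +
      ((α * s.1 + β * s.2) - (α * q.1 + β * q.2)) := by
    have : ((α * p.1 + β * p.2 + (α * q.1 + β * q.2) : ℤ) : ℝ) <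
      ((α * r.1 + β * r.2 + (α * s.1 + β * s.2) : ℤ) : ℝ) := by exact_mod_cast h5
    push_cast at this
    linarith
  have hs : (1 - t) * (1 - u) * ((α * r.1 + β * r.2) - (α * p.1 + β * p.2)) +
      (1 - t) * u * ((α * s.1 + β * s.2) - (α * p.1 + β * p.2)) +
      t * (1 - u) * ((α * r.1 + β * r.2) - (α * q.1 + β * q.2)) +
      t * u * ((α * s.1 + β * s.2) - (α * q.1 + β * q.2)) = 0 := by
    linear_combination (-α : ℝ) * e1 - β * e2
  have t0 : 0 < 1 - t := by linarith
  have u0 : 0 < 1 - u := by linarith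
  have m1 := mul_nonneg (mul_pos t0 u0).le k1
  have m2 := mul_nonneg (mul_pos t0 hu).le k2
  have m3 := mul_nonneg (mul_pos ht u0).le k3
  have m4 := mul_nonneg (mul_pos ht hu).le k4
  have z1 := (mul_eq_zero.1 (show _ = (0 : ℝ) by linarith :
    (1 - t) * (1 - u) * ((α * r.1 + β * r.2) - (α * p.1 + β * p.2)) = (0 : ℝ))).resolve_left
      (mul_pos t0 u0).ne'
  have z4 := (mul_eq_zero.1 (show _ = (0 : ℝ) by linarith :
    t * u * ((α * s.1 + β * s.2) - (α * q.1 + β * q.2)) = (0 : ℝ))).resolve_left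
      (mul_pos ht hu).ne'
  linarith

theorem segmentPoint_injective (h : p ≠ q) : Function.Injective (segmentPoint p q) := by
  intro t u he
  simp only [segmentPoint, Prod.mk.injEq] at he
  obtain ⟨e1, e2⟩ := he
  by_contra hne
  have hne' : t - u ≠ 0 := sub_ne_zero.2 hne
  refine h (Prod.ext ?_ ?_)
  · have : (t - u) * ((q.1 : ℝ) - p.1) = 0 := by linear_combination e1
    have := (mul_eq_zero.1 this).resolve_left hne'
    exact_mod_cast (sub_eq_zero.1 this).symm
  · have : (t - u) * ((q.2 : ℝ) - p.2) = 0 := by linear_combination e2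
    have := (mul_eq_zero.1 this).resolve_left hne'
    exact_mod_cast (sub_eq_zero.1 this).symm

end SegmentsSeparated

open SegmentsSeparated in
/-- A drawing with straight edges between integer points is a plane embedding if the edges are
separated from each other and from the other vertices. -/
theorem isPlanar_of_segmentsSeparated {V : Type} {G : SimpleGraph V} (pos : V → ℤ × ℤ)
    (hpos : Function.Injective pos)
    (hv : ∀ x y z, G.Adj x y → z ≠ x → z ≠ y → SegmentsSeparated (pos x) (pos y) (pos z) (pos z))
    (he : ∀ x y x' y', G.Adj x y → G.Adj x' y' → s(x, y) ≠ s(x', y') →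
      SegmentsSeparated (pos x) (pos y) (pos x') (pos y')) : IsPlanar G := by
  have hends : ∀ e : G.edgeSet, ∃ x y, e.1 = s(x, y) := by
    rintro ⟨e, -⟩
    induction e with | _ x y => exact ⟨x, y, rfl⟩
  choose a b hab using hends
  have hadj : ∀ e, G.Adj (a e) (b e) := fun e => by
    rw [← SimpleGraph.mem_edgeSet, ← hab]; exact e.2
  have hne : ∀ e, pos (a e) ≠ pos (b e) := fun e h => (hadj e).ne (hpos h)
  have h0 : ∀ p q : ℤ × ℤ, segmentPoint p q 0 = ((p.1 : ℝ), (p.2 : ℝ)) := fun p q => by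
    simp [segmentPoint]
  have h1 : ∀ p q : ℤ × ℤ, segmentPoint p q 1 = ((q.1 : ℝ), (q.2 : ℝ)) := fun p q => by
    simp [segmentPoint]
  -- A vertex is treated as the interior point of a degenerate segment, so edges are kept off
  -- vertices by the same separation.
  have hc : ∀ p : ℤ × ℤ, segmentPoint p p (1 / 2) = ((p.1 : ℝ), (p.2 : ℝ)) := fun p => by
    simp only [segmentPoint, Prod.mk.injEq]; constructor <;> ring
  refine ⟨{
    point := fun z => ((pos z).1, (pos z).2)
    point_injective := fun x y h => hpos (by
      simp only [Prod.mk.injEq, Int.cast_inj] at h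
      exact Prod.ext h.1 h.2)
    arc := fun e => ⟨fun t => segmentPoint (pos (a e)) (pos (b e)) t, by
      unfold segmentPoint; fun_prop⟩
    arc_injective := fun e t u h => Subtype.ext (segmentPoint_injective (hne e) h)
    arc_ends := fun e => ?_
    arc_avoids := fun e t ht z h => ?_
    arc_disjoint := fun e f hef t ht u hu => ?_ }⟩
  · rw [hab e, Sym2.map_mk]
    simp [h0, h1]
  · have t0 : (0 : ℝ) < t := ht.1
    have t1 : (t : ℝ) < 1 := ht.2
    simp only [ContinuousMap.coe_mk] at h
    by_cases hza : z = a e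
    · rw [hza, ← h0 (pos (a e)) (pos (b e))] at h
      exact t0.ne' (segmentPoint_injective (hne e) h)
    by_cases hzb : z = b e
    · rw [hzb, ← h1 (pos (a e)) (pos (b e))] at h
      exact t1.ne (segmentPoint_injective (hne e) h)
    · rw [← hc (pos z)] at h
      exact (hv _ _ _ (hadj e) hza hzb).segmentPoint_ne t0 t1 (by norm_num) (by norm_num) h
  · refine (he _ _ _ _ (hadj e) (hadj f) ?_).segmentPoint_ne ht.1 ht.2 hu.1 hu.2
    rw [← hab e, ← hab f]
    exact fun h => hef (Subtype.ext h)

namespace SegmentsSeparated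

variable {p q r s : ℤ × ℤ}

theorem of_fst_le (h1 : p.1 ≤ r.1) (h2 : p.1 ≤ s.1) (h3 : q.1 ≤ r.1) (h4 : q.1 ≤ s.1)
    (h5 : p.1 + q.1 < r.1 + s.1) : SegmentsSeparated p q r s :=
  ⟨1, 0, by linarith, by linarith, by linarith, by linarith, by linarith⟩

theorem of_snd_le (h1 : p.2 ≤ r.2) (h2 : p.2 ≤ s.2) (h3 : q.2 ≤ r.2) (h4 : q.2 ≤ s.2)
    (h5 : p.2 + q.2 < r.2 + s.2) : SegmentsSeparated p q r s :=
  ⟨0, 1, by linarith, by linarith, by linarith, by linarith, by linarith⟩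

/-- Two edges in a vertical strip. -/
theorem of_strip {x y y' z z' : ℤ} (h1 : y ≤ z) (h2 : y' ≤ z') (h3 : y + y' < z + z') :
    SegmentsSeparated (x - 1, y) (x, y') (x - 1, z) (x, z') := by
  -- This functional is constant on the lower edge.
  refine ⟨y - y', 1, ?_, ?_, ?_, ?_, ?_⟩ <;> simp only <;> linarith

theorem translate (h : SegmentsSeparated p q r s) (x y : ℤ) : SegmentsSeparated
    (x + p.1, y + p.2) (x + q.1, y + q.2) (x + r.1, y + r.2) (x + s.1, y + s.2) := by
  obtain ⟨α, β, h1, h2, h3, h4, h5⟩ := h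
  refine ⟨α, β, ?_, ?_, ?_, ?_, ?_⟩ <;> simp only <;> linarith

theorem of_sym2_eq {V : Type} {pos : V → ℤ × ℤ} {x y x' y' x₀ y₀ x₁ y₁ : V}
    (h : s(x, y) = s(x₀, y₀)) (h' : s(x', y') = s(x₁, y₁))
    (hs : SegmentsSeparated (pos x₀) (pos y₀) (pos x₁) (pos y₁)) :
    SegmentsSeparated (pos x) (pos y) (pos x') (pos y') := by
  rw [Sym2.eq_iff] at h h'
  rcases h with ⟨rfl, rfl⟩ | ⟨rfl, rfl⟩ <;> rcases h' with ⟨rfl, rfl⟩ | ⟨rfl, rfl⟩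
  · exact hs
  · exact hs.swap_right
  · exact hs.swap_left
  · exact hs.swap_left.swap_right

/-- Some functional with small coefficients separates the segments. -/
def search (p q r s : ℤ × ℤ) : Prop :=
  ∃ a b : Fin 7, (a.val - 3 : ℤ) * p.1 + (b.val - 3) * p.2 ≤ (a.val - 3) * r.1 + (b.val - 3) * r.2 ∧
    (a.val - 3 : ℤ) * p.1 + (b.val - 3) * p.2 ≤ (a.val - 3) * s.1 + (b.val - 3) * s.2 ∧
    (a.val - 3 : ℤ) * q.1 + (b.val - 3) * q.2 ≤ (a.val - 3) * r.1 + (b.val - 3) * r.2 ∧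
    (a.val - 3 : ℤ) * q.1 + (b.val - 3) * q.2 ≤ (a.val - 3) * s.1 + (b.val - 3) * s.2 ∧
    (a.val - 3 : ℤ) * p.1 + (b.val - 3) * p.2 + ((a.val - 3) * q.1 + (b.val - 3) * q.2) <
      (a.val - 3) * r.1 + (b.val - 3) * r.2 + ((a.val - 3) * s.1 + (b.val - 3) * s.2)

instance (p q r s : ℤ × ℤ) : Decidable (search p q r s) := by unfold search; infer_instance

theorem of_search (h : search p q r s) : SegmentsSeparated p q r s := by
  obtain ⟨a, b, h⟩ := h
  exact ⟨_, _, h⟩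

end SegmentsSeparated

/-- A straight-line drawing of a gadget in the box `[0, w] × [-2, 2]` with the ports in the middle
of the left and of the right side. -/
structure GadgetDrawing {p : ℕ} (rel : Fin (p + 1) → Fin (p + 1) → Prop) (w : ℤ)
    (lU lW : Fin (p + 1) → ℤ × ℤ) : Prop where
  left_port : lW 0 = (0, 0)
  right_port : lU 0 = (w, 0)
  box_U : ∀ a, 0 ≤ (lU a).1 ∧ (lU a).1 ≤ w ∧ -2 ≤ (lU a).2 ∧ (lU a).2 ≤ 2
  box_W : ∀ a, 0 ≤ (lW a).1 ∧ (lW a).1 ≤ w ∧ -2 ≤ (lW a).2 ∧ (lW a).2 ≤ 2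
  inj_U : ∀ a a', lU a = lU a' → a = a'
  inj_W : ∀ a a', lW a = lW a' → a = a'
  ne : ∀ a a', lU a ≠ lW a'
  edges : ∀ a b a' b', rel a b → rel a' b' → ¬ (a = a' ∧ b = b') →
    SegmentsSeparated.search (lU a) (lW b) (lU a') (lW b')
  avoids_U : ∀ a b a', rel a b → a' ≠ a → SegmentsSeparated.search (lU a) (lW b) (lU a') (lU a')
  avoids_W : ∀ a b b', rel a b → b' ≠ b → SegmentsSeparated.search (lU a) (lW b) (lW b') (lW b')

/-! ### Planar drawings of track systems -/

namespace TrackSystem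

variable {V : Type} {G : SimpleGraph V} {R : Type} {k p : ℕ} {rel : Fin (p + 1) → Fin (p + 1) → Prop}
  (T : TrackSystem G R k p rel)

/-- The left end of the bridge before the gadget `j` (after the gadget `j - 1`). -/
def bridgeLeft (u : V) (r : R) (j : ℕ) : V :=
  if h : 0 < j ∧ j ≤ k then T.U r ⟨j - 1, by omega⟩ 0 else u

/-- The right end of the bridge before the gadget `j` (after the gadget `j - 1`). -/
def bridgeRight (v : V) (r : R) (j : ℕ) : V := if h : j < k then T.W r ⟨j, h⟩ 0 else v

/-- Every edge lies in a gadget or is a bridge. The bridges of a track are numbered 0, …, k, so that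
those at `u` and `v` need no separate treatment in the drawing. -/
theorem exists_of_adj (u v : V) (hcov : ∀ z, z = u ∨ z = v ∨ ∃ r i a, z = T.U r i a ∨ z = T.W r i a)
    (hu : ∀ y, G.Adj u y → ∃ r, ∃ i : Fin k, i.val = 0 ∧ y = T.W r i 0)
    (hv : ∀ y, G.Adj v y → ∃ r, ∃ i : Fin k, i.val + 1 = k ∧ y = T.U r i 0)
    (hprv : ∀ r i, i.val = 0 → T.prv r i = u) (hnxt : ∀ r i, i.val + 1 = k → T.nxt r i = v)
    {x y : V} (h : G.Adj x y) :
    (∃ r i a b, rel a b ∧ s(x, y) = s(T.U r i a, T.W r i b)) ∨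
      ∃ r j, j ≤ k ∧ s(x, y) = s(T.bridgeLeft u r j, T.bridgeRight v r j) := by
  rcases hcov x with rfl | rfl | ⟨r, i, a, rfl | rfl⟩
  · obtain ⟨r, i, hi, rfl⟩ := hu y h
    refine Or.inr ⟨r, 0, Nat.zero_le _, ?_⟩
    rw [bridgeLeft, dif_neg (by omega), bridgeRight, dif_pos (by omega)]
    exact congrArg (fun i => s(x, T.W r i 0)) (Fin.ext (a := i) (b := ⟨0, by omega⟩) hi)
  · obtain ⟨r, i, hi, rfl⟩ := hv y h
    refine Or.inr ⟨r, k, le_rfl, ?_⟩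
    rw [bridgeLeft, dif_pos (by omega), bridgeRight, dif_neg (by omega), Sym2.eq_swap]
    exact congrArg (fun i => s(T.U r i 0, x))
      (Fin.ext (a := i) (b := ⟨k - 1, by omega⟩) (by simp only; omega))
  · rcases T.adj_U.1 h with ⟨b, hb, rfl⟩ | ⟨rfl, rfl⟩
    · exact Or.inl ⟨r, i, a, b, hb, rfl⟩
    · refine Or.inr ⟨r, i.val + 1, i.2, ?_⟩
      rw [bridgeLeft, dif_pos (by omega), bridgeRight]
      split_ifs with hk
      · rw [T.nxt_eq (i := i) (j := ⟨i.val + 1, hk⟩) rfl]; rfl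
      · rw [hnxt r i (by omega)]; rfl
  · rcases T.adj_W.1 h with ⟨b, hb, rfl⟩ | ⟨rfl, rfl⟩
    · exact Or.inl ⟨r, i, b, a, hb, Sym2.eq_swap⟩
    · refine Or.inr ⟨r, i.val, i.2.le, ?_⟩
      rw [Sym2.eq_swap, bridgeRight, dif_pos i.2, bridgeLeft]
      split_ifs with hk
      · rw [T.prv_eq (i := ⟨i.val - 1, by omega⟩) (j := i) (by simp only; omega)]
      · rw [hprv r i (by omega)]

/-- A graph that consists of tracks between two vertices is planar if its gadgets are drawn suitably. -/
theorem isPlanar_of_two_ends (u v : V)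
    (hcov : ∀ z, z = u ∨ z = v ∨ ∃ r i a, z = T.U r i a ∨ z = T.W r i a)
    (hu : ∀ y, G.Adj u y → ∃ r, ∃ i : Fin k, i.val = 0 ∧ y = T.W r i 0)
    (hv : ∀ y, G.Adj v y → ∃ r, ∃ i : Fin k, i.val + 1 = k ∧ y = T.U r i 0)
    (hprv : ∀ r i, i.val = 0 → T.prv r i = u) (hnxt : ∀ r i, i.val + 1 = k → T.nxt r i = v)
    {num : R → ℕ} (hnum : Function.Injective num) (hk : 0 < k) {w : ℤ} (hw : 0 ≤ w) {lU lW : Fin (p + 1) → ℤ × ℤ} (D : GadgetDrawing rel w lU lW)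
    (pos : V → ℤ × ℤ) (pu : pos u = (-1, 0)) (pv : pos v = ((w + 1) * k, 0))
    (pU : ∀ r i a, pos (T.U r i a) = ((w + 1) * i.val + (lU a).1, 10 * num r + (lU a).2))
    (pW : ∀ r i a, pos (T.W r i a) = ((w + 1) * i.val + (lW a).1, 10 * num r + (lW a).2)) :
    IsPlanar G := by
  -- The gadgets with number i lie in the columns from (w + 1)i to (w + 1)i + w, one track above the
  -- other at distance 10, and the bridges with number j fill the strip of width 1 that ends at (w +
  -- 1)j.
  have hmul : ∀ {i j : ℕ}, i < j → (w + 1) * (i : ℤ) + (w + 1) ≤ (w + 1) * (j : ℤ) := by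
    intro i j h
    have : (i : ℤ) + 1 ≤ j := by exact_mod_cast h
    nlinarith
  have hmul' : ∀ {i j : ℕ}, i ≤ j → (w + 1) * (i : ℤ) ≤ (w + 1) * (j : ℤ) := by
    intro i j h
    have : (i : ℤ) ≤ j := by exact_mod_cast h
    nlinarith
  have hmul0 : ∀ i : ℕ, 0 ≤ (w + 1) * (i : ℤ) := fun i => by positivity
  have pL : ∀ r j, j ≤ k → pos (T.bridgeLeft u r j) =
      ((w + 1) * j - 1, if 0 < j then 10 * (num r : ℤ) else 0) := by
    intro r j hj
    unfold bridgeLeft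
    by_cases h : 0 < j
    · rw [dif_pos ⟨h, hj⟩, if_pos h, pU, D.right_port]
      simp only [Nat.cast_sub (show 1 ≤ j from h), Nat.cast_one, Prod.mk.injEq]
      constructor <;> ring
    · rw [dif_neg (fun h' => h h'.1), if_neg h, pu, show j = 0 by omega]
      simp
  have pR : ∀ r j, j ≤ k → pos (T.bridgeRight v r j) =
      ((w + 1) * j, if j < k then 10 * (num r : ℤ) else 0) := by
    intro r j hj
    unfold bridgeRight
    split_ifs with h
    · rw [pW, D.left_port]; simp
    · rw [pv, show j = k by omega]
  -- the box of a gadget vertex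
  have hbox : ∀ (r : R) (i : Fin k) z, (∃ a, z = T.U r i a ∨ z = T.W r i a) →
      (w + 1) * (i.val : ℤ) ≤ (pos z).1 ∧ (pos z).1 ≤ (w + 1) * (i.val : ℤ) + w ∧
      10 * (num r : ℤ) - 2 ≤ (pos z).2 ∧ (pos z).2 ≤ 10 * (num r : ℤ) + 2 := by
    rintro r i z ⟨a, rfl | rfl⟩
    · obtain ⟨h1, h2, h3, h4⟩ := D.box_U a
      rw [pU]
      refine ⟨?_, ?_, ?_, ?_⟩ <;> simp only <;> linarith
    · obtain ⟨h1, h2, h3, h4⟩ := D.box_W a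
      rw [pW]
      refine ⟨?_, ?_, ?_, ?_⟩ <;> simp only <;> linarith
  -- Gadgets with different numbers are separated by a vertical line, gadgets with the same number
  -- on different tracks by a horizontal one.
  have hfar : ∀ (r r' : R) (i i' : Fin k) z z' y y', (∃ a, z = T.U r i a ∨ z = T.W r i a) →
      (∃ a, z' = T.U r i a ∨ z' = T.W r i a) → (∃ a, y = T.U r' i' a ∨ y = T.W r' i' a) →
      (∃ a, y' = T.U r' i' a ∨ y' = T.W r' i' a) → ¬ (r = r' ∧ i = i') →
      SegmentsSeparated (pos z) (pos z') (pos y) (pos y') := by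
    intro r r' i i' z z' y y' hz hz' hy hy' hne
    obtain ⟨a1, a2, a3, a4⟩ := hbox r i z hz
    obtain ⟨b1, b2, b3, b4⟩ := hbox r i z' hz'
    obtain ⟨c1, c2, c3, c4⟩ := hbox r' i' y hy
    obtain ⟨d1, d2, d3, d4⟩ := hbox r' i' y' hy'
    rcases Nat.lt_trichotomy i.val i'.val with h | h | h
    · have := hmul h
      apply SegmentsSeparated.of_fst_le <;> linarith
    · have hr : num r ≠ num r' := fun h' => hne ⟨hnum h', Fin.ext h⟩
      rcases Nat.lt_or_gt_of_ne hr with h' | h'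
      · have : (num r : ℤ) + 1 ≤ num r' := by exact_mod_cast h'
        apply SegmentsSeparated.of_snd_le <;> linarith
      · have : (num r' : ℤ) + 1 ≤ num r := by exact_mod_cast h'
        apply SegmentsSeparated.symm
        apply SegmentsSeparated.of_snd_le <;> linarith
    · have := hmul h
      apply SegmentsSeparated.symm
      apply SegmentsSeparated.of_fst_le <;> linarith
  have hbridge : ∀ (r' : R) (j : ℕ) (r : R) (i : Fin k) z z', j ≤ k →
      (∃ a, z = T.U r i a ∨ z = T.W r i a) → (∃ a, z' = T.U r i a ∨ z' = T.W r i a) →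
      SegmentsSeparated (pos (T.bridgeLeft u r' j)) (pos (T.bridgeRight v r' j)) (pos z) (pos z') := by
    intro r' j r i z z' hj hz hz'
    obtain ⟨a1, a2, a3, a4⟩ := hbox r i z hz
    obtain ⟨b1, b2, b3, b4⟩ := hbox r i z' hz'
    rw [pL r' j hj, pR r' j hj]
    rcases Nat.lt_or_ge i.val j with h | h
    · have := hmul h
      apply SegmentsSeparated.symm
      apply SegmentsSeparated.of_fst_le <;> simp only <;> linarith
    · have := hmul' h
      apply SegmentsSeparated.of_fst_le <;> simp only <;> linarith
  have hadj := fun x y (h : G.Adj x y) => T.exists_of_adj u v hcov hu hv hprv hnxt h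
  refine isPlanar_of_segmentsSeparated pos ?_ ?_ ?_
  · intro x y hxy
    have hux : ∀ (r : R) (i : Fin k) z, (∃ a, z = T.U r i a ∨ z = T.W r i a) → pos z ≠ pos u := by
      intro r i z hz h
      obtain ⟨a1, -⟩ := hbox r i z hz
      have := hmul0 i.val
      rw [h, pu] at a1
      simp only at a1
      linarith
    have hvx : ∀ (r : R) (i : Fin k) z, (∃ a, z = T.U r i a ∨ z = T.W r i a) → pos z ≠ pos v := by
      intro r i z hz h
      obtain ⟨-, a2, -⟩ := hbox r i z hz
      have := hmul i.2
      rw [h, pv] at a2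
      simp only at a2
      linarith
    have huv : pos u ≠ pos v := by
      intro h
      have := hmul0 k
      rw [pu, pv, Prod.mk.injEq] at h
      linarith [h.1]
    rcases hcov x with rfl | rfl | ⟨r, i, a, hx⟩ <;> rcases hcov y with rfl | rfl | ⟨r', i', a', hy⟩
    · rfl
    · exact absurd hxy huv
    · exact absurd hxy.symm (hux r' i' y ⟨a', hy⟩)
    · exact absurd hxy.symm huv
    · rfl
    · exact absurd hxy.symm (hvx r' i' y ⟨a', hy⟩)
    · exact absurd hxy (hux r i x ⟨a, hx⟩)
    · exact absurd hxy (hvx r i x ⟨a, hx⟩)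
    · obtain ⟨a1, a2, a3, a4⟩ := hbox r i x ⟨a, hx⟩
      obtain ⟨b1, b2, b3, b4⟩ := hbox r' i' y ⟨a', hy⟩
      rw [hxy] at a1 a2 a3 a4
      have hi : i = i' := by
        rcases Nat.lt_trichotomy i.val i'.val with h | h | h
        · have := hmul h; linarith
        · exact Fin.ext h
        · have := hmul h; linarith
      have hr : r = r' := by
        rcases Nat.lt_trichotomy (num r) (num r') with h | h | h
        · have : (num r : ℤ) + 1 ≤ num r' := by exact_mod_cast h
          linarith
        · exact hnum h
        · have : (num r' : ℤ) + 1 ≤ num r := by exact_mod_cast h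
          linarith
      subst hi hr
      have hcancel : ∀ p q : ℤ × ℤ, ((w + 1) * (i.val : ℤ) + p.1, 10 * (num r : ℤ) + p.2) =
          ((w + 1) * (i.val : ℤ) + q.1, 10 * (num r : ℤ) + q.2) → p = q := by
        intro p q h
        rw [Prod.mk.injEq] at h
        exact Prod.ext (by linarith [h.1]) (by linarith [h.2])
      rcases hx with rfl | rfl <;> rcases hy with rfl | rfl <;> simp only [pU, pW] at hxy
      · rw [D.inj_U _ _ (hcancel _ _ hxy)]
      · exact absurd (hcancel _ _ hxy) (D.ne _ _)
      · exact absurd (hcancel _ _ hxy).symm (D.ne _ _)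
      · rw [D.inj_W _ _ (hcancel _ _ hxy)]
  · intro x y z h hzx hzy
    rcases hadj x y h with ⟨r, i, a, b, hab, he⟩ | ⟨r, j, hj, he⟩
    · refine SegmentsSeparated.of_sym2_eq (pos := pos) he (rfl : s(z, z) = s(z, z)) ?_
      have hzU : z ≠ T.U r i a := by
        rintro rfl
        rcases Sym2.eq_iff.1 he with ⟨rfl, -⟩ | ⟨-, rfl⟩
        · exact hzx rfl
        · exact hzy rfl
      have hzW : z ≠ T.W r i b := by
        rintro rfl
        rcases Sym2.eq_iff.1 he with ⟨-, rfl⟩ | ⟨rfl, -⟩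
        · exact hzy rfl
        · exact hzx rfl
      obtain ⟨a1, a2, -⟩ := hbox r i _ ⟨a, Or.inl rfl⟩
      obtain ⟨b1, b2, -⟩ := hbox r i _ ⟨b, Or.inr rfl⟩
      rcases hcov z with rfl | rfl | ⟨r', i', a', hz⟩
      · have := hmul0 i.val
        apply SegmentsSeparated.symm
        apply SegmentsSeparated.of_fst_le <;> rw [pu] <;> simp only <;> linarith
      · have := hmul i.2
        apply SegmentsSeparated.of_fst_le <;> rw [pv] <;> simp only <;> linarith
      · by_cases hri : r = r' ∧ i = i'
        · obtain ⟨rfl, rfl⟩ := hri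
          rcases hz with rfl | rfl
          · rw [pU, pU, pW]
            exact (SegmentsSeparated.of_search (D.avoids_U a b a' hab
              (by rintro rfl; exact hzU rfl))).translate _ _
          · rw [pU, pW, pW]
            exact (SegmentsSeparated.of_search (D.avoids_W a b a' hab
              (by rintro rfl; exact hzW rfl))).translate _ _
        · exact hfar r r' i i' _ _ _ _ ⟨a, Or.inl rfl⟩ ⟨b, Or.inr rfl⟩ ⟨a', hz⟩ ⟨a', hz⟩ hri
    · refine SegmentsSeparated.of_sym2_eq (pos := pos) he (rfl : s(z, z) = s(z, z)) ?_
      rcases hcov z with rfl | rfl | ⟨r', i', a', hz⟩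
      · have := hmul0 j
        rw [pL r j hj, pR r j hj, pu]
        apply SegmentsSeparated.symm
        apply SegmentsSeparated.of_fst_le <;> simp only <;> linarith
      · have := hmul' hj
        rw [pL r j hj, pR r j hj, pv]
        apply SegmentsSeparated.of_fst_le <;> simp only <;> linarith
      · exact hbridge r j r' i' z z hj ⟨a', hz⟩ ⟨a', hz⟩
  · intro x y x' y' h h' hne
    rcases hadj x y h with ⟨r, i, a, b, hab, he⟩ | ⟨r, j, hj, he⟩ <;>
      rcases hadj x' y' h' with ⟨r', i', a', b', hab', he'⟩ | ⟨r', j', hj', he'⟩ <;>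
      refine SegmentsSeparated.of_sym2_eq he he' ?_
    · by_cases hri : r = r' ∧ i = i'
      · obtain ⟨rfl, rfl⟩ := hri
        rw [pU, pU, pW, pW]
        refine (SegmentsSeparated.of_search (D.edges a b a' b' hab hab' ?_)).translate _ _
        rintro ⟨rfl, rfl⟩
        exact hne (he.trans he'.symm)
      · exact hfar r r' i i' _ _ _ _ ⟨a, Or.inl rfl⟩ ⟨b, Or.inr rfl⟩ ⟨a', Or.inl rfl⟩
          ⟨b', Or.inr rfl⟩ hri
    · exact (hbridge r' j' r i _ _ hj' ⟨a, Or.inl rfl⟩ ⟨b, Or.inr rfl⟩).symm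
    · exact hbridge r j r' i' _ _ hj ⟨a', Or.inl rfl⟩ ⟨b', Or.inr rfl⟩
    · rw [pL r j hj, pR r j hj, pL r' j' hj', pR r' j' hj']
      rcases Nat.lt_trichotomy j j' with h1 | rfl | h1
      · have := hmul h1
        apply SegmentsSeparated.of_fst_le <;> simp only <;> linarith
      -- Bridges in one strip are ordered by their track at both ends. They may share one end, at
      -- `u` or at `v`, but not both, since k > 0.
      · have key : ∀ r r' : R, num r < num r' → SegmentsSeparated
            ((w + 1) * (j : ℤ) - 1, if 0 < j then 10 * (num r : ℤ) else 0)
            ((w + 1) * (j : ℤ), if j < k then 10 * (num r : ℤ) else 0)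
            ((w + 1) * (j : ℤ) - 1, if 0 < j then 10 * (num r' : ℤ) else 0)
            ((w + 1) * (j : ℤ), if j < k then 10 * (num r' : ℤ) else 0) := by
          intro r r' hr
          have : (num r : ℤ) < num r' := by exact_mod_cast hr
          apply SegmentsSeparated.of_strip
          · split_ifs <;> linarith
          · split_ifs <;> linarith
          · split_ifs <;> linarith
        rcases Nat.lt_trichotomy (num r) (num r') with h2 | h2 | h2
        · exact key r r' h2
        · obtain rfl := hnum h2
          exact absurd (he.trans he'.symm) hne
        · exact (key r' r h2).symm
      · have := hmul h1
        apply SegmentsSeparated.symm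
        apply SegmentsSeparated.of_fst_le <;> simp only <;> linarith

end TrackSystem

/-! ### Drawings of the hexagon graphs and of the block graphs -/

section Families

theorem gadgetDrawing_hexagon : GadgetDrawing HexVertex.gadgetRel 3
    ![(3, 0), (1, 1), (1, -1)] ![(0, 0), (2, 1), (2, -1)] := by
  constructor <;> decide +kernel

theorem gadgetDrawing_block : GadgetDrawing blockRel 5
    ![(5, 0), (1, 2), (1, -2), (3, 0)] ![(0, 0), (4, 2), (4, -2), (2, 0)] := by
  constructor <;> decide +kernel

/-- The drawing of a hexagon. -/
def HexVertex.pos {k : ℕ} : HexVertex k → ℤ × ℤ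
  | .u => (-1, 0)
  | .v => (4 * k, 0)
  | .hex i c => (4 * i.val + (![0, 1, 2, 3, 2, 1] c : ℤ), (![0, 1, 1, 0, -1, -1] c : ℤ))

theorem HexVertex.isPlanar {k : ℕ} (hk : 0 < k) : IsPlanar (hexagonGraph k) := by
  refine (trackSystem k).isPlanar_of_two_ends .u .v ?_ ?_ ?_ ?_ ?_ (num := fun _ => 0)
    (fun _ _ _ => rfl) hk (by norm_num) gadgetDrawing_hexagon HexVertex.pos rfl ?_ ?_ ?_
  · rintro (_ | _ | ⟨i, c⟩)
    · exact Or.inl rfl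
    · exact Or.inr (Or.inl rfl)
    · obtain ⟨a, ha⟩ := eq_cornerU_or_cornerW c
      exact Or.inr (Or.inr ⟨(), i, a, by simpa [trackSystem] using ha⟩)
  · intro y h
    rcases y with _ | _ | ⟨i, c⟩
    · exact absurd h (SimpleGraph.irrefl _)
    · exact absurd h not_adj_u_v
    · obtain ⟨hi, rfl⟩ := adj_hex_u.1 h.symm
      exact ⟨(), i, hi, rfl⟩
  · intro y h
    rcases y with _ | _ | ⟨i, c⟩
    · exact absurd h.symm not_adj_u_v
    · exact absurd h (SimpleGraph.irrefl _)
    · obtain ⟨hi, rfl⟩ := adj_hex_v.1 h.symm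
      exact ⟨(), i, hi, rfl⟩
  · exact fun _ i hi => (eq_prv.2 (Or.inr ⟨hi, rfl⟩)).symm
  · exact fun _ i hi => (eq_nxt.2 (Or.inr ⟨hi, rfl⟩)).symm
  · rfl
  · intro r i a
    fin_cases a <;> simp [trackSystem, HexVertex.pos, cornerU]
  · intro r i a
    fin_cases a <;> simp [trackSystem, HexVertex.pos, cornerW]

/-- The drawing of the block graph. -/
def BlockVertex.pos {k : ℕ} : BlockVertex k → ℤ × ℤ
  | .u => (-1, 0)
  | .v => (6 * k, 0)
  | .blockU r i a => (6 * i.val + (![5, 1, 1, 3] a : ℤ), 10 * r.val + (![0, 2, -2, 0] a : ℤ))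
  | .blockV r i b => (6 * i.val + (![0, 4, 4, 2] b : ℤ), 10 * r.val + (![0, 2, -2, 0] b : ℤ))

theorem BlockVertex.isPlanar {k : ℕ} (hk : 0 < k) : IsPlanar (blockGraph k) := by
  refine (trackSystem k).isPlanar_of_two_ends .u .v ?_ ?_ ?_ ?_ ?_ (num := Fin.val)
    Fin.val_injective hk (by norm_num) gadgetDrawing_block BlockVertex.pos rfl ?_ ?_ ?_
  · rintro (_ | _ | ⟨r, i, c⟩ | ⟨r, i, c⟩)
    · exact Or.inl rfl
    · exact Or.inr (Or.inl rfl)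
    · exact Or.inr (Or.inr ⟨r, i, c, Or.inl rfl⟩)
    · exact Or.inr (Or.inr ⟨r, i, c, Or.inr rfl⟩)
  · intro y h
    rcases y with _ | _ | ⟨r, i, c⟩ | ⟨r, i, c⟩
    · exact absurd h (SimpleGraph.irrefl _)
    · exact absurd h not_adj_u_v
    · exact absurd h.symm not_adj_blockU_u
    · obtain ⟨hi, rfl⟩ := adj_blockV_u.1 h.symm
      exact ⟨r, i, hi, rfl⟩
  · intro y h
    rcases y with _ | _ | ⟨r, i, c⟩ | ⟨r, i, c⟩
    · exact absurd h.symm not_adj_u_v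
    · exact absurd h (SimpleGraph.irrefl _)
    · obtain ⟨hi, rfl⟩ := adj_blockU_v.1 h.symm
      exact ⟨r, i, hi, rfl⟩
    · exact absurd h.symm not_adj_blockV_v
  · exact fun _ i hi => (eq_prv.2 (Or.inr ⟨hi, rfl⟩)).symm
  · exact fun _ i hi => (eq_nxt.2 (Or.inr ⟨hi, rfl⟩)).symm
  · rfl
  · intro r i a
    fin_cases a <;> simp [trackSystem, BlockVertex.pos]
  · intro r i a
    fin_cases a <;> simp [trackSystem, BlockVertex.pos]

end Families

theorem hexagonGraphs_subset : hexagonGraphs ⊆ planarBipartite := by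
  rintro _ ⟨j, rfl⟩
  exact ⟨HexVertex.isBipartite, HexVertex.isPlanar (Nat.succ_pos j)⟩

/-! ### Hamiltonian cycles -/

section HamiltonianCycle

variable {V : Type} {G : SimpleGraph V}

theorem exists_walk_of_adj_succ (n : ℕ) (f : ℕ → V) (h : ∀ i < n, G.Adj (f i) (f (i + 1))) :
    ∃ p : G.Walk (f 0) (f n), p.length = n ∧ ∀ i ≤ n, p.getVert i = f i := by
  induction n generalizing f with
  | zero =>
    refine ⟨.nil, rfl, fun i hi => ?_⟩
    rw [Nat.le_zero.1 hi]
    rfl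
  | succ n ih =>
    obtain ⟨p, hp, hv⟩ := ih (fun i => f (i + 1)) fun i hi => h (i + 1) (by omega)
    refine ⟨.cons (h 0 (by omega)) p, by rw [SimpleGraph.Walk.length_cons, hp], fun i hi => ?_⟩
    rcases i with _ | i
    · simp
    · rw [SimpleGraph.Walk.getVert_cons_succ]
      exact hv i (by omega)

/-- A cyclic enumeration of the vertices in which consecutive vertices are adjacent shows that the
graph is Hamiltonian. -/
theorem isHamiltonian_of_next [Fintype V] [DecidableEq V] (next : V → V) (pos : V → ℕ) (x₀ : V) (h0 : pos x₀ = 0)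
    (hN : 2 < Fintype.card V)
    (hnext : ∀ x, pos x + 1 < Fintype.card V → G.Adj x (next x) ∧ pos (next x) = pos x + 1)
    (hlast : ∀ x, pos x + 1 = Fintype.card V → G.Adj x x₀) : G.IsHamiltonian := by
  obtain ⟨n, hn⟩ : ∃ n, Fintype.card V = n + 1 := ⟨_, (Nat.succ_pred_eq_of_pos (by omega)).symm⟩
  set f : ℕ → V := fun i => next^[i] x₀ with hf
  have hstep : ∀ i, f (i + 1) = next (f i) := fun i => Function.iterate_succ_apply' _ _ _
  -- So `pos` inverts the enumeration, and the vertices visited in the first n steps are distinct.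
  have hpos : ∀ i ≤ n, pos (f i) = i := by
    intro i
    induction i with
    | zero => exact fun _ => h0
    | succ i ih =>
      intro hi
      have := ih (by omega)
      rw [hstep, (hnext (f i) (by omega)).2, this]
  obtain ⟨p, hp, hv⟩ := exists_walk_of_adj_succ n f fun i hi => by
    rw [hstep]
    exact (hnext (f i) (by rw [hpos i hi.le]; omega)).1
  have hpath : p.IsPath := by
    rw [← SimpleGraph.Walk.IsPath.getVert_injOn_iff]
    intro i hi j hj hij
    rw [Set.mem_ofPred_eq, hp] at hi hj
    rw [hv i hi, hv j hj] at hij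
    rw [← hpos i hi, ← hpos j hj, hij]
  have hclose : G.Adj (f n) (f 0) := hlast (f n) (by rw [hpos n le_rfl]; omega)
  intro _
  refine ⟨f n, .cons hclose p, ?_⟩
  rw [SimpleGraph.Walk.isHamiltonianCycle_iff_isCycle_and_length_eq]
  refine ⟨(SimpleGraph.Walk.cons_isCycle_iff _ _).2 ⟨hpath, fun h => ?_⟩, ?_⟩
  · rw [Sym2.eq_swap] at h
    have := hpath.length_eq_one_of_mem_edges h
    omega
  · rw [SimpleGraph.Walk.length_cons, hp, hn]

/-- A graph that falls into three parts when two vertices are deleted is not Hamiltonian. -/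
theorem not_isHamiltonian_of_parts [Fintype V] [DecidableEq V] (u v : V) (huv : u ≠ v) (part : V → Option (Fin 3))
    (hpart : ∀ x y, G.Adj x y → x ≠ u → x ≠ v → y ≠ u → y ≠ v → part x = part y)
    (hne : ∀ r, ∃ x, x ≠ u ∧ x ≠ v ∧ part x = some r) : ¬ G.IsHamiltonian := by
  intro hG
  have : Nontrivial V := ⟨u, v, huv⟩
  obtain ⟨p, hp⟩ := hG.exists_isHamiltonianCycle u
  have hinj := hp.isCycle.getVert_injOn
  have hN : p.getVert p.length = u := p.getVert_length
  obtain ⟨m, hm, hmN⟩ := SimpleGraph.Walk.mem_support_iff_exists_getVert.1 (hp.mem_support v)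
  have hm0 : 1 ≤ m := by
    by_contra h
    rw [show m = 0 by omega, SimpleGraph.Walk.getVert_zero] at hm
    exact huv hm
  have hneu : ∀ i, 1 ≤ i → i < p.length → p.getVert i ≠ u := by
    intro i h1 h2 h
    have := hinj (x₁ := i) (x₂ := p.length) ⟨h1, h2.le⟩ ⟨by omega, le_rfl⟩ (h.trans hN.symm)
    omega
  have hnev : ∀ i, 1 ≤ i → i ≤ p.length → i ≠ m → p.getVert i ≠ v := by
    intro i h1 h2 h3 h
    exact h3 (hinj (x₁ := i) (x₂ := m) ⟨h1, h2⟩ ⟨hm0, hmN⟩ (h.trans hm.symm))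
  -- The cycle starts at `u` and meets `v` at position `m`. Each of the two arcs between them stays
  -- within a single part, so two arcs cannot reach three parts.
  have hA : ∀ i, i + 1 < m → part (p.getVert (i + 1)) = part (p.getVert 1) := by
    intro i
    induction i with
    | zero => exact fun _ => rfl
    | succ i ih =>
      intro hi
      rw [← ih (by omega)]
      exact (hpart _ _ (p.adj_getVert_succ (by omega)) (hneu _ (by omega) (by omega))
        (hnev _ (by omega) (by omega) (by omega)) (hneu _ (by omega) (by omega))
        (hnev _ (by omega) (by omega) (by omega))).symm
  have hB : ∀ i, m + 1 + i < p.length → part (p.getVert (m + 1 + i)) = part (p.getVert (m + 1)) := by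
    intro i
    induction i with
    | zero => exact fun _ => rfl
    | succ i ih =>
      intro hi
      rw [← ih (by omega), ← Nat.add_assoc]
      exact (hpart _ _ (p.adj_getVert_succ (i := m + 1 + i) (by omega))
        (hneu (m + 1 + i) (by omega) (by omega)) (hnev (m + 1 + i) (by omega) (by omega) (by omega))
        (hneu (m + 1 + i + 1) (by omega) (by omega))
        (hnev (m + 1 + i + 1) (by omega) (by omega) (by omega))).symm
  have hall : ∀ r, some r = part (p.getVert 1) ∨ some r = part (p.getVert (m + 1)) := by
    intro r
    obtain ⟨x, hxu, hxv, hx⟩ := hne r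
    obtain ⟨i, hi, hiN⟩ := SimpleGraph.Walk.mem_support_iff_exists_getVert.1 (hp.mem_support x)
    have h0 : i ≠ 0 := by
      rintro rfl
      rw [SimpleGraph.Walk.getVert_zero] at hi
      exact hxu hi.symm
    have h1 : i ≠ p.length := by
      rintro rfl
      exact hxu (hi.symm.trans hN)
    have h2 : i ≠ m := by
      rintro rfl
      exact hxv (hi.symm.trans hm)
    rw [← hx, ← hi]
    rcases Nat.lt_or_gt_of_ne h2 with h | h
    · refine Or.inl ?_
      have := hA (i - 1) (by omega)
      rwa [Nat.sub_add_cancel (by omega)] at this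
    · refine Or.inr ?_
      have := hB (i - (m + 1)) (by omega)
      rwa [Nat.add_sub_cancel' (by omega)] at this
  exact (show ∀ a b : Option (Fin 3), ¬ ∀ r, some r = a ∨ some r = b by decide) _ _ hall

end HamiltonianCycle

/-! ### Block graphs are not Hamiltonian -/

namespace BlockVertex

/-- The track of a vertex. -/
def track {k : ℕ} : BlockVertex k → Option (Fin 3)
  | .u => none
  | .v => none
  | .blockU r _ _ => some r
  | .blockV r _ _ => some r

theorem not_isHamiltonian {k : ℕ} [DecidableEq (BlockVertex k)] (hk : 0 < k) :
    ¬ (blockGraph k).IsHamiltonian := by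
  refine not_isHamiltonian_of_parts BlockVertex.u BlockVertex.v (by simp) track ?_
    fun r => ⟨BlockVertex.blockU r ⟨0, hk⟩ 0, by simp, by simp, rfl⟩
  intro x y h h1 h2 h3 h4
  rcases x with _ | _ | ⟨r, i, a⟩ | ⟨r, i, a⟩ <;> rcases y with _ | _ | ⟨s, j, b⟩ | ⟨s, j, b⟩ <;>
    first
    | exact absurd rfl h1
    | exact absurd rfl h2
    | exact absurd rfl h3
    | exact absurd rfl h4
    | skip
  · exact absurd h not_adj_blockU_blockU
  · exact congrArg some (adj_blockU_blockV.1 h).1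
  · exact congrArg some (adj_blockU_blockV.1 h.symm).1.symm
  · exact absurd h not_adj_blockV_blockV

end BlockVertex

theorem blockGraphs_subset :
    blockGraphs ⊆ (regularBipartite ∩ planarBipartite) \ hamiltonianBipartite := by

  rintro _ ⟨j, rfl⟩
  refine ⟨⟨⟨BlockVertex.isBipartite, 3, BlockVertex.isRegularOfDegree (Nat.succ_pos j)⟩,
    BlockVertex.isBipartite, BlockVertex.isPlanar (Nat.succ_pos j)⟩, fun h => ?_⟩
  exact @BlockVertex.not_isHamiltonian _ (fun _ _ => Classical.propDecidable _) (Nat.succ_pos j) h.2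

/-! ### A Hamiltonian cycle of the block graph with a ladder -/

namespace LadderVertex

variable {k : ℕ}

/-- The number of a vertex in the Hamiltonian cycle. -/
def cyclePos : LadderVertex k → ℕ
  | .u => 0
  | .v => 18 * k + 5
  | .blockU r i a => blockPos k r i (![7, 1, 5, 3] a)
  | .blockV r i b => blockPos k r i (![0, 2, 6, 4] b)
  | .lad i s => 8 * k + 1 + 2 * (k + 1 - i) + if s = rail i then 1 else 0
where
  blockPos (k : ℕ) (r : Fin 3) (i e : ℕ) : ℕ :=
    if r = 0 then 1 + 8 * i + e else if r = 1 then 10 * k + 5 + 8 * i + e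
    else 18 * k + 6 + 8 * (k - 1 - i) + (7 - e)

/-- The next vertex in the Hamiltonian cycle. -/
def cycleNext (hk : 0 < k) : LadderVertex k → LadderVertex k
  | .u => .blockV 0 ⟨0, hk⟩ 0
  | .v => .blockU 2 ⟨k - 1, by omega⟩ 0
  | .blockU r i a =>
      if r = 2 then .blockV r i (![2, 0, 3, 1] a) else if a = 0 then nxt r i else .blockV r i a
  | .blockV r i b =>
      if r = 2 then if b = 0 then prv r i else .blockU r i b else .blockU r i (![1, 3, 0, 2] b)
  | .lad i s => if s = rail i then ladPrv hk i s else .lad i (!s)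

theorem adj_cycleNext (hk : 0 < k) (x : LadderVertex k) : (ladderGraph k).Adj x (cycleNext hk x) := by
  rcases x with _ | _ | ⟨r, i, a⟩ | ⟨r, i, b⟩ | ⟨i, s⟩
  · exact (adj_blockV_u.2 ⟨Or.inl rfl, rfl, rfl⟩).symm
  · exact (adj_blockU_v.2 ⟨Or.inr rfl, by simp only; omega, rfl⟩).symm
  · have h1 : ∀ a : Fin 4, blockRel a (![2, 0, 3, 1] a) := by decide
    have h2 : ∀ a : Fin 4, a ≠ 0 → blockRel a a := by decide
    simp only [cycleNext]
    split_ifs with h h'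
    · exact adj_blockU_blockV.2 ⟨rfl, Or.inl ⟨rfl, h1 a⟩⟩
    · exact (trackSystem k).adj_U.2 (Or.inr ⟨h', rfl⟩)
    · exact adj_blockU_blockV.2 ⟨rfl, Or.inl ⟨rfl, h2 a h'⟩⟩
  · have h1 : ∀ b : Fin 4, blockRel (![1, 3, 0, 2] b) b := by decide
    have h2 : ∀ a : Fin 4, a ≠ 0 → blockRel a a := by decide
    simp only [cycleNext]
    split_ifs with h h'
    · exact (trackSystem k).adj_W.2 (Or.inr ⟨h', rfl⟩)
    · exact (adj_blockU_blockV.2 ⟨rfl, Or.inl ⟨rfl, h2 b h'⟩⟩).symm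
    · exact (adj_blockU_blockV.2 ⟨rfl, Or.inl ⟨rfl, h1 b⟩⟩).symm
  · simp only [cycleNext]
    split_ifs with h
    · exact (adj_lad hk).2 (Or.inr (Or.inl rfl))
    · exact (adj_lad hk).2 (Or.inl rfl)

/-- The cycle runs from `u` along the first track, through the ladder from the last rung to the
first with every rung crossed, along the second track to `v`, and back along the third track. Within
a block it follows the path V₀ U₁ V₁ U₃ V₃ U₂ V₂ U₀, reversed on the third track. -/
theorem cyclePos_cycleNext (he : Even k) (hk : 0 < k) (x : LadderVertex k)
    (hx : cyclePos x + 1 < 26 * k + 6) : cyclePos (cycleNext hk x) = cyclePos x + 1 := by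
  have hl : rail (k + 1) = true := by
    rw [rail, show (k + 1) % 2 = 1 by have := Nat.even_iff.1 he; omega]; rfl
  rcases x with _ | _ | ⟨r, i, a⟩ | ⟨r, i, b⟩ | ⟨i, s⟩
  · rfl
  · simp [cycleNext, cyclePos, cyclePos.blockPos]
  · have hi := i.2
    have h1 : ∀ a : Fin 4, 7 - (![0, 2, 6, 4] : Fin 4 → ℕ) (![2, 0, 3, 1] a) =
      7 - (![7, 1, 5, 3] : Fin 4 → ℕ) a + 1 := by decide
    have h2 : ∀ a : Fin 4, a ≠ 0 → (![0, 2, 6, 4] : Fin 4 → ℕ) a = (![7, 1, 5, 3] : Fin 4 → ℕ) a + 1 := by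
      decide
    have h3 : ∀ r : Fin 3, r ≠ 2 → r = 0 ∨ r = 1 := by decide
    simp only [cycleNext]
    split_ifs with h h'
    · subst h
      simp only [cyclePos, cyclePos.blockPos, h1]
      simp
      omega
    · subst h'
      by_cases hlt : i.val + 1 < k
      · rw [nxt, dif_pos hlt]
        rcases h3 r h with rfl | rfl
        · simp [cyclePos, cyclePos.blockPos]; omega
        · simp [cyclePos, cyclePos.blockPos]; omega
      · rw [nxt, dif_neg hlt]
        rcases h3 r h with rfl | rfl
        · simp [cyclePos, cyclePos.blockPos, hl]; omega
        · simp [cyclePos, cyclePos.blockPos]; omega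
    · have := h2 a h'
      rcases h3 r h with rfl | rfl <;> simp [cyclePos, cyclePos.blockPos, -Fin.isValue] <;> omega
  · have hi := i.2
    have h1 : ∀ b : Fin 4, (![7, 1, 5, 3] : Fin 4 → ℕ) (![1, 3, 0, 2] b) =
      (![0, 2, 6, 4] : Fin 4 → ℕ) b + 1 := by decide
    have h2 : ∀ b : Fin 4, b ≠ 0 → 7 - (![7, 1, 5, 3] : Fin 4 → ℕ) b =
      7 - (![0, 2, 6, 4] : Fin 4 → ℕ) b + 1 := by decide
    have h3 : ∀ r : Fin 3, r ≠ 2 → r = 0 ∨ r = 1 := by decide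
    simp only [cycleNext]
    split_ifs with h h'
    · subst h h'
      -- The left port of the first block of the third track is the last vertex of the enumeration
      -- and is excluded by `hx`.
      by_cases h0 : i.val = 0
      · simp [cyclePos, cyclePos.blockPos, h0] at hx
        omega
      · rw [prv, dif_neg h0]
        simp [cyclePos, cyclePos.blockPos]; omega
    · subst h
      have := h2 b h'
      simp only [cyclePos, cyclePos.blockPos, this]
      simp
      omega
    · have := h1 b
      rcases h3 r h with rfl | rfl <;> simp only [cyclePos, cyclePos.blockPos, this] <;> simp <;> omega
  · have hi := i.2
    simp only [cycleNext]
    split_ifs with h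
    · by_cases h0 : i.val = 0
      · rw [h0] at h
        have : s = false := h
        subst this
        rw [ladPrv, if_pos h0]
        simp [cyclePos, cyclePos.blockPos, h0, show rail 0 = false from rfl]; omega
      · rw [ladPrv, if_neg h0]
        have hr : s ≠ rail (i.val - 1) := by
          have := rail_succ (i.val - 1)
          rw [Nat.sub_add_cancel (by omega)] at this
          rw [h, this]
          cases rail (i.val - 1) <;> decide
        simp only [cyclePos, if_pos h, if_neg hr]
        omega
    · have hr : (!s) = rail i := by revert h; cases s <;> cases rail i <;> decide
      simp only [cyclePos, if_pos hr, if_neg h]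

theorem adj_u_of_cyclePos {x : LadderVertex k} (hx : cyclePos x + 1 = 26 * k + 6) (hk : 0 < k) :
    (ladderGraph k).Adj x .u := by
  rcases x with _ | _ | ⟨r, i, a⟩ | ⟨r, i, b⟩ | ⟨i, s⟩
  · simp only [cyclePos] at hx; omega
  · simp only [cyclePos] at hx; omega
  · have hi := i.2
    have h1 : ∀ a : Fin 4, 1 ≤ (![7, 1, 5, 3] : Fin 4 → ℕ) a ∧ (![7, 1, 5, 3] : Fin 4 → ℕ) a ≤ 7 := by
      decide
    have := h1 a
    simp only [cyclePos, cyclePos.blockPos] at hx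
    split_ifs at hx <;> omega
  · have hi := i.2
    have h1 : ∀ a : Fin 4, (a ≠ 0 → 1 ≤ (![0, 2, 6, 4] : Fin 4 → ℕ) a) ∧
      (![0, 2, 6, 4] : Fin 4 → ℕ) a ≤ 7 := by decide
    obtain ⟨h2, h3⟩ := h1 b
    simp only [cyclePos, cyclePos.blockPos] at hx
    split_ifs at hx with h4 h5
    · omega
    · omega
    · have hb : b = 0 := by
        by_contra h
        have := h2 h
        omega
      have hr : r = 2 := by revert h4 h5; revert r; decide
      exact adj_blockV_u.2 ⟨Or.inr hr, by omega, hb⟩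
  · have hi := i.2
    simp only [cyclePos] at hx
    split_ifs at hx <;> omega

theorem isHamiltonian [DecidableEq (LadderVertex k)] (he : Even k) (hk : 0 < k) :
    (ladderGraph k).IsHamiltonian := by
  refine isHamiltonian_of_next (cycleNext hk) cyclePos LadderVertex.u rfl ?_ (fun x hx => ?_) fun x hx => ?_
  · rw [card_eq]; omega
  · rw [card_eq] at hx
    exact ⟨adj_cycleNext hk x, cyclePos_cycleNext he hk x hx⟩
  · rw [card_eq] at hx
    exact adj_u_of_cyclePos hx hk

end LadderVertex

theorem ladderGraphs_subset : ladderGraphs ⊆ regularBipartite ∩ hamiltonianBipartite := by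

  rintro _ ⟨j, rfl⟩
  have he : Even (2 * j + 2) := ⟨j + 1, by ring⟩
  exact ⟨⟨LadderVertex.isBipartite he, 3, LadderVertex.isRegularOfDegree (Nat.succ_pos _)⟩,
    LadderVertex.isBipartite he,
    @LadderVertex.isHamiltonian _ (fun _ _ => Classical.propDecidable _) he (Nat.succ_pos _)⟩

theorem theorem1 :
    -- Broder's chain is not rapidly mixing on any of the four classes of bipartite graphs
    (¬ BroderRapidlyMixing planarBipartite ∧
      ¬ BroderRapidlyMixing regularBipartite ∧
      ¬ BroderRapidlyMixing hamiltonianBipartite ∧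
      ¬ BroderRapidlyMixing thresholdBipartite) ∧
    -- hexagon graphs
    (hexagonGraphs ⊆ planarBipartite ∧
      ExponentialLoading hexagonGraphs ∧
      ExponentialMixingTime hexagonGraphs ∧
      ¬ BroderRapidlyMixing hexagonGraphs) ∧
    -- odd triangle threshold graphs
    (oddTriangleGraphs ⊆ thresholdBipartite ∧
      ExponentialLoading oddTriangleGraphs ∧
      ExponentialMixingTime oddTriangleGraphs ∧
      ¬ BroderRapidlyMixing oddTriangleGraphs) ∧
    -- block graphs: regular and planar, but not Hamiltonian
    (blockGraphs ⊆ (regularBipartite ∩ planarBipartite) \ hamiltonianBipartite ∧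
      ExponentialLoading blockGraphs ∧
      ExponentialMixingTime blockGraphs ∧
      ¬ BroderRapidlyMixing blockGraphs) ∧
    -- block graphs with a ladder: regular and Hamiltonian
    (ladderGraphs ⊆ regularBipartite ∩ hamiltonianBipartite ∧
      ExponentialLoading ladderGraphs ∧
      ExponentialMixingTime ladderGraphs ∧
      ¬ BroderRapidlyMixing ladderGraphs) := by
  have hexagon := hexagonGraphs_hasBottleneck
  have triangle := oddTriangleGraphs_hasBottleneck
  have block := blockGraphs_hasBottleneck
  have ladder := ladderGraphs_hasBottleneck
  have hexagon' := not_broderRapidlyMixing hexagon.exponentialMixingTime hexagonGraphs_inputs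
  have triangle' := not_broderRapidlyMixing triangle.exponentialMixingTime oddTriangleGraphs_inputs
  have block' := not_broderRapidlyMixing block.exponentialMixingTime blockGraphs_inputs
  have ladder' := not_broderRapidlyMixing ladder.exponentialMixingTime ladderGraphs_inputs
  exact ⟨⟨fun h => hexagon' (h.mono hexagonGraphs_subset),
      fun h => block' (h.mono fun _ hG => (blockGraphs_subset hG).1.1),
      fun h => ladder' (h.mono fun _ hG => (ladderGraphs_subset hG).2),
      fun h => triangle' (h.mono oddTriangleGraphs_subset)⟩,
    ⟨hexagonGraphs_subset, hexagon.exponentialLoading, hexagon.exponentialMixingTime, hexagon'⟩,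
    ⟨oddTriangleGraphs_subset, triangle.exponentialLoading, triangle.exponentialMixingTime,
      triangle'⟩,
    ⟨blockGraphs_subset, block.exponentialLoading, block.exponentialMixingTime, block'⟩,
    ⟨ladderGraphs_subset, ladder.exponentialLoading, ladder.exponentialMixingTime, ladder'⟩⟩
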